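/- Let $K$ be a field and $T=K\langle x_1,\dots,x_n\rangle$ the free associative algebra, with $K[\underline x]\subseteq T$ the span of the standard monomials $\underline x^\alpha=x_1^{\alpha_1}\cdots x_n^{\alpha_n}$. A monomial ordering on $\mathbb N^n\times E$ ($E$ a finite set) is a total order $\prec$ such that $(\alpha,e)\prec(\beta,e')$ implies $(\alpha+\gamma,e)\prec(\beta+\gamma,e')$ for all $\gamma$; it is a well-ordering if moreover $(0,e)\preceq(\alpha,e)$ for all $\alpha,e$. For $|E|=1$ it orders the standard monomials of $T$, and it is extended to all words by comparing exponents $\operatorname{le}(x_{i_1}\cdots x_{i_k})=e_{i_1}+\dots+e_{i_k}$ first and breaking ties by length, then lexicographically; $\operatorname{lm}$, $\operatorname{lc}$, $\operatorname{le}$ denote leading monomial, leading coefficient and leading exponent. For $s\ne0$ in a set $S\subseteq T$ and words $m,m'$, the reduction defined by $(m,s,m')$ is the linear map of $T$ sending the word $m\operatorname{lm}(s)m'$ to $-\operatorname{lc}(s)^{-1}m(s-\operatorname{lc}(s)\operatorname{lm}(s))m'$ and fixing all other words; an element is irreducible with respect to $(S,\prec)$ if all reductions fix it. A PBW-reduction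 datum $(T,S,I,\prec)$ consists of a monomial well-ordering $\prec$, a set $S=\{x_jx_i-c_{ij}x_ix_j-d_{ij}\mid i<j\}$ with $c_{ij}\in K^*$, $d_{ij}\in K[\underline x]$, $\operatorname{lm}(d_{ij})\prec x_ix_j\prec x_jx_i$, such that every element of $T$ can be transformed into an element of $K[\underline x]$ by finitely many reductions with respect to $(S,\prec)$, and a finite set $I\subseteq K[\underline x]$ such that $$\{\beta+\operatorname{le}(p)\mid 0\neq p\in I,\ \beta\in\mathbb N^n\}=\{\operatorname{le}(p)\mid 0\ne p\in\langle I\cup S\rangle\cap K[\underline x]\},$$ where $\langle I\cup S\rangle$ is the two-sided ideal of $T$ generated by $I\cup S$. It is a datum of the $K$-algebra $A=T/\langle I\cup S\rangle$, which is called a PBW-reduction-algebra. Let $A$ be a PBW-reduction-algebra, $E$ a finite set, $\prec^E$ a monomial ordering on $\mathbb N^n\times E$, and for each $e\in E$ let $(T,S_e,I_e,\prec_e)$ be a PBW-reduction datum of $A$ (so $A=T/\langle I_e\cup S_e\rangle$), where $\alpha\prec_e\beta$ means $(\alpha,e)\prec^E(\beta,e)$. (Then $\prec^E$ is a well-ordering.)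 Each element of $A$ has a unique representative in $T$ that is irreducible with respect to $(\langle I_e\cup S_e\rangle,\prec_e)$; it lies in $K[\underline x]$. Applied in each component this defines for $a\in A^E$ coefficients $a_{e,\alpha}\in K$. If $a\neq0$, let $\operatorname{lec}(a)=(\operatorname{le}(a),\operatorname{lcomp}(a))$ be the $\prec^E$-largest $(\alpha,e)$ with $a_{e,\alpha}\ne0$, and let $\operatorname{lc}(a)$ be the corresponding coefficient; $\operatorname{lec}(0)$ is smaller than everything, and a sum with $\operatorname{lec}(0)$ or $\operatorname{le}(0)$ is again $\operatorname{lec}(0)$. For $G\subseteq A^E$ put $L(G)=\{\beta+\operatorname{lec}(g)\mid 0\ne g\in G,\beta\in\mathbb N^n\}$. A finite subset $G$ of a left submodule $M\subseteq A^E$ is a Gröbner basis of $M$ if every $m\in M$ can be written as $m=\sum_{g\in G}a_gg$ with $a_g\in A$ and $\operatorname{le}_{\prec_{\operatorname{lcomp}(g)}}(a_g)+\operatorname{lec}(g)\preceq^E\operatorname{lec}(m)$ for all $g\in G$. It is reduced if $0\notin G$, $\operatorname{lc}(g)=1$ for all $g\in G$, and $g_{e,\alpha}\ne0$ implies $(\alpha,e)\notin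 L(\{g'\})$ for all $g\neq g'$ in $G$. For nonzero $a,a'\in A^E$ with $\operatorname{lcomp}(a)=\operatorname{lcomp}(a')=e$ and $b=\max(\operatorname{le}(a),\operatorname{le}(a'))$ (componentwise), let $$\operatorname{spoly}(a,a')=\frac{\underline x^{b-\operatorname{le}(a)}a}{\operatorname{lc}(\underline x^{b-\operatorname{le}(a)}a)}-\frac{\underline x^{b-\operatorname{le}(a')}a'}{\operatorname{lc}(\underline x^{b-\operatorname{le}(a')}a')}$$ if $\underline x^b$ is irreducible with respect to $(\langle I_e\cup S_e\rangle,\prec_e)$, and $\operatorname{spoly}(a,a')=0$ otherwise or if $\operatorname{lcomp}(a)\ne\operatorname{lcomp}(a')$. For $p\in I_{\operatorname{lcomp}(a)}$ let $\operatorname{spoly}(a,p)=\underline x^{\max(\operatorname{le}(a),\operatorname{le}(p))-\operatorname{le}(a)}a$ if $p\neq0$, and $\operatorname{spoly}(a,0)=0$. Normal form procedure (for $a\in A^E$ and a finite set $H\subseteq A^E$): while $a\neq0$ and some $g\in H$ satisfies $\operatorname{lec}(a)\in L(\{g\})$, choose such a $g$ and replace $a$ by $\operatorname{lc}(a)\operatorname{spoly}(a,g)$;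 return $a$. Completion algorithm (for a finite set $G\subseteq A^E$): start with $H=G\setminus\{0\}=\{g_1,\dots,g_s\}$ and $Q=\{(g_i,g_j)\mid i<j\}\cup\{(g,p)\mid g\in H,\ p\in I_{\operatorname{lcomp}(g)}\}$. While $Q\neq\emptyset$: choose a pair $(t_1,t_2)\in Q$ and delete it from $Q$; compute a normal form $r$ of $\operatorname{spoly}(t_1,t_2)$ with respect to $H$ by the normal form procedure; if $r\ne0$, add all $(r,h)$, $h\in H$, and all $(r,p)$, $p\in I_{\operatorname{lcomp}(r)}$, to $Q$, and then add $r$ to $H$. Return $H$. **Theorem.** Let $G\subseteq A^E$ be finite. 1. Whatever choices are made, the completion algorithm (including all its normal form computations) terminates on the input $G$, and the set $H$ that it returns is a Gröbner basis of the left submodule ${}_A\langle G\rangle$ of $A^E$ with respect to $\prec^E$. 2. The left submodule ${}_A\langle G\rangle$ and the two-sided submodule ${}_A\langle G\rangle_A$ of $A^E$ generated by $G$ have reduced Gröbner bases (as left modules) with respect to $\prec^E$. 3. Reduced Gröbner bases of ${}_A\langle G\rangle$ and of ${}_A\langle G\rangle_A$ with respect to $\prec^E$ are computable. Precisely, for each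 of the two cases there is a single program, independent of $K$, $n$, $E=\{1,\dots,k\}$, $A$, the data and $G$, which on the input $n$, $k$, the $c_{ij}$, $d_{ij}$ and elements of $I_e$ for $e\in E$, and representatives in $K[\underline x]^E$ of the elements of $G$ (polynomials being given as lists of terms), halts and outputs a list of representatives in $K[\underline x]^E$ of the elements of a reduced Gröbner basis. Programs are finite, handle finite tuples and lists with bounded and unbounded loops, and use of $K$ only the constants $0,1$, addition, multiplication, negation, inversion and the zero test, and of $\prec^E$ only comparisons of two monomials. -/

import Mathlib

universe u v w

namespace PBWRed

/-! ### Monomials, orderings and leading data -/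

/-- Exponent vectors in `ℕⁿ`. -/
abbrev Expo (n : ℕ) : Type := Fin n → ℕ

/-- Monomials `x_{i₁} ⋯ x_{iₖ}` of the free associative algebra. -/
abbrev Word (n : ℕ) : Type := FreeMonoid (Fin n)

/-- The free associative algebra `K⟨x₁, …, xₙ⟩`, with its basis of words. -/
abbrev Free (K : Type*) [Field K] (n : ℕ) : Type _ := MonoidAlgebra K (Word n)

/-- The standard monomial `x₁^{α₁} ⋯ xₙ^{αₙ}` as a word. -/
def stdWord {n : ℕ} (α : Expo n) : Word n :=
  (List.ofFn fun i => FreeMonoid.of i ^ α i).prod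

/-- The exponent `e_{i₁} + ⋯ + e_{iₖ}` of the word `x_{i₁} ⋯ x_{iₖ}`. -/
def wordExpo {n : ℕ} (w : Word n) : Expo n := fun i => (FreeMonoid.toList w).count i

/-- The element `x₁^{α₁} ⋯ xₙ^{αₙ}` of the free algebra. -/
noncomputable def stdMon (K : Type*) [Field K] {n : ℕ} (α : Expo n) : Free K n :=
  MonoidAlgebra.single (stdWord α) 1

/-- `K[x₁, …, xₙ] ⊆ K⟨x₁, …, xₙ⟩`: the elements all of whose monomials are standard. -/
def IsPoly {K : Type*} [Field K] {n : ℕ} (t : Free K n) : Prop :=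
  ∀ w, t.coeff w ≠ 0 → ∃ α : Expo n, w = stdWord α

/-- A monomial ordering on the standard monomials `x^α (e)`, identified with pairs `(α, e)`,
given as its strict order. -/
structure IsMonomialOrdering {n : ℕ} {E : Type*}
    (lt : Expo n × E → Expo n × E → Prop) : Prop where
  total : IsStrictTotalOrder (Expo n × E) lt
  add_right : ∀ (α β γ : Expo n) (e e' : E), lt (α, e) (β, e') → lt (α + γ, e) (β + γ, e')

/-- A monomial well-ordering on the standard monomials `x^α` of the free algebra. -/
structure IsMonomialWellOrdering {n : ℕ} (lt : Expo n → Expo n → Prop) : Prop where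
  total : IsStrictTotalOrder (Expo n) lt
  add_right : ∀ α β γ : Expo n, lt α β → lt (α + γ) (β + γ)
  zero_le : ∀ α : Expo n, α = 0 ∨ lt 0 α

/-- The ordering `≺_e` on exponents induced by an ordering on `ℕⁿ × E`. -/
def restrict {n : ℕ} {E : Type*} (lt : Expo n × E → Expo n × E → Prop) (e : E) :
    Expo n → Expo n → Prop :=
  fun α β => lt (α, e) (β, e)

/-- The refinement of an ordering of the standard monomials to all words: first compare
exponents, then break ties by length and, for equal length, lexicographically. -/
def wordLt {n : ℕ} (lt : Expo n → Expo n → Prop) (w w' : Word n) : Prop :=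
  lt (wordExpo w) (wordExpo w') ∨
    (wordExpo w = wordExpo w' ∧
      ((FreeMonoid.toList w).length < (FreeMonoid.toList w').length ∨
        ((FreeMonoid.toList w).length = (FreeMonoid.toList w').length ∧
          FreeMonoid.toList w < FreeMonoid.toList w')))

open Classical in
/-- The largest element of a set with respect to a strict order (`none` if there is none, which
for the finite sets considered below means that the set is empty). -/
noncomputable def lead {M : Type*} (lt : M → M → Prop) (P : Set M) : Option M :=
  if h : ∃ m ∈ P, ∀ m' ∈ P, m' = m ∨ lt m' m then some h.choose else none

/-- `≼` on leading data, where `none` (the leading datum of `0`) is smaller than everything. -/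
def leOpt {M : Type*} (lt : M → M → Prop) : Option M → Option M → Prop
  | none, _ => True
  | some _, none => False
  | some p, some q => p = q ∨ lt p q

section FreeAlgebra

variable {K : Type*} [Field K] {n : ℕ}

/-- Leading monomial of an element of the free algebra. -/
noncomputable def lm (lt : Expo n → Expo n → Prop) (t : Free K n) : Option (Word n) :=
  lead (wordLt lt) {w | t.coeff w ≠ 0}

/-- Leading exponent of an element of the free algebra. -/
noncomputable def lexp (lt : Expo n → Expo n → Prop) (t : Free K n) : Option (Expo n) :=
  (lm lt t).map wordExpo

/-- The set `l(G)` of leading exponents of the nonzero elements of `G`. -/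
def lset (lt : Expo n → Expo n → Prop) (G : Set (Free K n)) : Set (Expo n) :=
  {α | ∃ g ∈ G, g ≠ 0 ∧ lexp lt g = some α}

/-- The set `L(G) = ℕⁿ + l(G)`. -/
def Lset (lt : Expo n → Expo n → Prop) (G : Set (Free K n)) : Set (Expo n) :=
  {α | ∃ γ ∈ lset lt G, ∃ β : Expo n, α = β + γ}

/-! ### Reductions -/

open Classical in
/-- The `K`-linear reduction map `ρ_{m,s,m'}` for `s ≠ 0`: it sends the monomial `m lm(s) m'` to
`m (- lc(s)⁻¹ tail(s)) m'` and fixes all other monomials. -/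
noncomputable def reduction (lt : Expo n → Expo n → Prop) (m : Word n) (s : Free K n)
    (m' : Word n) : Free K n →ₗ[K] Free K n :=
  let l : Word n := (lm lt s).getD 1
  let tail : Free K n := s - MonoidAlgebra.single l (s.coeff l)
  (Finsupp.linearCombination K fun w : Word n =>
      if w = m * l * m' then
        MonoidAlgebra.single m 1 * ((-(s.coeff l)⁻¹) • tail) * MonoidAlgebra.single m' 1
      else (MonoidAlgebra.single w 1 : Free K n)) ∘ₗ
    (MonoidAlgebra.coeffLinearEquiv K : Free K n ≃ₗ[K] (Word n →₀ K)).toLinearMap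

/-- `t` reduces to `t'` by a finite sequence of reductions with respect to `(S, ≺)`. -/
def Reduces (lt : Expo n → Expo n → Prop) (S : Set (Free K n)) : Free K n → Free K n → Prop :=
  Relation.ReflTransGen fun t t' =>
    ∃ s ∈ S, s ≠ 0 ∧ ∃ m m' : Word n, t' = reduction lt m s m' t

/-- `t` is irreducible with respect to `(S, ≺)`. -/
def IsIrred (lt : Expo n → Expo n → Prop) (S : Set (Free K n)) (t : Free K n) : Prop :=
  ∀ t', Reduces lt S t t' → t' = t

end FreeAlgebra

/-! ### PBW-reduction data -/

/-- The elements entering a PBW-reduction datum: the coefficients `c i j` and the polynomials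
`d i j` of the commutation relations (only `i < j` matters) and the finite set `I`. -/
structure Datum (K : Type*) [Field K] (n : ℕ) where
  c : Fin n → Fin n → K
  d : Fin n → Fin n → Free K n
  I : Finset (Free K n)

section Datum

variable {K : Type*} [Field K] {n : ℕ}

/-- The commutation relations `x_j x_i - c_{ij} x_i x_j - d_{ij}`, `i < j`. -/
noncomputable def Datum.S (D : Datum K n) : Set (Free K n) :=
  {s | ∃ i j : Fin n, i < j ∧
    s = MonoidAlgebra.single (FreeMonoid.of j * FreeMonoid.of i) 1
      - MonoidAlgebra.single (FreeMonoid.of i * FreeMonoid.of j) (D.c i j) - D.d i j}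

/-- The two-sided ideal `⟨I ∪ S⟩`. -/
noncomputable def Datum.ideal (D : Datum K n) : TwoSidedIdeal (Free K n) :=
  TwoSidedIdeal.span ((D.I : Set (Free K n)) ∪ D.S)

/-- `(S, ≺)` is a commutation system. -/
structure IsCommutationSystem (lt : Expo n → Expo n → Prop) (D : Datum K n) : Prop where
  c_ne_zero : ∀ i j : Fin n, i < j → D.c i j ≠ 0
  d_poly : ∀ i j : Fin n, i < j → IsPoly (D.d i j)
  d_lt : ∀ i j : Fin n, i < j → ∀ w, lm lt (D.d i j) = some w →
    wordLt lt w (FreeMonoid.of i * FreeMonoid.of j)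
  comm_lt : ∀ i j : Fin n, i < j →
    wordLt lt (FreeMonoid.of i * FreeMonoid.of j) (FreeMonoid.of j * FreeMonoid.of i)
  reduces : ∀ t : Free K n, ∃ p, IsPoly p ∧ Reduces lt D.S t p

/-- `(K⟨x₁,…,xₙ⟩, S, I, ≺)` is a PBW-reduction datum. -/
structure IsPBWReductionDatum (lt : Expo n → Expo n → Prop) (D : Datum K n) : Prop where
  well : IsMonomialWellOrdering lt
  comm : IsCommutationSystem lt D
  I_poly : ∀ p ∈ D.I, IsPoly p
  L_eq : Lset lt (D.I : Set (Free K n)) = lset lt {t | t ∈ D.ideal ∧ IsPoly t}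

end Datum

/-! ### Free modules over a PBW-reduction-algebra

The algebra `A` is presented by a surjection `π : K⟨x₁,…,xₙ⟩ → A`, and `A^E` is `E → A`. -/

section Module

variable {K : Type*} [Field K] {n : ℕ} {E : Type*} {A : Type*} [Ring A] [Algebra K A]

/-- `(A^E, ≺^E) = (K⟨x₁,…,xₙ⟩, S_e, I_e, ≺_e)_{e ∈ E}`: for each `e` the quadruple is a
PBW-reduction datum of `A`, where `≺_e` is the ordering induced by `≺^E`. -/
structure IsModuleDatum (π : Free K n →ₐ[K] A) (lt : Expo n × E → Expo n × E → Prop)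
    (D : E → Datum K n) : Prop where
  ordering : IsMonomialOrdering lt
  surjective : Function.Surjective π
  datum : ∀ e, IsPBWReductionDatum (restrict lt e) (D e)
  ker_eq : ∀ e, ∀ t : Free K n, π t = 0 ↔ t ∈ (D e).ideal

/-- Irreducibility with respect to `(ker π, ≺)`. -/
def IsNormal (π : Free K n →ₐ[K] A) (lt : Expo n → Expo n → Prop) (t : Free K n) : Prop :=
  IsIrred lt {s | π s = 0} t

open Classical in
/-- `τ : A → K⟨x₁,…,xₙ⟩`, sending an element to its (unique) irreducible representative. -/
noncomputable def tau (π : Free K n →ₐ[K] A) (lt : Expo n → Expo n → Prop) (a : A) : Free K n :=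
  if h : ∃ t, IsNormal π lt t ∧ π t = a then h.choose else 0

/-- Leading exponent of an element of `A`. -/
noncomputable def leadA (π : Free K n →ₐ[K] A) (lt : Expo n → Expo n → Prop) (a : A) :
    Option (Expo n) :=
  lexp lt (tau π lt a)

/-- The coefficient `(τ(a))_{e,α}` for `a ∈ A^E`. -/
noncomputable def coef (π : Free K n →ₐ[K] A) (lt : Expo n × E → Expo n × E → Prop)
    (a : E → A) (p : Expo n × E) : K :=
  (tau π (restrict lt p.2) (a p.2)).coeff (stdWord p.1)

/-- Extended leading exponent `(le(a), lcomp(a))` of `a ∈ A^E`; it is `none` for `a = 0`. -/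
noncomputable def lec (π : Free K n →ₐ[K] A) (lt : Expo n × E → Expo n × E → Prop)
    (a : E → A) : Option (Expo n × E) :=
  lead lt {p | coef π lt a p ≠ 0}

/-- Leading coefficient of `a ∈ A^E`. -/
noncomputable def lc (π : Free K n →ₐ[K] A) (lt : Expo n × E → Expo n × E → Prop)
    (a : E → A) : K :=
  (lec π lt a).elim 0 (coef π lt a)

/-- The set `L(G) ⊆ ℕⁿ × E` for `G ⊆ A^E`. -/
def LsetM (π : Free K n →ₐ[K] A) (lt : Expo n × E → Expo n × E → Prop)
    (G : Set (E → A)) : Set (Expo n × E) :=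
  {q | ∃ g ∈ G, g ≠ 0 ∧ ∃ p, lec π lt g = some p ∧ ∃ β : Expo n, q = (β + p.1, p.2)}

/-- `le_{≺_{lcomp(g)}}(a) + lec(g)`, for `a ∈ A` and `g ∈ A^E`; it is `none` if `a` or `g` is
zero. -/
noncomputable def sumLec (π : Free K n →ₐ[K] A) (lt : Expo n × E → Expo n × E → Prop)
    (a : A) (g : E → A) : Option (Expo n × E) :=
  (lec π lt g).bind fun p => (leadA π (restrict lt p.2) a).map fun α => (α + p.1, p.2)

/-- The finite set `G` is a Gröbner basis of the left submodule `M ⊆ A^E`: `G ⊆ M` and every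
element of `M` has a standard representation. -/
def IsGroebnerBasis (π : Free K n →ₐ[K] A) (lt : Expo n × E → Expo n × E → Prop)
    (M : Submodule A (E → A)) (G : Finset (E → A)) : Prop :=
  (∀ g ∈ G, g ∈ M) ∧
    ∀ m ∈ M, ∃ a : (E → A) → A, m = ∑ g ∈ G, a g • g ∧
      ∀ g ∈ G, leOpt lt (sumLec π lt (a g) g) (lec π lt m)

/-- `G` is a reduced Gröbner basis of `M`. -/
structure IsReducedGroebnerBasis (π : Free K n →ₐ[K] A)
    (lt : Expo n × E → Expo n × E → Prop) (M : Submodule A (E → A))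
    (G : Finset (E → A)) : Prop where
  isGroebnerBasis : IsGroebnerBasis π lt M G
  zero_notMem : (0 : E → A) ∉ G
  lc_eq_one : ∀ g ∈ G, lc π lt g = 1
  reduced : ∀ g ∈ G, ∀ (e : E) (α : Expo n), coef π lt g (α, e) ≠ 0 →
    ∀ g' ∈ G, g' ≠ g → ∀ p, lec π lt g' = some p → ∀ γ : Expo n, (α, e) ≠ (p.1 + γ, p.2)

/-- The left submodule of `A^E` generated by `G`. -/
def leftSpan (A : Type*) [Ring A] {E : Type*} (G : Set (E → A)) : Submodule A (E → A) :=
  Submodule.span A G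

/-- The two-sided submodule of the bimodule `A^E` generated by `G`: the smallest left submodule
that contains `G` and is stable under right multiplication. -/
def twoSidedSpan (A : Type*) [Ring A] {E : Type*} (G : Set (E → A)) : Submodule A (E → A) :=
  sInf {M | G ⊆ M ∧ ∀ m ∈ M, ∀ b : A, (fun e => m e * b) ∈ M}

/-! ### S-polynomials and the completion algorithm -/

/-- `x^γ a` for `a ∈ A^E`. -/
noncomputable def monSmul (π : Free K n →ₐ[K] A) (γ : Expo n) (a : E → A) : E → A :=
  π (stdMon K γ) • a

open Classical in
/-- The `s`-polynomial of `a` and `a'`. The exponents `b` and `c` of the usual definition are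
`α ⊔ β` and `α ⊔ β - α`, `α ⊔ β - β`. -/
noncomputable def spoly (π : Free K n →ₐ[K] A) (lt : Expo n × E → Expo n × E → Prop)
    (a a' : E → A) : E → A :=
  match lec π lt a, lec π lt a' with
  | some (α, e), some (β, e') =>
    if e = e' ∧ IsNormal π (restrict lt e) (stdMon K (α ⊔ β)) then
      (lc π lt (monSmul π (α ⊔ β - α) a))⁻¹ • monSmul π (α ⊔ β - α) a
        - (lc π lt (monSmul π (α ⊔ β - β) a'))⁻¹ • monSmul π (α ⊔ β - β) a'
    else 0
  | _, _ => 0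

/-- The `s`-polynomial of `a` and `p ∈ I_e` with `e = lcomp(a)`; it is `0` for `p = 0`. -/
noncomputable def spolyRel (π : Free K n →ₐ[K] A) (lt : Expo n × E → Expo n × E → Prop)
    (a : E → A) (p : Free K n) : E → A :=
  match lec π lt a with
  | some (α, e) =>
    match lexp (restrict lt e) p with
    | some β => monSmul π (α ⊔ β - α) a
    | none => 0
  | none => 0

/-- One pass of the `while` loop of the normal form algorithm for `a` with respect to `G`, with
an arbitrary choice of an element `g` of `G` whose leading monomial divides that of `a`. -/
def NFStep (π : Free K n →ₐ[K] A) (lt : Expo n × E → Expo n × E → Prop)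
    (G : Finset (E → A)) (a b : E → A) : Prop :=
  a ≠ 0 ∧ ∃ g ∈ G, (∃ q, lec π lt a = some q ∧ q ∈ LsetM π lt {g}) ∧
    b = lc π lt a • spoly π lt a g

/-- Critical pairs `(g, g')` with `g, g' ∈ A^E`, or `(g, p)` with `p ∈ I_{lcomp(g)}`. -/
abbrev CPair (K : Type*) [Field K] (n : ℕ) (E A : Type*) : Type _ :=
  (E → A) × ((E → A) ⊕ Free K n)

/-- The `s`-polynomial of a critical pair. -/
noncomputable def spolyPair (π : Free K n →ₐ[K] A) (lt : Expo n × E → Expo n × E → Prop)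
    (t : CPair K n E A) : E → A :=
  match t.2 with
  | Sum.inl g' => spoly π lt t.1 g'
  | Sum.inr p => spolyRel π lt t.1 p

/-- `I_{lcomp(g)}`, for `g ≠ 0`. -/
noncomputable def relsOf (π : Free K n →ₐ[K] A) (lt : Expo n × E → Expo n × E → Prop)
    (D : E → Datum K n) (g : E → A) : Finset (Free K n) :=
  (lec π lt g).elim ∅ fun p => (D p.2).I

/-- States of the completion algorithm. `outer T H`: at the head of the main loop, with the set `T`
of pending pairs and the current set `H`. `inner T H a`: inside the normal form computation with
respect to `H`, with current value `a`. -/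
inductive BState (K : Type*) [Field K] (n : ℕ) (E A : Type*)
  | outer (T : Finset (CPair K n E A)) (H : Finset (E → A))
  | inner (T : Finset (CPair K n E A)) (H : Finset (E → A)) (a : E → A)

open Classical in
/-- The steps of the completion algorithm; all choices are arbitrary. -/
inductive BStep (π : Free K n →ₐ[K] A) (lt : Expo n × E → Expo n × E → Prop)
    (D : E → Datum K n) : BState K n E A → BState K n E A → Prop
  | choose (T : Finset (CPair K n E A)) (H : Finset (E → A)) (t : CPair K n E A) (ht : t ∈ T) :
      BStep π lt D (.outer T H) (.inner (T.erase t) H (spolyPair π lt t))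
  | reduce (T : Finset (CPair K n E A)) (H : Finset (E → A)) (a b : E → A)
      (h : NFStep π lt H a b) :
      BStep π lt D (.inner T H a) (.inner T H b)
  | discard (T : Finset (CPair K n E A)) (H : Finset (E → A)) :
      BStep π lt D (.inner T H 0) (.outer T H)
  | insert (T : Finset (CPair K n E A)) (H : Finset (E → A)) (r : E → A) (hr : r ≠ 0)
      (h : ∀ g ∈ H, ∀ q, lec π lt r = some q → q ∉ LsetM π lt {g}) :
      BStep π lt D (.inner T H r)
        (.outer (T ∪ H.image (fun g => (r, Sum.inl g))
            ∪ (relsOf π lt D r).image (fun p => (r, Sum.inr p)))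
          (Insert.insert r H))

/-- The initial states for the input `G`: `H = G \ {0} = {g₁, …, g_s}`, enumerated in any way, and
`T = {(g_i, g_j) | i < j} ∪ {(g, p) | g ∈ H, p ∈ I_{lcomp(g)}}`. -/
def IsInitial (π : Free K n →ₐ[K] A) (lt : Expo n × E → Expo n × E → Prop)
    (D : E → Datum K n) (G : Finset (E → A)) (s : BState K n E A) : Prop :=
  ∃ (l : List (E → A)) (T : Finset (CPair K n E A)) (H : Finset (E → A)),
    l.Nodup ∧ (∀ g, g ∈ l ↔ g ∈ G ∧ g ≠ 0) ∧ (∀ g, g ∈ H ↔ g ∈ l) ∧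
    (∀ t, t ∈ T ↔ (∃ i j : Fin l.length, i < j ∧ t = (l.get i, Sum.inl (l.get j))) ∨
      ∃ g ∈ l, ∃ p ∈ relsOf π lt D g, t = (g, Sum.inr p)) ∧
    s = .outer T H

/-- Every run of the completion algorithm on the input `G` is finite (including all the normal
form computations), and each run halts at the head of the main loop with no pending pair and a
Gröbner basis of the left module generated by `G`. -/
def CompletionCorrectAndTerminates (π : Free K n →ₐ[K] A)
    (lt : Expo n × E → Expo n × E → Prop) (D : E → Datum K n) (G : Finset (E → A)) : Prop :=
  (∃ s, IsInitial π lt D G s) ∧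
    ∀ s₀, IsInitial π lt D G s₀ →
      Acc (fun s' s => BStep π lt D s s') s₀ ∧
      ∀ s, Relation.ReflTransGen (BStep π lt D) s₀ s → (∀ s', ¬ BStep π lt D s s') →
        ∃ H, s = .outer ∅ H ∧ IsGroebnerBasis π lt (leftSpan A (G : Set (E → A))) H

end Module

/-! ### Programs over a field

Computability is uniform: programs are finite pieces of syntax that handle finite data (tuples,
lists, tagged unions) with entries in a field, of which they use only `0`, `1`, the arithmetic
operations and the zero test; a monomial ordering is consulted by comparing two monomials. Natural
numbers are lists over the one-point type. -/

/-- Data types. -/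
inductive Ty : Type
  | one
  | fld
  | prod (a b : Ty)
  | sum (a b : Ty)
  | list (a : Ty)

/-- The data of a given type, over the field `K`. -/
@[reducible] def Ty.Val (K : Type u) : Ty → Type u
  | .one => PUnit.{u + 1}
  | .fld => K
  | .prod a b => Ty.Val K a × Ty.Val K b
  | .sum a b => Ty.Val K a ⊕ Ty.Val K b
  | .list a => List (Ty.Val K a)

/-- Truth values: `inl` is true and `inr` is false. -/
abbrev Ty.bool : Ty := .sum .one .one

/-- Natural numbers in unary notation. -/
abbrev Ty.nat : Ty := .list .one

/-- Exponent vectors. -/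
abbrev Ty.expo : Ty := .list .nat

/-- Monomials `x^α (e)`, with `e` given by its index. -/
abbrev Ty.mon : Ty := .prod .expo .nat

/-- Programs with input type `a` and output type `b`. -/
inductive Prog : Ty → Ty → Type
  | id (a : Ty) : Prog a a
  | comp {a b c : Ty} (g : Prog b c) (f : Prog a b) : Prog a c
  | unit (a : Ty) : Prog a .one
  | pair {a b c : Ty} (f : Prog a b) (g : Prog a c) : Prog a (.prod b c)
  | fst (a b : Ty) : Prog (.prod a b) a
  | snd (a b : Ty) : Prog (.prod a b) b
  | inl (a b : Ty) : Prog a (.sum a b)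
  | inr (a b : Ty) : Prog b (.sum a b)
  /-- Case distinction, with a context of type `c`. -/
  | cases {a b c d : Ty} (f : Prog (.prod a c) d) (g : Prog (.prod b c) d) :
      Prog (.prod (.sum a b) c) d
  | nil (a : Ty) : Prog .one (.list a)
  | cons (a : Ty) : Prog (.prod a (.list a)) (.list a)
  | uncons (a : Ty) : Prog (.list a) (.sum .one (.prod a (.list a)))
  /-- Bounded loop through a list, updating a state of type `s`. -/
  | forEach {a s : Ty} (f : Prog (.prod s a) s) : Prog (.prod s (.list a)) s
  /-- Unbounded loop: repeat as long as the body returns a new state (`inr`). -/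
  | loop {a b : Ty} (f : Prog a (.sum b a)) : Prog a b
  | zero : Prog .one .fld
  | one : Prog .one .fld
  | add : Prog (.prod .fld .fld) .fld
  | mul : Prog (.prod .fld .fld) .fld
  | neg : Prog .fld .fld
  | inv : Prog .fld .fld
  | isZero : Prog .fld .bool
  /-- Comparison of two monomials. -/
  | less : Prog (.prod .mon .mon) .bool

open Classical in
/-- The truth value of a proposition. -/
noncomputable def truth (K : Type u) (p : Prop) : Ty.bool.Val K :=
  if p then Sum.inl PUnit.unit else Sum.inr PUnit.unit

/-- The partial function computed by a program over the field `K`, when the comparison of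
monomials is answered by `ord`. -/
noncomputable def Prog.eval {K : Type u} [Field K]
    (ord : Ty.mon.Val K → Ty.mon.Val K → Prop) :
    {a b : Ty} → Prog a b → a.Val K → Part (b.Val K)
  | _, _, .id _ => fun x => Part.some x
  | _, _, .comp g f => fun x => (f.eval ord x).bind (g.eval ord)
  | _, _, .unit _ => fun _ => Part.some PUnit.unit
  | _, _, .pair f g => fun x => (f.eval ord x).bind fun y => (g.eval ord x).map fun z => (y, z)
  | _, _, .fst _ _ => fun x => Part.some x.1
  | _, _, .snd _ _ => fun x => Part.some x.2
  | _, _, .inl _ _ => fun x => Part.some (Sum.inl x)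
  | _, _, .inr _ _ => fun x => Part.some (Sum.inr x)
  | _, _, .cases f g => fun x =>
      match x.1 with
      | Sum.inl y => f.eval ord (y, x.2)
      | Sum.inr y => g.eval ord (y, x.2)
  | _, _, .nil _ => fun _ => Part.some []
  | _, _, .cons _ => fun x => Part.some (x.1 :: x.2)
  | _, _, .uncons _ => fun x =>
      match x with
      | [] => Part.some (Sum.inl PUnit.unit)
      | y :: l => Part.some (Sum.inr (y, l))
  | _, _, .forEach f => fun x => x.2.foldlM (m := Part) (fun s y => f.eval ord (s, y)) x.1
  | _, _, .loop f => PFun.fix (f.eval ord)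
  | _, _, .zero => fun _ => Part.some (0 : K)
  | _, _, .one => fun _ => Part.some (1 : K)
  | _, _, .add => fun x => Part.some (x.1 + x.2 : K)
  | _, _, .mul => fun x => Part.some (x.1 * x.2 : K)
  | _, _, .neg => fun x => Part.some (-x : K)
  | _, _, .inv => fun x => Part.some (x⁻¹ : K)
  | _, _, .isZero => fun x => Part.some (truth K (x = (0 : K)))
  | _, _, .less => fun x => Part.some (truth K (ord x.1 x.2))

/-! ### Presentation of the input and of the output -/

/-- A polynomial given as a list of terms `c x^α`. -/
abbrev PolyTerms (K : Type u) (n : ℕ) : Type u := List (K × Expo n)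

/-- An element of `K[x]^k` given as a list of terms `c x^α (e)`. -/
abbrev ModTerms (K : Type u) (n k : ℕ) : Type u := List (K × (Expo n × Fin k))

/-- The polynomial with the given terms. -/
noncomputable def polyOf {K : Type u} [Field K] {n : ℕ} (f : PolyTerms K n) : Free K n :=
  (f.map fun t => t.1 • stdMon K t.2).sum

/-- The class in `A^k` of the element of `K[x]^k` with the given terms. -/
noncomputable def classOf {K : Type u} [Field K] {n k : ℕ} {A : Type v} [Ring A] [Algebra K A]
    (π : Free K n →ₐ[K] A) (f : ModTerms K n k) : Fin k → A :=
  (f.map fun t => (Pi.single t.2.2 (π (t.1 • stdMon K t.2.1)) : Fin k → A)).sum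

open Classical in
/-- The finite set of classes of a list of elements of `K[x]^k`. -/
noncomputable def classesOf {K : Type u} [Field K] {n k : ℕ} {A : Type v} [Ring A] [Algebra K A]
    (π : Free K n →ₐ[K] A) (G : List (ModTerms K n k)) : Finset (Fin k → A) :=
  (G.map (classOf π)).toFinset

/-- The finite data of a PBW-reduction datum, with all polynomials given by their terms. -/
structure RawDatum (K : Type u) (n : ℕ) where
  c : Fin n → Fin n → K
  d : Fin n → Fin n → PolyTerms K n
  I : List (PolyTerms K n)

open Classical in
noncomputable def RawDatum.toDatum {K : Type u} [Field K] {n : ℕ} (R : RawDatum K n) :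
    Datum K n where
  c := R.c
  d := fun i j => polyOf (R.d i j)
  I := (R.I.map polyOf).toFinset

def encNat (K : Type u) (m : ℕ) : Ty.nat.Val K := List.replicate m PUnit.unit

def encExpo (K : Type u) {n : ℕ} (α : Expo n) : Ty.expo.Val K :=
  List.ofFn fun i => encNat K (α i)

def encMon (K : Type u) {n k : ℕ} (p : Expo n × Fin k) : Ty.mon.Val K :=
  (encExpo K p.1, encNat K p.2)

abbrev Ty.poly : Ty := .list (.prod .fld .expo)

abbrev Ty.modElt : Ty := .list (.prod .fld .mon)

abbrev Ty.datum : Ty := .prod (.list (.list (.prod .fld .poly))) (.list .poly)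

abbrev Ty.input : Ty := .prod (.prod .nat .nat) (.prod (.list .datum) (.list .modElt))

def encPoly {K : Type u} {n : ℕ} (f : PolyTerms K n) : Ty.poly.Val K :=
  f.map fun t => (t.1, encExpo K t.2)

def encModElt {K : Type u} {n k : ℕ} (f : ModTerms K n k) : Ty.modElt.Val K :=
  f.map fun t => (t.1, encMon K t.2)

def encDatum {K : Type u} {n : ℕ} (R : RawDatum K n) : Ty.datum.Val K :=
  (List.ofFn fun i => List.ofFn fun j => (R.c i j, encPoly (R.d i j)), R.I.map encPoly)

/-- The input of an algorithm: `n`, `k`, the PBW-reduction data and the generators. -/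
def encInput {K : Type u} {n k : ℕ} (R : Fin k → RawDatum K n) (G : List (ModTerms K n k)) :
    Ty.input.Val K :=
  ((encNat K n, encNat K k), (List.ofFn fun e => encDatum (R e), G.map encModElt))

/-- The answers to comparisons of monomials given by an ordering on `ℕⁿ × {1,…,k}`. -/
def ordOf (K : Type u) {n k : ℕ} (lt : Expo n × Fin k → Expo n × Fin k → Prop)
    (x y : Ty.mon.Val K) : Prop :=
  ∃ p q, x = encMon K p ∧ y = encMon K q ∧ lt p q

end PBWRed

set_option linter.unusedSectionVars false

namespace PBWRed

/-! ### Words and exponents -/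

section Words

variable {n : ℕ}

/-! The proof works with the filtration of `A^E` by monomials. The commutation relations rewrite
every word as a nonzero multiple of the standard monomial with the same exponent plus terms of
smaller exponent (`Sys.Compatible.exists_wv_sub_mem`). So multiplication by a word shifts leading
terms as in the commutative case, up to a nonzero factor and smaller terms. The only new phenomenon
is that the shifted monomial may be reducible, in which case the product drops. The condition on
L(I) says that the reducible standard monomials are exactly the multiples of leading monomials of I
(`IsModuleDatum.mem_Lset_iff`). The other monomials x^α (e), collected in `normalSet`, form a
K-basis of `A^E`. Dickson's lemma makes the ordering well-founded.

Buchberger's criterion (`IsModuleDatum.buchberger`) lowers the bound p of a representation of m as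
long as p exceeds lec(m). If p is reducible, each summand at p is a monomial multiple of an
s-polynomial with a relation in I and can be replaced by smaller summands. If p is irreducible,
s-polynomials make all summands at p scalar multiples of a single x^γ g modulo smaller ones. The
coefficient of m at p is zero, so the total scalar vanishes.

For the completion algorithm, the invariant (`StateInv`) is that every s-polynomial is pending, in
progress, or has a standard representation within every bound of itself. Termination is a
lexicographic induction: insertions enlarge the monomial set generated by lec(H), which can happen
only finitely often by Dickson's lemma; otherwise the number of pending pairs drops; within a normal
form computation the leading exponent drops.

Reduced bases exist for every left submodule M (`IsModuleDatum.exists_isReducedGroebnerBasis`).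
Modulo M each monomial is a combination of irreducible monomials that are not leading exponents of
M. This gives monic elements with reduced tails, one for each of the finitely many minimal leading
exponents.

For computability, a variant of the algorithm is written on lists of terms. Rules "leading monomial
→ tail" represent basis elements, and the relations in I become rules whose element is zero, so both
kinds of s-polynomials are treated alike. For the two-sided case the products of each new element
with the variables from the right are queued as well. When the queue is empty, the left span of the
rules is stable under right multiplication. Discarding rules with redundant leading monomials and
reducing the tails gives the reduced basis (`ComplInv.isReducedGroebnerBasis`).

The predicates `Cp` and `CpR` express that a function or relation is computed by one program for all
fields and orderings. They are closed under list recursion and loops, which yields programs for the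
list algorithm on unary indices. This algorithm commutes with injective renaming of variables and
components (`SysRel`), so its correctness over `Fin n` and `Fin k` carries over to encoded data. -/

/-- The exponent of a list of variables. -/
def listExpo (l : List (Fin n)) : Expo n := fun i => l.count i

@[simp] theorem listExpo_nil : listExpo ([] : List (Fin n)) = 0 := by
  ext i; simp [listExpo]

theorem listExpo_append (l l' : List (Fin n)) : listExpo (l ++ l') = listExpo l + listExpo l' := by
  ext i; simp [listExpo]

theorem listExpo_cons (i : Fin n) (l : List (Fin n)) :
    listExpo (i :: l) = listExpo [i] + listExpo l := by
  rw [← listExpo_append]; rfl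

theorem listExpo_eq_of_perm {l l' : List (Fin n)} (h : l.Perm l') : listExpo l = listExpo l' := by
  ext i; exact h.count_eq i

theorem perm_of_listExpo_eq {l l' : List (Fin n)} (h : listExpo l = listExpo l') : l.Perm l' :=
  List.perm_iff_count.2 fun i => congrFun h i

theorem listExpo_diff (l l' : List (Fin n)) : listExpo (l.diff l') = listExpo l - listExpo l' := by
  ext i; simp [listExpo, List.count_diff]

theorem wordExpo_ofList (l : List (Fin n)) : wordExpo (FreeMonoid.ofList l) = listExpo l := rfl

theorem wordExpo_eq (w : Word n) : wordExpo w = listExpo (FreeMonoid.toList w) := rfl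

theorem wordExpo_mul (u v : Word n) : wordExpo (u * v) = wordExpo u + wordExpo v := by
  simp [wordExpo_eq, listExpo_append]

/-- The sorted list of variables with given exponent. -/
def stdList (α : Expo n) : List (Fin n) := (List.ofFn fun i => List.replicate (α i) i).flatten

theorem toList_stdWord (α : Expo n) : FreeMonoid.toList (stdWord α) = stdList α := by
  rw [stdWord, FreeMonoid.toList_prod, stdList, List.map_ofFn]
  congr 2
  funext i
  simp only [Function.comp]
  induction α i with
  | zero => simp
  | succ k ih => rw [pow_succ', FreeMonoid.toList_mul, ih]; simp [List.replicate_succ]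

theorem stdWord_eq (α : Expo n) : stdWord α = FreeMonoid.ofList (stdList α) := by
  rw [← toList_stdWord]; rfl

theorem listExpo_stdList (α : Expo n) : listExpo (stdList α) = α := by
  ext i
  simp only [listExpo, stdList, List.count_flatten, List.map_ofFn, List.sum_ofFn, Function.comp,
    List.count_replicate]
  rw [Finset.sum_eq_single i] <;> simp +contextual

theorem wordExpo_stdWord (α : Expo n) : wordExpo (stdWord α) = α := by
  rw [wordExpo_eq, toList_stdWord, listExpo_stdList]

theorem stdWord_injective : Function.Injective (stdWord : Expo n → Word n) :=
  Function.LeftInverse.injective wordExpo_stdWord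

theorem stdList_pairwise (α : Expo n) : (stdList α).Pairwise (· ≤ ·) := by
  rw [stdList, List.pairwise_flatten]
  constructor
  · intro l hl
    rw [List.mem_ofFn] at hl
    obtain ⟨i, rfl⟩ := hl
    exact List.pairwise_replicate.2 (Or.inr le_rfl)
  · rw [List.pairwise_ofFn]
    intro i j hij x hx y hy
    rw [List.eq_of_mem_replicate hx, List.eq_of_mem_replicate hy]
    exact hij.le

theorem eq_stdList_of_pairwise {l : List (Fin n)} (h : l.Pairwise (· ≤ ·)) :
    l = stdList (listExpo l) := by
  apply List.Perm.eq_of_pairwise (le := (· ≤ ·)) _ h (stdList_pairwise _)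
  · exact perm_of_listExpo_eq (listExpo_stdList _).symm
  · intro a b _ _ h1 h2; exact le_antisymm h1 h2

theorem eq_stdWord_of_pairwise {w : Word n} (h : (FreeMonoid.toList w).Pairwise (· ≤ ·)) :
    w = stdWord (wordExpo w) := by
  rw [stdWord_eq, wordExpo_eq, ← eq_stdList_of_pairwise h]; rfl

theorem stdList_zero : stdList (0 : Expo n) = [] := by
  rw [← List.length_eq_zero_iff, stdList]
  simp

/-- A sorted list is the lexicographically smallest one among its permutations. -/
theorem not_lt_of_perm_of_pairwise {α : Type*} [LinearOrder α] {l l' : List α} (h : l.Pairwise (· ≤ ·))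
    (hp : l'.Perm l) : ¬ l' < l := by
  induction l generalizing l' with
  | nil => rw [hp.eq_nil]; exact lt_irrefl _
  | cons a l ih =>
    cases l' with
    | nil => simpa using hp.length_eq
    | cons b l' =>
      rw [List.pairwise_cons] at h
      have hb : b ∈ a :: l := hp.subset (List.mem_cons_self)
      intro hlt
      rw [List.cons_lt_cons_iff] at hlt
      rcases hlt with hlt | ⟨rfl, hlt⟩
      · rcases List.mem_cons.1 hb with rfl | hb
        · exact lt_irrefl _ hlt
        · exact absurd (h.1 b hb) (not_le.2 hlt)
      · exact ih h.2 (List.perm_cons _ |>.1 hp) hlt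

end Words

/-! ### Orders -/

section Orders

theorem lead_eq_some_iff {M : Type*} {lt : M → M → Prop} (hlt : IsStrictTotalOrder M lt)
    {P : Set M} {m : M} :
    lead lt P = some m ↔ m ∈ P ∧ ∀ m' ∈ P, m' = m ∨ lt m' m := by
  unfold lead
  split_ifs with h
  · rw [Option.some_inj]
    constructor
    · rintro rfl; exact h.choose_spec
    · intro hm
      rcases hm.2 _ h.choose_spec.1 with h1 | h1
      · exact h1
      · rcases h.choose_spec.2 _ hm.1 with h2 | h2
        · exact h2.symm
        · exact absurd (hlt.trans _ _ _ h1 h2) (hlt.irrefl _)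
  · simp only [false_iff]
    intro hm
    exact h ⟨m, hm⟩

theorem exists_lead {M : Type*} {lt : M → M → Prop} (hlt : IsStrictTotalOrder M lt)
    {P : Set M} (hP : P.Finite) (hne : P.Nonempty) : ∃ m, lead lt P = some m := by
  suffices ∃ m ∈ P, ∀ m' ∈ P, m' = m ∨ lt m' m by
    obtain ⟨m, hm⟩ := this
    exact ⟨m, (lead_eq_some_iff hlt).2 hm⟩
  induction P, hP using Set.Finite.induction_on with
  | empty => simp at hne
  | @insert a s _ _ ih =>
    rcases s.eq_empty_or_nonempty with rfl | hs
    · exact ⟨a, by simp, by simp⟩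
    · obtain ⟨m, hm, hm'⟩ := ih hs
      rcases @trichotomous_of M lt _ a m with h | h | h
      · refine ⟨m, by simp [hm], ?_⟩
        rintro m' (rfl | h')
        · exact Or.inr h
        · exact hm' _ h'
      · subst h
        refine ⟨a, by simp, ?_⟩
        rintro m' (rfl | h')
        · exact Or.inl rfl
        · exact hm' _ h'
      · refine ⟨a, by simp, ?_⟩
        rintro m' (rfl | h')
        · exact Or.inl rfl
        · rcases hm' _ h' with rfl | h2
          · exact Or.inr h
          · exact Or.inr (hlt.trans _ _ _ h2 h)

variable {n : ℕ}

theorem add_left_of_lt {lt : Expo n → Expo n → Prop} (h : IsMonomialWellOrdering lt) {α β : Expo n}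
    (γ : Expo n) (hl : lt α β) : lt (γ + α) (γ + β) := by
  rw [add_comm γ, add_comm γ]; exact h.add_right _ _ _ hl

theorem wordLt_isStrictTotalOrder {lt : Expo n → Expo n → Prop} (h : IsMonomialWellOrdering lt) :
    IsStrictTotalOrder (Word n) (wordLt lt) where
  trichotomous a b hab hba := by
    have := h.total
    simp only [wordLt, not_or, not_and] at hab hba
    have he : wordExpo a = wordExpo b := by
      rcases @trichotomous_of _ lt _ (wordExpo a) (wordExpo b) with h | h | h
      · exact absurd h hab.1
      · exact h
      · exact absurd h hba.1
    have h1 := hab.2 he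
    have h2 := hba.2 he.symm
    have hl : (FreeMonoid.toList a).length = (FreeMonoid.toList b).length := by omega
    exact FreeMonoid.toList.injective
      (le_antisymm (not_lt.1 (h2.2 hl.symm)) (not_lt.1 (h1.2 hl)))
  irrefl a := by
    have := h.total
    rintro (h1 | ⟨-, h1 | ⟨-, h1⟩⟩)
    · exact h.total.irrefl _ h1
    · exact lt_irrefl _ h1
    · exact lt_irrefl _ h1
  trans a b c := by
    rintro (h1 | ⟨e1, h1⟩) (h2 | ⟨e2, h2⟩)
    · exact Or.inl (h.total.trans _ _ _ h1 h2)
    · exact Or.inl (e2 ▸ h1)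
    · exact Or.inl (e1 ▸ h2)
    · refine Or.inr ⟨e1.trans e2, ?_⟩
      rcases h1 with h1 | ⟨l1, h1⟩ <;> rcases h2 with h2 | ⟨l2, h2⟩
      · exact Or.inl (h1.trans h2)
      · exact Or.inl (l2 ▸ h1)
      · exact Or.inl (l1 ▸ h2)
      · exact Or.inr ⟨l1.trans l2, h1.trans h2⟩

theorem append_lt_append_right {α : Type*} [LinearOrder α] {a b : List α} (hl : a.length = b.length)
    (h : a < b) (c : List α) : a ++ c < b ++ c := by
  induction a generalizing b with
  | nil => cases b <;> simp_all
  | cons x a ih =>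
    cases b with
    | nil => simp at hl
    | cons y b =>
      rw [List.cons_lt_cons_iff] at h
      rw [List.cons_append, List.cons_append, List.cons_lt_cons_iff]
      rcases h with h | ⟨rfl, h⟩
      · exact Or.inl h
      · exact Or.inr ⟨rfl, ih (by simpa using hl) h⟩

theorem append_lt_append_left {α : Type*} [LinearOrder α] {a b : List α}
    (h : a < b) (c : List α) : c ++ a < c ++ b := by
  induction c with
  | nil => simpa
  | cons x c ih => rw [List.cons_append, List.cons_append, List.cons_lt_cons_iff]; exact Or.inr ⟨rfl, ih⟩

/-- Lexicographic comparison survives concatenation on the right only between words of equal length,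
which is why length is compared first. -/
theorem wordLt_mul {lt : Expo n → Expo n → Prop} (h : IsMonomialWellOrdering lt) {a b : Word n}
    (hab : wordLt lt a b) (m m' : Word n) : wordLt lt (m * a * m') (m * b * m') := by
  simp only [wordLt, wordExpo_mul, FreeMonoid.toList_mul, List.length_append] at hab ⊢
  rcases hab with hab | ⟨e, hab⟩
  · exact Or.inl (h.add_right _ _ _ (add_left_of_lt h _ hab))
  · refine Or.inr ⟨by rw [e], ?_⟩
    rcases hab with hab | ⟨l, hab⟩
    · left; omega
    · exact Or.inr ⟨by omega, append_lt_append_right (by simp [l]) (append_lt_append_left hab _) _⟩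

/-- A tie of exponents is impossible: a word with the same exponent is a permutation of the sorted
word, which is lexicographically smallest. Below a standard monomial the tie-breaking rules are
therefore invisible. -/
theorem wordExpo_le_of_wordLt {lt : Expo n → Expo n → Prop} {a : Word n} {α : Expo n}
    (h : wordLt lt a (stdWord α)) : lt (wordExpo a) α := by
  rcases h with h | ⟨e, h⟩
  · rwa [wordExpo_stdWord] at h
  · exfalso
    have hp := perm_of_listExpo_eq (l := FreeMonoid.toList a) (l' := FreeMonoid.toList (stdWord α)) e
    rcases h with h | ⟨-, h⟩
    · exact h.ne hp.length_eq
    · refine not_lt_of_perm_of_pairwise ?_ hp h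
      rw [toList_stdWord]; exact stdList_pairwise α

/-- A monomial ordering on `ℕⁿ × E` all of whose components are well-orderings is well-founded. -/
theorem wellFounded_of_restrict {E : Type*} [Finite E] {lt : Expo n × E → Expo n × E → Prop}
    (h : IsMonomialOrdering lt) (h0 : ∀ e, IsMonomialWellOrdering (restrict lt e)) :
    WellFounded lt := by
  have := h.total
  rw [wellFounded_iff_isEmpty_descending_chain]
  refine ⟨fun ⟨f, hf⟩ => ?_⟩
  have hdec : ∀ i j, i < j → lt (f j) (f i) := by
    intro i j hij
    induction j, hij using Nat.le_induction with
    | base => exact hf i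
    | succ j _ ih => exact h.total.trans _ _ _ (hf j) ih
  -- Dickson's lemma: in a descending chain some earlier monomial divides a later one. Since `0` is
  -- the least exponent in each component, the multiple cannot be smaller.
  have hw : WellQuasiOrdered (fun a b : Expo n × E => a.1 ≤ b.1 ∧ a.2 = b.2) :=
    WellQuasiOrdered.prod (r := fun a b : Expo n => a ≤ b) wellQuasiOrdered_le
      (Finite.wellQuasiOrdered (fun a b : E => a = b))
  obtain ⟨i, j, hij, hle, he⟩ := hw f
  have hd := hdec i j hij
  have h1 := (h0 (f j).2).zero_le ((f j).1 - (f i).1)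
  have h2 : (f j).1 - (f i).1 + (f i).1 = (f j).1 := tsub_add_cancel_of_le hle
  rcases h1 with h1 | h1
  · rw [h1, zero_add] at h2
    have : f j = f i := Prod.ext h2.symm he.symm
    rw [this] at hd
    exact h.total.irrefl _ hd
  · have h3 := h.add_right _ _ (f i).1 _ _ h1
    rw [h2, zero_add] at h3
    have : ((f i).1, (f j).2) = f i := Prod.ext rfl he.symm
    rw [this] at h3
    exact h.total.irrefl _ (h.total.trans _ _ _ h3 hd)

end Orders

end PBWRed

namespace PBWRed

/-! ### Sorting words -/

/-- Commutation relations `x_j x_i = cf e i j x_i x_j + dw e i j`, one system for each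
component `e`, with all polynomials given as lists of terms. -/
structure Sys (K ι κ : Type*) where
  le : ι → ι → Bool
  cf : κ → ι → ι → K
  dw : κ → ι → ι → List (K × List ι)

/-- Multiplication of a list of terms by a scalar. -/
def scale {K β : Type*} [Mul K] (c : K) (l : List (K × β)) : List (K × β) :=
  l.map fun t => (c * t.1, t.2)

/-- Left multiplication by a word. -/
def lmulTerms {K ι : Type*} (w : List ι) (l : List (K × List ι)) : List (K × List ι) :=
  l.map fun t => (t.1, w ++ t.2)

section SortWord

variable {K ι κ : Type*} [Field K]

/-- Rewrites the product of a variable and a sorted word as a multiple of a sorted word plus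
smaller terms. -/
def Sys.ins (S : Sys K ι κ) (e : κ) (i : ι) : List ι → K × (List ι × List (K × List ι))
  | [] => (1, ([i], []))
  | j :: u =>
    bif S.le i j then (1, (i :: j :: u, []))
    else
      (S.cf e j i * (S.ins e i u).1, (j :: (S.ins e i u).2.1,
        scale (S.cf e j i) (lmulTerms [j] (S.ins e i u).2.2) ++
          (S.dw e j i).map fun t => (t.1, t.2 ++ u)))

/-- Rewrites a word as a multiple of a sorted word plus smaller terms. -/
def Sys.sort (S : Sys K ι κ) (e : κ) : List ι → K × (List ι × List (K × List ι))
  | [] => (1, ([], []))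
  | i :: w =>
    ((S.sort e w).1 * (S.ins e i (S.sort e w).2.1).1, ((S.ins e i (S.sort e w).2.1).2.1,
      scale (S.sort e w).1 (S.ins e i (S.sort e w).2.1).2.2 ++ lmulTerms [i] (S.sort e w).2.2))

end SortWord

/-! ### Values of words in the algebra and correctness of sorting -/

section Values

variable {K : Type*} [Field K] {n : ℕ} {E : Type*} {A : Type*} [Ring A] [Algebra K A]
  (π : Free K n →ₐ[K] A)

/-- The class of a word. -/
noncomputable def wv (w : List (Fin n)) : A := π (MonoidAlgebra.single (FreeMonoid.ofList w) 1)

theorem wv_nil : wv π [] = 1 := by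
  rw [wv, FreeMonoid.ofList_nil, ← MonoidAlgebra.one_def, map_one]

theorem wv_append (w w' : List (Fin n)) : wv π (w ++ w') = wv π w * wv π w' := by
  rw [wv, wv, wv, ← map_mul, MonoidAlgebra.single_mul_single, one_mul, FreeMonoid.ofList_append]

theorem wv_cons (i : Fin n) (w : List (Fin n)) : wv π (i :: w) = wv π [i] * wv π w := by
  rw [← wv_append]; rfl

/-- The class of a list of terms. -/
noncomputable def pv (l : List (K × List (Fin n))) : A := (l.map fun t => t.1 • wv π t.2).sum

@[simp] theorem pv_nil : pv π [] = 0 := rfl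

theorem pv_append (l l' : List (K × List (Fin n))) : pv π (l ++ l') = pv π l + pv π l' := by
  simp [pv]

theorem pv_cons (t : K × List (Fin n)) (l : List (K × List (Fin n))) :
    pv π (t :: l) = t.1 • wv π t.2 + pv π l := by
  simp [pv]

theorem pv_scale (c : K) (l : List (K × List (Fin n))) : pv π (scale c l) = c • pv π l := by
  induction l with
  | nil => simp [scale]
  | cons t l ih => rw [scale, List.map_cons, pv_cons, ← scale, ih, pv_cons, smul_add, mul_smul]

theorem pv_lmulTerms (w : List (Fin n)) (l : List (K × List (Fin n))) :
    pv π (lmulTerms w l) = wv π w * pv π l := by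
  induction l with
  | nil => simp [lmulTerms]
  | cons t l ih =>
    rw [lmulTerms, List.map_cons, pv_cons, ← lmulTerms, ih, pv_cons, mul_add, wv_append,
      mul_smul_comm]

theorem pv_rmul (w : List (Fin n)) (l : List (K × List (Fin n))) :
    pv π (l.map fun t => (t.1, t.2 ++ w)) = pv π l * wv π w := by
  induction l with
  | nil => simp
  | cons t l ih =>
    rw [List.map_cons, pv_cons, ih, pv_cons, add_mul, wv_append, smul_mul_assoc]

/-- The system `S` describes the commutation relations of `A`. -/
structure Sys.Compatible (lt : Expo n × E → Expo n × E → Prop) (S : Sys K (Fin n) E) : Prop where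
  ordering : IsMonomialOrdering lt
  le_iff : ∀ i j, S.le i j = true ↔ i ≤ j
  cf_ne : ∀ e i j, i < j → S.cf e i j ≠ 0
  rel : ∀ e i j, i < j → wv π [j, i] = S.cf e i j • wv π [i, j] + pv π (S.dw e i j)
  dw_lt : ∀ e i j, i < j → ∀ t ∈ S.dw e i j, lt (listExpo t.2, e) (listExpo [i, j], e)

theorem IsMonomialOrdering.add_left {lt : Expo n × E → Expo n × E → Prop}
    (h : IsMonomialOrdering lt) {α β : Expo n} {e e' : E} (γ : Expo n) (hl : lt (α, e) (β, e')) :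
    lt (γ + α, e) (γ + β, e') := by
  rw [add_comm γ, add_comm γ]; exact h.add_right _ _ _ _ _ hl

/-- The properties of the output `r` of sorting the word `w`. -/
structure IsSorting (lt : Expo n × E → Expo n × E → Prop) (e : E) (w : List (Fin n))
    (r : K × (List (Fin n) × List (K × List (Fin n)))) : Prop where
  ne : r.1 ≠ 0
  eq : wv π w = r.1 • wv π r.2.1 + pv π r.2.2
  perm : r.2.1.Perm w
  sorted : r.2.1.Pairwise (· ≤ ·)
  low : ∀ t ∈ r.2.2, lt (listExpo t.2, e) (listExpo w, e)

variable {π} {lt : Expo n × E → Expo n × E → Prop} {S : Sys K (Fin n) E}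

/-- The variable moves to the right past each smaller `j`. One exchange contributes the factor `cf`
and the lower terms `dw` times the rest of the word; the lower terms of the recursive call are
multiplied by `j` from the left. Compatibility of the ordering with addition keeps both kinds below
the exponent of the word. -/
theorem Sys.Compatible.isSorting_ins (h : S.Compatible π lt) (e : E) (i : Fin n)
    (u : List (Fin n)) (hu : u.Pairwise (· ≤ ·)) : IsSorting π lt e (i :: u) (S.ins e i u) := by
  induction u with
  | nil => exact ⟨by simp [Sys.ins], by simp [Sys.ins], .refl _, by simp [Sys.ins], by simp [Sys.ins]⟩
  | cons j u ih =>
    rw [List.pairwise_cons] at hu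
    cases hle : S.le i j with
    | true =>
      have hij := (h.le_iff i j).1 hle
      refine ⟨by simp [Sys.ins, hle], by simp [Sys.ins, hle], by simp [Sys.ins, hle], ?_,
        by simp [Sys.ins, hle]⟩
      simp only [Sys.ins, hle, cond_true, List.pairwise_cons]
      refine ⟨?_, hu⟩
      intro a ha
      rcases List.mem_cons.1 ha with rfl | ha
      · exact hij
      · exact hij.trans (hu.1 a ha)
    | false =>
      have hji : j < i := by
        by_contra hh
        rw [(h.le_iff i j).2 (not_lt.1 hh)] at hle
        cases hle
      have ih := ih hu.2
      simp only [Sys.ins, hle, cond_false]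
      refine ⟨mul_ne_zero (h.cf_ne _ _ _ hji) ih.ne, ?_, ?_, ?_, ?_⟩
      · have h1 : wv π (i :: j :: u) = wv π [i, j] * wv π u := by rw [← wv_append]; rfl
        have h2 : wv π [j, i] * wv π u = wv π [j] * wv π (i :: u) := by
          rw [← wv_append, ← wv_append]; rfl
        rw [h1, h.rel e j i hji, add_mul, smul_mul_assoc, h2, ih.eq, pv_append, pv_scale,
          pv_lmulTerms, pv_rmul, mul_add, smul_add, mul_smul_comm, ← wv_cons, mul_smul, add_assoc]
      · exact (List.Perm.cons j ih.perm).trans (List.Perm.swap i j u)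
      · rw [List.pairwise_cons]
        refine ⟨fun a ha => ?_, ih.sorted⟩
        rcases List.mem_cons.1 (ih.perm.subset ha) with rfl | ha
        · exact hji.le
        · exact hu.1 a ha
      · intro t ht
        have hex : listExpo (i :: j :: u) = listExpo [j] + listExpo (i :: u) := by
          rw [← listExpo_append]
          exact listExpo_eq_of_perm (List.Perm.swap _ _ u)
        rcases List.mem_append.1 ht with ht | ht
        · simp only [scale, lmulTerms, List.map_map, List.mem_map] at ht
          obtain ⟨s, hs, rfl⟩ := ht
          simp only [Function.comp, listExpo_append, hex]
          exact h.ordering.add_left _ (ih.low s hs)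
        · rw [List.mem_map] at ht
          obtain ⟨s, hs, rfl⟩ := ht
          have : listExpo (i :: j :: u) = listExpo [j, i] + listExpo u := by
            rw [← listExpo_append]
            exact listExpo_eq_of_perm (List.Perm.swap _ _ u)
          simp only [listExpo_append, this]
          exact h.ordering.add_right _ _ _ _ _ (h.dw_lt e j i hji s hs)

/-- This is insertion sort. The lower terms are left unsorted, since only their exponents matter for
later induction. -/
theorem Sys.Compatible.isSorting_sort (h : S.Compatible π lt) (e : E) (w : List (Fin n)) :
    IsSorting π lt e w (S.sort e w) := by
  induction w with
  | nil => exact ⟨by simp [Sys.sort], by simp [Sys.sort], .refl _, by simp [Sys.sort], by simp [Sys.sort]⟩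
  | cons i w ih =>
    have hi := h.isSorting_ins e i _ ih.sorted
    have hp : listExpo (i :: (S.sort e w).2.1) = listExpo (i :: w) :=
      listExpo_eq_of_perm (List.Perm.cons i ih.perm)
    refine ⟨mul_ne_zero ih.ne hi.ne, ?_, hi.perm.trans (ih.perm.cons i), hi.sorted, ?_⟩
    · have := ih.eq
      simp only [Sys.sort]
      rw [wv_cons, this, mul_add, mul_smul_comm, ← wv_cons, hi.eq, pv_append, pv_scale,
        pv_lmulTerms, smul_add, mul_smul, add_assoc]
    · intro t ht
      rcases List.mem_append.1 ht with ht | ht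
      · simp only [scale, List.mem_map] at ht
        obtain ⟨s, hs, rfl⟩ := ht
        rw [← hp]
        exact hi.low s hs
      · simp only [lmulTerms, List.mem_map] at ht
        obtain ⟨s, hs, rfl⟩ := ht
        rw [listExpo_append, listExpo_cons i w]
        exact h.ordering.add_left _ (ih.low s hs)

/-- `x^α` as an element of `A`. -/
noncomputable def xm (π : Free K n →ₐ[K] A) (α : Expo n) : A := π (stdMon K α)

theorem wv_stdList (α : Expo n) : wv π (stdList α) = xm π α := by
  rw [wv, ← stdWord_eq]; rfl

theorem wv_of_pairwise {u : List (Fin n)} (h : u.Pairwise (· ≤ ·)) :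
    wv π u = xm π (listExpo u) := by
  conv_lhs => rw [eq_stdList_of_pairwise h]
  exact wv_stdList _

theorem xm_zero : xm π 0 = 1 := by
  rw [← wv_stdList, stdList_zero, wv_nil]

/-- Every word is a nonzero multiple of the standard monomial with the same exponent, up to
smaller standard monomials. -/
theorem Sys.Compatible.exists_wv_sub_mem (h : S.Compatible π lt) (hwf : WellFounded lt) (e : E)
    (w : List (Fin n)) : ∃ c : K, c ≠ 0 ∧ wv π w - c • xm π (listExpo w) ∈
      Submodule.span K (xm π '' {β | lt (β, e) (listExpo w, e)}) := by
  have := h.ordering.total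
  obtain ⟨α, hα⟩ : ∃ α, α = listExpo w := ⟨_, rfl⟩
  obtain ⟨p, hp⟩ : ∃ p, p = (α, e) := ⟨_, rfl⟩
  -- One call of `sort` treats the leading word; its unsorted lower terms have smaller exponents and
  -- are covered by induction.
  induction p using hwf.induction generalizing α w with
  | _ p ih =>
    subst hp hα
    have hs := h.isSorting_sort e w
    refine ⟨_, hs.ne, ?_⟩
    rw [hs.eq, wv_of_pairwise hs.sorted, listExpo_eq_of_perm hs.perm, add_sub_cancel_left]
    refine list_sum_mem fun x hx => ?_
    rw [List.mem_map] at hx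
    obtain ⟨t, ht, rfl⟩ := hx
    have hlow := hs.low t ht
    obtain ⟨c, -, hc⟩ := ih _ hlow _ _ rfl rfl
    refine Submodule.smul_mem _ _ ?_
    rw [← sub_add_cancel (wv π t.2) (c • xm π (listExpo t.2))]
    refine add_mem (Submodule.span_mono (Set.image_mono fun β hβ => ?_) hc) ?_
    · exact h.ordering.total.trans _ _ _ hβ hlow
    · exact Submodule.smul_mem _ _ (Submodule.subset_span ⟨_, hlow, rfl⟩)

end Values

end PBWRed

namespace PBWRed

/-! ### Irreducible representatives -/

section Free

variable {K : Type*} [Field K] {n : ℕ}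

theorem lm_eq_some_iff {lt : Expo n → Expo n → Prop} (h : IsMonomialWellOrdering lt)
    {t : Free K n} {w : Word n} :
    lm lt t = some w ↔ t.coeff w ≠ 0 ∧ ∀ w', t.coeff w' ≠ 0 → w' = w ∨ wordLt lt w' w :=
  lead_eq_some_iff (wordLt_isStrictTotalOrder h)

theorem exists_lm {lt : Expo n → Expo n → Prop} (h : IsMonomialWellOrdering lt)
    {t : Free K n} (ht : t ≠ 0) : ∃ w, lm lt t = some w := by
  refine exists_lead (wordLt_isStrictTotalOrder h) ?_ ?_
  · exact t.coeff.hasFiniteSupport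
  · by_contra hne
    rw [Set.not_nonempty_iff_eq_empty] at hne
    apply ht
    rw [← MonoidAlgebra.coeff_eq_zero]
    ext w
    by_contra hw
    have : w ∈ {w | t.coeff w ≠ 0} := hw
    rw [hne] at this
    exact this

theorem lexp_eq_some_of_isPoly {lt : Expo n → Expo n → Prop} (h : IsMonomialWellOrdering lt)
    {t : Free K n} (ht : IsPoly t) {α : Expo n} :
    lexp lt t = some α ↔ lm lt t = some (stdWord α) := by
  rw [lexp, Option.map_eq_some_iff]
  constructor
  · rintro ⟨w, hw, rfl⟩
    obtain ⟨β, rfl⟩ := ht w ((lm_eq_some_iff h).1 hw).1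
    rwa [wordExpo_stdWord]
  · intro hw
    exact ⟨_, hw, wordExpo_stdWord α⟩

theorem coeff_stdMon [DecidableEq (Word n)] (α : Expo n) (w : Word n) :
    (stdMon K α).coeff w = if stdWord α = w then 1 else 0 :=
  by rw [stdMon, MonoidAlgebra.coeff_single, Finsupp.single_apply]

theorem eq_sum_single (t : Free K n) :
    t = ∑ w ∈ t.coeff.support, t.coeff w • (MonoidAlgebra.single w 1 : Free K n) := by
  conv_lhs => rw [← MonoidAlgebra.sum_coeff_single t]
  rw [Finsupp.sum]
  refine Finset.sum_congr rfl fun w _ => ?_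
  rw [MonoidAlgebra.smul_single, smul_eq_mul, mul_one]

theorem single_mul_mul_single_coeff (m m' : Word n) (s : Free K n) (w : Word n)
    (h : (MonoidAlgebra.single m 1 * s * MonoidAlgebra.single m' 1 : Free K n).coeff w ≠ 0) :
    ∃ v, s.coeff v ≠ 0 ∧ w = m * v * m' := by
  classical
  by_contra hcon
  push Not at hcon
  apply h
  conv_lhs => rw [eq_sum_single s, Finset.mul_sum, Finset.sum_mul]
  rw [MonoidAlgebra.coeff_sum, Finsupp.finsetSum_apply]
  refine Finset.sum_eq_zero fun v hv => ?_
  rw [mul_smul_comm, smul_mul_assoc, MonoidAlgebra.single_mul_single,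
    MonoidAlgebra.single_mul_single, MonoidAlgebra.coeff_smul_apply,
    MonoidAlgebra.coeff_single, Finsupp.single_apply, if_neg, smul_zero]
  intro heq
  exact hcon v (Finsupp.mem_support_iff.1 hv) heq.symm

theorem single_mul_mul_single_coeff_self (m m' : Word n) (s : Free K n) (v : Word n) :
    (MonoidAlgebra.single m 1 * s * MonoidAlgebra.single m' 1 : Free K n).coeff (m * v * m')
      = s.coeff v := by
  rw [MonoidAlgebra.coeff_mul_single_eq_coeff_mul (m * v) fun a _ => mul_left_inj m',
    MonoidAlgebra.coeff_single_mul_eq_mul_coeff v fun a _ => mul_right_inj m, one_mul, mul_one]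

theorem reduction_eq_self {lt : Expo n → Expo n → Prop} {m m' : Word n} {s t : Free K n}
    (h : ∀ w, t.coeff w ≠ 0 → w ≠ m * (lm lt s).getD 1 * m') : reduction lt m s m' t = t := by
  classical
  conv_rhs => rw [eq_sum_single t]
  simp only [reduction, LinearMap.comp_apply, Finsupp.linearCombination_apply, Finsupp.sum]
  refine Finset.sum_congr rfl fun w hw => ?_
  rw [if_neg (h w (Finsupp.mem_support_iff.1 hw))]
  rfl

theorem reduction_coeff_eq_zero {lt : Expo n → Expo n → Prop} {s t : Free K n} {l : Word n}
    (hl : lm lt s = some l) : (reduction lt 1 s 1 t).coeff l = 0 := by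
  classical
  simp only [reduction, LinearMap.comp_apply, Finsupp.linearCombination_apply, Finsupp.sum]
  rw [MonoidAlgebra.coeff_sum, Finsupp.finsetSum_apply]
  refine Finset.sum_eq_zero fun w hw => ?_
  rw [MonoidAlgebra.coeff_smul_apply, hl]
  simp only [Option.getD_some, one_mul, mul_one]
  split_ifs with h
  · rw [← MonoidAlgebra.one_def, one_mul, mul_one, MonoidAlgebra.coeff_smul_apply,
      MonoidAlgebra.coeff_sub, Finsupp.sub_apply, MonoidAlgebra.coeff_single, Finsupp.single_apply, if_pos rfl]
    simp
  · rw [MonoidAlgebra.coeff_single, Finsupp.single_apply, if_neg h, smul_zero]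

/-- The words that are the leading monomial of an element of the kernel. -/
def IsReducibleWord {A : Type*} [Ring A] [Algebra K A] (π : Free K n →ₐ[K] A)
    (lt : Expo n → Expo n → Prop) (w : Word n) : Prop :=
  ∃ s : Free K n, π s = 0 ∧ lm lt s = some w

variable {A : Type*} [Ring A] [Algebra K A] {π : Free K n →ₐ[K] A}

/-- The kernel is a two-sided ideal, so a reduction that acts on a word `m lm(s) m'` of `t` exhibits
this word as the leading word of `m s m'` in the kernel. Conversely, reducing by an element of the
kernel with leading word `w` and `m = m' = 1` makes the coefficient of `w` zero. -/
theorem isNormal_iff {lt : Expo n → Expo n → Prop} (h : IsMonomialWellOrdering lt) {t : Free K n} :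
    IsNormal π lt t ↔ ∀ w, t.coeff w ≠ 0 → ¬ IsReducibleWord π lt w := by
  constructor
  · rintro ht w hw ⟨s, hs, hl⟩
    have hs0 : s ≠ 0 := by
      rintro rfl
      exact ((lm_eq_some_iff h).1 hl).1 rfl
    have := ht (reduction lt 1 s 1 t) (Relation.ReflTransGen.single ⟨s, hs, hs0, 1, 1, rfl⟩)
    apply hw
    rw [← this]
    exact reduction_coeff_eq_zero hl
  · intro ht t' hr
    induction hr with
    | refl => rfl
    | tail _ hstep ih =>
      subst ih
      obtain ⟨s, hs, hs0, m, m', rfl⟩ := hstep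
      apply reduction_eq_self
      intro w hw hwe
      obtain ⟨l, hl⟩ := exists_lm h hs0
      rw [hl, Option.getD_some] at hwe
      refine ht w hw ⟨MonoidAlgebra.single m 1 * s * MonoidAlgebra.single m' 1, ?_, ?_⟩
      · rw [map_mul, map_mul, show π s = 0 from hs, mul_zero, zero_mul]
      · rw [lm_eq_some_iff h] at hl ⊢
        subst hwe
        refine ⟨by rw [single_mul_mul_single_coeff_self]; exact hl.1, fun w' hw' => ?_⟩
        obtain ⟨v, hv, rfl⟩ := single_mul_mul_single_coeff m m' s w' hw'
        rcases hl.2 v hv with rfl | h1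
        · exact Or.inl rfl
        · exact Or.inr (wordLt_mul h h1 _ _)

theorem Reduces.mono {lt : Expo n → Expo n → Prop} {S S' : Set (Free K n)} (h : S ⊆ S')
    {t t' : Free K n} (ht : Reduces lt S t t') : Reduces lt S' t t' :=
  Relation.ReflTransGen.mono (r := fun t t' =>
    ∃ s ∈ S, s ≠ 0 ∧ ∃ m m' : Word n, t' = reduction lt m s m' t)
    (fun _ _ ⟨s, hs, h'⟩ => ⟨s, h hs, h'⟩) _ _ ht

theorem IsNormal.add {lt : Expo n → Expo n → Prop} (h : IsMonomialWellOrdering lt)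
    {t t' : Free K n} (ht : IsNormal π lt t) (ht' : IsNormal π lt t') : IsNormal π lt (t + t') := by
  rw [isNormal_iff h] at *
  intro w hw
  by_cases h1 : t.coeff w = 0
  · refine ht' w fun h2 => hw ?_
    rw [MonoidAlgebra.coeff_add, Finsupp.add_apply, h1, h2, add_zero]
  · exact ht w h1

theorem IsNormal.smul {lt : Expo n → Expo n → Prop} (h : IsMonomialWellOrdering lt)
    {t : Free K n} (ht : IsNormal π lt t) (c : K) : IsNormal π lt (c • t) := by
  rw [isNormal_iff h] at *
  intro w hw
  refine ht w fun h2 => hw ?_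
  rw [MonoidAlgebra.coeff_smul_apply, h2, smul_zero]

/-- The difference is irreducible and lies in the kernel. If it were nonzero, its own leading word
would be reducible. -/
theorem IsNormal.eq_of_map_eq {lt : Expo n → Expo n → Prop} (h : IsMonomialWellOrdering lt)
    {t t' : Free K n} (ht : IsNormal π lt t) (ht' : IsNormal π lt t') (he : π t = π t') : t = t' := by
  by_contra hne
  have hs : IsNormal π lt (t + (-1 : K) • t') := ht.add h (ht'.smul h _)
  have hne' : t + (-1 : K) • t' ≠ 0 := by
    intro h0
    apply hne
    rw [neg_one_smul, ← sub_eq_add_neg] at h0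
    exact sub_eq_zero.1 h0
  obtain ⟨w, hw⟩ := exists_lm h hne'
  refine (isNormal_iff h).1 hs w ((lm_eq_some_iff h).1 hw).1 ⟨_, ?_, hw⟩
  rw [map_add, map_smul, he, neg_one_smul, add_neg_cancel]

end Free

/-! ### Irreducible monomials and normal forms for PBW-reduction data -/

section ModuleDatum

variable {K : Type*} [Field K] {n : ℕ} {E : Type*} {A : Type*} [Ring A] [Algebra K A]
  {π : Free K n →ₐ[K] A} {lt : Expo n × E → Expo n × E → Prop} {D : E → Datum K n}

/-- The commutation relations of a family of data, as lists of terms. -/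
noncomputable def sysOf (D : E → Datum K n) : Sys K (Fin n) E where
  le i j := decide (i ≤ j)
  cf e i j := (D e).c i j
  dw e i j := ((D e).d i j).coeff.support.toList.map fun w =>
    (((D e).d i j).coeff w, FreeMonoid.toList w)

theorem IsModuleDatum.map_S (h : IsModuleDatum π lt D) (e : E) {s : Free K n} (hs : s ∈ (D e).S) :
    π s = 0 :=
  (h.ker_eq e s).2 (TwoSidedIdeal.subset_span (Or.inr hs))

theorem IsModuleDatum.map_I (h : IsModuleDatum π lt D) (e : E) {s : Free K n} (hs : s ∈ (D e).I) :
    π s = 0 :=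
  (h.ker_eq e s).2 (TwoSidedIdeal.subset_span (Or.inl hs))

theorem IsModuleDatum.wv_rel (h : IsModuleDatum π lt D) (e : E) {i j : Fin n} (hij : i < j) :
    wv π [j, i] = (D e).c i j • wv π [i, j] + π ((D e).d i j) := by
  have := h.map_S e (s := MonoidAlgebra.single (FreeMonoid.of j * FreeMonoid.of i) 1
      - MonoidAlgebra.single (FreeMonoid.of i * FreeMonoid.of j) ((D e).c i j) - (D e).d i j)
    ⟨i, j, hij, rfl⟩
  rw [map_sub, map_sub, sub_sub, sub_eq_zero] at this
  rw [wv, wv, ← map_smul, MonoidAlgebra.smul_single, smul_eq_mul, mul_one]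
  exact this

/-- The datum bounds the words of `d i j` by the word `x_i x_j`. This word is standard for `i < j`,
so the bound is strict already on exponents. -/
theorem IsModuleDatum.d_lt (h : IsModuleDatum π lt D) (e : E) {i j : Fin n} (hij : i < j)
    {w : Word n} (hw : ((D e).d i j).coeff w ≠ 0) :
    lt (wordExpo w, e) (listExpo [i, j], e) := by
  have hd := h.datum e
  have hne : (D e).d i j ≠ 0 := by
    intro h0; rw [h0] at hw; exact hw rfl
  obtain ⟨l, hl⟩ := exists_lm hd.well hne
  have h1 := hd.comm.d_lt i j hij l hl
  have h2 : wordLt (restrict lt e) w (FreeMonoid.of i * FreeMonoid.of j) := by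
    rcases ((lm_eq_some_iff hd.well).1 hl).2 w hw with rfl | h3
    · exact h1
    · exact (wordLt_isStrictTotalOrder hd.well).trans _ _ _ h3 h1
  have h3 : (FreeMonoid.of i * FreeMonoid.of j : Word n) = stdWord (listExpo [i, j]) := by
    refine eq_stdWord_of_pairwise (w := FreeMonoid.of i * FreeMonoid.of j) ?_
    change List.Pairwise _ [i, j]
    simp [hij.le]
  rw [h3] at h2
  exact wordExpo_le_of_wordLt h2

theorem IsModuleDatum.compatible (h : IsModuleDatum π lt D) : (sysOf D).Compatible π lt where
  ordering := h.ordering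
  le_iff i j := by simp [sysOf]
  cf_ne e i j hij := (h.datum e).comm.c_ne_zero i j hij
  rel e i j hij := by
    rw [h.wv_rel e hij]
    congr 1
    conv_lhs => rw [eq_sum_single ((D e).d i j)]
    rw [map_sum, pv, sysOf, List.map_map, ← Finset.sum_map_toList]
    congr 1
    refine List.map_congr_left fun w _ => ?_
    rw [map_smul]
    rfl
  dw_lt e i j hij t ht := by
    simp only [sysOf, List.mem_map, Finset.mem_toList, Finsupp.mem_support_iff] at ht
    obtain ⟨w, hw, rfl⟩ := ht
    exact h.d_lt e hij hw

variable [Finite E]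

theorem IsModuleDatum.wf (h : IsModuleDatum π lt D) : WellFounded lt :=
  wellFounded_of_restrict h.ordering fun e => (h.datum e).well

theorem IsModuleDatum.exists_wv_sub_mem (h : IsModuleDatum π lt D) (e : E)
    (w : List (Fin n)) : ∃ c : K, c ≠ 0 ∧ wv π w - c • xm π (listExpo w) ∈
      Submodule.span K (xm π '' {β | lt (β, e) (listExpo w, e)}) :=
  h.compatible.exists_wv_sub_mem h.wf e w

theorem IsModuleDatum.wv_mem (h : IsModuleDatum π lt D) (e : E)
    (w : List (Fin n)) : wv π w ∈
      Submodule.span K (xm π '' {β | β = listExpo w ∨ lt (β, e) (listExpo w, e)}) := by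
  obtain ⟨c, -, hc⟩ := h.exists_wv_sub_mem e w
  rw [← sub_add_cancel (wv π w) (c • xm π (listExpo w))]
  exact add_mem (Submodule.span_mono (Set.image_mono fun β hβ => Or.inr hβ) hc)
    (Submodule.smul_mem _ _ (Submodule.subset_span ⟨_, Or.inl rfl, rfl⟩))

/-- The set of irreducible monomials `x^α (e)`. -/
def normalSet (lt : Expo n × E → Expo n × E → Prop) (D : E → Datum K n) : Set (Expo n × E) :=
  {p | p.1 ∉ Lset (restrict lt p.2) ((D p.2).I : Set (Free K n))}

/-- The leading monomial of an element of the kernel is a combination of smaller monomials. -/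
theorem IsModuleDatum.xm_mem_of_lm (h : IsModuleDatum π lt D) {e : E} {α : Expo n} {s : Free K n}
    (hs : π s = 0) (hl : lm (restrict lt e) s = some (stdWord α)) :
    xm π α ∈ Submodule.span K (xm π '' {β | lt (β, e) (α, e)}) := by
  classical
  rw [lm_eq_some_iff (h.datum e).well] at hl
  rw [eq_sum_single s, map_sum, ← Finset.add_sum_erase _ _
    (Finsupp.mem_support_iff.2 hl.1), map_smul] at hs
  have h1 : xm π α = -(s.coeff (stdWord α))⁻¹ • ∑ w ∈ s.coeff.support.erase (stdWord α),
      π (s.coeff w • MonoidAlgebra.single w 1) := by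
    rw [eq_neg_of_add_eq_zero_right hs, smul_neg, neg_smul, neg_neg, smul_smul,
      inv_mul_cancel₀ hl.1, one_smul]
    rfl
  rw [h1]
  refine Submodule.smul_mem _ _ (Submodule.sum_mem _ fun w hw => ?_)
  rw [Finset.mem_erase, Finsupp.mem_support_iff] at hw
  have h2 := wordExpo_le_of_wordLt ((hl.2 w hw.2).resolve_left hw.1)
  rw [map_smul]
  refine Submodule.smul_mem _ _ ?_
  refine Submodule.span_mono (Set.image_mono ?_) (h.wv_mem e (FreeMonoid.toList w))
  rintro β (rfl | hβ)
  · exact h2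
  · exact h.ordering.total.trans _ _ _ hβ h2

/-- The defining equation of a datum concerns elements of the ideal that lie in K[x], whereas
reducibility admits any element of the kernel. Given such an element with leading word `x^α`, the
class of `x^α` is a combination of classes of smaller standard monomials, and `x^α` minus this
combination is an element of K[x] in the kernel with the same leading monomial. -/
theorem IsModuleDatum.mem_Lset_iff (h : IsModuleDatum π lt D) (e : E) (α : Expo n) :
    α ∈ Lset (restrict lt e) ((D e).I : Set (Free K n)) ↔
      IsReducibleWord π (restrict lt e) (stdWord α) := by
  classical
  have hd := h.datum e
  rw [hd.L_eq]
  constructor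
  · rintro ⟨g, ⟨hg, hp⟩, -, hl⟩
    exact ⟨g, (h.ker_eq e g).2 hg, (lexp_eq_some_of_isPoly hd.well hp).1 hl⟩
  · rintro ⟨s, hs, hl⟩
    have hmem := h.xm_mem_of_lm hs hl
    -- The combination is lifted from `A` to a combination `g` of standard monomials below `x^α` in
    -- the free algebra.
    have himg : xm π '' {β | lt (β, e) (α, e)} =
        π.toLinearMap '' ((stdMon K : Expo n → Free K n) '' {β | lt (β, e) (α, e)}) := by
      rw [Set.image_image]; rfl
    rw [himg, ← Submodule.map_span] at hmem
    obtain ⟨g, hg, hgα⟩ := hmem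
    have hsupp : ∀ w, g.coeff w ≠ 0 → ∃ β, w = stdWord β ∧ lt (β, e) (α, e) := by
      clear hgα
      induction hg using Submodule.span_induction with
      | mem x hx =>
        obtain ⟨β, hβ, rfl⟩ := hx
        intro w hw
        rw [coeff_stdMon] at hw
        exact ⟨β, (by_contra fun hne => hw (if_neg fun hh => hne hh.symm)), hβ⟩
      | zero => intro w hw; exact absurd rfl hw
      | add x y _ _ hx hy =>
        intro w hw
        by_cases h0 : x.coeff w = 0
        · refine hy w fun h1 => hw ?_
          rw [MonoidAlgebra.coeff_add, Finsupp.add_apply, h0, h1, add_zero]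
        · exact hx w h0
      | smul c x _ hx =>
        intro w hw
        refine hx w fun h1 => hw ?_
        rw [MonoidAlgebra.coeff_smul_apply, h1, smul_zero]
    have hgα' : g.coeff (stdWord α) = 0 := by
      by_contra hne
      obtain ⟨β, hβ, hlt⟩ := hsupp _ hne
      rw [stdWord_injective hβ] at hlt
      exact h.ordering.total.irrefl _ hlt
    have hcf : ∀ w, (stdMon K α - g).coeff w = (if stdWord α = w then 1 else 0) - g.coeff w := by
      intro w
      rw [MonoidAlgebra.coeff_sub, Finsupp.sub_apply, coeff_stdMon]
    have hcα : (stdMon K α - g).coeff (stdWord α) ≠ 0 := by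
      rw [hcf, hgα', if_pos rfl, sub_zero]; exact one_ne_zero
    have hlm : lm (restrict lt e) (stdMon K α - g) = some (stdWord α) := by
      rw [lm_eq_some_iff hd.well]
      refine ⟨hcα, fun w hw => ?_⟩
      by_cases hwα : stdWord α = w
      · exact Or.inl hwα.symm
      · rw [hcf, if_neg hwα, zero_sub, neg_ne_zero] at hw
        obtain ⟨β, rfl, hlt⟩ := hsupp w hw
        right; left
        rwa [wordExpo_stdWord, wordExpo_stdWord]
    have hp : IsPoly (stdMon K α - g) := by
      intro w hw
      by_cases hwα : stdWord α = w
      · exact ⟨α, hwα.symm⟩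
      · rw [hcf, if_neg hwα, zero_sub, neg_ne_zero] at hw
        obtain ⟨β, rfl, -⟩ := hsupp w hw
        exact ⟨β, rfl⟩
    refine ⟨_, ⟨?_, hp⟩, ?_, (lexp_eq_some_of_isPoly hd.well hp).2 hlm⟩
    · rw [← h.ker_eq e, map_sub]
      change xm π α - π.toLinearMap g = 0
      rw [hgα, sub_self]
    · intro h0
      rw [h0] at hcα
      exact hcα rfl

theorem IsModuleDatum.isNormal_stdMon_iff (h : IsModuleDatum π lt D) (e : E) (α : Expo n) :
    IsNormal π (restrict lt e) (stdMon K α) ↔ (α, e) ∈ normalSet lt D := by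
  classical
  rw [isNormal_iff (h.datum e).well]
  change _ ↔ ¬ _
  rw [h.mem_Lset_iff]
  constructor
  · intro hh
    refine hh _ ?_
    rw [coeff_stdMon, if_pos rfl]; exact one_ne_zero
  · intro hh w hw
    rw [coeff_stdMon] at hw
    have : stdWord α = w := by by_contra hne; exact hw (if_neg hne)
    rwa [← this]

/-- The commutation relations lie in the kernel, so an irreducible element is fixed by the
reductions that carry it into K[x]. -/
theorem IsModuleDatum.isPoly_of_isNormal (h : IsModuleDatum π lt D) (e : E) {t : Free K n}
    (ht : IsNormal π (restrict lt e) t) : IsPoly t := by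
  obtain ⟨p, hp, hr⟩ := (h.datum e).comm.reduces t
  have := ht p (hr.mono fun s hs => h.map_S e hs)
  rwa [← this]

theorem IsModuleDatum.isNormal_iff_forall (h : IsModuleDatum π lt D) (e : E) {t : Free K n} :
    IsNormal π (restrict lt e) t ↔
      ∀ w, t.coeff w ≠ 0 → ∃ α, w = stdWord α ∧ (α, e) ∈ normalSet lt D := by
  constructor
  · intro ht w hw
    obtain ⟨α, rfl⟩ := h.isPoly_of_isNormal e ht w hw
    exact ⟨α, rfl, fun hα => (isNormal_iff (h.datum e).well).1 ht _ hw ((h.mem_Lset_iff e α).1 hα)⟩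
  · intro ht
    rw [isNormal_iff (h.datum e).well]
    intro w hw hr
    obtain ⟨α, rfl, hα⟩ := ht w hw
    exact hα ((h.mem_Lset_iff e α).2 hr)

/-- A reducible monomial is a combination of smaller monomials. -/
theorem IsModuleDatum.xm_mem_of_notMem (h : IsModuleDatum π lt D) {e : E} {α : Expo n}
    (hα : (α, e) ∉ normalSet lt D) :
    xm π α ∈ Submodule.span K (xm π '' {β | lt (β, e) (α, e)}) := by
  have hα' : α ∈ Lset (restrict lt e) ((D e).I : Set (Free K n)) := not_not.1 hα
  rw [(h.datum e).L_eq] at hα'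
  obtain ⟨g, ⟨hg, hp⟩, -, hl⟩ := hα'
  exact h.xm_mem_of_lm ((h.ker_eq e g).2 hg) ((lexp_eq_some_of_isPoly (h.datum e).well hp).1 hl)

theorem IsModuleDatum.xm_mem_span_normal (h : IsModuleDatum π lt D) (e : E) (α : Expo n) :
    xm π α ∈ Submodule.span K
      (xm π '' {β | (β = α ∨ lt (β, e) (α, e)) ∧ (β, e) ∈ normalSet lt D}) := by
  obtain ⟨p, hp⟩ : ∃ p, p = (α, e) := ⟨_, rfl⟩
  induction p using h.wf.induction generalizing α with
  | _ p ih =>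
    subst hp
    by_cases hα : (α, e) ∈ normalSet lt D
    · exact Submodule.subset_span ⟨α, ⟨Or.inl rfl, hα⟩, rfl⟩
    · have h1 := h.xm_mem_of_notMem hα
      refine (Submodule.span_le.2 ?_) h1
      rintro _ ⟨β, hβ, rfl⟩
      refine Submodule.span_mono (Set.image_mono ?_) (ih _ hβ β rfl)
      rintro γ ⟨rfl | hγ, hn⟩
      · exact ⟨Or.inr hβ, hn⟩
      · exact ⟨Or.inr (h.ordering.total.trans _ _ _ hγ hβ), hn⟩

/-- Every word is a combination of standard monomials and each of these of irreducible ones, by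
well-founded induction; lifting the combination to the free algebra gives the representative. -/
theorem IsModuleDatum.exists_isNormal (h : IsModuleDatum π lt D) (e : E) (a : A) :
    ∃ t, IsNormal π (restrict lt e) t ∧ π t = a := by
  classical
  obtain ⟨s, rfl⟩ := h.surjective a
  have h1 : π s ∈ Submodule.span K (π.toLinearMap ''
      ((stdMon K : Expo n → Free K n) '' {β | (β, e) ∈ normalSet lt D})) := by
    rw [eq_sum_single s, map_sum]
    refine Submodule.sum_mem _ fun w _ => ?_
    rw [map_smul]
    refine Submodule.smul_mem _ _ ((Submodule.span_le.2 ?_) (h.wv_mem e (FreeMonoid.toList w)))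
    rintro _ ⟨β, -, rfl⟩
    rw [Set.image_image]
    exact Submodule.span_mono (Set.image_mono fun γ hγ => hγ.2) (h.xm_mem_span_normal e β)
  rw [← Submodule.map_span] at h1
  obtain ⟨t, ht, hts⟩ := h1
  refine ⟨t, ?_, hts⟩
  have hw := (h.datum e).well
  clear hts
  induction ht using Submodule.span_induction with
  | mem x hx =>
    obtain ⟨β, hβ, rfl⟩ := hx
    exact (h.isNormal_stdMon_iff e β).2 hβ
  | zero => exact (isNormal_iff hw).2 fun w hw => absurd rfl hw
  | add x y _ _ hx hy => exact hx.add hw hy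
  | smul c x _ hx => exact hx.smul hw c

theorem IsModuleDatum.isNormal_tau (h : IsModuleDatum π lt D) (e : E) (a : A) :
    IsNormal π (restrict lt e) (tau π (restrict lt e) a) := by
  rw [tau, dif_pos (h.exists_isNormal e a)]
  exact (h.exists_isNormal e a).choose_spec.1

theorem IsModuleDatum.map_tau (h : IsModuleDatum π lt D) (e : E) (a : A) :
    π (tau π (restrict lt e) a) = a := by
  rw [tau, dif_pos (h.exists_isNormal e a)]
  exact (h.exists_isNormal e a).choose_spec.2

theorem IsModuleDatum.tau_eq (h : IsModuleDatum π lt D) (e : E) {t : Free K n}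
    (ht : IsNormal π (restrict lt e) t) : tau π (restrict lt e) (π t) = t :=
  (h.isNormal_tau e _).eq_of_map_eq (h.datum e).well ht (h.map_tau e _)

theorem IsModuleDatum.tau_add (h : IsModuleDatum π lt D) (e : E) (a b : A) :
    tau π (restrict lt e) (a + b) = tau π (restrict lt e) a + tau π (restrict lt e) b := by
  conv_lhs => rw [← h.map_tau e a, ← h.map_tau e b, ← map_add]
  exact h.tau_eq e ((h.isNormal_tau e a).add (h.datum e).well (h.isNormal_tau e b))

theorem IsModuleDatum.tau_smul (h : IsModuleDatum π lt D) (e : E) (c : K) (a : A) :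
    tau π (restrict lt e) (c • a) = c • tau π (restrict lt e) a := by
  conv_lhs => rw [← h.map_tau e a, ← map_smul]
  exact h.tau_eq e ((h.isNormal_tau e a).smul (h.datum e).well c)

theorem IsModuleDatum.tau_xm (h : IsModuleDatum π lt D) {e : E} {α : Expo n}
    (hα : (α, e) ∈ normalSet lt D) : tau π (restrict lt e) (xm π α) = stdMon K α :=
  h.tau_eq e ((h.isNormal_stdMon_iff e α).2 hα)

end ModuleDatum

end PBWRed

namespace PBWRed

/-! ### Leading data in free modules -/

section ModuleTheory

variable {K : Type*} [Field K] {n : ℕ} {E : Type*} [Finite E] {A : Type*} [Ring A]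
  [Algebra K A] {π : Free K n →ₐ[K] A} {lt : Expo n × E → Expo n × E → Prop} {D : E → Datum K n}

/-- Sets of monomials closed under taking smaller monomials. -/
def IsLower {M : Type*} (lt : M → M → Prop) (B : Set M) : Prop := ∀ p q, lt q p → p ∈ B → q ∈ B

theorem isLower_lt (h : IsModuleDatum π lt D) (p : Expo n × E) : IsLower lt {q | lt q p} :=
  fun _ _ h1 h2 => h.ordering.total.trans _ _ _ h1 h2

theorem isLower_le (h : IsModuleDatum π lt D) (p : Expo n × E) :
    IsLower lt {q | q = p ∨ lt q p} := by
  rintro q r h1 (rfl | h2)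
  · exact Or.inr h1
  · exact Or.inr (h.ordering.total.trans _ _ _ h1 h2)

/-- Taking normal forms only replaces monomials by smaller ones, so a set closed under smaller
exponents is preserved. -/
theorem IsModuleDatum.tau_coeff_of_mem_span (h : IsModuleDatum π lt D) {e : E} {Γ : Set (Expo n)}
    (hΓ : ∀ α β, lt (β, e) (α, e) → α ∈ Γ → β ∈ Γ) {a : A}
    (ha : a ∈ Submodule.span K (xm π '' Γ)) {w : Word n}
    (hw : (tau π (restrict lt e) a).coeff w ≠ 0) :
    ∃ α ∈ Γ, w = stdWord α ∧ (α, e) ∈ normalSet lt D := by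
  classical
  have ha' : a ∈ Submodule.span K (xm π '' {β | β ∈ Γ ∧ (β, e) ∈ normalSet lt D}) := by
    refine Submodule.span_le.2 ?_ ha
    rintro _ ⟨α, hα, rfl⟩
    refine Submodule.span_mono (Set.image_mono ?_) (h.xm_mem_span_normal e α)
    rintro β ⟨rfl | hβ, hn⟩
    · exact ⟨hα, hn⟩
    · exact ⟨hΓ _ _ hβ hα, hn⟩
  clear ha
  induction ha' using Submodule.span_induction generalizing w with
  | mem x hx =>
    obtain ⟨α, ⟨hα, hn⟩, rfl⟩ := hx
    rw [h.tau_xm hn, coeff_stdMon] at hw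
    exact ⟨α, hα, by by_contra hne; exact hw (if_neg fun hh => hne hh.symm), hn⟩
  | zero =>
    have : tau π (restrict lt e) (0 : A) = 0 := by
      have := h.tau_smul e 0 0
      rwa [zero_smul, zero_smul] at this
    rw [this] at hw
    exact absurd rfl hw
  | add x y _ _ hx hy =>
    rw [h.tau_add, MonoidAlgebra.coeff_add, Finsupp.add_apply] at hw
    by_cases h0 : (tau π (restrict lt e) x).coeff w = 0
    · rw [h0, zero_add] at hw; exact hy hw
    · exact hx h0
  | smul c x _ hx =>
    rw [h.tau_smul, MonoidAlgebra.coeff_smul_apply] at hw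
    exact hx (right_ne_zero_of_smul hw)

theorem IsModuleDatum.coef_add (h : IsModuleDatum π lt D) (a b : E → A) (p : Expo n × E) :
    coef π lt (a + b) p = coef π lt a p + coef π lt b p := by
  rw [coef, Pi.add_apply, h.tau_add, MonoidAlgebra.coeff_add, Finsupp.add_apply]; rfl

theorem IsModuleDatum.coef_smul (h : IsModuleDatum π lt D) (c : K) (a : E → A) (p : Expo n × E) :
    coef π lt (c • a) p = c * coef π lt a p := by
  rw [coef, Pi.smul_apply, h.tau_smul, MonoidAlgebra.coeff_smul_apply]; rfl

/-- The coefficient of a monomial as a linear form. -/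
noncomputable def IsModuleDatum.coefL (h : IsModuleDatum π lt D) (p : Expo n × E) :
    (E → A) →ₗ[K] K where
  toFun a := coef π lt a p
  map_add' a b := h.coef_add a b p
  map_smul' c a := h.coef_smul c a p

theorem IsModuleDatum.coef_zero (h : IsModuleDatum π lt D) (p : Expo n × E) :
    coef π lt (0 : E → A) p = 0 := (h.coefL p).map_zero

theorem IsModuleDatum.coef_sub (h : IsModuleDatum π lt D) (a b : E → A) (p : Expo n × E) :
    coef π lt (a - b) p = coef π lt a p - coef π lt b p := (h.coefL p).map_sub a b

theorem IsModuleDatum.mem_normalSet_of_coef_ne (h : IsModuleDatum π lt D) {a : E → A}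
    {p : Expo n × E} (hp : coef π lt a p ≠ 0) : p ∈ normalSet lt D := by
  obtain ⟨α, hα, hn⟩ := (h.isNormal_iff_forall p.2).1 (h.isNormal_tau p.2 (a p.2)) _ hp
  rw [← stdWord_injective hα] at hn
  exact hn

theorem coef_finite (a : E → A) : {p | coef π lt a p ≠ 0}.Finite := by
  have : {p | coef π lt a p ≠ 0} ⊆ ⋃ e : E, (fun α => (α, e)) ''
      (stdWord ⁻¹' {w | (tau π (restrict lt e) (a e)).coeff w ≠ 0}) := by
    rintro ⟨α, e⟩ hp
    exact Set.mem_iUnion.2 ⟨e, α, hp, rfl⟩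
  refine Set.Finite.subset (Set.finite_iUnion fun e => Set.Finite.image _ ?_) this
  exact Set.Finite.preimage stdWord_injective.injOn
    (tau π (restrict lt e) (a e)).coeff.hasFiniteSupport

open Classical in
/-- The class of the monomial `x^α (e)`. -/
noncomputable def mon (π : Free K n →ₐ[K] A) (q : Expo n × E) : E → A := Pi.single q.2 (xm π q.1)

theorem mon_apply_self (α : Expo n) (e : E) : mon π (α, e) e = xm π α := by
  simp [mon]

theorem mon_apply_of_ne (q : Expo n × E) {e : E} (he : e ≠ q.2) : mon π q e = 0 := by
  simp [mon, he]

/-- Linear combinations of the monomials in `B`. -/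
noncomputable def fil (π : Free K n →ₐ[K] A) (B : Set (Expo n × E)) : Submodule K (E → A) :=
  Submodule.span K (mon π '' B)

theorem fil_mono {B B' : Set (Expo n × E)} (hB : B ⊆ B') : fil π B ≤ fil π B' :=
  Submodule.span_mono (Set.image_mono hB)

theorem mon_mem_fil {B : Set (Expo n × E)} {p : Expo n × E} (hp : p ∈ B) : mon π p ∈ fil π B :=
  Submodule.subset_span ⟨p, hp, rfl⟩

theorem single_mem_fil [DecidableEq E] {B : Set (Expo n × E)} {e : E} {a : A}
    (ha : a ∈ Submodule.span K (xm π '' {α | (α, e) ∈ B})) : (Pi.single e a : E → A) ∈ fil π B := by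
  induction ha using Submodule.span_induction with
  | mem x hx =>
    obtain ⟨α, hα, rfl⟩ := hx
    have := mon_mem_fil (π := π) (B := B) hα
    unfold mon at this
    convert this
  | zero => rw [Pi.single_zero]; exact zero_mem _
  | add x y _ _ hx hy => rw [Pi.single_add]; exact add_mem hx hy
  | smul c x _ hx => rw [Pi.single_smul]; exact Submodule.smul_mem _ _ hx

theorem IsModuleDatum.mem_fil_support (h : IsModuleDatum π lt D) (a : E → A) :
    a ∈ fil π {p | coef π lt a p ≠ 0} := by
  classical
  have := Fintype.ofFinite E
  rw [← Finset.univ_sum_single a]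
  refine Submodule.sum_mem _ fun e _ => ?_
  refine single_mem_fil ?_
  rw [Finset.univ_sum_single a]
  suffices π (tau π (restrict lt e) (a e)) ∈
      Submodule.span K (xm π '' {α | coef π lt a (α, e) ≠ 0}) by rwa [h.map_tau] at this
  rw [eq_sum_single (tau π (restrict lt e) (a e)), map_sum]
  refine Submodule.sum_mem _ fun w hw => ?_
  rw [Finsupp.mem_support_iff] at hw
  obtain ⟨α, rfl, -⟩ := (h.isNormal_iff_forall e).1 (h.isNormal_tau e (a e)) _ hw
  rw [map_smul]
  exact Submodule.smul_mem _ _ (Submodule.subset_span ⟨α, hw, rfl⟩)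

/-- The span involves reducible monomials too. For a lower set `B` this does no harm, because their
normal forms stay in `B`, and membership can be tested on the coefficients of the normal form. -/
theorem IsModuleDatum.mem_fil_iff (h : IsModuleDatum π lt D) {B : Set (Expo n × E)}
    (hB : IsLower lt B) {a : E → A} : a ∈ fil π B ↔ ∀ p, coef π lt a p ≠ 0 → p ∈ B := by
  constructor
  · rintro ha ⟨α, e⟩ hp
    have : a e ∈ Submodule.span K (xm π '' {α | (α, e) ∈ B}) := by
      clear hp
      induction ha using Submodule.span_induction with
      | mem x hx =>
        obtain ⟨⟨β, e'⟩, hq, rfl⟩ := hx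
        by_cases he : e = e'
        · subst he
          rw [mon_apply_self]
          exact Submodule.subset_span ⟨β, hq, rfl⟩
        · rw [mon_apply_of_ne (β, e') he]; exact zero_mem _
      | zero => exact zero_mem _
      | add x y _ _ hx hy => exact add_mem hx hy
      | smul c x _ hx => exact Submodule.smul_mem _ _ hx
    obtain ⟨β, hβ, hw, -⟩ := h.tau_coeff_of_mem_span (fun _ _ h1 h2 => hB _ _ h1 h2) this hp
    obtain rfl : α = β := stdWord_injective hw
    exact hβ
  · intro hp
    exact fil_mono hp (h.mem_fil_support a)

theorem IsModuleDatum.eq_zero_of_coef (h : IsModuleDatum π lt D) {a : E → A}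
    (ha : ∀ p, coef π lt a p = 0) : a = 0 := by
  have := h.mem_fil_support a
  simpa [fil, ha] using this

theorem IsModuleDatum.coef_mon (h : IsModuleDatum π lt D) {q : Expo n × E}
    (hq : q ∈ normalSet lt D) : coef π lt (mon π q) q = 1 := by
  classical
  obtain ⟨α, e⟩ := q
  simp only [coef]
  rw [mon_apply_self, h.tau_xm hq, coeff_stdMon, if_pos rfl]

theorem IsModuleDatum.coef_eq_zero_of_mem_fil (h : IsModuleDatum π lt D) {p : Expo n × E}
    {a : E → A} (ha : a ∈ fil π {q | lt q p}) : coef π lt a p = 0 := by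
  by_contra hne
  exact h.ordering.total.irrefl _ ((h.mem_fil_iff (isLower_lt h p)).1 ha _ hne)

theorem IsModuleDatum.mon_mem_fil_of_notMem (h : IsModuleDatum π lt D) {p : Expo n × E}
    (hp : p ∉ normalSet lt D) : mon π p ∈ fil π {q | lt q p} := by
  classical
  rw [mon]
  exact single_mem_fil (h.xm_mem_of_notMem (e := p.2) (α := p.1) hp)

theorem IsModuleDatum.coef_mon_of_ne (h : IsModuleDatum π lt D) {p q : Expo n × E}
    (hq : q ∈ normalSet lt D) (hpq : p ≠ q) : coef π lt (mon π q) p = 0 := by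
  classical
  obtain ⟨α, e⟩ := q
  obtain ⟨β, e'⟩ := p
  simp only [coef]
  by_cases he : e' = e
  · subst he
    rw [mon_apply_self, h.tau_xm hq, coeff_stdMon, if_neg]
    intro hh
    exact hpq (by rw [stdWord_injective hh])
  · rw [mon_apply_of_ne (α, e) he]
    exact h.coef_zero (β, e')

/-! #### Leading exponents -/

theorem IsModuleDatum.lec_eq_some_iff (h : IsModuleDatum π lt D) {a : E → A} {p : Expo n × E} :
    lec π lt a = some p ↔ coef π lt a p ≠ 0 ∧ ∀ q, coef π lt a q ≠ 0 → q = p ∨ lt q p :=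
  lead_eq_some_iff h.ordering.total

theorem IsModuleDatum.exists_lec (h : IsModuleDatum π lt D) {a : E → A} (ha : a ≠ 0) :
    ∃ p, lec π lt a = some p := by
  refine exists_lead h.ordering.total (coef_finite a) ?_
  by_contra hne
  rw [Set.not_nonempty_iff_eq_empty] at hne
  refine ha (h.eq_zero_of_coef fun p => ?_)
  by_contra hp
  have : p ∈ {p | coef π lt a p ≠ 0} := hp
  rw [hne] at this
  exact this

theorem IsModuleDatum.ne_zero_of_lec (h : IsModuleDatum π lt D) {a : E → A} {p : Expo n × E}
    (hp : lec π lt a = some p) : a ≠ 0 := by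
  rintro rfl
  exact (h.lec_eq_some_iff.1 hp).1 (h.coef_zero p)

theorem lc_eq {a : E → A} {p : Expo n × E}
    (hp : lec π lt a = some p) : lc π lt a = coef π lt a p := by
  rw [lc, hp]; rfl

theorem IsModuleDatum.lec_mem_normalSet (h : IsModuleDatum π lt D) {a : E → A} {p : Expo n × E}
    (hp : lec π lt a = some p) : p ∈ normalSet lt D :=
  h.mem_normalSet_of_coef_ne (h.lec_eq_some_iff.1 hp).1

theorem IsModuleDatum.lec_mem_of_mem_fil (h : IsModuleDatum π lt D) {B : Set (Expo n × E)}
    (hB : IsLower lt B) {a : E → A} (ha : a ∈ fil π B) {p : Expo n × E}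
    (hp : lec π lt a = some p) : p ∈ B :=
  (h.mem_fil_iff hB).1 ha _ (h.lec_eq_some_iff.1 hp).1

theorem IsModuleDatum.mem_fil_of_lec (h : IsModuleDatum π lt D) {a : E → A} {p : Expo n × E}
    (hp : lec π lt a = some p) {B : Set (Expo n × E)} (hB : IsLower lt B) (hpB : p ∈ B) :
    a ∈ fil π B := by
  rw [h.mem_fil_iff hB]
  intro q hq
  rcases (h.lec_eq_some_iff.1 hp).2 q hq with rfl | h1
  · exact hpB
  · exact hB _ _ h1 hpB

theorem IsModuleDatum.sub_mem_fil_of_lec (h : IsModuleDatum π lt D) {a : E → A} {p : Expo n × E}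
    (hp : lec π lt a = some p) : a - coef π lt a p • mon π p ∈ fil π {q | lt q p} := by
  rw [h.mem_fil_iff (isLower_lt h p)]
  intro q hq
  have hn := h.lec_mem_normalSet hp
  rw [h.coef_sub, h.coef_smul] at hq
  by_cases hqp : q = p
  · subst hqp
    rw [h.coef_mon hn, mul_one, sub_self] at hq
    exact absurd rfl hq
  · rw [h.coef_mon_of_ne hn hqp, mul_zero, sub_zero] at hq
    exact ((h.lec_eq_some_iff.1 hp).2 q hq).resolve_left hqp

theorem IsModuleDatum.coef_eq_of_sub_mem (h : IsModuleDatum π lt D) {a : E → A} {p : Expo n × E}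
    {c : K} (hn : p ∈ normalSet lt D)
    (ha : a - c • mon π p ∈ fil π {q | lt q p}) : coef π lt a p = c := by
  have := h.coef_eq_zero_of_mem_fil ha
  rwa [h.coef_sub, h.coef_smul, h.coef_mon hn, mul_one, sub_eq_zero] at this

/-- This is how leading exponents are determined throughout. Irreducibility of `p` is essential,
since a reducible monomial is itself a combination of smaller ones. -/
theorem IsModuleDatum.lec_eq_of_sub_mem (h : IsModuleDatum π lt D) {a : E → A} {p : Expo n × E}
    {c : K} (hc : c ≠ 0) (hn : p ∈ normalSet lt D)
    (ha : a - c • mon π p ∈ fil π {q | lt q p}) : lec π lt a = some p := by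
  rw [h.lec_eq_some_iff, h.coef_eq_of_sub_mem hn ha]
  refine ⟨hc, fun q hq => ?_⟩
  by_cases hqp : q = p
  · exact Or.inl hqp
  · right
    refine (h.mem_fil_iff (isLower_lt h p)).1 ha q ?_
    rwa [h.coef_sub, h.coef_smul, h.coef_mon_of_ne hn hqp, mul_zero, sub_zero]

/-! #### Multiplication by monomials -/

/-- Addition of an exponent to a monomial `x^α (e)`. -/
def shift (γ : Expo n) (p : Expo n × E) : Expo n × E := (γ + p.1, p.2)

theorem shift_shift (γ δ : Expo n) (p : Expo n × E) : shift γ (shift δ p) = shift (γ + δ) p := by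
  simp [shift, add_assoc]

theorem shift_zero (p : Expo n × E) : shift 0 p = p := by
  simp [shift]

theorem IsModuleDatum.shift_lt (h : IsModuleDatum π lt D) {p q : Expo n × E} (γ : Expo n)
    (hl : lt p q) : lt (shift γ p) (shift γ q) := h.ordering.add_left γ hl

theorem IsModuleDatum.shift_lt_shift (h : IsModuleDatum π lt D) {p : Expo n × E} {γ δ : Expo n}
    (hl : lt (γ, p.2) (δ, p.2)) : lt (shift γ p) (shift δ p) := h.ordering.add_right _ _ p.1 _ _ hl

/-- The product stays in the component of `q`, so the relations and the ordering of that component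
alone govern the sorting. -/
theorem IsModuleDatum.wv_smul_mon (h : IsModuleDatum π lt D) (w : List (Fin n))
    (q : Expo n × E) : ∃ c : K, c ≠ 0 ∧ wv π w • mon π q - c • mon π (shift (listExpo w) q) ∈
      fil π {r | lt r (shift (listExpo w) q)} := by
  classical
  obtain ⟨c, hc, hm⟩ := h.exists_wv_sub_mem q.2 (w ++ stdList q.1)
  refine ⟨c, hc, ?_⟩
  rw [wv_append, wv_stdList, listExpo_append, listExpo_stdList] at hm
  have : wv π w • mon π q - c • mon π (shift (listExpo w) q) =
      Pi.single q.2 (wv π w * xm π q.1 - c • xm π (listExpo w + q.1)) := by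
    rw [Pi.single_sub, Pi.single_smul, mon, mon, ← smul_eq_mul, Pi.single_smul]
    rfl
  rw [this]
  exact single_mem_fil hm

theorem IsModuleDatum.wv_smul_mem_fil (h : IsModuleDatum π lt D) (w : List (Fin n))
    {B B' : Set (Expo n × E)} (hB' : IsLower lt B') (hBB : ∀ q ∈ B, shift (listExpo w) q ∈ B')
    {a : E → A} (ha : a ∈ fil π B) : wv π w • a ∈ fil π B' := by
  induction ha using Submodule.span_induction with
  | mem x hx =>
    obtain ⟨q, hq, rfl⟩ := hx
    obtain ⟨c, -, hc⟩ := h.wv_smul_mon w q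
    rw [← sub_add_cancel (wv π w • mon π q) (c • mon π (shift (listExpo w) q))]
    have hm := hBB q hq
    exact add_mem (fil_mono (fun r hr => hB' _ _ hr hm) hc)
      (Submodule.smul_mem _ _ (mon_mem_fil hm))
  | zero => rw [smul_zero]; exact zero_mem _
  | add x y _ _ hx hy => rw [smul_add]; exact add_mem hx hy
  | smul c x _ hx => rw [smul_comm]; exact Submodule.smul_mem _ _ hx

/-- The shifted monomial is not assumed irreducible, hence the formulation as a congruence: in the
reducible case the product lies strictly below it and its leading exponent is not determined by
this. -/
theorem IsModuleDatum.wv_smul_of_lec (h : IsModuleDatum π lt D) (w : List (Fin n)) {a : E → A}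
    {p : Expo n × E} (hp : lec π lt a = some p) :
    ∃ c : K, c ≠ 0 ∧ wv π w • a - c • mon π (shift (listExpo w) p) ∈
      fil π {r | lt r (shift (listExpo w) p)} := by
  obtain ⟨c, hc, hm⟩ := h.wv_smul_mon w p
  refine ⟨coef π lt a p * c, mul_ne_zero (h.lec_eq_some_iff.1 hp).1 hc, ?_⟩
  have h1 := h.wv_smul_mem_fil w (isLower_lt h (shift (listExpo w) p))
    (fun q hq => h.shift_lt _ hq) (h.sub_mem_fil_of_lec hp)
  have h2 := add_mem h1 (Submodule.smul_mem _ (coef π lt a p) hm)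
  convert h2 using 1
  rw [smul_sub, smul_sub, smul_smul, smul_comm (wv π w) (coef π lt a p)]
  abel

/-! #### Standard representations -/

/-- Linear combinations of elements `x^γ g`, `g ∈ H`, with `γ + lec(g) ∈ B`. -/
noncomputable def stdRep (π : Free K n →ₐ[K] A) (lt : Expo n × E → Expo n × E → Prop)
    (H : Set (E → A)) (B : Set (Expo n × E)) : Submodule K (E → A) :=
  Submodule.span K {x | ∃ g ∈ H, ∃ γ q, lec π lt g = some q ∧ shift γ q ∈ B ∧ x = xm π γ • g}

theorem stdRep_mono {H H' : Set (E → A)} (hH : H ⊆ H') {B B' : Set (Expo n × E)} (hB : B ⊆ B') :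
    stdRep π lt H B ≤ stdRep π lt H' B' := by
  refine Submodule.span_mono ?_
  rintro _ ⟨g, hg, γ, q, hq, hm, rfl⟩
  exact ⟨g, hH hg, γ, q, hq, hB hm, rfl⟩

theorem smul_mem_stdRep {H : Set (E → A)} {B : Set (Expo n × E)} {g : E → A} (hg : g ∈ H)
    {q : Expo n × E} (hq : lec π lt g = some q) {γ : Expo n} (hm : shift γ q ∈ B) :
    xm π γ • g ∈ stdRep π lt H B :=
  Submodule.subset_span ⟨g, hg, γ, q, hq, hm, rfl⟩

theorem mem_stdRep_self {H : Set (E → A)} {B : Set (Expo n × E)} {g : E → A} (hg : g ∈ H)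
    {q : Expo n × E} (hq : lec π lt g = some q) (hm : q ∈ B) :
    g ∈ stdRep π lt H B := by
  have := smul_mem_stdRep (π := π) (B := B) hg hq (γ := 0) (by rwa [shift_zero])
  rwa [xm_zero, one_smul] at this

theorem stdRep_le_span (H : Set (E → A)) (B : Set (Expo n × E)) :
    stdRep π lt H B ≤ (Submodule.span A H).restrictScalars K := by
  refine Submodule.span_le.2 ?_
  rintro _ ⟨g, hg, γ, q, -, -, rfl⟩
  exact Submodule.smul_mem _ _ (Submodule.subset_span hg)

theorem smul_mem_stdRep_of_mem_span {H : Set (E → A)}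
    {B : Set (Expo n × E)} {g : E → A} (hg : g ∈ H)
    {q : Expo n × E} (hq : lec π lt g = some q) {Γ : Set (Expo n)} (hΓ : ∀ γ ∈ Γ, shift γ q ∈ B)
    {a : A} (ha : a ∈ Submodule.span K (xm π '' Γ)) : a • g ∈ stdRep π lt H B := by
  induction ha using Submodule.span_induction with
  | mem x hx =>
    obtain ⟨γ, hγ, rfl⟩ := hx
    exact smul_mem_stdRep hg hq (hΓ γ hγ)
  | zero => rw [zero_smul]; exact zero_mem _
  | add x y _ _ hx hy => rw [add_smul]; exact add_mem hx hy
  | smul c x _ hx => rw [smul_assoc]; exact Submodule.smul_mem _ _ hx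

/-- Multiplying an element of `H` by a word or by the corresponding standard monomial is the same
up to a factor and smaller elements. -/
theorem IsModuleDatum.wv_smul_sub_mem_stdRep (h : IsModuleDatum π lt D) {H : Set (E → A)}
    {g : E → A} (hg : g ∈ H) {q : Expo n × E} (hq : lec π lt g = some q) (w : List (Fin n)) :
    ∃ c : K, c ≠ 0 ∧ wv π w • g - c • xm π (listExpo w) • g ∈
      stdRep π lt H {r | lt r (shift (listExpo w) q)} := by
  obtain ⟨c, hc, hm⟩ := h.exists_wv_sub_mem q.2 w
  refine ⟨c, hc, ?_⟩
  have he : wv π w • g - c • xm π (listExpo w) • g = (wv π w - c • xm π (listExpo w)) • g := by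
    rw [sub_smul, smul_assoc]
  rw [he]
  exact smul_mem_stdRep_of_mem_span hg hq (Γ := {γ | lt (γ, q.2) (listExpo w, q.2)})
    (fun γ hγ => show lt (shift γ q) (shift (listExpo w) q) from
      h.shift_lt_shift (p := q) (γ := γ) (δ := listExpo w) hγ) hm

theorem IsModuleDatum.wv_smul_mem_stdRep (h : IsModuleDatum π lt D) {H : Set (E → A)}
    {B : Set (Expo n × E)} (hB : IsLower lt B)
    {g : E → A} (hg : g ∈ H) {q : Expo n × E} (hq : lec π lt g = some q) {w : List (Fin n)}
    (hw : shift (listExpo w) q ∈ B) : wv π w • g ∈ stdRep π lt H B := by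
  obtain ⟨c, -, hm⟩ := h.wv_smul_sub_mem_stdRep hg hq w
  rw [← sub_add_cancel (wv π w • g) (c • xm π (listExpo w) • g)]
  exact add_mem (stdRep_mono subset_rfl (fun r hr => hB _ _ hr hw) hm)
    (Submodule.smul_mem _ _ (smul_mem_stdRep hg hq hw))

theorem IsModuleDatum.wv_smul_stdRep (h : IsModuleDatum π lt D) {H : Set (E → A)}
    (w : List (Fin n)) {B B' : Set (Expo n × E)} (hB' : IsLower lt B')
    (hBB : ∀ q ∈ B, shift (listExpo w) q ∈ B')
    {a : E → A} (ha : a ∈ stdRep π lt H B) : wv π w • a ∈ stdRep π lt H B' := by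
  induction ha using Submodule.span_induction with
  | mem x hx =>
    obtain ⟨g, hg, γ, q, hq, hm, rfl⟩ := hx
    rw [← wv_stdList, ← mul_smul, ← wv_append]
    refine h.wv_smul_mem_stdRep hB' hg hq ?_
    rw [listExpo_append, listExpo_stdList, ← shift_shift]
    exact hBB _ hm
  | zero => rw [smul_zero]; exact zero_mem _
  | add x y _ _ hx hy => rw [smul_add]; exact add_mem hx hy
  | smul c x _ hx => rw [smul_comm]; exact Submodule.smul_mem _ _ hx

theorem IsModuleDatum.stdRep_le_fil (h : IsModuleDatum π lt D) {H : Set (E → A)}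
    {B : Set (Expo n × E)} (hB : IsLower lt B) : stdRep π lt H B ≤ fil π B := by
  refine Submodule.span_le.2 ?_
  rintro _ ⟨g, hg, γ, q, hq, hm, rfl⟩
  rw [← wv_stdList]
  refine h.wv_smul_mem_fil _ hB (B := {r | r = q ∨ lt r q}) ?_
    (h.mem_fil_of_lec hq (isLower_le h q) (Or.inl rfl))
  rw [listExpo_stdList]
  rintro r (rfl | hr)
  · exact hm
  · exact hB _ _ (h.shift_lt γ hr) hm

/-- Elements of `stdRep` belong to a `stdRep` bounded by a single monomial of `B`. -/
theorem IsModuleDatum.exists_mem_stdRep_le (h : IsModuleDatum π lt D) {H : Set (E → A)}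
    {B : Set (Expo n × E)} {a : E → A} (ha : a ∈ stdRep π lt H B) :
    a = 0 ∨ ∃ p ∈ B, a ∈ stdRep π lt H {q | q = p ∨ lt q p} := by
  have := h.ordering.total
  induction ha using Submodule.span_induction with
  | mem x hx =>
    obtain ⟨g, hg, γ, q, hq, hm, rfl⟩ := hx
    exact Or.inr ⟨_, hm, smul_mem_stdRep hg hq (Or.inl rfl)⟩
  | zero => exact Or.inl rfl
  | add x y _ _ hx hy =>
    rcases hx with rfl | ⟨p, hp, hx⟩
    · rwa [zero_add]
    rcases hy with rfl | ⟨q, hq, hy⟩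
    · rw [add_zero]; exact Or.inr ⟨p, hp, hx⟩
    right
    rcases @trichotomous_of _ lt _ p q with h1 | rfl | h1
    · refine ⟨q, hq, add_mem (stdRep_mono subset_rfl ?_ hx) hy⟩
      rintro r (rfl | hr)
      · exact Or.inr h1
      · exact Or.inr (h.ordering.total.trans _ _ _ hr h1)
    · exact ⟨p, hp, add_mem hx hy⟩
    · refine ⟨p, hp, add_mem hx (stdRep_mono subset_rfl ?_ hy)⟩
      rintro r (rfl | hr)
      · exact Or.inr h1
      · exact Or.inr (h.ordering.total.trans _ _ _ hr h1)
  | smul c x _ hx =>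
    rcases hx with rfl | ⟨p, hp, hx⟩
    · left; rw [smul_zero]
    · exact Or.inr ⟨p, hp, Submodule.smul_mem _ _ hx⟩

theorem IsModuleDatum.mem_span_xm (h : IsModuleDatum π lt D) (e : E) (a : A) :
    a ∈ Submodule.span K (xm π '' Set.univ) := by
  suffices π (tau π (restrict lt e) a) ∈ Submodule.span K (xm π '' Set.univ) by
    rwa [h.map_tau] at this
  rw [eq_sum_single (tau π (restrict lt e) a), map_sum]
  refine Submodule.sum_mem _ fun w hw => ?_
  rw [Finsupp.mem_support_iff] at hw
  obtain ⟨α, rfl, -⟩ := (h.isNormal_iff_forall e).1 (h.isNormal_tau e a) _ hw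
  rw [map_smul]
  exact Submodule.smul_mem _ _ (Submodule.subset_span ⟨α, trivial, rfl⟩)

theorem IsModuleDatum.mem_stdRep_univ (h : IsModuleDatum π lt D) {H : Set (E → A)}
    {a : E → A} (ha : a ∈ Submodule.span A H) : a ∈ stdRep π lt H Set.univ := by
  have hsm : ∀ b : A, ∀ x ∈ stdRep π lt H Set.univ, b • x ∈ stdRep π lt H Set.univ := by
    intro b x hx
    -- A component is needed only to have a datum with respect to which elements of `A` are written
    -- in standard monomials; without components `A^E` is zero.
    rcases isEmpty_or_nonempty E with hE | ⟨⟨e⟩⟩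
    · rw [Subsingleton.elim (b • x) 0]; exact zero_mem _
    have hb := h.mem_span_xm e b
    induction hb using Submodule.span_induction with
    | mem c hc =>
      obtain ⟨γ, -, rfl⟩ := hc
      rw [← wv_stdList]
      exact h.wv_smul_stdRep _ (fun _ _ _ _ => trivial) (fun _ _ => trivial) hx
    | zero => rw [zero_smul]; exact zero_mem _
    | add x y _ _ hx hy => rw [add_smul]; exact add_mem hx hy
    | smul c x _ hx => rw [smul_assoc]; exact Submodule.smul_mem _ _ hx
  induction ha using Submodule.span_induction with
  | mem x hx =>
    by_cases hx0 : x = 0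
    · rw [hx0]; exact zero_mem _
    · obtain ⟨q, hq⟩ := h.exists_lec hx0
      exact mem_stdRep_self hx hq trivial
  | zero => exact zero_mem _
  | add x y _ _ hx hy => exact add_mem hx hy
  | smul c x _ hx => exact hsm c x hx

/-! #### Gröbner bases -/

/-- All multiples of the same `g` are collected into one coefficient `b g`, and the bound on the
individual multiples becomes a bound on the exponents in `b g`. -/
theorem exists_of_mem_stdRep [DecidableEq (E → A)] {G : Finset (E → A)}
    {B : Set (Expo n × E)} {a : E → A} (ha : a ∈ stdRep π lt (G : Set (E → A)) B) :
    ∃ b : (E → A) → A, a = ∑ g ∈ G, b g • g ∧ ∀ g ∈ G, ∀ q, lec π lt g = some q →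
      b g ∈ Submodule.span K (xm π '' {γ | shift γ q ∈ B}) := by
  induction ha using Submodule.span_induction with
  | mem x hx =>
    obtain ⟨g, hg, γ, q, hq, hm, rfl⟩ := hx
    refine ⟨Pi.single g (xm π γ), ?_, ?_⟩
    · rw [Finset.sum_eq_single g]
      · rw [Pi.single_eq_same]
      · intro g' _ hne; rw [Pi.single_eq_of_ne hne, zero_smul]
      · intro hne; exact absurd hg hne
    · intro g' _ q' hq'
      by_cases hgg : g' = g
      · subst hgg
        rw [hq, Option.some_inj] at hq'
        subst hq'
        rw [Pi.single_eq_same]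
        exact Submodule.subset_span ⟨γ, hm, rfl⟩
      · rw [Pi.single_eq_of_ne hgg]; exact zero_mem _
  | zero => exact ⟨0, by simp, fun _ _ _ _ => zero_mem _⟩
  | add x y _ _ hx hy =>
    obtain ⟨b, rfl, hb⟩ := hx
    obtain ⟨c, rfl, hc⟩ := hy
    refine ⟨b + c, ?_, fun g hg q hq => add_mem (hb g hg q hq) (hc g hg q hq)⟩
    rw [← Finset.sum_add_distrib]
    exact Finset.sum_congr rfl fun g _ => by rw [Pi.add_apply, add_smul]
  | smul c x _ hx =>
    obtain ⟨b, rfl, hb⟩ := hx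
    refine ⟨c • b, ?_, fun g hg q hq => Submodule.smul_mem _ _ (hb g hg q hq)⟩
    rw [Finset.smul_sum]
    exact Finset.sum_congr rfl fun g _ => by rw [Pi.smul_apply, smul_assoc]

/-- The exponents γ with γ + lec(g) ≼ lec(m) form a lower set for the ordering of the component of
`g`. A coefficient spanned by such `x^γ` therefore has a normal form with leading exponent in this
set, which is the bound required of a Gröbner basis. -/
theorem IsModuleDatum.isGroebnerBasis_of_stdRep (h : IsModuleDatum π lt D)
    {M : Submodule A (E → A)} {G : Finset (E → A)} (hG : ∀ g ∈ G, g ∈ M)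
    (hM : ∀ m ∈ M, ∀ p, lec π lt m = some p →
      m ∈ stdRep π lt (G : Set (E → A)) {q | q = p ∨ lt q p}) : IsGroebnerBasis π lt M G := by
  classical
  refine ⟨hG, fun m hm => ?_⟩
  have tau_zero : ∀ e, leadA π (restrict lt e) (0 : A) = none := by
    intro e
    have : tau π (restrict lt e) (0 : A) = 0 := by
      have := h.tau_smul e 0 0
      rwa [zero_smul, zero_smul] at this
    rw [leadA, this, lexp, Option.map_eq_none_iff, Option.eq_none_iff_forall_ne_some]
    intro w hw
    exact ((lm_eq_some_iff (h.datum e).well).1 hw).1 rfl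
  by_cases hm0 : m = 0
  · subst hm0
    refine ⟨0, by simp, fun g _ => ?_⟩
    rw [sumLec]
    cases lec π lt g with
    | none => trivial
    | some p => rw [Option.bind_some, Pi.zero_apply, tau_zero]; trivial
  · obtain ⟨p, hp⟩ := h.exists_lec hm0
    obtain ⟨b, hb, hbG⟩ := exists_of_mem_stdRep (hM m hm p hp)
    refine ⟨b, hb, fun g hg => ?_⟩
    rw [sumLec, hp]
    cases hq : lec π lt g with
    | none => trivial
    | some q =>
      rw [Option.bind_some]
      cases hl : leadA π (restrict lt q.2) (b g) with
      | none => trivial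
      | some α =>
        rw [leadA, lexp, Option.map_eq_some_iff] at hl
        obtain ⟨w, hw, rfl⟩ := hl
        rw [lm_eq_some_iff (h.datum q.2).well] at hw
        have hlow : ∀ α β, lt (β, q.2) (α, q.2) → α ∈ {γ | shift γ q ∈ {r | r = p ∨ lt r p}} →
            β ∈ {γ | shift γ q ∈ {r | r = p ∨ lt r p}} := fun α β h1 h2 =>
          isLower_le h p _ _ (h.shift_lt_shift h1) h2
        obtain ⟨α, hα, hwα, -⟩ := h.tau_coeff_of_mem_span hlow (hbG g hg q hq) hw.1
        rw [hwα, wordExpo_stdWord]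
        exact hα

end ModuleTheory

end PBWRed

namespace PBWRed

/-! ### Buchberger's criterion -/

section Buchberger

variable {K : Type*} [Field K] {n : ℕ} {E : Type*} [Finite E] {A : Type*} [Ring A]
  [Algebra K A] {π : Free K n →ₐ[K] A} {lt : Expo n × E → Expo n × E → Prop} {D : E → Datum K n}

theorem IsModuleDatum.xm_smul_xm_smul (h : IsModuleDatum π lt D) {H : Set (E → A)}
    {g : E → A} (hg : g ∈ H) {q : Expo n × E} (hq : lec π lt g = some q) {ε δ γ : Expo n}
    (hγ : ε + δ = γ) : ∃ c : K, c ≠ 0 ∧ xm π ε • xm π δ • g - c • xm π γ • g ∈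
      stdRep π lt H {r | lt r (shift γ q)} := by
  obtain ⟨c, hc, hm⟩ := h.wv_smul_sub_mem_stdRep hg hq (stdList ε ++ stdList δ)
  rw [listExpo_append, listExpo_stdList, listExpo_stdList, hγ, wv_append, wv_stdList, wv_stdList,
    mul_smul] at hm
  exact ⟨c, hc, hm⟩

theorem IsModuleDatum.xm_smul_stdRep_lt (h : IsModuleDatum π lt D) {H : Set (E → A)}
    {p q : Expo n × E} {ε : Expo n} (hpq : shift ε q = p) {x : E → A}
    (hx : x ∈ stdRep π lt H {r | lt r q}) : xm π ε • x ∈ stdRep π lt H {r | lt r p} := by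
  rw [← wv_stdList]
  refine h.wv_smul_stdRep _ (isLower_lt h p) ?_ hx
  intro r hr
  rw [listExpo_stdList, ← hpq]
  exact h.shift_lt ε hr

theorem normalSet_of_le {p : Expo n × E} (hp : p ∈ normalSet lt D) {α : Expo n} (hα : α ≤ p.1) :
    (α, p.2) ∈ normalSet lt D := by
  rintro ⟨γ, hγ, β, rfl⟩
  refine hp ⟨γ, hγ, p.1 - γ, ?_⟩
  have : γ ≤ p.1 := le_trans (by intro i; simp) hα
  rw [tsub_add_cancel_of_le this]

/-- A reducible `p` is a multiple of the leading exponent β of some element of I, hence of `α ⊔ β`.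
Up to a factor and smaller elements, `x^γ g` is then a monomial multiple of the s-polynomial of `g`
with that relation, which has a representation below `α ⊔ β` by `h2`. -/
theorem IsModuleDatum.mem_stdRep_lt_of_notMem (h : IsModuleDatum π lt D) {H : Set (E → A)}
    (h2 : ∀ g ∈ H, ∀ α e, lec π lt g = some (α, e) →
      ∀ β ∈ lset (restrict lt e) ((D e).I : Set (Free K n)),
        xm π (α ⊔ β - α) • g ∈ stdRep π lt H {r | lt r (α ⊔ β, e)})
    {p : Expo n × E} (hp : p ∉ normalSet lt D) {g : E → A} (hg : g ∈ H) {q : Expo n × E}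
    (hq : lec π lt g = some q) {γ : Expo n} (hγ : shift γ q = p) :
    xm π γ • g ∈ stdRep π lt H {r | lt r p} := by
  obtain ⟨α, e⟩ := q
  subst hγ
  obtain ⟨β, hβ, δ, hδ⟩ := not_not.1 hp
  simp only [shift] at hδ hβ
  have hle : α ⊔ β ≤ γ + α := sup_le (by intro i; simp) (by rw [hδ]; intro i; simp)
  have hε : (γ + α - α ⊔ β) + (α ⊔ β - α) = γ := by
    have h3 : (γ + α - α ⊔ β) + (α ⊔ β - α) + α = γ + α := by
      rw [add_assoc, tsub_add_cancel_of_le le_sup_left, tsub_add_cancel_of_le hle]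
    exact add_right_cancel h3
  obtain ⟨c, hc, hm⟩ := h.xm_smul_xm_smul hg hq hε
  have h4 := h.xm_smul_stdRep_lt (p := shift γ (α, e)) (ε := γ + α - α ⊔ β)
    (by simp only [shift]; rw [tsub_add_cancel_of_le hle]) (h2 g hg α e hq β hβ)
  have h5 := sub_mem h4 hm
  rw [sub_sub_cancel] at h5
  exact (Submodule.smul_mem_iff _ hc).1 h5

/-- The least common multiple of the two leading monomials divides the irreducible `p`, so it is
irreducible and the s-polynomial is available. Multiplying its representation by a monomial compares
the two multiples at `p`; noncommutativity only changes the constants. -/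
theorem IsModuleDatum.sub_mem_stdRep_lt (h : IsModuleDatum π lt D) {H : Set (E → A)}
    (h1 : ∀ g ∈ H, ∀ g' ∈ H, ∀ α β e, lec π lt g = some (α, e) → lec π lt g' = some (β, e) →
      g ≠ g' → (α ⊔ β, e) ∈ normalSet lt D → ∃ c c' : K, c ≠ 0 ∧ c' ≠ 0 ∧
        c • xm π (α ⊔ β - α) • g - c' • xm π (α ⊔ β - β) • g' ∈
          stdRep π lt H {r | lt r (α ⊔ β, e)})
    {p : Expo n × E} (hp : p ∈ normalSet lt D) {g g' : E → A} (hg : g ∈ H) (hg' : g' ∈ H)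
    {q q' : Expo n × E} (hq : lec π lt g = some q) (hq' : lec π lt g' = some q')
    {γ γ' : Expo n} (hγ : shift γ q = p) (hγ' : shift γ' q' = p) :
    ∃ t : K, xm π γ • g - t • xm π γ' • g' ∈ stdRep π lt H {r | lt r p} := by
  by_cases hgg : g = g'
  · subst hgg
    rw [hq, Option.some_inj] at hq'
    subst hq'
    have : γ = γ' := by
      have := congrArg Prod.fst (hγ.trans hγ'.symm)
      simpa [shift] using this
    subst this
    exact ⟨1, by rw [one_smul, sub_self]; exact zero_mem _⟩
  obtain ⟨α, e⟩ := q
  obtain ⟨β, e'⟩ := q'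
  obtain ⟨κ, e''⟩ := p
  simp only [shift, Prod.mk.injEq] at hγ hγ'
  obtain ⟨hγ, rfl⟩ := hγ
  obtain ⟨hγ', rfl⟩ := hγ'
  have hα : α ≤ κ := by rw [← hγ]; intro i; simp
  have hβ : β ≤ κ := by rw [← hγ']; intro i; simp
  have hle : α ⊔ β ≤ κ := sup_le hα hβ
  have hε : (κ - α ⊔ β) + (α ⊔ β - α) = γ := by
    refine add_right_cancel (b := α) ?_
    rw [add_assoc, tsub_add_cancel_of_le le_sup_left, tsub_add_cancel_of_le hle, hγ]
  have hε' : (κ - α ⊔ β) + (α ⊔ β - β) = γ' := by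
    refine add_right_cancel (b := β) ?_
    rw [add_assoc, tsub_add_cancel_of_le le_sup_right, tsub_add_cancel_of_le hle, hγ']
  obtain ⟨c, c', hc, hc', hm⟩ := h1 g hg g' hg' α β e' hq hq' hgg (normalSet_of_le hp hle)
  obtain ⟨d, hd, hm1⟩ := h.xm_smul_xm_smul hg hq hε
  obtain ⟨d', hd', hm2⟩ := h.xm_smul_xm_smul hg' hq' hε'
  have hsγ : shift γ (α, e') = (κ, e') := by simp [shift, hγ]
  have hsγ' : shift γ' (β, e') = (κ, e') := by simp [shift, hγ']
  rw [hsγ] at hm1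
  rw [hsγ'] at hm2
  have hm3 := h.xm_smul_stdRep_lt (p := (κ, e')) (ε := κ - α ⊔ β)
    (by simp only [shift]; rw [tsub_add_cancel_of_le hle]) hm
  -- Multiplying the two halves of the s-polynomial by the missing monomial gives `d x^γ g` and `d'
  -- x^γ' g'` modulo smaller elements, so the relation becomes `c d x^γ g ≡ c' d' x^γ' g'`.
  refine ⟨(c * d)⁻¹ * (c' * d'), ?_⟩
  have hcd : c * d ≠ 0 := mul_ne_zero hc hd
  have h6 := sub_mem (add_mem hm3 (Submodule.smul_mem _ c' hm2)) (Submodule.smul_mem _ c hm1)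
  have e1 : xm π (κ - α ⊔ β) • (c • xm π (α ⊔ β - α) • g - c' • xm π (α ⊔ β - β) • g') =
      c • (xm π (κ - α ⊔ β) • xm π (α ⊔ β - α) • g) -
        c' • (xm π (κ - α ⊔ β) • xm π (α ⊔ β - β) • g') := by
    rw [smul_sub, smul_comm _ c, smul_comm _ c']
  have e2 : ∀ x y u v : E → A, c • x - c' • y + c' • (y - d' • v) - c • (x - d • u) =
      (c * d) • u - (c' * d') • v := by
    intro x y u v; module
  rw [e1, e2] at h6
  have h7 := Submodule.smul_mem _ (c * d)⁻¹ h6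
  rwa [smul_sub, smul_smul, inv_mul_cancel₀ hcd, one_smul, smul_smul] at h7

/-- For irreducible `p`, fix one multiple `x^γ g` at `p`. All other summands at `p` are scalar
multiples of it modulo smaller ones, so `x ≡ t x^γ g`. The coefficient of `x` at `p` is zero and
that of `x^γ g` is not, which forces `t = 0`. For reducible `p` each summand at `p` drops
separately. -/
theorem IsModuleDatum.mem_stdRep_lt_of_mem_fil (h : IsModuleDatum π lt D) {H : Set (E → A)}
    (h1 : ∀ g ∈ H, ∀ g' ∈ H, ∀ α β e, lec π lt g = some (α, e) → lec π lt g' = some (β, e) →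
      g ≠ g' → (α ⊔ β, e) ∈ normalSet lt D → ∃ c c' : K, c ≠ 0 ∧ c' ≠ 0 ∧
        c • xm π (α ⊔ β - α) • g - c' • xm π (α ⊔ β - β) • g' ∈
          stdRep π lt H {r | lt r (α ⊔ β, e)})
    (h2 : ∀ g ∈ H, ∀ α e, lec π lt g = some (α, e) →
      ∀ β ∈ lset (restrict lt e) ((D e).I : Set (Free K n)),
        xm π (α ⊔ β - α) • g ∈ stdRep π lt H {r | lt r (α ⊔ β, e)})
    {p : Expo n × E} {x : E → A} (hx : x ∈ stdRep π lt H {q | q = p ∨ lt q p})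
    (hxf : x ∈ fil π {q | lt q p}) : x ∈ stdRep π lt H {q | lt q p} := by
  by_cases hp : p ∈ normalSet lt D
  · by_cases hex : ∃ g ∈ H, ∃ γ q, lec π lt g = some q ∧ shift γ q = p
    · obtain ⟨g, hg, γ, q, hq, hγ⟩ := hex
      have key : ∃ t : K, x - t • xm π γ • g ∈ stdRep π lt H {q | lt q p} := by
        clear hxf
        induction hx using Submodule.span_induction with
        | mem x hx =>
          obtain ⟨g', hg', γ', q', hq', hm, rfl⟩ := hx
          rcases hm with hm | hm
          · exact h.sub_mem_stdRep_lt h1 hp hg' hg hq' hq hm hγ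
          · exact ⟨0, by rw [zero_smul, sub_zero]; exact smul_mem_stdRep hg' hq' hm⟩
        | zero => exact ⟨0, by rw [zero_smul, sub_zero]; exact zero_mem _⟩
        | add x y _ _ hx hy =>
          obtain ⟨t, ht⟩ := hx
          obtain ⟨s, hs⟩ := hy
          exact ⟨t + s, by rw [add_smul, add_sub_add_comm]; exact add_mem ht hs⟩
        | smul c x _ hx =>
          obtain ⟨t, ht⟩ := hx
          exact ⟨c * t, by rw [mul_smul, ← smul_sub]; exact Submodule.smul_mem _ _ ht⟩
      obtain ⟨t, ht⟩ := key
      have h3 := sub_mem hxf (h.stdRep_le_fil (isLower_lt h p) ht)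
      rw [sub_sub_cancel] at h3
      obtain ⟨c, hc, hm⟩ := h.wv_smul_of_lec (stdList γ) hq
      rw [listExpo_stdList, hγ, wv_stdList] at hm
      have h4 := h.coef_eq_of_sub_mem hp hm
      have h5 := h.coef_eq_zero_of_mem_fil h3
      rw [h.coef_smul, h4] at h5
      have ht0 : t = 0 := (mul_eq_zero.1 h5).resolve_right hc
      rwa [ht0, zero_smul, sub_zero] at ht
    · refine (Submodule.span_mono ?_) hx
      rintro _ ⟨g, hg, γ, q, hq, hm, rfl⟩
      refine ⟨g, hg, γ, q, hq, hm.resolve_left fun hh => hex ⟨g, hg, γ, q, hq, hh⟩, rfl⟩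
  · refine (Submodule.span_le.2 ?_) hx
    rintro _ ⟨g, hg, γ, q, hq, hm, rfl⟩
    rcases hm with hm | hm
    · exact h.mem_stdRep_lt_of_notMem h2 hp hg hq hm
    · exact smul_mem_stdRep hg hq hm

/-- Buchberger's criterion. -/
theorem IsModuleDatum.buchberger (h : IsModuleDatum π lt D) {H : Set (E → A)}
    (h1 : ∀ g ∈ H, ∀ g' ∈ H, ∀ α β e, lec π lt g = some (α, e) → lec π lt g' = some (β, e) →
      g ≠ g' → (α ⊔ β, e) ∈ normalSet lt D → ∃ c c' : K, c ≠ 0 ∧ c' ≠ 0 ∧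
        c • xm π (α ⊔ β - α) • g - c' • xm π (α ⊔ β - β) • g' ∈
          stdRep π lt H {r | lt r (α ⊔ β, e)})
    (h2 : ∀ g ∈ H, ∀ α e, lec π lt g = some (α, e) →
      ∀ β ∈ lset (restrict lt e) ((D e).I : Set (Free K n)),
        xm π (α ⊔ β - α) • g ∈ stdRep π lt H {r | lt r (α ⊔ β, e)})
    {m : E → A} (hm : m ∈ Submodule.span A H) {p : Expo n × E} (hp : lec π lt m = some p) :
    m ∈ stdRep π lt H {q | q = p ∨ lt q p} := by
  -- Well-founded descent on the bound of the representation until the bound equals the leading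
  -- exponent.
  have key : ∀ q, m ∈ stdRep π lt H {r | r = q ∨ lt r q} →
      m ∈ stdRep π lt H {r | r = p ∨ lt r p} := by
    intro q
    induction q using h.wf.induction with
    | _ q ih =>
      intro hq
      have h3 := h.lec_mem_of_mem_fil (isLower_le h q) (h.stdRep_le_fil (isLower_le h q) hq) hp
      rcases h3 with rfl | h3
      · exact hq
      · have h4 := h.mem_stdRep_lt_of_mem_fil h1 h2 hq (h.mem_fil_of_lec hp (isLower_lt h q) h3)
        rcases h.exists_mem_stdRep_le h4 with rfl | ⟨r, hr, h5⟩
        · exact zero_mem _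
        · exact ih r hr h5
  rcases h.exists_mem_stdRep_le (h.mem_stdRep_univ hm) with rfl | ⟨q, -, hq⟩
  · exact zero_mem _
  · exact key q hq

/-! ### Division and reduced Gröbner bases -/

/-- The set of leading exponents of the nonzero elements of `M`. -/
def lecSet (π : Free K n →ₐ[K] A) (lt : Expo n × E → Expo n × E → Prop)
    (M : Submodule A (E → A)) : Set (Expo n × E) :=
  {p | ∃ m ∈ M, lec π lt m = some p}

theorem smul_mem_of_mem {M : Submodule A (E → A)} (c : K) {m : E → A} (hm : m ∈ M) : c • m ∈ M :=
  Submodule.smul_mem (M.restrictScalars K) c hm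

/-- Division: a multiple of some `g` cancels the leading term, the difference stays in `M` and has a
smaller leading exponent, and induction applies. -/
theorem IsModuleDatum.mem_stdRep_of_lecSet (h : IsModuleDatum π lt D) {M : Submodule A (E → A)}
    {G : Set (E → A)} (hG : G ⊆ M)
    (hL : ∀ p ∈ lecSet π lt M, ∃ g ∈ G, ∃ γ q, lec π lt g = some q ∧ shift γ q = p)
    {m : E → A} (hm : m ∈ M) {p : Expo n × E} (hp : lec π lt m = some p) :
    m ∈ stdRep π lt G {q | q = p ∨ lt q p} := by
  induction p using h.wf.induction generalizing m with
  | _ p ih =>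
    obtain ⟨g, hg, γ, q, hq, hγ⟩ := hL p ⟨m, hm, hp⟩
    obtain ⟨c, hc, hcm⟩ := h.wv_smul_of_lec (stdList γ) hq
    rw [listExpo_stdList, hγ, wv_stdList] at hcm
    have h1 := h.sub_mem_fil_of_lec hp
    set t := coef π lt m p with ht
    have h2 : m - (t / c) • xm π γ • g ∈ fil π {q | lt q p} := by
      have := sub_mem h1 (Submodule.smul_mem _ (t / c) hcm)
      convert this using 1
      rw [smul_sub, smul_smul, div_mul_cancel₀ _ hc]
      abel
    have h3 : m - (t / c) • xm π γ • g ∈ M :=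
      sub_mem hm (smul_mem_of_mem _ (Submodule.smul_mem _ _ (hG hg)))
    have h4 : (t / c) • xm π γ • g ∈ stdRep π lt G {q | q = p ∨ lt q p} :=
      Submodule.smul_mem _ _ (smul_mem_stdRep hg hq (Or.inl hγ))
    rw [← sub_add_cancel m ((t / c) • xm π γ • g)]
    refine add_mem ?_ h4
    by_cases h0 : m - (t / c) • xm π γ • g = 0
    · rw [h0]; exact zero_mem _
    · obtain ⟨p', hp'⟩ := h.exists_lec h0
      have hlt : lt p' p := h.lec_mem_of_mem_fil (isLower_lt h p) h2 hp'
      refine stdRep_mono subset_rfl ?_ (ih p' hlt h3 hp')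
      rintro r (rfl | hr)
      · exact Or.inr hlt
      · exact Or.inr (h.ordering.total.trans _ _ _ hr hlt)

/-- Leading exponents are irreducible, so `lecSet` can be closed under multiples only inside
`normalSet`. -/
theorem IsModuleDatum.shift_mem_lecSet (h : IsModuleDatum π lt D) {M : Submodule A (E → A)}
    {p : Expo n × E} (hp : p ∈ lecSet π lt M) {γ : Expo n} (hn : shift γ p ∈ normalSet lt D) :
    shift γ p ∈ lecSet π lt M := by
  obtain ⟨m, hm, hmp⟩ := hp
  obtain ⟨c, hc, hcm⟩ := h.wv_smul_of_lec (stdList γ) hmp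
  rw [listExpo_stdList] at hcm
  exact ⟨_, Submodule.smul_mem _ _ hm, h.lec_eq_of_sub_mem hc hn hcm⟩

/-- A criterion for being a reduced Gröbner basis in terms of leading exponents. -/
theorem IsModuleDatum.isReducedGroebnerBasis (h : IsModuleDatum π lt D)
    {M : Submodule A (E → A)} {G : Finset (E → A)}
    (hG : ∀ g ∈ G, g ∈ M ∧ ∃ p, lec π lt g = some p ∧ coef π lt g p = 1 ∧
      ∀ q, q ≠ p → coef π lt g q ≠ 0 → q ∉ lecSet π lt M)
    (hL : ∀ p ∈ lecSet π lt M, ∃ g ∈ G, ∃ γ q, lec π lt g = some q ∧ shift γ q = p)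
    (hmin : ∀ g ∈ G, ∀ g' ∈ G, ∀ q γ, lec π lt g = some q →
      lec π lt g' = some (shift γ q) → g' = g) : IsReducedGroebnerBasis π lt M G where
  isGroebnerBasis := h.isGroebnerBasis_of_stdRep (fun g hg => (hG g hg).1) fun m hm p hp =>
    h.mem_stdRep_of_lecSet (fun g hg => (hG g hg).1) hL hm hp
  zero_notMem h0 := by
    obtain ⟨-, p, hp, -⟩ := hG 0 h0
    exact h.ne_zero_of_lec hp rfl
  lc_eq_one g hg := by
    obtain ⟨-, p, hp, h1, -⟩ := hG g hg
    rw [lc_eq hp, h1]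
  reduced := by
    intro g hg e α hne g' hg' hgg p hp γ heq
    obtain ⟨-, p', hp', -, hq⟩ := hG g hg
    have heq' : (α, e) = shift γ p := by rw [heq, shift, add_comm]
    -- At the leading monomial of `g`, a violation contradicts `hmin`. At any other monomial of `g`,
    -- the multiple of lec(g') is irreducible because it occurs in `g`, so it is a leading exponent
    -- of `M`, which the tail of `g` avoids.
    by_cases hpp : (α, e) = p'
    · rw [← hpp, heq'] at hp'
      exact hgg (hmin g' hg' g hg p γ hp hp').symm
    · refine hq _ hpp hne ?_
      have hn := h.mem_normalSet_of_coef_ne hne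
      rw [heq'] at hn ⊢
      exact h.shift_mem_lecSet ⟨g', (hG g' hg').1, hp⟩ hn

/-- By induction a monomial can be replaced by smaller ones if it is reducible, or, modulo `M`, if
it is a leading exponent of `M`. What remains are irreducible monomials outside of `lecSet`. -/
theorem IsModuleDatum.mon_mem_sup (h : IsModuleDatum π lt D) (M : Submodule A (E → A))
    (p : Expo n × E) : mon π p ∈ (M.restrictScalars K ⊓ fil π {q | q = p ∨ lt q p}) ⊔
      fil π {q | q ∈ normalSet lt D ∧ q ∉ lecSet π lt M ∧ (q = p ∨ lt q p)} := by
  induction p using h.wf.induction with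
  | _ p ih =>
    have hlow : fil π {q | lt q p} ≤ (M.restrictScalars K ⊓ fil π {q | q = p ∨ lt q p}) ⊔
        fil π {q | q ∈ normalSet lt D ∧ q ∉ lecSet π lt M ∧ (q = p ∨ lt q p)} := by
      refine Submodule.span_le.2 ?_
      rintro _ ⟨q, hq, rfl⟩
      have hsub : ∀ r, (r = q ∨ lt r q) → (r = p ∨ lt r p) := by
        rintro r (rfl | hr)
        · exact Or.inr hq
        · exact Or.inr (h.ordering.total.trans _ _ _ hr hq)
      refine SetLike.le_def.1 (sup_le_sup ?_ ?_) (ih q hq)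
      · exact inf_le_inf le_rfl (fil_mono hsub)
      · exact fil_mono fun r hr => ⟨hr.1, hr.2.1, hsub r hr.2.2⟩
    by_cases hn : p ∈ normalSet lt D
    · by_cases hL : p ∈ lecSet π lt M
      · obtain ⟨m, hm, hp⟩ := hL
        have h1 := hlow (h.sub_mem_fil_of_lec hp)
        have hc := (h.lec_eq_some_iff.1 hp).1
        have h2 : m ∈ (M.restrictScalars K ⊓ fil π {q | q = p ∨ lt q p}) ⊔
            fil π {q | q ∈ normalSet lt D ∧ q ∉ lecSet π lt M ∧ (q = p ∨ lt q p)} :=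
          Submodule.mem_sup_left ⟨hm, h.mem_fil_of_lec hp (isLower_le h p) (Or.inl rfl)⟩
        have h3 := sub_mem h2 h1
        rw [sub_sub_cancel] at h3
        exact (Submodule.smul_mem_iff _ hc).1 h3
      · exact Submodule.mem_sup_right (mon_mem_fil ⟨hn, hL, Or.inl rfl⟩)
    · exact hlow (h.mon_mem_fil_of_notMem hn)

/-- Elements with a support outside of the leading exponents of `M`, except for the leading one. -/
theorem IsModuleDatum.exists_reduced_element (h : IsModuleDatum π lt D) (M : Submodule A (E → A))
    {p : Expo n × E} (hp : p ∈ lecSet π lt M) : ∃ g ∈ M, lec π lt g = some p ∧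
      coef π lt g p = 1 ∧ ∀ q, q ≠ p → coef π lt g q ≠ 0 → q ∉ lecSet π lt M := by
  obtain ⟨m, hm, hmp⟩ := hp
  have hn := h.lec_mem_normalSet hmp
  -- Here `a + b = x^p` with `a ∈ M`. Since `p` is a leading exponent of `M`, it does not occur in
  -- `b`; hence `b` lies strictly below `p` and `a` is monic with leading exponent `p`.
  obtain ⟨a, ⟨haM, ha⟩, b, hb, hab⟩ := Submodule.mem_sup.1 (h.mon_mem_sup M p)
  have hb' : ∀ q, coef π lt b q ≠ 0 → q ∉ lecSet π lt M ∧ (q = p ∨ lt q p) := by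
    intro q hq
    clear hab
    induction hb using Submodule.span_induction with
    | mem x hx =>
      obtain ⟨r, hr, rfl⟩ := hx
      have : q = r := by
        by_contra hne
        exact hq (h.coef_mon_of_ne hr.1 hne)
      subst this
      exact hr.2
    | zero => exact absurd (h.coef_zero q) hq
    | add x y _ _ hx hy =>
      rw [h.coef_add] at hq
      by_cases h0 : coef π lt x q = 0
      · exact hy fun h1 => hq (by rw [h0, h1, add_zero])
      · exact hx h0
    | smul c x _ hx =>
      rw [h.coef_smul] at hq
      exact hx (right_ne_zero_of_mul hq)
  have hbL : ∀ q, coef π lt b q ≠ 0 → lt q p := by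
    intro q hq
    obtain ⟨h1, h2⟩ := hb' q hq
    refine h2.resolve_left fun h3 => h1 ?_
    rw [h3]; exact ⟨m, hm, hmp⟩
  have hbf : b ∈ fil π {q | lt q p} := (h.mem_fil_iff (isLower_lt h p)).2 hbL
  have hsub : a - (1 : K) • mon π p ∈ fil π {q | lt q p} := by
    have : a - (1 : K) • mon π p = -b := by rw [one_smul, ← hab]; abel
    rw [this]; exact neg_mem hbf
  refine ⟨a, haM, h.lec_eq_of_sub_mem one_ne_zero hn hsub, h.coef_eq_of_sub_mem hn hsub,
    fun q hqp hq => (hb' q ?_).1⟩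
  have hae : a = mon π p - b := by rw [← hab]; abel
  rw [hae, h.coef_sub, h.coef_mon_of_ne hn hqp, zero_sub, neg_ne_zero] at hq
  exact hq

/-- Componentwise divisibility of monomials `x^α (e)`. -/
def Dvd' (p q : Expo n × E) : Prop := p.1 ≤ q.1 ∧ p.2 = q.2

theorem dvd'_iff {p q : Expo n × E} : Dvd' p q ↔ ∃ γ, shift γ p = q := by
  constructor
  · rintro ⟨h1, h2⟩
    refine ⟨q.1 - p.1, Prod.ext ?_ h2⟩
    exact tsub_add_cancel_of_le h1
  · rintro ⟨γ, rfl⟩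
    exact ⟨by intro i; simp [shift], rfl⟩

theorem wellQuasiOrdered_dvd' : WellQuasiOrdered (Dvd' : Expo n × E → Expo n × E → Prop) :=
  WellQuasiOrdered.prod (r := fun a b : Expo n => a ≤ b) wellQuasiOrdered_le
    (Finite.wellQuasiOrdered (fun a b : E => a = b))

theorem Dvd'.trans {p q r : Expo n × E} (h1 : Dvd' p q) (h2 : Dvd' q r) : Dvd' p r :=
  ⟨h1.1.trans h2.1, h1.2.trans h2.2⟩

theorem Dvd'.antisymm {p q : Expo n × E} (h1 : Dvd' p q) (h2 : Dvd' q p) : p = q :=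
  Prod.ext (le_antisymm h1.1 h2.1) h1.2

/-- Divisibility is a well-quasi-order, so its strict part is well-founded. -/
theorem exists_minimal_dvd' (L : Set (Expo n × E)) {p : Expo n × E} (hp : p ∈ L) :
    ∃ q ∈ L, Dvd' q p ∧ ∀ r ∈ L, Dvd' r q → r = q := by
  have hpre : IsPreorder (Expo n × E) Dvd' :=
    { refl := fun p => ⟨le_rfl, rfl⟩, trans := fun _ _ _ => Dvd'.trans }
  have hwf := (wellQuasiOrdered_dvd' (n := n) (E := E)).wellFounded
  obtain ⟨q, ⟨hq, hqp⟩, hmin⟩ := hwf.has_min {q | q ∈ L ∧ Dvd' q p} ⟨p, hp, le_rfl, rfl⟩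
  refine ⟨q, hq, hqp, fun r hr hrq => ?_⟩
  by_contra hne
  exact hmin r ⟨hr, hrq.trans hqp⟩ ⟨hrq, fun h2 => hne (hrq.antisymm h2)⟩

/-- Every submodule has a reduced Gröbner basis. -/
theorem IsModuleDatum.exists_isReducedGroebnerBasis (h : IsModuleDatum π lt D)
    (M : Submodule A (E → A)) : ∃ G, IsReducedGroebnerBasis π lt M G := by
  classical
  -- The minimal leading exponents form an antichain for divisibility, which is finite by Dickson's
  -- lemma; each contributes one reduced element.
  set L := {p | p ∈ lecSet π lt M ∧ ∀ r ∈ lecSet π lt M, Dvd' r p → r = p} with hLdef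
  have hfin : L.Finite := by
    refine IsAntichain.finite_of_wellQuasiOrdered (r := Dvd') ?_ wellQuasiOrdered_dvd'
    intro p hp q hq hne hd
    exact hne (hq.2 p hp.1 hd)
  choose! f hfM hf1 hf2 hf3 using fun p (hp : p ∈ lecSet π lt M) => h.exists_reduced_element M hp
  refine ⟨hfin.toFinset.image f, h.isReducedGroebnerBasis ?_ ?_ ?_⟩
  · intro g hg
    obtain ⟨p, hp, rfl⟩ := Finset.mem_image.1 hg
    have hp' : p ∈ lecSet π lt M := ((Set.Finite.mem_toFinset _).1 hp).1
    exact ⟨hfM p hp', p, hf1 p hp', hf2 p hp', hf3 p hp'⟩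
  · intro p hp
    obtain ⟨q, hq, hqp, hmin⟩ := exists_minimal_dvd' _ hp
    obtain ⟨γ, hγ⟩ := dvd'_iff.1 hqp
    exact ⟨f q, Finset.mem_image.2 ⟨q, (Set.Finite.mem_toFinset _).2 ⟨hq, hmin⟩, rfl⟩, γ, q,
      hf1 q hq, hγ⟩
  · intro g hg g' hg' q γ hq hq'
    obtain ⟨p, hp, rfl⟩ := Finset.mem_image.1 hg
    obtain ⟨p', hp', rfl⟩ := Finset.mem_image.1 hg'
    have hpL := (Set.Finite.mem_toFinset hfin).1 hp
    have hpL' := (Set.Finite.mem_toFinset hfin).1 hp'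
    rw [hf1 p hpL.1, Option.some_inj] at hq
    rw [hf1 p' hpL'.1, Option.some_inj] at hq'
    subst hq
    rw [hpL'.2 p hpL.1 (dvd'_iff.2 ⟨γ, hq'.symm⟩)]

end Buchberger

end PBWRed

namespace PBWRed

/-! ### The completion algorithm -/

section Completion

variable {K : Type*} [Field K] {n : ℕ} {E : Type*} [Finite E] {A : Type*} [Ring A]
  [Algebra K A] {π : Free K n →ₐ[K] A} {lt : Expo n × E → Expo n × E → Prop} {D : E → Datum K n}

/-- Dickson's lemma: there is no infinite chain of sets of monomials each of which has an element
that is not a multiple of an element of the previous one. -/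
theorem wellFounded_dickson : WellFounded (fun S' S : Set (Expo n × E) =>
    S ⊆ S' ∧ ∃ p ∈ S', ∀ q ∈ S, ¬ Dvd' q p) := by
  rw [wellFounded_iff_isEmpty_descending_chain]
  refine ⟨fun ⟨f, hf⟩ => ?_⟩
  have hmono : ∀ i j, i ≤ j → f i ⊆ f j := by
    intro i j hij
    induction j, hij using Nat.le_induction with
    | base => exact subset_rfl
    | succ j _ ih => exact ih.trans (hf j).1
  choose p hp hpn using fun i => (hf i).2
  obtain ⟨i, j, hij, hd⟩ := wellQuasiOrdered_dvd' p
  exact hpn j (p i) (hmono (i + 1) j hij (hp i)) hd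

theorem IsModuleDatum.lec_xm_smul (h : IsModuleDatum π lt D) {a : E → A} {p : Expo n × E}
    (hp : lec π lt a = some p) {γ : Expo n} (hn : shift γ p ∈ normalSet lt D) :
    lec π lt (xm π γ • a) = some (shift γ p) := by
  obtain ⟨c, hc, hm⟩ := h.wv_smul_of_lec (stdList γ) hp
  rw [wv_stdList, listExpo_stdList] at hm
  exact h.lec_eq_of_sub_mem hc hn hm

theorem IsModuleDatum.inv_lc_smul_sub_mem (h : IsModuleDatum π lt D) {a : E → A} {p : Expo n × E}
    (hp : lec π lt a = some p) : (lc π lt a)⁻¹ • a - mon π p ∈ fil π {q | lt q p} := by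
  have h1 := Submodule.smul_mem _ (lc π lt a)⁻¹ (h.sub_mem_fil_of_lec hp)
  rwa [smul_sub, smul_smul, ← lc_eq hp, inv_mul_cancel₀, one_smul] at h1
  rw [lc_eq hp]
  exact (h.lec_eq_some_iff.1 hp).1

/-- The `s`-polynomial of two elements with irreducible least common multiple of the leading
monomials. -/
theorem IsModuleDatum.spoly_eq (h : IsModuleDatum π lt D) {g g' : E → A} {α β : Expo n} {e : E}
    (hg : lec π lt g = some (α, e)) (hg' : lec π lt g' = some (β, e))
    (hn : (α ⊔ β, e) ∈ normalSet lt D) :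
    spoly π lt g g' = (lc π lt (xm π (α ⊔ β - α) • g))⁻¹ • xm π (α ⊔ β - α) • g -
      (lc π lt (xm π (α ⊔ β - β) • g'))⁻¹ • xm π (α ⊔ β - β) • g' ∧
    lc π lt (xm π (α ⊔ β - α) • g) ≠ 0 ∧ lc π lt (xm π (α ⊔ β - β) • g') ≠ 0 ∧
    spoly π lt g g' ∈ fil π {q | lt q (α ⊔ β, e)} := by
  have hs : shift (α ⊔ β - α) (α, e) = (α ⊔ β, e) := by
    simp only [shift]; rw [tsub_add_cancel_of_le le_sup_left]
  have hs' : shift (α ⊔ β - β) (β, e) = (α ⊔ β, e) := by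
    simp only [shift]; rw [tsub_add_cancel_of_le le_sup_right]
  have h1 := h.lec_xm_smul hg (γ := α ⊔ β - α) (by rwa [hs])
  have h2 := h.lec_xm_smul hg' (γ := α ⊔ β - β) (by rwa [hs'])
  rw [hs] at h1
  rw [hs'] at h2
  have heq : spoly π lt g g' = (lc π lt (xm π (α ⊔ β - α) • g))⁻¹ • xm π (α ⊔ β - α) • g -
      (lc π lt (xm π (α ⊔ β - β) • g'))⁻¹ • xm π (α ⊔ β - β) • g' := by
    simp only [spoly, hg, hg']
    rw [if_pos ⟨rfl, (h.isNormal_stdMon_iff e _).2 hn⟩]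
    rfl
  refine ⟨heq, ?_, ?_, ?_⟩
  · rw [lc_eq h1]; exact (h.lec_eq_some_iff.1 h1).1
  · rw [lc_eq h2]; exact (h.lec_eq_some_iff.1 h2).1
  · rw [heq]
    have := sub_mem (h.inv_lc_smul_sub_mem h1) (h.inv_lc_smul_sub_mem h2)
    rwa [sub_sub_sub_cancel_right] at this

/-- The least common multiple of the leading monomials is the leading monomial of `a`, which is
irreducible, so the s-polynomial is not set to zero by convention. Rescaled by lc(a) it is `a` minus
the multiple of `x^γ g` that cancels the leading term. -/
theorem IsModuleDatum.nfStep_spec (h : IsModuleDatum π lt D) {H : Finset (E → A)} {a b : E → A}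
    (hs : NFStep π lt H a b) : ∃ g ∈ H, ∃ γ q p, ∃ c : K, lec π lt a = some p ∧
      lec π lt g = some q ∧ shift γ q = p ∧ b = a - c • xm π γ • g ∧ b ∈ fil π {r | lt r p} := by
  obtain ⟨-, g, hg, ⟨p, hp, g', hg', -, q, hq, γ, hγ⟩, rfl⟩ := hs
  obtain rfl : g' = g := hg'
  obtain ⟨β, e⟩ := q
  have hn := h.lec_mem_normalSet hp
  subst hγ
  have hsup : (γ + β) ⊔ β = γ + β := sup_eq_left.2 (by intro i; simp)
  obtain ⟨heq, hc, -, hmem⟩ := h.spoly_eq hp hq (by rwa [hsup])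
  rw [hsup] at heq hc hmem
  rw [tsub_self, xm_zero, one_smul] at hc heq
  rw [add_tsub_cancel_right] at heq
  refine ⟨g', hg, γ, (β, e), (γ + β, e),
    lc π lt a * (lc π lt (xm π γ • g'))⁻¹, hp, hq, rfl, ?_, Submodule.smul_mem _ _ hmem⟩
  rw [heq, smul_sub, smul_smul, mul_inv_cancel₀ hc, one_smul, smul_smul]

/-- Every bound for `s` is a bound for a standard representation of `s`. -/
def HasStdRep (π : Free K n →ₐ[K] A) (lt : Expo n × E → Expo n × E → Prop)
    (H : Set (E → A)) (s : E → A) : Prop :=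
  ∀ B, IsLower lt B → s ∈ fil π B → s ∈ stdRep π lt H B

theorem HasStdRep.mono {H H' : Set (E → A)} (hH : H ⊆ H') {s : E → A}
    (hs : HasStdRep π lt H s) : HasStdRep π lt H' s :=
  fun B hB hm => stdRep_mono hH subset_rfl (hs B hB hm)

/-- The invariant of the main loop; `X` are the `s`-polynomials in progress. -/
structure LoopInv (π : Free K n →ₐ[K] A) (lt : Expo n × E → Expo n × E → Prop)
    (D : E → Datum K n) (M : Submodule A (E → A)) (T : Finset (CPair K n E A))
    (H : Finset (E → A)) (X : Set (E → A)) : Prop where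
  zero : (0 : E → A) ∉ H
  span : Submodule.span A (H : Set (E → A)) = M
  mem : ∀ t ∈ T, t.1 ∈ H ∧ ∀ g', t.2 = Sum.inl g' → g' ∈ H
  pairs : ∀ g ∈ H, ∀ g' ∈ H, g ≠ g' → ∃ t : CPair K n E A,
    (t = (g, Sum.inl g') ∨ t = (g', Sum.inl g)) ∧
    (t ∈ T ∨ HasStdRep π lt (H : Set (E → A)) (spolyPair π lt t) ∨ spolyPair π lt t ∈ X)
  rels : ∀ g ∈ H, ∀ p ∈ relsOf π lt D g, (g, Sum.inr p) ∈ T ∨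
    HasStdRep π lt (H : Set (E → A)) (spolyPair π lt (g, Sum.inr p)) ∨
    spolyPair π lt ((g, Sum.inr p) : CPair K n E A) ∈ X

/-- The invariant of the completion algorithm. -/
def StateInv (π : Free K n →ₐ[K] A) (lt : Expo n × E → Expo n × E → Prop)
    (D : E → Datum K n) (M : Submodule A (E → A)) : BState K n E A → Prop
  | .outer T H => LoopInv π lt D M T H ∅
  | .inner T H a => ∃ s, LoopInv π lt D M T H {s} ∧ a ∈ M ∧
      ∀ B, IsLower lt B → s ∈ fil π B → a ∈ fil π B ∧ s - a ∈ stdRep π lt (H : Set (E → A)) B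

/-- The exponent `α ⊔ β` is a multiple of a leading exponent of I, hence reducible, so the product
drops strictly below it. -/
theorem IsModuleDatum.spolyRel_eq (h : IsModuleDatum π lt D) {g : E → A} {α β : Expo n} {e : E}
    (hg : lec π lt g = some (α, e)) {p : Free K n} (hp : p ∈ (D e).I)
    (hβ : lexp (restrict lt e) p = some β) : spolyRel π lt g p = xm π (α ⊔ β - α) • g ∧
      spolyRel π lt g p ∈ fil π {q | lt q (α ⊔ β, e)} := by
  have heq : spolyRel π lt g p = xm π (α ⊔ β - α) • g := by
    simp only [spolyRel, hg, hβ]; rfl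
  refine ⟨heq, ?_⟩
  rw [heq]
  have hs : shift (α ⊔ β - α) (α, e) = (α ⊔ β, e) := by
    simp only [shift]; rw [tsub_add_cancel_of_le le_sup_left]
  obtain ⟨c, -, hm⟩ := h.wv_smul_of_lec (stdList (α ⊔ β - α)) hg
  rw [wv_stdList, listExpo_stdList, hs] at hm
  have hn : (α ⊔ β, e) ∉ normalSet lt D := by
    refine not_not.2 ⟨β, ⟨p, hp, ?_, hβ⟩, α ⊔ β - β, (tsub_add_cancel_of_le le_sup_right).symm⟩
    rintro rfl
    rw [lexp, Option.map_eq_some_iff] at hβ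
    obtain ⟨w, hw, -⟩ := hβ
    exact ((lm_eq_some_iff (h.datum e).well).1 hw).1 rfl
  have := add_mem hm (Submodule.smul_mem _ c (h.mon_mem_fil_of_notMem hn))
  rwa [sub_add_cancel] at this

theorem spolyPair_mem {M : Submodule A (E → A)} {t : CPair K n E A} (h1 : t.1 ∈ M)
    (h2 : ∀ g', t.2 = Sum.inl g' → g' ∈ M) : spolyPair π lt t ∈ M := by
  obtain ⟨g, g' | p⟩ := t
  · simp only [spolyPair, spoly]
    split
    · split_ifs
      · exact sub_mem (smul_mem_of_mem _ (Submodule.smul_mem _ _ h1))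
          (smul_mem_of_mem _ (Submodule.smul_mem _ _ (h2 g' rfl)))
      · exact zero_mem _
    · exact zero_mem _
  · simp only [spolyPair, spolyRel]
    split
    · split
      · exact Submodule.smul_mem _ _ h1
      · exact zero_mem _
    · exact zero_mem _

/-- At the end of the main loop, `H` is a Gröbner basis. -/
theorem LoopInv.isGroebnerBasis (h : IsModuleDatum π lt D) {M : Submodule A (E → A)}
    {H : Finset (E → A)} (hH : LoopInv π lt D M ∅ H ∅) : IsGroebnerBasis π lt M H := by
  refine h.isGroebnerBasis_of_stdRep (fun g hg => hH.span ▸ Submodule.subset_span hg)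
    fun m hm p hp => h.buchberger ?_ ?_ (hH.span ▸ hm) hp
  · intro g hg g' hg' α β e hq hq' hgg hn
    obtain ⟨t, ht, ht'⟩ := hH.pairs g hg g' hg' hgg
    have hstd : HasStdRep π lt (H : Set (E → A)) (spolyPair π lt t) := by
      simpa using ht'
    rcases ht with rfl | rfl
    · obtain ⟨heq, hc, hc', hf⟩ := h.spoly_eq hq hq' hn
      exact ⟨_, _, inv_ne_zero hc, inv_ne_zero hc', heq ▸ hstd _ (isLower_lt h _) hf⟩
    -- The pair was stored in the opposite order; its s-polynomial differs by a sign.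
    · obtain ⟨heq, hc, hc', hf⟩ := h.spoly_eq hq' hq (by rwa [sup_comm])
      have h1 := hstd _ (isLower_lt h _) hf
      change spoly π lt g' g ∈ _ at h1
      rw [heq, sup_comm β α] at h1
      rw [sup_comm β α] at hc hc'
      refine ⟨_, _, inv_ne_zero hc', inv_ne_zero hc, ?_⟩
      rw [← neg_sub]
      exact neg_mem h1
  · rintro g hg α e hq β ⟨p, hp, -, hβ⟩
    have hstd : HasStdRep π lt (H : Set (E → A)) (spolyPair π lt (g, Sum.inr p)) := by
      have := hH.rels g hg p (by simp only [relsOf, hq]; exact hp)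
      simpa using this
    obtain ⟨heq, hf⟩ := h.spolyRel_eq hq hp hβ
    have h1 := hstd _ (isLower_lt h _) hf
    change spolyRel π lt g p ∈ _ at h1
    rwa [heq] at h1

/-- During a normal form computation for the s-polynomial `s`, the difference `s - a` has a
representation within every bound of `s`, and `a` obeys the same bounds. At the end either `a = 0`,
or `a` joins `H` and is its own representation; in both cases `s` acquires a standard
representation. -/
theorem StateInv.step (h : IsModuleDatum π lt D) {M : Submodule A (E → A)} {s s' : BState K n E A}
    (hs : StateInv π lt D M s) (hst : BStep π lt D s s') : StateInv π lt D M s' := by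
  classical
  cases hst with
  | choose T H t ht =>
    refine ⟨spolyPair π lt t, ⟨hs.zero, hs.span, fun t' ht' => hs.mem t' (Finset.mem_of_mem_erase ht'),
      ?_, ?_⟩, ?_, fun B _ hf => ⟨hf, by rw [sub_self]; exact zero_mem _⟩⟩
    · intro g hg g' hg' hne
      obtain ⟨t', h1, h2⟩ := hs.pairs g hg g' hg' hne
      refine ⟨t', h1, ?_⟩
      rcases h2 with h2 | h2 | h2
      · by_cases htt : t' = t
        · subst htt; exact Or.inr (Or.inr rfl)
        · exact Or.inl (Finset.mem_erase.2 ⟨htt, h2⟩)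
      · exact Or.inr (Or.inl h2)
      · exact absurd h2 (Set.notMem_empty _)
    · intro g hg p hp
      rcases hs.rels g hg p hp with h2 | h2 | h2
      · by_cases htt : (g, Sum.inr p) = t
        · subst htt; exact Or.inr (Or.inr rfl)
        · exact Or.inl (Finset.mem_erase.2 ⟨htt, h2⟩)
      · exact Or.inr (Or.inl h2)
      · exact absurd h2 (Set.notMem_empty _)
    · obtain ⟨h1, h2⟩ := hs.mem t ht
      exact spolyPair_mem (hs.span ▸ Submodule.subset_span h1)
        fun g' hg' => hs.span ▸ Submodule.subset_span (h2 g' hg')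
  | reduce T H a b hn =>
    obtain ⟨s, h1, ha, h2⟩ := hs
    obtain ⟨g, hg, γ, q, p, c, hp, hq, hγ, rfl, hf⟩ := h.nfStep_spec hn
    have hgM : g ∈ M := h1.span ▸ Submodule.subset_span hg
    refine ⟨s, h1, sub_mem ha (smul_mem_of_mem _ (Submodule.smul_mem _ _ hgM)), fun B hB hsB => ?_⟩
    obtain ⟨h3, h4⟩ := h2 B hB hsB
    have hpB := h.lec_mem_of_mem_fil hB h3 hp
    refine ⟨fil_mono (fun r hr => hB _ _ hr hpB) hf, ?_⟩
    rw [sub_sub_eq_add_sub, add_sub_right_comm]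
    exact add_mem h4 (Submodule.smul_mem _ _ (smul_mem_stdRep hg hq (hγ ▸ hpB)))
  | discard T H =>
    obtain ⟨s, h1, -, h2⟩ := hs
    have hstd : HasStdRep π lt (H : Set (E → A)) s := fun B hB hsB => by
      have := (h2 B hB hsB).2
      rwa [sub_zero] at this
    refine ⟨h1.zero, h1.span, h1.mem, ?_, ?_⟩
    · intro g hg g' hg' hne
      obtain ⟨t', h3, h4⟩ := h1.pairs g hg g' hg' hne
      refine ⟨t', h3, ?_⟩
      rcases h4 with h4 | h4 | h4
      · exact Or.inl h4
      · exact Or.inr (Or.inl h4)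
      · right; left; rw [Set.mem_singleton_iff.1 h4]; exact hstd
    · intro g hg p hp
      rcases h1.rels g hg p hp with h4 | h4 | h4
      · exact Or.inl h4
      · exact Or.inr (Or.inl h4)
      · right; left; rw [Set.mem_singleton_iff.1 h4]; exact hstd
  | insert T H r hr hnr =>
    obtain ⟨s, h1, hrM, h2⟩ := hs
    have hsub : (H : Set (E → A)) ⊆ (Insert.insert r H : Finset (E → A)) := by
      simp
    have hstd : HasStdRep π lt ((Insert.insert r H : Finset (E → A)) : Set (E → A)) s := by
      intro B hB hsB
      obtain ⟨h3, h4⟩ := h2 B hB hsB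
      obtain ⟨q, hq⟩ := h.exists_lec hr
      rw [← sub_add_cancel s r]
      exact add_mem (stdRep_mono hsub subset_rfl h4)
        (mem_stdRep_self (by simp) hq (h.lec_mem_of_mem_fil hB h3 hq))
    refine ⟨?_, ?_, ?_, ?_, ?_⟩
    · rw [Finset.mem_insert, not_or]; exact ⟨hr.symm, h1.zero⟩
    · rw [Finset.coe_insert, Submodule.span_insert, h1.span, sup_eq_right]
      exact (Submodule.span_singleton_le_iff_mem _ _).2 hrM
    · intro t ht
      rw [Finset.mem_union, Finset.mem_union, Finset.mem_image, Finset.mem_image] at ht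
      rcases ht with (ht | ⟨g, hg, rfl⟩) | ⟨p, hp, rfl⟩
      · obtain ⟨h3, h4⟩ := h1.mem t ht
        exact ⟨Finset.mem_insert_of_mem h3, fun g' hg' => Finset.mem_insert_of_mem (h4 g' hg')⟩
      · refine ⟨Finset.mem_insert_self _ _, fun g' hg' => ?_⟩
        obtain rfl : g = g' := Sum.inl_injective hg'
        exact Finset.mem_insert_of_mem hg
      · exact ⟨Finset.mem_insert_self _ _, fun g' hg' => by cases hg'⟩
    · intro g hg g' hg' hne
      rw [Finset.mem_insert] at hg hg'
      have hnew : ∀ g ∈ H, (r, Sum.inl g) ∈ T ∪ H.image (fun g => ((r, Sum.inl g) : CPair K n E A))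
          ∪ (relsOf π lt D r).image (fun p => (r, Sum.inr p)) := fun g hg =>
        Finset.mem_union_left _ (Finset.mem_union_right _ (Finset.mem_image_of_mem _ hg))
      rcases hg with rfl | hg
      · exact ⟨_, Or.inl rfl, Or.inl (hnew _ (hg'.resolve_left fun hh => hne hh.symm))⟩
      · rcases hg' with rfl | hg'
        · exact ⟨_, Or.inr rfl, Or.inl (hnew _ hg)⟩
        · obtain ⟨t', h3, h4⟩ := h1.pairs g hg g' hg' hne
          refine ⟨t', h3, ?_⟩
          rcases h4 with h4 | h4 | h4
          · exact Or.inl (Finset.mem_union_left _ (Finset.mem_union_left _ h4))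
          · exact Or.inr (Or.inl (h4.mono hsub))
          · right; left; rw [Set.mem_singleton_iff.1 h4]; exact hstd
    · intro g hg p hp
      rw [Finset.mem_insert] at hg
      rcases hg with rfl | hg
      · exact Or.inl (Finset.mem_union_right _ (Finset.mem_image_of_mem _ hp))
      · rcases h1.rels g hg p hp with h4 | h4 | h4
        · exact Or.inl (Finset.mem_union_left _ (Finset.mem_union_left _ h4))
        · exact Or.inr (Or.inl (h4.mono hsub))
        · right; left; rw [Set.mem_singleton_iff.1 h4]; exact hstd

theorem IsInitial.stateInv {G : Finset (E → A)} {s : BState K n E A}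
    (hs : IsInitial π lt D G s) : StateInv π lt D (leftSpan A (G : Set (E → A))) s := by
  obtain ⟨l, T, H, hl, hlG, hH, hT, rfl⟩ := hs
  refine ⟨?_, ?_, ?_, ?_, ?_⟩
  · intro h0
    exact ((hlG 0).1 ((hH 0).1 h0)).2 rfl
  · apply le_antisymm
    · exact Submodule.span_mono fun g hg => ((hlG g).1 ((hH g).1 hg)).1
    · refine Submodule.span_le.2 fun g hg => ?_
      by_cases h0 : g = 0
      · rw [h0]; exact zero_mem _
      · exact Submodule.subset_span ((hH g).2 ((hlG g).2 ⟨hg, h0⟩))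
  · intro t ht
    rcases (hT t).1 ht with ⟨i, j, -, rfl⟩ | ⟨g, hg, p, -, rfl⟩
    · refine ⟨(hH _).2 (List.get_mem _ _), fun g' hg' => ?_⟩
      rw [← Sum.inl_injective hg']
      exact (hH _).2 (List.get_mem _ _)
    · exact ⟨(hH _).2 hg, fun g' hg' => by cases hg'⟩
  · intro g hg g' hg' hne
    obtain ⟨i, rfl⟩ := List.get_of_mem ((hH g).1 hg)
    obtain ⟨j, rfl⟩ := List.get_of_mem ((hH g').1 hg')
    rcases lt_trichotomy i j with hij | hij | hij
    · exact ⟨_, Or.inl rfl, Or.inl ((hT _).2 (Or.inl ⟨i, j, hij, rfl⟩))⟩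
    · exact absurd (congrArg _ hij) hne
    · exact ⟨_, Or.inr rfl, Or.inl ((hT _).2 (Or.inl ⟨j, i, hij, rfl⟩))⟩
  · intro g hg p hp
    exact Or.inl ((hT _).2 (Or.inr ⟨g, (hH g).1 hg, p, hp, rfl⟩))

theorem exists_isInitial (G : Finset (E → A)) : ∃ s, IsInitial π lt D G s := by
  classical
  have hfin : {t : CPair K n E A | (∃ i j : Fin (G.erase 0).toList.length, i < j ∧
      t = ((G.erase 0).toList.get i, Sum.inl ((G.erase 0).toList.get j))) ∨
      ∃ g ∈ (G.erase 0).toList, ∃ p ∈ relsOf π lt D g, t = (g, Sum.inr p)}.Finite := by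
    refine Set.Finite.union ?_ ?_
    · refine (Set.finite_range fun ij : Fin (G.erase 0).toList.length ×
        Fin (G.erase 0).toList.length => (((G.erase 0).toList.get ij.1,
          Sum.inl ((G.erase 0).toList.get ij.2)) : CPair K n E A)).subset ?_
      rintro _ ⟨i, j, -, rfl⟩
      exact ⟨(i, j), rfl⟩
    · refine (((G.erase 0).biUnion fun g => (relsOf π lt D g).image
        fun p => ((g, Sum.inr p) : CPair K n E A)).finite_toSet).subset ?_
      rintro _ ⟨g, hg, p, hp, rfl⟩
      simp only [Finset.coe_biUnion, Set.mem_iUnion]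
      exact ⟨g, Finset.mem_toList.1 hg, Finset.mem_coe.2 (Finset.mem_image_of_mem _ hp)⟩
  refine ⟨_, (G.erase 0).toList, hfin.toFinset, G.erase 0, Finset.nodup_toList _, ?_, ?_, ?_, rfl⟩
  · intro g
    rw [Finset.mem_toList, Finset.mem_erase, and_comm]
  · intro g; rw [Finset.mem_toList]
  · intro t
    rw [Set.Finite.mem_toFinset]; rfl

/-- Three nested inductions: on the set of leading exponents of `H`, which grows in the sense of
Dickson's lemma at each insertion; on the number of pending pairs, which drops when nothing is
inserted; and on the leading exponent of the current element inside a normal form computation. -/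
theorem IsModuleDatum.acc_outer (h : IsModuleDatum π lt D) (T : Finset (CPair K n E A))
    (H : Finset (E → A)) : Acc (fun s' s => BStep π lt D s s') (.outer T H) := by
  classical
  obtain ⟨S, hS⟩ : ∃ S, S = {q | ∃ g ∈ H, lec π lt g = some q} := ⟨_, rfl⟩
  revert T H
  refine wellFounded_dickson.induction (C := fun S : Set (Expo n × E) =>
    ∀ (T : Finset (CPair K n E A)) (H : Finset (E → A)), S = {q | ∃ g ∈ H, lec π lt g = some q} →
      Acc (fun s' s => BStep π lt D s s') (.outer T H)) S fun S ih T H hS => ?_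
  · subst hS
    obtain ⟨k, hk⟩ : ∃ k, k = T.card := ⟨_, rfl⟩
    induction k using Nat.strong_induction_on generalizing T with
    | _ k ihk =>
      subst hk
      have hinner : ∀ T' : Finset (CPair K n E A), T'.card < T.card → ∀ a,
          Acc (fun s' s => BStep π lt D s s') (.inner T' H a) := by
        intro T' hT'
        -- The value `0` has no leading exponent and is treated before the innermost induction.
        have hzero : Acc (fun s' s => BStep π lt D s s') (.inner T' H 0) := by
          refine Acc.intro _ fun s' hs' => ?_
          cases hs' with
          | reduce _ _ _ _ hr => exact absurd rfl hr.1
          | discard => exact ihk _ hT' T' rfl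
          | insert _ _ _ hr => exact absurd rfl hr
        intro a
        by_cases ha : a = 0
        · rw [ha]; exact hzero
        · obtain ⟨p, hp⟩ := h.exists_lec ha
          induction p using h.wf.induction generalizing a with
          | _ p ihp =>
            refine Acc.intro _ fun s' hs' => ?_
            cases hs' with
            | reduce _ _ _ b hr =>
              by_cases hb : b = 0
              · rw [hb]; exact hzero
              · obtain ⟨g, -, γ, q, p', c, hp', -, -, -, hf⟩ := h.nfStep_spec hr
                rw [hp, Option.some_inj] at hp'
                subst hp'
                obtain ⟨q, hq⟩ := h.exists_lec hb
                exact ihp q (h.lec_mem_of_mem_fil (isLower_lt h p) hf hq) b hb hq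
            | discard => exact absurd rfl ha
            | insert _ _ _ hr hn =>
              refine ih _ ⟨?_, p, ?_, ?_⟩ _ _ rfl
              · rintro q ⟨g, hg, hq⟩
                exact ⟨g, Finset.mem_insert_of_mem hg, hq⟩
              · exact ⟨a, Finset.mem_insert_self _ _, hp⟩
              · rintro q ⟨g, hg, hq⟩ hd
                obtain ⟨γ, hγ⟩ := dvd'_iff.1 hd
                exact hn g hg p hp ⟨g, rfl, h.ne_zero_of_lec hq, q, hq, γ, hγ.symm⟩
      refine Acc.intro _ fun s' hs' => ?_
      cases hs' with
      | choose _ _ t ht => exact hinner _ (Finset.card_erase_lt_of_mem ht) _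

/-- The completion algorithm terminates with a Gröbner basis. -/
theorem IsModuleDatum.completionCorrectAndTerminates (h : IsModuleDatum π lt D)
    (G : Finset (E → A)) : CompletionCorrectAndTerminates π lt D G := by
  refine ⟨exists_isInitial G, fun s₀ hs₀ => ⟨?_, fun s hs hstuck => ?_⟩⟩
  · obtain ⟨l, T, H, -, -, -, -, rfl⟩ := hs₀
    exact h.acc_outer T H
  · have hinv : StateInv π lt D (leftSpan A (G : Set (E → A))) s := by
      clear hstuck
      induction hs with
      | refl => exact hs₀.stateInv
      | tail _ hst ih => exact StateInv.step h ih hst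
    cases s with
    | outer T H =>
      have hT : T = ∅ := by
        by_contra hne
        obtain ⟨t, ht⟩ := Finset.nonempty_iff_ne_empty.2 hne
        exact hstuck _ (BStep.choose T H t ht)
      subst hT
      exact ⟨H, rfl, LoopInv.isGroebnerBasis h hinv⟩
    -- A state inside a normal form computation is never final: `0` is discarded, and a nonzero
    -- value is either reducible by `H` or inserted.
    | inner T H a =>
      exfalso
      by_cases ha : a = 0
      · subst ha; exact hstuck _ (BStep.discard T H)
      · by_cases hr : ∀ g ∈ H, ∀ q, lec π lt a = some q → q ∉ LsetM π lt {g}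
        · exact hstuck _ (BStep.insert T H a ha hr)
        · push Not at hr
          obtain ⟨g, hg, q, hq, hqL⟩ := hr
          exact hstuck _ (BStep.reduce T H a _ ⟨ha, g, hg, ⟨q, hq, hqL⟩, rfl⟩)

end Completion

end PBWRed

namespace PBWRed

/-! ### Rewriting elements of free modules -/

/-- Terms `c w (e)` with a word `w`. -/
abbrev WTerm (K ι κ : Type*) := K × (List ι × κ)

/-- A rule `x^α (e) → Σ c w (e')`. -/
abbrev Rule (K ι κ : Type*) := (List ι × κ) × List (WTerm K ι κ)

section Rewriting

variable {K ι κ : Type*} [Field K] [DecidableEq ι] [DecidableEq κ]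

def lmulWTerms (w : List ι) (l : List (WTerm K ι κ)) : List (WTerm K ι κ) :=
  l.map fun t => (t.1, (w ++ t.2.1, t.2.2))

def atComp (e : κ) (l : List (K × List ι)) : List (WTerm K ι κ) := l.map fun t => (t.1, (t.2, e))

/-- The product of a monomial and the leading monomial of a rule. -/
def Sys.prodSort (S : Sys K ι κ) (ρ : Rule K ι κ) (b : List ι) :
    K × (List ι × List (K × List ι)) :=
  S.sort ρ.1.2 (b.diff ρ.1.1 ++ ρ.1.1)

/-- The result of applying a rule to the monomial `b`. -/
def Sys.redBy (S : Sys K ι κ) (ρ : Rule K ι κ) (b : List ι) : List (WTerm K ι κ) :=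
  -- Sorting the quotient word times the leading word gives `c x^b` plus lower terms. Solving for
  -- `x^b` and replacing the leading word by the tail of the rule gives the two summands.
  scale (S.prodSort ρ b).1⁻¹ (lmulWTerms (b.diff ρ.1.1) ρ.2) ++
    scale (-(S.prodSort ρ b).1⁻¹) (atComp ρ.1.2 (S.prodSort ρ b).2.2)

/-- The leading monomial of the rule divides the monomial `t`. -/
def Rule.Divides (ρ : Rule K ι κ) (t : List ι × κ) : Prop :=
  ρ.1.2 = t.2 ∧ ρ.1.1.diff t.1 = []

instance (ρ : Rule K ι κ) (t : List ι × κ) : Decidable (ρ.Divides t) :=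
  inferInstanceAs (Decidable (_ ∧ _))

/-- One step of the normal form computation; the state consists of the terms still to be treated
and of the irreducible terms found so far. -/
def Sys.nfStep (S : Sys K ι κ) (R : List (Rule K ι κ)) :
    List (WTerm K ι κ) × List (WTerm K ι κ) →
      List (WTerm K ι κ) ⊕ (List (WTerm K ι κ) × List (WTerm K ι κ))
  | ([], dn) => Sum.inl dn
  | (t :: l, dn) =>
    match R.filter fun ρ => ρ.Divides ((S.sort t.2.2 t.2.1).2.1, t.2.2) with
    -- Only the sorted leading monomial is finished; the lower terms produced by sorting go back to
    -- the pending terms.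
    | [] => Sum.inr (scale t.1 (atComp t.2.2 (S.sort t.2.2 t.2.1).2.2) ++ l,
        (t.1 * (S.sort t.2.2 t.2.1).1, ((S.sort t.2.2 t.2.1).2.1, t.2.2)) :: dn)
    | ρ :: _ => Sum.inr (scale (t.1 * (S.sort t.2.2 t.2.1).1) (S.redBy ρ (S.sort t.2.2 t.2.1).2.1) ++
        (scale t.1 (atComp t.2.2 (S.sort t.2.2 t.2.1).2.2) ++ l), dn)

/-- Adds a term to a list of terms with distinct monomials. -/
def addTerm (t : WTerm K ι κ) : List (WTerm K ι κ) → List (WTerm K ι κ)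
  | [] => [t]
  | s :: l => if s.2 = t.2 then (s.1 + t.1, s.2) :: l else s :: addTerm t l

open Classical in
/-- Collects the terms with the same monomial and drops zero terms. -/
noncomputable def collect (l : List (WTerm K ι κ)) : List (WTerm K ι κ) :=
  (l.foldr addTerm []).filter fun t => t.1 ≠ 0

open Classical in
/-- Moves the largest term to the front. -/
noncomputable def front (lt : List ι × κ → List ι × κ → Prop) :
    List (WTerm K ι κ) → List (WTerm K ι κ)
  | [] => []
  | t :: l =>
    match front lt l with
    | [] => [t]
    | s :: l' => if lt s.2 t.2 then t :: s :: l' else s :: t :: l'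

/-- The rule whose leading term is the first term of a list. -/
def mkRules : List (WTerm K ι κ) → List (Rule K ι κ)
  | [] => []
  | s :: l => [(s.2, scale (-s.1⁻¹) l)]

/-- The `s`-polynomial of two rules. -/
def Sys.spair (S : Sys K ι κ) (ρ ρ' : Rule K ι κ) : List (WTerm K ι κ) :=
  if ρ.1.2 = ρ'.1.2 then
    S.redBy ρ (ρ.1.1.diff ρ'.1.1 ++ ρ'.1.1) ++ scale (-1) (S.redBy ρ' (ρ.1.1.diff ρ'.1.1 ++ ρ'.1.1))
  else []

/-- The element of the module given by a rule. -/
def Rule.terms (ρ : Rule K ι κ) : List (WTerm K ι κ) := (1, ρ.1) :: scale (-1) ρ.2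

def rmulWTerms (i : ι) (l : List (WTerm K ι κ)) : List (WTerm K ι κ) :=
  l.map fun t => (t.1, (t.2.1 ++ [i], t.2.2))

/-- The new elements to be treated after adding the rule `ρ`. -/
def Sys.newPairs (S : Sys K ι κ) (vars : List ι) (R : List (Rule K ι κ)) (ρ : Rule K ι κ) :
    List (List (WTerm K ι κ)) :=
  R.map (S.spair ρ) ++ vars.map fun i => rmulWTerms i ρ.terms

/-- Removes the rules whose leading monomial is a multiple of another one. -/
def minimize : List (Rule K ι κ) → List (Rule K ι κ)
  | [] => []
  | ρ :: H => ρ :: (minimize H).filter fun ρ' => ¬ ρ.Divides ρ'.1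

end Rewriting

/-! ### Correctness and termination of rewriting -/

section Semantics

variable {K : Type*} [Field K] {n : ℕ} {E : Type*} [Finite E] [DecidableEq E] {A : Type*} [Ring A]
  [Algebra K A] {π : Free K n →ₐ[K] A} {lt : Expo n × E → Expo n × E → Prop} {D : E → Datum K n}

/-- The exponent and component of a word in a component. -/
def ex (t : List (Fin n) × E) : Expo n × E := (listExpo t.1, t.2)

/-- The class of a word in a component. -/
noncomputable def tv (π : Free K n →ₐ[K] A) (t : List (Fin n) × E) : E → A :=
  wv π t.1 • mon π (0, t.2)

/-- The class of a list of terms. -/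
noncomputable def mv (π : Free K n →ₐ[K] A) (l : List (WTerm K (Fin n) E)) : E → A :=
  (l.map fun t => t.1 • tv π t.2).sum

theorem mv_nil : mv π ([] : List (WTerm K (Fin n) E)) = 0 := rfl

theorem mv_append (l l' : List (WTerm K (Fin n) E)) : mv π (l ++ l') = mv π l + mv π l' := by
  simp [mv]

theorem mv_cons (t : WTerm K (Fin n) E) (l : List (WTerm K (Fin n) E)) :
    mv π (t :: l) = t.1 • tv π t.2 + mv π l := by
  simp [mv]

theorem mv_scale (c : K) (l : List (WTerm K (Fin n) E)) : mv π (scale c l) = c • mv π l := by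
  induction l with
  | nil => simp [scale, mv]
  | cons t l ih => rw [scale, List.map_cons, mv_cons, ← scale, ih, mv_cons, smul_add, mul_smul]

theorem tv_append (w w' : List (Fin n)) (e : E) : tv π (w ++ w', e) = wv π w • tv π (w', e) := by
  rw [tv, tv, wv_append, mul_smul]

theorem mv_lmulWTerms (w : List (Fin n)) (l : List (WTerm K (Fin n) E)) :
    mv π (lmulWTerms w l) = wv π w • mv π l := by
  induction l with
  | nil => simp [lmulWTerms, mv]
  | cons t l ih =>
    rw [lmulWTerms, List.map_cons, mv_cons, ← lmulWTerms, ih, mv_cons, smul_add, tv_append,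
      smul_comm (wv π w)]

theorem mv_atComp (e : E) (l : List (K × List (Fin n))) :
    mv π (atComp e l) = pv π l • mon π (0, e) := by
  induction l with
  | nil => simp [atComp, mv]
  | cons t l ih =>
    rw [atComp, List.map_cons, mv_cons, ← atComp, ih, pv_cons, add_smul, smul_assoc]
    rfl

theorem mon_eq_smul (α : Expo n) (e : E) : mon π (α, e) = xm π α • mon π (0, e) := by
  classical
  funext e'
  rw [Pi.smul_apply]
  by_cases he : e' = e
  · subst he
    rw [mon_apply_self, mon_apply_self, xm_zero, smul_eq_mul, mul_one]
  · rw [mon_apply_of_ne (α, e) he, mon_apply_of_ne (0, e) he, smul_zero]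

theorem tv_of_pairwise {t : List (Fin n) × E} (h : t.1.Pairwise (· ≤ ·)) :
    tv π t = mon π (ex t) := by
  rw [tv, wv_of_pairwise h, ex, ← mon_eq_smul]

theorem IsModuleDatum.tv_mem_fil (h : IsModuleDatum π lt D) {B : Set (Expo n × E)}
    (hB : IsLower lt B) {t : List (Fin n) × E} (ht : ex t ∈ B) : tv π t ∈ fil π B := by
  have hs : shift (listExpo t.1) ((0, t.2) : Expo n × E) = ex t := by
    simp [shift, ex]
  refine h.wv_smul_mem_fil _ hB (B := {(0, t.2)}) ?_ (mon_mem_fil rfl)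
  rintro q rfl
  rwa [hs]

theorem IsModuleDatum.mv_mem_fil (h : IsModuleDatum π lt D) {B : Set (Expo n × E)}
    (hB : IsLower lt B) {l : List (WTerm K (Fin n) E)} (hl : ∀ t ∈ l, ex t.2 ∈ B) :
    mv π l ∈ fil π B := by
  refine list_sum_mem fun x hx => ?_
  obtain ⟨t, ht, rfl⟩ := List.mem_map.1 hx
  exact Submodule.smul_mem _ _ (h.tv_mem_fil hB (hl t ht))

/-- `List.diff` subtracts multiplicities with truncation, so it is empty exactly if the exponent of
the rule is componentwise at most that of `t`. -/
theorem divides_iff {ρ : Rule K (Fin n) E} {t : List (Fin n) × E} :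
    ρ.Divides t ↔ Dvd' (ex ρ.1) (ex t) := by
  have : ρ.1.1.diff t.1 = [] ↔ listExpo ρ.1.1 ≤ listExpo t.1 := by
    rw [← tsub_eq_zero_iff_le, ← listExpo_diff]
    constructor
    · intro h; rw [h, listExpo_nil]
    · intro h
      have := perm_of_listExpo_eq (h.trans listExpo_nil.symm)
      exact this.eq_nil
  rw [Rule.Divides, this, and_comm]; rfl

/-- The element of the module given by a rule. -/
noncomputable def Rule.elem (π : Free K n →ₐ[K] A) (ρ : Rule K (Fin n) E) : E → A :=
  tv π ρ.1 - mv π ρ.2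

theorem Rule.mv_terms (ρ : Rule K (Fin n) E) : mv π ρ.terms = ρ.elem π := by
  rw [Rule.terms, mv_cons, mv_scale, one_smul, neg_one_smul, Rule.elem, sub_eq_add_neg]

/-- The leading monomial of the rule is standard, and larger than all other terms. -/
structure Rule.IsOk (lt : Expo n × E → Expo n × E → Prop) (ρ : Rule K (Fin n) E) : Prop where
  sorted : ρ.1.1.Pairwise (· ≤ ·)
  low : ∀ t ∈ ρ.2, lt (ex t.2) (ex ρ.1)

theorem IsModuleDatum.lec_elem (h : IsModuleDatum π lt D) {ρ : Rule K (Fin n) E}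
    (hρ : ρ.IsOk lt) (hn : ex ρ.1 ∈ normalSet lt D) : lec π lt (ρ.elem π) = some (ex ρ.1) := by
  refine h.lec_eq_of_sub_mem one_ne_zero hn ?_
  rw [Rule.elem, tv_of_pairwise hρ.sorted, one_smul, sub_sub_cancel_left]
  exact neg_mem (h.mv_mem_fil (isLower_lt h _) hρ.low)

/-- Applying a rule to `b` subtracts a multiple of the element of the module given by the rule. -/
theorem Sys.Compatible.redBy_spec {S : Sys K (Fin n) E} (hS : S.Compatible π lt)
    {ρ : Rule K (Fin n) E} (hρ : ρ.IsOk lt) {b : List (Fin n)} (hb : listExpo ρ.1.1 ≤ listExpo b) :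
    (∃ c : K, c ≠ 0 ∧ mv π (S.redBy ρ b) =
      mon π (listExpo b, ρ.1.2) - c • wv π (b.diff ρ.1.1) • ρ.elem π) ∧
    ∀ t ∈ S.redBy ρ b, lt (ex t.2) (listExpo b, ρ.1.2) := by
  have hs := hS.isSorting_sort ρ.1.2 (b.diff ρ.1.1 ++ ρ.1.1)
  have hex : listExpo (b.diff ρ.1.1 ++ ρ.1.1) = listExpo b := by
    rw [listExpo_append, listExpo_diff, tsub_add_cancel_of_le hb]
  have hex' : listExpo (S.prodSort ρ b).2.1 = listExpo b := by
    rw [← hex]; exact listExpo_eq_of_perm hs.perm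
  rw [← Sys.prodSort] at hs
  refine ⟨⟨(S.prodSort ρ b).1⁻¹, inv_ne_zero hs.ne, ?_⟩, ?_⟩
  · have h1 : pv π (S.prodSort ρ b).2.2 =
        wv π (b.diff ρ.1.1 ++ ρ.1.1) - (S.prodSort ρ b).1 • xm π (listExpo b) := by
      rw [hs.eq, wv_of_pairwise hs.sorted, hex', add_sub_cancel_left]
    rw [Sys.redBy, mv_append, mv_scale, mv_scale, mv_lmulWTerms, mv_atComp, h1, sub_smul,
      smul_assoc, ← mon_eq_smul, Rule.elem, smul_sub (wv π _), ← tv_append, neg_smul, smul_sub _ _ (wv π _ • _),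
      smul_sub, smul_smul _ (S.prodSort ρ b).1, inv_mul_cancel₀ hs.ne, one_smul]
    simp only [tv]
    abel
  · intro t ht
    rw [Sys.redBy, List.mem_append] at ht
    rcases ht with ht | ht
    · simp only [scale, lmulWTerms, List.map_map, List.mem_map] at ht
      obtain ⟨s, hs', rfl⟩ := ht
      have := hS.ordering.add_left (listExpo (b.diff ρ.1.1)) (hρ.low s hs')
      simp only [Function.comp, ex, listExpo_append]
      rw [← listExpo_append, ← listExpo_append, hex] at this
      rw [← listExpo_append]
      exact this
    · simp only [scale, atComp, List.map_map, List.mem_map] at ht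
      obtain ⟨s, hs', rfl⟩ := ht
      have := hs.low s hs'
      rw [hex] at this
      exact this

/-- The rules used for computing normal forms: their elements are zero or belong to `H`. -/
structure GoodRules (π : Free K n →ₐ[K] A) (lt : Expo n × E → Expo n × E → Prop)
    (H : Set (E → A)) (R : List (Rule K (Fin n) E)) : Prop where
  ok : ∀ ρ ∈ R, ρ.IsOk lt
  elem : ∀ ρ ∈ R, ρ.elem π = 0 ∨ (ρ.elem π ∈ H ∧ lec π lt (ρ.elem π) = some (ex ρ.1))

/-- The state `(todo, dn)` occurs in the computation of a normal form of `q`. -/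
structure NFInv (π : Free K n →ₐ[K] A) (lt : Expo n × E → Expo n × E → Prop)
    (H : Set (E → A)) (R : List (Rule K (Fin n) E)) (q : List (WTerm K (Fin n) E))
    (s : List (WTerm K (Fin n) E) × List (WTerm K (Fin n) E)) : Prop where
  irred : ∀ t ∈ s.2, t.2.1.Pairwise (· ≤ ·) ∧ ∀ ρ ∈ R, ¬ ρ.Divides t.2
  bound : ∀ B, IsLower lt B → (∀ t ∈ q, ex t.2 ∈ B) → (∀ t ∈ s.1, ex t.2 ∈ B) ∧
    (∀ t ∈ s.2, ex t.2 ∈ B) ∧ mv π q - (mv π s.1 + mv π s.2) ∈ stdRep π lt H B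

theorem NFInv.init (H : Set (E → A)) (R : List (Rule K (Fin n) E))
    (q : List (WTerm K (Fin n) E)) : NFInv π lt H R q (q, []) where
  irred := by simp
  bound B _ hq := ⟨hq, by simp, by rw [mv_nil, add_zero, sub_self]; exact zero_mem _⟩

/-- The order on the states of the normal form computation. -/
def nfLt (lt : Expo n × E → Expo n × E → Prop)
    (s' s : List (WTerm K (Fin n) E) × List (WTerm K (Fin n) E)) : Prop :=
  Relation.CutExpand lt (s'.1.map (fun t => ex t.2) : List (Expo n × E))
    (s.1.map (fun t => ex t.2) : List (Expo n × E))

/-- The exponents of the pending terms are compared as multisets. Each step replaces one of them by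
finitely many smaller ones, so termination does not depend on collecting equal terms. -/
theorem IsModuleDatum.wellFounded_nfLt (h : IsModuleDatum π lt D) :
    WellFounded (nfLt (K := K) lt) :=
  have := h.ordering.total
  InvImage.wf (fun s : List (WTerm K (Fin n) E) × List (WTerm K (Fin n) E) =>
    ((s.1.map (fun t : WTerm K (Fin n) E => ex t.2) : List (Expo n × E)) : Multiset (Expo n × E))) h.wf.cutExpand

theorem nfLt_of_append (lt : Expo n × E → Expo n × E → Prop) (t : WTerm K (Fin n) E)
    (l l' dn dn' : List (WTerm K (Fin n) E)) (hl : ∀ s ∈ l', lt (ex s.2) (ex t.2)) :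
    nfLt lt (l' ++ l, dn') (t :: l, dn) := by
  refine ⟨(l'.map fun t => ex t.2 : List (Expo n × E)), ex t.2, ?_, ?_⟩
  · intro p hp
    rw [Multiset.mem_coe, List.mem_map] at hp
    obtain ⟨s, hs, rfl⟩ := hp
    exact hl s hs
  · rw [← Multiset.coe_singleton, Multiset.coe_add, Multiset.coe_add, Multiset.coe_eq_coe,
      List.map_append, List.map_cons]
    refine List.perm_iff_count.2 fun a => ?_
    simp only [List.count_append, List.count_cons, List.count_nil]
    omega

theorem sort_exp {S : Sys K (Fin n) E} (hS : S.Compatible π lt) (t : List (Fin n) × E) :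
    ex ((S.sort t.2 t.1).2.1, t.2) = ex t := by
  rw [ex, listExpo_eq_of_perm (hS.isSorting_sort t.2 t.1).perm]; rfl

theorem mv_scale_atComp {S : Sys K (Fin n) E} (hS : S.Compatible π lt) (t : WTerm K (Fin n) E) :
    mv π (scale t.1 (atComp t.2.2 (S.sort t.2.2 t.2.1).2.2)) =
      t.1 • tv π t.2 - (t.1 * (S.sort t.2.2 t.2.1).1) • mon π (ex t.2) := by
  have hs := hS.isSorting_sort t.2.2 t.2.1
  rw [mv_scale, mv_atComp, tv, hs.eq, add_smul, smul_assoc, wv_of_pairwise hs.sorted, ← mon_eq_smul,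
    listExpo_eq_of_perm hs.perm, smul_add, mul_smul, ex]
  abel

theorem mem_scale_atComp_lt {S : Sys K (Fin n) E} (hS : S.Compatible π lt) (t : WTerm K (Fin n) E) :
    ∀ s ∈ scale t.1 (atComp t.2.2 (S.sort t.2.2 t.2.1).2.2), lt (ex s.2) (ex t.2) := by
  intro s hs
  simp only [scale, atComp, List.map_map, List.mem_map] at hs
  obtain ⟨r, hr, rfl⟩ := hs
  exact (hS.isSorting_sort t.2.2 t.2.1).low r hr

theorem mem_scale {c : K} {l : List (WTerm K (Fin n) E)} {s : WTerm K (Fin n) E}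
    (hs : s ∈ scale c l) : ∃ t ∈ l, s.2 = t.2 := by
  simp only [scale, List.mem_map] at hs
  obtain ⟨t, ht, rfl⟩ := hs
  exact ⟨t, ht, rfl⟩

/-- Sorting does not change the value. If no rule applies, a term only moves to the finished ones;
otherwise a multiple of the element of a rule is subtracted, whose leading monomial shifts to the
monomial being rewritten. The accumulated difference thus stays in `stdRep` for every bound of `q`.
-/
theorem NFInv.step (h : IsModuleDatum π lt D) {S : Sys K (Fin n) E} (hS : S.Compatible π lt)
    {H : Set (E → A)} {R : List (Rule K (Fin n) E)} (hR : GoodRules π lt H R)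
    {q : List (WTerm K (Fin n) E)} {s s' : List (WTerm K (Fin n) E) × List (WTerm K (Fin n) E)}
    (hs : NFInv π lt H R q s) (hst : S.nfStep R s = Sum.inr s') :
    NFInv π lt H R q s' ∧ nfLt lt s' s := by
  obtain ⟨l, dn⟩ := s
  cases l with
  | nil => simp [Sys.nfStep] at hst
  | cons t l =>
    have hso := hS.isSorting_sort t.2.2 t.2.1
    have hlow := mem_scale_atComp_lt hS t
    have hmv := mv_scale_atComp hS t
    have hexp := sort_exp hS t.2
    rw [Sys.nfStep] at hst
    split at hst
    · next hf =>
      obtain rfl := Sum.inr_injective hst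
      refine ⟨⟨?_, ?_⟩, nfLt_of_append _ _ _ _ _ _ hlow⟩
      · intro r hr
        rcases List.mem_cons.1 hr with rfl | hr
        · refine ⟨hso.sorted, fun ρ hρ hd => ?_⟩
          have : ρ ∈ R.filter fun ρ => ρ.Divides ((S.sort t.2.2 t.2.1).2.1, t.2.2) :=
            List.mem_filter.2 ⟨hρ, by simpa using hd⟩
          rw [hf] at this
          cases this
        · exact hs.irred r hr
      · intro B hB hq
        obtain ⟨h1, h2, h3⟩ := hs.bound B hB hq
        have ht := h1 t (List.mem_cons_self)
        refine ⟨?_, ?_, ?_⟩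
        · intro r hr
          rcases List.mem_append.1 hr with hr | hr
          · exact hB _ _ (hlow r hr) ht
          · exact h1 r (List.mem_cons_of_mem _ hr)
        · intro r hr
          rcases List.mem_cons.1 hr with rfl | hr
          · rw [hexp]; exact ht
          · exact h2 r hr
        · convert h3 using 2
          rw [mv_append, hmv, mv_cons, mv_cons,
            tv_of_pairwise (t := ((S.sort t.2.2 t.2.1).2.1, t.2.2)) hso.sorted, hexp]
          abel
    · next ρ R' hf =>
      obtain rfl := Sum.inr_injective hst
      have hρ : ρ ∈ R.filter fun ρ => ρ.Divides ((S.sort t.2.2 t.2.1).2.1, t.2.2) := by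
        rw [hf]; exact List.mem_cons_self
      rw [List.mem_filter, decide_eq_true_eq] at hρ
      obtain ⟨hρR, hd⟩ := hρ
      have hd' := divides_iff.1 hd
      have he : ρ.1.2 = t.2.2 := hd'.2
      obtain ⟨⟨c, hc, hmr⟩, hrl⟩ := hS.redBy_spec (hR.ok ρ hρR) hd'.1
      have hexp' : (listExpo (S.sort t.2.2 t.2.1).2.1, ρ.1.2) = ex t.2 := by
        rw [he]; exact hexp
      rw [hexp'] at hmr hrl
      have hlow2 : ∀ r ∈ scale (t.1 * (S.sort t.2.2 t.2.1).1)
          (S.redBy ρ (S.sort t.2.2 t.2.1).2.1), lt (ex r.2) (ex t.2) := by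
        intro r hr
        obtain ⟨r', hr', hrr⟩ := mem_scale hr
        rw [hrr]; exact hrl r' hr'
      refine ⟨⟨hs.irred, ?_⟩, ?_⟩
      · intro B hB hq
        obtain ⟨h1, h2, h3⟩ := hs.bound B hB hq
        have ht := h1 t (List.mem_cons_self)
        refine ⟨?_, h2, ?_⟩
        · intro r hr
          rcases List.mem_append.1 hr with hr | hr
          · exact hB _ _ (hlow2 r hr) ht
          rcases List.mem_append.1 hr with hr | hr
          · exact hB _ _ (hlow r hr) ht
          · exact h1 r (List.mem_cons_of_mem _ hr)
        · have h4 : wv π ((S.sort t.2.2 t.2.1).2.1.diff ρ.1.1) • ρ.elem π ∈ stdRep π lt H B := by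
            -- Rules coming from relations have the element zero and contribute nothing to the
            -- representation.
            rcases hR.elem ρ hρR with h0 | ⟨hH, hl⟩
            · rw [h0, smul_zero]; exact zero_mem _
            · refine h.wv_smul_mem_stdRep hB hH hl ?_
              have : shift (listExpo ((S.sort t.2.2 t.2.1).2.1.diff ρ.1.1)) (ex ρ.1) = ex t.2 := by
                rw [← hexp', listExpo_diff, shift]
                refine Prod.ext ?_ rfl
                exact tsub_add_cancel_of_le hd'.1
              rw [this]; exact ht
          have h5 := add_mem h3 (Submodule.smul_mem _ ((t.1 * (S.sort t.2.2 t.2.1).1) * c) h4)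
          convert h5 using 1
          rw [mv_append, mv_append, hmv, mv_scale, hmr, mv_cons, smul_sub, smul_smul _ c]
          abel
      · rw [← List.append_assoc]
        refine nfLt_of_append _ _ _ _ _ _ fun r hr => ?_
        rcases List.mem_append.1 hr with hr | hr
        · exact hlow2 r hr
        · exact hlow r hr

/-- The properties of a normal form `r` of `q`. -/
structure IsNF (π : Free K n →ₐ[K] A) (lt : Expo n × E → Expo n × E → Prop)
    (H : Set (E → A)) (R : List (Rule K (Fin n) E)) (q r : List (WTerm K (Fin n) E)) : Prop where
  irred : ∀ t ∈ r, t.2.1.Pairwise (· ≤ ·) ∧ ∀ ρ ∈ R, ¬ ρ.Divides t.2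
  bound : ∀ B, IsLower lt B → (∀ t ∈ q, ex t.2 ∈ B) →
    (∀ t ∈ r, ex t.2 ∈ B) ∧ mv π q - mv π r ∈ stdRep π lt H B

theorem NFInv.isNF {S : Sys K (Fin n) E} {H : Set (E → A)} {R : List (Rule K (Fin n) E)}
    {q r : List (WTerm K (Fin n) E)} {s : List (WTerm K (Fin n) E) × List (WTerm K (Fin n) E)}
    (hs : NFInv π lt H R q s) (hst : S.nfStep R s = Sum.inl r) : IsNF π lt H R q r := by
  obtain ⟨l, dn⟩ := s
  cases l with
  | nil =>
    obtain rfl : dn = r := Sum.inl_injective hst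
    refine ⟨hs.irred, fun B hB hq => ?_⟩
    obtain ⟨-, h2, h3⟩ := hs.bound B hB hq
    rw [mv_nil, zero_add] at h3
    exact ⟨h2, h3⟩
  | cons t l =>
    rw [Sys.nfStep] at hst
    split at hst <;> simp at hst

/-! #### Collecting terms -/

theorem mv_addTerm (t : WTerm K (Fin n) E) (l : List (WTerm K (Fin n) E)) :
    mv π (addTerm t l) = t.1 • tv π t.2 + mv π l := by
  induction l with
  | nil => rw [addTerm, mv_cons]
  | cons s l ih =>
    rw [addTerm]
    split_ifs with hst
    · rw [mv_cons, mv_cons, add_smul, hst, add_assoc, add_left_comm]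
    · rw [mv_cons, ih, mv_cons, add_left_comm]

theorem addTerm_keys {ι κ : Type*} [DecidableEq ι] [DecidableEq κ] (t : WTerm K ι κ)
    (l : List (WTerm K ι κ)) : ∀ s ∈ addTerm t l, s.2 = t.2 ∨ ∃ r ∈ l, s.2 = r.2 := by
  induction l with
  | nil => simp [addTerm]
  | cons r l ih =>
    intro s hs
    rw [addTerm] at hs
    split_ifs at hs with hst
    · rcases List.mem_cons.1 hs with rfl | hs
      · exact Or.inl hst
      · exact Or.inr ⟨s, List.mem_cons_of_mem _ hs, rfl⟩
    · rcases List.mem_cons.1 hs with rfl | hs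
      · exact Or.inr ⟨s, List.mem_cons_self, rfl⟩
      · rcases ih s hs with h1 | ⟨r', h1, h2⟩
        · exact Or.inl h1
        · exact Or.inr ⟨r', List.mem_cons_of_mem _ h1, h2⟩

theorem addTerm_pairwise {ι κ : Type*} [DecidableEq ι] [DecidableEq κ] (t : WTerm K ι κ)
    {l : List (WTerm K ι κ)} (hl : l.Pairwise fun a b => a.2 ≠ b.2) :
    (addTerm t l).Pairwise fun a b => a.2 ≠ b.2 := by
  induction l with
  | nil => simp [addTerm]
  | cons s l ih =>
    rw [List.pairwise_cons] at hl
    rw [addTerm]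
    split_ifs with hst
    · exact List.pairwise_cons.2 ⟨hl.1, hl.2⟩
    · refine List.pairwise_cons.2 ⟨fun r hr => ?_, ih hl.2⟩
      rcases addTerm_keys t l r hr with h1 | ⟨r', h1, h2⟩
      · rw [h1]; exact hst
      · rw [h2]; exact hl.1 r' h1

theorem mv_collect (l : List (WTerm K (Fin n) E)) : mv π (collect l) = mv π l := by
  classical
  have h1 : mv π (l.foldr addTerm []) = mv π l := by
    induction l with
    | nil => rfl
    | cons t l ih => rw [List.foldr_cons, mv_addTerm, ih, mv_cons]
  have h2 : ∀ l : List (WTerm K (Fin n) E), mv π (l.filter fun t => t.1 ≠ 0) = mv π l := by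
    intro l
    induction l with
    | nil => rfl
    | cons t l ih =>
      by_cases ht : t.1 = 0
      · rw [List.filter_cons_of_neg (by simpa using ht), ih, mv_cons, ht, zero_smul, zero_add]
      · rw [List.filter_cons_of_pos (by simpa using ht), mv_cons, mv_cons, ih]
  rw [collect, ← h1]
  convert h2 (l.foldr addTerm [])

theorem collect_keys {ι κ : Type*} [DecidableEq ι] [DecidableEq κ] {l : List (WTerm K ι κ)} :
    ∀ s ∈ collect l, ∃ r ∈ l, s.2 = r.2 := by
  classical
  intro s hs
  rw [collect, List.mem_filter] at hs
  replace hs := hs.1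
  induction l generalizing s with
  | nil => cases hs
  | cons t l ih =>
    rcases addTerm_keys _ _ _ hs with h1 | ⟨r, h1, h2⟩
    · exact ⟨t, List.mem_cons_self, h1⟩
    · obtain ⟨r', h3, h4⟩ := ih r h1
      exact ⟨r', List.mem_cons_of_mem _ h3, h2.trans h4⟩

theorem collect_ne_zero {ι κ : Type*} [DecidableEq ι] [DecidableEq κ] {l : List (WTerm K ι κ)}
    {s : WTerm K ι κ} (hs : s ∈ collect l) : s.1 ≠ 0 := by
  rw [collect, List.mem_filter] at hs
  simpa using hs.2

theorem collect_pairwise {ι κ : Type*} [DecidableEq ι] [DecidableEq κ] (l : List (WTerm K ι κ)) :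
    (collect l).Pairwise fun a b => a.2 ≠ b.2 := by
  rw [collect]
  refine List.Pairwise.filter _ ?_
  induction l with
  | nil => exact List.Pairwise.nil
  | cons t l ih => exact addTerm_pairwise t ih

theorem front_perm {ι κ : Type*} (lt : List ι × κ → List ι × κ → Prop) (l : List (WTerm K ι κ)) :
    (front lt l).Perm l := by
  induction l with
  | nil => exact List.Perm.refl _
  | cons t l ih =>
    rw [front]
    split
    · next hf => rw [hf] at ih; rw [ih.symm.eq_nil]
    · next s l' hf =>
      rw [hf] at ih
      split_ifs
      · exact ih.cons t
      · exact (List.Perm.swap t s l').trans (ih.cons t)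

/-- Totality and transitivity are required only on the words that occur: `exLt` cannot separate
permutations of a word, but it is total on sorted words. -/
theorem front_spec {ι κ : Type*} {lt : List ι × κ → List ι × κ → Prop} {l : List (WTerm K ι κ)}
    (htr : ∀ a ∈ l, ∀ b ∈ l, a.2 ≠ b.2 → ¬ lt a.2 b.2 → lt b.2 a.2)
    (htrans : ∀ a ∈ l, ∀ b ∈ l, ∀ c ∈ l, lt a.2 b.2 → lt b.2 c.2 → lt a.2 c.2)
    (hl : l.Pairwise fun a b => a.2 ≠ b.2) {s : WTerm K ι κ} {l' : List (WTerm K ι κ)}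
    (hf : front lt l = s :: l') : ∀ t ∈ l', lt t.2 s.2 := by
  induction l generalizing s l' with
  | nil => cases hf
  | cons t l ih =>
    have hperm := front_perm lt l
    have ih := @ih (fun a ha b hb => htr a (List.mem_cons_of_mem _ ha) b (List.mem_cons_of_mem _ hb))
      (fun a ha b hb c hc => htrans a (List.mem_cons_of_mem _ ha) b (List.mem_cons_of_mem _ hb) c
        (List.mem_cons_of_mem _ hc)) (List.pairwise_cons.1 hl).2
    rw [front] at hf
    split at hf
    · cases hf; intro t ht; cases ht
    · next s' l'' hf' =>
      have hs' : s' ∈ l := hperm.subset (by rw [hf']; exact List.mem_cons_self)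
      have hl'' : ∀ r ∈ l'', r ∈ l := fun r hr =>
        hperm.subset (by rw [hf']; exact List.mem_cons_of_mem _ hr)
      have hall := ih hf'
      split_ifs at hf with hlt
      · cases hf
        intro r hr
        rcases List.mem_cons.1 hr with rfl | hr
        · exact hlt
        · exact htrans r (List.mem_cons_of_mem _ (hl'' r hr)) s' (List.mem_cons_of_mem _ hs') t
            List.mem_cons_self (hall r hr) hlt
      · cases hf
        intro r hr
        rcases List.mem_cons.1 hr with rfl | hr
        · exact htr _ (List.mem_cons_of_mem _ hs') _ List.mem_cons_self
            ((List.pairwise_cons.1 hl).1 s hs').symm hlt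
        · exact hall r hr

theorem mv_perm {l l' : List (WTerm K (Fin n) E)} (hl : l.Perm l') : mv π l = mv π l' :=
  (hl.map _).sum_eq

end Semantics

end PBWRed

namespace PBWRed

/-! ### Completion with rules -/

section CompletionStep

variable {K ι κ : Type*} [Field K] [DecidableEq ι] [DecidableEq κ]

/-- Adds the rule given by a normal form `r` to the rules `H` and the new elements to be treated
to `Q`. -/
noncomputable def Sys.complStep (S : Sys K ι κ) (vars : List ι) (ltw : List ι × κ → List ι × κ → Prop)
    (RI H : List (Rule K ι κ)) (Q : List (List (WTerm K ι κ))) (r : List (WTerm K ι κ)) :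
    List (Rule K ι κ) × List (List (WTerm K ι κ)) :=
  (mkRules (front ltw (collect r)) ++ H,
    (mkRules (front ltw (collect r))).flatMap (S.newPairs vars (RI ++ H)) ++ Q)

theorem minimize_subset (H : List (Rule K ι κ)) : ∀ ρ ∈ minimize H, ρ ∈ H := by
  induction H with
  | nil => simp [minimize]
  | cons ρ H ih =>
    intro ρ' hρ'
    rw [minimize, List.mem_cons] at hρ'
    rcases hρ' with rfl | hρ'
    · exact List.mem_cons_self
    · exact List.mem_cons_of_mem _ (ih _ (List.mem_filter.1 hρ').1)

/-- Newer rules stand at the front. The leading monomial of a new rule is a normal form, so no older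
one divides it; only older multiples of newer leading monomials have to be dropped. -/
theorem minimize_pairwise {H : List (Rule K ι κ)} (hH : H.Pairwise fun ρ ρ' => ¬ ρ'.Divides ρ.1) :
    (minimize H).Pairwise fun ρ ρ' => ¬ ρ'.Divides ρ.1 ∧ ¬ ρ.Divides ρ'.1 := by
  induction H with
  | nil => simp [minimize]
  | cons ρ H ih =>
    rw [List.pairwise_cons] at hH
    rw [minimize, List.pairwise_cons]
    refine ⟨fun ρ' hρ' => ?_, (ih hH.2).filter _⟩
    rw [List.mem_filter, decide_eq_true_eq] at hρ'
    exact ⟨hH.1 ρ' (minimize_subset H ρ' hρ'.1), hρ'.2⟩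

end CompletionStep

/-! ### Invariant, termination and correctness of completion with rules -/

section Completion

variable {K : Type*} [Field K] {n : ℕ} {E : Type*} [Finite E] [DecidableEq E] {A : Type*} [Ring A]
  [Algebra K A] {π : Free K n →ₐ[K] A} {lt : Expo n × E → Expo n × E → Prop} {D : E → Datum K n}
  {S : Sys K (Fin n) E}

theorem minimize_covers (H : List (Rule K (Fin n) E)) :
    ∀ ρ ∈ H, ∃ ρ' ∈ minimize H, Dvd' (ex ρ'.1) (ex ρ.1) := by
  induction H with
  | nil => simp
  | cons ρ₀ H ih =>
    intro ρ hρ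
    rw [minimize]
    rcases List.mem_cons.1 hρ with rfl | hρ
    · exact ⟨ρ, List.mem_cons_self, le_rfl, rfl⟩
    · obtain ⟨ρ', h1, h2⟩ := ih ρ hρ
      by_cases hd : ρ₀.Divides ρ'.1
      · exact ⟨ρ₀, List.mem_cons_self, (divides_iff.1 hd).trans h2⟩
      · exact ⟨ρ', List.mem_cons_of_mem _ (List.mem_filter.2 ⟨h1, by simpa using hd⟩), h2⟩

/-- The elements given by a list of rules. -/
def elems (π : Free K n →ₐ[K] A) (H : List (Rule K (Fin n) E)) : Set (E → A) :=
  {x | ∃ ρ ∈ H, ρ.elem π = x}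

theorem elems_mono {H H' : List (Rule K (Fin n) E)} (h : H ⊆ H') : elems π H ⊆ elems π H' :=
  fun _ ⟨ρ, hρ, hx⟩ => ⟨ρ, h hρ, hx⟩

/-- Right multiplication by a variable. -/
noncomputable def rmulVar (π : Free K n →ₐ[K] A) (i : Fin n) (m : E → A) : E → A :=
  fun e => m e * wv π [i]

theorem rmulVar_add (i : Fin n) (m m' : E → A) :
    rmulVar π i (m + m') = rmulVar π i m + rmulVar π i m' := by
  funext e; simp [rmulVar, add_mul]

theorem rmulVar_smul (i : Fin n) (a : A) (m : E → A) :
    rmulVar π i (a • m) = a • rmulVar π i m := by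
  funext e; simp [rmulVar, mul_assoc]

theorem rmulVar_zero (i : Fin n) : rmulVar π i (0 : E → A) = 0 := by
  funext e; simp [rmulVar]

theorem tv_rmul (i : Fin n) (w : List (Fin n)) (e : E) :
    tv π (w ++ [i], e) = rmulVar π i (tv π (w, e)) := by
  funext e'
  simp only [tv, rmulVar, Pi.smul_apply, smul_eq_mul, wv_append]
  by_cases he : e' = e
  · subst he
    rw [mon_apply_self, xm_zero, mul_one, mul_one]
  · rw [mon_apply_of_ne _ he, mul_zero, mul_zero, zero_mul]

theorem mv_rmulWTerms (i : Fin n) (l : List (WTerm K (Fin n) E)) :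
    mv π (rmulWTerms i l) = rmulVar π i (mv π l) := by
  induction l with
  | nil => simp [rmulWTerms, mv, rmulVar_zero]
  | cons t l ih =>
    rw [rmulWTerms, List.map_cons, mv_cons, ← rmulWTerms, ih, mv_cons, rmulVar_add, tv_rmul]
    congr 1
    funext e
    simp [rmulVar]

/-- The least common multiple of the leading monomials of two rules. -/
def Rule.lcm (ρ ρ' : Rule K (Fin n) E) : Expo n × E :=
  (listExpo ρ.1.1 ⊔ listExpo ρ'.1.1, ρ.1.2)

/-- Both rules are applied to the least common multiple of their leading monomials, and this
monomial cancels in the difference. Irreducibility is not needed, so the lemma also covers pairs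
with rules coming from relations. -/
theorem Sys.Compatible.spair_spec (hS : S.Compatible π lt) {ρ ρ' : Rule K (Fin n) E}
    (hρ : ρ.IsOk lt) (hρ' : ρ'.IsOk lt) (he : ρ.1.2 = ρ'.1.2) :
    (∃ (c c' : K) (w w' : List (Fin n)), c ≠ 0 ∧ c' ≠ 0 ∧
      shift (listExpo w) (ex ρ.1) = ρ.lcm ρ' ∧ shift (listExpo w') (ex ρ'.1) = ρ.lcm ρ' ∧
      mv π (S.spair ρ ρ') = c' • wv π w' • ρ'.elem π - c • wv π w • ρ.elem π) ∧
    ∀ t ∈ S.spair ρ ρ', lt (ex t.2) (ρ.lcm ρ') := by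
  have hb : listExpo (ρ.1.1.diff ρ'.1.1 ++ ρ'.1.1) = listExpo ρ.1.1 ⊔ listExpo ρ'.1.1 := by
    rw [listExpo_append, listExpo_diff]
    funext i
    exact tsub_add_eq_max
  obtain ⟨⟨c, hc, h1⟩, h2⟩ := hS.redBy_spec hρ (b := ρ.1.1.diff ρ'.1.1 ++ ρ'.1.1)
    (by rw [hb]; exact le_sup_left)
  obtain ⟨⟨c', hc', h1'⟩, h2'⟩ := hS.redBy_spec hρ' (b := ρ.1.1.diff ρ'.1.1 ++ ρ'.1.1)
    (by rw [hb]; exact le_sup_right)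
  rw [hb] at h1 h2 h1' h2'
  refine ⟨⟨c, c', (ρ.1.1.diff ρ'.1.1 ++ ρ'.1.1).diff ρ.1.1,
    (ρ.1.1.diff ρ'.1.1 ++ ρ'.1.1).diff ρ'.1.1, hc, hc', ?_, ?_, ?_⟩, ?_⟩
  · rw [listExpo_diff, hb]
    exact Prod.ext (tsub_add_cancel_of_le le_sup_left) rfl
  · rw [listExpo_diff, hb]
    exact Prod.ext (tsub_add_cancel_of_le le_sup_right) he.symm
  · rw [Sys.spair, if_pos he, mv_append, mv_scale, h1, h1', he, neg_one_smul]
    abel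
  · intro t ht
    rw [Sys.spair, if_pos he, List.mem_append] at ht
    rcases ht with ht | ht
    · exact h2 t ht
    · obtain ⟨s, hs, hts⟩ := mem_scale ht
      rw [hts, Rule.lcm, he]
      exact h2' s hs

/-- The `s`-polynomial has a standard representation. -/
def PairDone (π : Free K n →ₐ[K] A) (lt : Expo n × E → Expo n × E → Prop)
    (S : Sys K (Fin n) E) (H : List (Rule K (Fin n) E)) (ρ ρ' : Rule K (Fin n) E) : Prop :=
  mv π (S.spair ρ ρ') ∈ stdRep π lt (elems π H) {r | lt r (ρ.lcm ρ')}

/-- The rules for the relations of the algebra. -/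
structure RelRules (π : Free K n →ₐ[K] A) (lt : Expo n × E → Expo n × E → Prop)
    (D : E → Datum K n) (RI : List (Rule K (Fin n) E)) : Prop where
  ok : ∀ ρ ∈ RI, ρ.IsOk lt
  zero : ∀ ρ ∈ RI, ρ.elem π = 0
  complete : ∀ e, ∀ β ∈ lset (restrict lt e) ((D e).I : Set (Free K n)),
    ∃ ρ ∈ RI, ex ρ.1 = (β, e)

theorem RelRules.mem_normalSet {RI : List (Rule K (Fin n) E)} (hRI : RelRules π lt D RI)
    {t : List (Fin n) × E} (ht : ∀ ρ ∈ RI, ¬ ρ.Divides t) : ex t ∈ normalSet lt D := by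
  intro hL
  obtain ⟨γ, hγ, β, hβ⟩ := hL
  obtain ⟨ρ, hρ, he⟩ := hRI.complete _ γ hγ
  refine ht ρ hρ (divides_iff.2 ?_)
  rw [he]
  refine ⟨?_, rfl⟩
  rw [hβ]
  exact le_add_self

/-- The state `(H, Q)` occurs in the completion for the submodule `M` generated by `G`. -/
structure ComplInv (π : Free K n →ₐ[K] A) (lt : Expo n × E → Expo n × E → Prop)
    (D : E → Datum K n) (S : Sys K (Fin n) E) (RI : List (Rule K (Fin n) E))
    (vars : List (Fin n)) (M : Submodule A (E → A)) (G : Set (E → A))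
    (s : List (Rule K (Fin n) E) × List (List (WTerm K (Fin n) E))) : Prop where
  ok : ∀ ρ ∈ s.1, ρ.IsOk lt ∧ ex ρ.1 ∈ normalSet lt D ∧ ρ.elem π ∈ M
  mem : ∀ q ∈ s.2, mv π q ∈ M
  rel : ∀ ρ ∈ s.1, ∀ ρ' ∈ RI, ρ.1.2 = ρ'.1.2 → S.spair ρ ρ' ∈ s.2 ∨ PairDone π lt S s.1 ρ ρ'
  pair : s.1.Pairwise fun ρ ρ' => ρ.1.2 = ρ'.1.2 → S.spair ρ ρ' ∈ s.2 ∨ PairDone π lt S s.1 ρ ρ'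
  anti : s.1.Pairwise fun ρ ρ' => ¬ ρ'.Divides ρ.1
  gen : ∀ g ∈ G, g ∈ Submodule.span A (elems π s.1 ∪ {x | ∃ q ∈ s.2, mv π q = x})
  -- For empty `vars` the completion is one-sided. If `vars` lists all variables, this makes the
  -- left span of the rules stable under right multiplication once the queue is empty.
  right : ∀ ρ ∈ s.1, ∀ i ∈ vars,
    rmulVar π i (ρ.elem π) ∈ Submodule.span A (elems π s.1 ∪ {x | ∃ q ∈ s.2, mv π q = x})

theorem ComplInv.init (RI : List (Rule K (Fin n) E)) (vars : List (Fin n)) {M : Submodule A (E → A)}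
    {Q : List (List (WTerm K (Fin n) E))} (hQ : {x | ∃ q ∈ Q, mv π q = x} ⊆ (M : Set (E → A))) :
    ComplInv π lt D S RI vars M {x | ∃ q ∈ Q, mv π q = x} ([], Q) where
  ok := by simp
  mem q hq := hQ ⟨q, hq, rfl⟩
  rel := by simp
  pair := List.Pairwise.nil
  anti := List.Pairwise.nil
  gen g hg := Submodule.subset_span (Or.inr hg)
  right := by simp

theorem ComplInv.goodRules (h : IsModuleDatum π lt D) {RI : List (Rule K (Fin n) E)}
    (hRI : RelRules π lt D RI) {vars : List (Fin n)} {M : Submodule A (E → A)} {G : Set (E → A)}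
    {s : List (Rule K (Fin n) E) × List (List (WTerm K (Fin n) E))}
    (hs : ComplInv π lt D S RI vars M G s) :
    GoodRules π lt (elems π s.1) (RI ++ s.1) where
  ok ρ hρ := by
    rcases List.mem_append.1 hρ with hρ | hρ
    · exact hRI.ok ρ hρ
    · exact (hs.ok ρ hρ).1
  elem ρ hρ := by
    rcases List.mem_append.1 hρ with hρ | hρ
    · exact Or.inl (hRI.zero ρ hρ)
    · exact Or.inr ⟨⟨ρ, hρ, rfl⟩, h.lec_elem (hs.ok ρ hρ).1 (hs.ok ρ hρ).2.1⟩

/-- The order on the states of the completion. -/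
def complLt (s' s : List (Rule K (Fin n) E) × List (List (WTerm K (Fin n) E))) : Prop :=
  Prod.Lex (fun S' S : Set (Expo n × E) => S ⊆ S' ∧ ∃ p ∈ S', ∀ q ∈ S, ¬ Dvd' q p) (· < ·)
    (({p | ∃ ρ ∈ s'.1, ex ρ.1 = p} : Set (Expo n × E)), s'.2.length)
    (({p | ∃ ρ ∈ s.1, ex ρ.1 = p} : Set (Expo n × E)), s.2.length)

/-- A new rule adds a leading monomial not divisible by earlier ones, however much it adds to the
queue; without a new rule the queue gets shorter. -/
theorem wellFounded_complLt : WellFounded (complLt (K := K) (n := n) (E := E)) :=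
  InvImage.wf (fun s : List (Rule K (Fin n) E) × List (List (WTerm K (Fin n) E)) =>
    (({p | ∃ ρ ∈ s.1, ex ρ.1 = p} : Set (Expo n × E)), s.2.length))
    (WellFounded.prod_lex wellFounded_dickson Nat.lt_wfRel.wf)

/-- The order on words in components that is used for finding leading terms. -/
def exLt (lt : Expo n × E → Expo n × E → Prop) (a b : List (Fin n) × E) : Prop := lt (ex a) (ex b)

theorem ex_injOn {a b : List (Fin n) × E} (ha : a.1.Pairwise (· ≤ ·)) (hb : b.1.Pairwise (· ≤ ·))
    (hab : ex a = ex b) : a = b := by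
  refine Prod.ext ?_ (congrArg (Prod.snd : Expo n × E → E) hab)
  rw [eq_stdList_of_pairwise ha, eq_stdList_of_pairwise hb]
  exact congrArg stdList (congrArg (Prod.fst : Expo n × E → Expo n) hab)

/-- After collection the sorted words are distinct, hence their exponents in components are
distinct, and the front term is strictly larger than all others. -/
theorem IsModuleDatum.front_collect (h : IsModuleDatum π lt D) {r : List (WTerm K (Fin n) E)}
    (hr : ∀ t ∈ r, t.2.1.Pairwise (· ≤ ·)) {s : WTerm K (Fin n) E} {l : List (WTerm K (Fin n) E)}
    (hf : front (exLt lt) (collect r) = s :: l) :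
    s.1 ≠ 0 ∧ (∃ t ∈ r, s.2 = t.2) ∧ (∀ t ∈ l, lt (ex t.2) (ex s.2)) ∧ 
      mv π r = s.1 • tv π s.2 + mv π l := by
  have hperm := front_perm (exLt lt) (collect r)
  rw [hf] at hperm
  have hso : ∀ t ∈ collect r, t.2.1.Pairwise (· ≤ ·) := by
    intro t ht
    obtain ⟨t', ht', hk⟩ := collect_keys t ht
    rw [hk]; exact hr t' ht'
  have hs : s ∈ collect r := hperm.subset List.mem_cons_self
  refine ⟨collect_ne_zero hs, collect_keys s hs, ?_, ?_⟩
  · refine front_spec ?_ ?_ (collect_pairwise r) hf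
    · intro a ha b hb hab hlt
      have := h.ordering.total
      rcases trichotomous_of lt (ex a.2) (ex b.2) with h1 | h1 | h1
      · exact absurd h1 hlt
      · exact absurd (ex_injOn (hso a ha) (hso b hb) h1) hab
      · exact h1
    · intro a _ b _ c _ h1 h2
      exact h.ordering.total.trans _ _ _ h1 h2
  · rw [← mv_collect, ← mv_perm hperm, mv_cons]

/-- If the normal form `r` collects to nothing, `q` is represented by the old rules and leaves the
queue. Otherwise `r` is a nonzero multiple of the element of the new rule `ρ₀`, whose leading
monomial is irreducible and not a multiple of older ones; then `q = (q - r) + r` is represented by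
the enlarged list. Stability of `M` under right multiplication keeps the queued products in `M`. -/
theorem ComplInv.step (h : IsModuleDatum π lt D) (hS : S.Compatible π lt)
    {RI : List (Rule K (Fin n) E)}
    (hRI : RelRules π lt D RI) {vars : List (Fin n)} {M : Submodule A (E → A)} {G : Set (E → A)}
    (hM : ∀ m ∈ M, ∀ i ∈ vars, rmulVar π i m ∈ M)
    {H : List (Rule K (Fin n) E)} {q : List (WTerm K (Fin n) E)}
    {Q : List (List (WTerm K (Fin n) E))} {r : List (WTerm K (Fin n) E)}
    (hs : ComplInv π lt D S RI vars M G (H, q :: Q))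
    (hr : IsNF π lt (elems π H) (RI ++ H) q r) :
    ComplInv π lt D S RI vars M G (S.complStep vars (exLt lt) RI H Q r) ∧
      complLt (S.complStep vars (exLt lt) RI H Q r) (H, q :: Q) := by
  have hHM : Submodule.span A (elems π H) ≤ M := by
    refine Submodule.span_le.2 ?_
    rintro _ ⟨ρ, hρ, rfl⟩
    exact (hs.ok ρ hρ).2.2
  have hqr : mv π q - mv π r ∈ Submodule.span A (elems π H) :=
    stdRep_le_span (lt := lt) (elems π H) Set.univ
      (hr.bound Set.univ (fun _ _ _ _ => trivial) (fun _ _ => trivial)).2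
  have hrM : mv π r ∈ M := by
    have := M.sub_mem (hs.mem q List.mem_cons_self) (hHM hqr)
    rwa [sub_sub_cancel] at this
  rw [Sys.complStep]
  rcases hf : front (exLt lt) (collect r) with _ | ⟨s, l⟩
  · have hr0 : mv π r = 0 := by
      have hp := front_perm (exLt lt) (collect r)
      rw [hf] at hp
      rw [← mv_collect, ← mv_perm hp, mv_nil]
    rw [mkRules, List.nil_append, List.flatMap_nil, List.nil_append]
    rw [hr0, sub_zero] at hqr
    have hspan : Submodule.span A (elems π H ∪ {x | ∃ q' ∈ q :: Q, mv π q' = x}) ≤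
        Submodule.span A (elems π H ∪ {x | ∃ q ∈ Q, mv π q = x}) := by
      refine Submodule.span_le.2 ?_
      rintro x (hx | ⟨q', hq', rfl⟩)
      · exact Submodule.subset_span (Or.inl hx)
      · rcases List.mem_cons.1 hq' with rfl | hq'
        · exact Submodule.span_mono Set.subset_union_left hqr
        · exact Submodule.subset_span (Or.inr ⟨q', hq', rfl⟩)
    have hpair : ∀ ρ ρ' : Rule K (Fin n) E, ρ.IsOk lt → ρ'.IsOk lt → ρ.1.2 = ρ'.1.2 →
        (S.spair ρ ρ' ∈ q :: Q ∨ PairDone π lt S H ρ ρ') →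
        S.spair ρ ρ' ∈ Q ∨ PairDone π lt S H ρ ρ' := by
      intro ρ ρ' hρ hρ' he hp
      rcases hp with hp | hp
      · rcases List.mem_cons.1 hp with hp | hp
        · right
          have := (hr.bound {r | lt r (ρ.lcm ρ')} (isLower_lt h _)
            (by rw [← hp]; exact (hS.spair_spec hρ hρ' he).2)).2
          rw [hr0, sub_zero] at this
          rw [PairDone, hp]; exact this
        · exact Or.inl hp
      · exact Or.inr hp
    refine ⟨⟨hs.ok, fun q hq => hs.mem q (List.mem_cons_of_mem _ hq), ?_, ?_, hs.anti,
      fun g hg => hspan (hs.gen g hg), fun ρ hρ i hi => hspan (hs.right ρ hρ i hi)⟩, ?_⟩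
    · intro ρ hρ ρ' hρ' he
      exact hpair ρ ρ' (hs.ok ρ hρ).1 (hRI.ok ρ' hρ') he (hs.rel ρ hρ ρ' hρ' he)
    · exact hs.pair.imp_of_mem fun {ρ ρ'} hρ hρ' hp he =>
        hpair ρ ρ' (hs.ok ρ hρ).1 (hs.ok ρ' hρ').1 he (hp he)
    · exact Prod.Lex.right _ (by simp)
  · obtain ⟨hs0, ⟨t, ht, hst⟩, hlow, hmv⟩ := h.front_collect (π := π) (fun t ht => (hr.irred t ht).1) hf
    rw [mkRules]
    set ρ₀ : Rule K (Fin n) E := (s.2, scale (-s.1⁻¹) l) with hρ₀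
    have hok : ρ₀.IsOk lt := by
      constructor
      · rw [hρ₀, hst]; exact (hr.irred t ht).1
      · intro t' ht'
        obtain ⟨t'', ht'', hk⟩ := mem_scale ht'
        rw [hk]; exact hlow t'' ht''
    have hdiv : ∀ ρ ∈ RI ++ H, ¬ ρ.Divides ρ₀.1 := by
      intro ρ hρ
      have := (hr.irred t ht).2 ρ hρ
      rwa [← hst] at this
    have hnorm : ex ρ₀.1 ∈ normalSet lt D :=
      hRI.mem_normalSet fun ρ hρ => hdiv ρ (List.mem_append_left _ hρ)
    have hel : mv π r = s.1 • ρ₀.elem π := by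
      rw [hmv, Rule.elem, mv_scale, neg_smul, sub_neg_eq_add, smul_add, smul_smul,
        mul_inv_cancel₀ hs0, one_smul]
    have helM : ρ₀.elem π ∈ M := by
      have := smul_mem_of_mem s.1⁻¹ hrM
      rwa [hel, smul_smul, inv_mul_cancel₀ hs0, one_smul] at this
    have hlec := h.lec_elem hok hnorm
    have hsub : elems π H ⊆ elems π (ρ₀ :: H) := elems_mono (List.subset_cons_self _ _)
    have hρ₀mem : ρ₀.elem π ∈ elems π (ρ₀ :: H) := ⟨ρ₀, List.mem_cons_self, rfl⟩
    simp only [List.flatMap_cons, List.flatMap_nil, List.append_nil, List.singleton_append]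
    have hnew : ∀ x ∈ S.newPairs vars (RI ++ H) ρ₀,
        (∃ ρ ∈ RI ++ H, S.spair ρ₀ ρ = x) ∨ ∃ i ∈ vars, rmulWTerms i ρ₀.terms = x := by
      intro x hx
      simpa only [Sys.newPairs, List.mem_append, List.mem_map] using hx
    have hQ : ∀ x ∈ Q, x ∈ S.newPairs vars (RI ++ H) ρ₀ ++ Q :=
      fun x hx => List.mem_append_right _ hx
    set Q' := S.newPairs vars (RI ++ H) ρ₀ ++ Q with hQ'
    have hspan : Submodule.span A (elems π H ∪ {x | ∃ q' ∈ q :: Q, mv π q' = x}) ≤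
        Submodule.span A (elems π (ρ₀ :: H) ∪ {x | ∃ q ∈ Q', mv π q = x}) := by
      refine Submodule.span_le.2 ?_
      rintro x (hx | ⟨q', hq', rfl⟩)
      · exact Submodule.subset_span (Or.inl (hsub hx))
      · rcases List.mem_cons.1 hq' with rfl | hq'
        · rw [← sub_add_cancel (mv π q') (mv π r)]
          refine add_mem (Submodule.span_mono (hsub.trans Set.subset_union_left) hqr) ?_
          rw [hel]
          exact smul_mem_of_mem _ (Submodule.subset_span (Or.inl hρ₀mem))
        · exact Submodule.subset_span (Or.inr ⟨q', hQ _ hq', rfl⟩)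
    have hpair : ∀ ρ ρ' : Rule K (Fin n) E, ρ.IsOk lt → ρ'.IsOk lt → ρ.1.2 = ρ'.1.2 →
        (S.spair ρ ρ' ∈ q :: Q ∨ PairDone π lt S H ρ ρ') →
        S.spair ρ ρ' ∈ Q' ∨ PairDone π lt S (ρ₀ :: H) ρ ρ' := by
      intro ρ ρ' hρ hρ' he hp
      rcases hp with hp | hp
      · rcases List.mem_cons.1 hp with hp | hp
        · right
          obtain ⟨h1, h2⟩ := hr.bound {r | lt r (ρ.lcm ρ')} (isLower_lt h _)
            (by rw [← hp]; exact (hS.spair_spec hρ hρ' he).2)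
          rw [PairDone, hp, ← sub_add_cancel (mv π q) (mv π r)]
          refine add_mem (stdRep_mono hsub subset_rfl h2) ?_
          rw [hel]
          refine Submodule.smul_mem _ _ (mem_stdRep_self hρ₀mem hlec ?_)
          have := h1 t ht
          rwa [← hst] at this
        · exact Or.inl (hQ _ hp)
      · exact Or.inr (stdRep_mono hsub subset_rfl hp)
    refine ⟨⟨?_, ?_, ?_, ?_, ?_, fun g hg => hspan (hs.gen g hg), ?_⟩, ?_⟩
    · intro ρ hρ
      rcases List.mem_cons.1 hρ with rfl | hρ
      · exact ⟨hok, hnorm, helM⟩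
      · exact hs.ok ρ hρ
    · intro x hx
      rcases List.mem_append.1 hx with hx | hx
      · rcases hnew x hx with ⟨ρ, hρ, rfl⟩ | ⟨i, hi, rfl⟩
        · have hρok : ρ.IsOk lt := by
            rcases List.mem_append.1 hρ with hρ | hρ
            · exact hRI.ok ρ hρ
            · exact (hs.ok ρ hρ).1
          have hρM : ρ.elem π ∈ M := by
            rcases List.mem_append.1 hρ with hρ | hρ
            · rw [hRI.zero ρ hρ]; exact M.zero_mem
            · exact (hs.ok ρ hρ).2.2
          by_cases he : ρ₀.1.2 = ρ.1.2
          · obtain ⟨⟨c, c', w, w', -, -, -, -, h1⟩, -⟩ := hS.spair_spec hok hρok he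
            rw [h1]
            exact M.sub_mem (smul_mem_of_mem _ (M.smul_mem _ hρM))
              (smul_mem_of_mem _ (M.smul_mem _ helM))
          · rw [Sys.spair, if_neg he, mv_nil]; exact M.zero_mem
        · rw [mv_rmulWTerms, Rule.mv_terms]
          exact hM _ helM i hi
      · exact hs.mem x (List.mem_cons_of_mem _ hx)
    · intro ρ hρ ρ' hρ' he
      rcases List.mem_cons.1 hρ with rfl | hρ
      · left
        refine List.mem_append_left _ ?_
        rw [Sys.newPairs, List.mem_append]
        exact Or.inl (List.mem_map_of_mem (List.mem_append_left _ hρ'))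
      · exact hpair ρ ρ' (hs.ok ρ hρ).1 (hRI.ok ρ' hρ') he (hs.rel ρ hρ ρ' hρ' he)
    · refine List.pairwise_cons.2 ⟨fun ρ' hρ' he => ?_, ?_⟩
      · left
        refine List.mem_append_left _ ?_
        rw [Sys.newPairs, List.mem_append]
        exact Or.inl (List.mem_map_of_mem (List.mem_append_right _ hρ'))
      · exact hs.pair.imp_of_mem fun {ρ ρ'} hρ hρ' hp he =>
          hpair ρ ρ' (hs.ok ρ hρ).1 (hs.ok ρ' hρ').1 he (hp he)
    · exact List.pairwise_cons.2 ⟨fun ρ' hρ' => hdiv ρ' (List.mem_append_right _ hρ'), hs.anti⟩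
    · intro ρ hρ i hi
      rcases List.mem_cons.1 hρ with rfl | hρ
      · refine Submodule.subset_span (Or.inr ⟨rmulWTerms i ρ₀.terms, ?_, ?_⟩)
        · refine List.mem_append_left _ ?_
          rw [Sys.newPairs, List.mem_append]
          exact Or.inr (List.mem_map_of_mem hi)
        · rw [mv_rmulWTerms, Rule.mv_terms]
      · exact hspan (hs.right ρ hρ i hi)
    · refine Prod.Lex.left _ _ ⟨?_, ex ρ₀.1, ⟨ρ₀, List.mem_cons_self, rfl⟩, ?_⟩
      · rintro p ⟨ρ, hρ, rfl⟩
        exact ⟨ρ, List.mem_cons_of_mem _ hρ, rfl⟩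
      · rintro p ⟨ρ, hρ, rfl⟩ hd
        exact hdiv ρ (List.mem_append_right _ hρ) (divides_iff.2 hd)

/-- If no leading exponent of `H` divided `p`, all summands would lie strictly below `p`, and so
would `m`. -/
theorem IsModuleDatum.exists_of_mem_stdRep (h : IsModuleDatum π lt D) {H : Set (E → A)}
    {m : E → A} {p : Expo n × E} (hp : lec π lt m = some p)
    (hm : m ∈ stdRep π lt H {q | q = p ∨ lt q p}) :
    ∃ g ∈ H, ∃ q, lec π lt g = some q ∧ Dvd' q p := by
  by_contra hne
  have h1 : m ∈ stdRep π lt H {q | lt q p} := by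
    refine (Submodule.span_mono ?_ : stdRep π lt H {q | q = p ∨ lt q p} ≤ _) hm
    rintro _ ⟨g, hg, γ, q, hq, hs, rfl⟩
    refine ⟨g, hg, γ, q, hq, ?_, rfl⟩
    rcases hs with hs | hs
    · exact absurd ⟨g, hg, q, hq, dvd'_iff.2 ⟨γ, hs⟩⟩ hne
    · exact hs
  have := h.ordering.total
  exact irrefl_of lt p (h.lec_mem_of_mem_fil (isLower_lt h p) (h.stdRep_le_fil (isLower_lt h p) h1) hp)

/-- With an empty queue, the left span of the rules contains `G` and is stable under right
multiplication by `vars`, so it contains `M` by minimality. Buchberger's criterion applies: pairs of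
rules give its first hypothesis, pairs with relation rules its second. -/
theorem ComplInv.exists_dvd (h : IsModuleDatum π lt D) (hS : S.Compatible π lt)
    {RI : List (Rule K (Fin n) E)}
    (hRI : RelRules π lt D RI) {vars : List (Fin n)} {M : Submodule A (E → A)} {G : Set (E → A)}
    (hM : ∀ N : Submodule A (E → A), G ⊆ N → (∀ m ∈ N, ∀ i ∈ vars, rmulVar π i m ∈ N) → M ≤ N)
    {H : List (Rule K (Fin n) E)}
    (hs : ComplInv π lt D S RI vars M G (H, [])) {p : Expo n × E} (hp : p ∈ lecSet π lt M) :
    ∃ ρ ∈ H, Dvd' (ex ρ.1) p := by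
  have hun : elems π H ∪ {x | ∃ q ∈ ([] : List (List (WTerm K (Fin n) E))), mv π q = x} =
      elems π H := by simp
  have hle : M ≤ Submodule.span A (elems π H) := by
    refine hM _ (fun g hg => ?_) fun m hm i hi => ?_
    · have := hs.gen g hg
      rwa [hun] at this
    · induction hm using Submodule.span_induction with
      | mem x hx =>
        obtain ⟨ρ, hρ, rfl⟩ := hx
        have := hs.right ρ hρ i hi
        rwa [hun] at this
      | zero => rw [rmulVar_zero]; exact zero_mem _
      | add x y _ _ hx hy => rw [rmulVar_add]; exact add_mem hx hy
      | smul a x _ hx => rw [rmulVar_smul]; exact Submodule.smul_mem _ _ hx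
  have hlec : ∀ ρ ∈ H, lec π lt (ρ.elem π) = some (ex ρ.1) := fun ρ hρ =>
    h.lec_elem (hs.ok ρ hρ).1 (hs.ok ρ hρ).2.1
  have hmul : ∀ ρ ∈ H, ∀ (w : List (Fin n)) (γ : Expo n) (p : Expo n × E), listExpo w = γ →
      shift γ (ex ρ.1) = p → ∃ c : K, c ≠ 0 ∧ wv π w • ρ.elem π - c • xm π γ • ρ.elem π ∈
        stdRep π lt (elems π H) {r | lt r p} := by
    rintro ρ hρ w γ p rfl rfl
    exact h.wv_smul_sub_mem_stdRep (H := elems π H) ⟨ρ, hρ, rfl⟩ (hlec ρ hρ) w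
  obtain ⟨m, hm, hmp⟩ := hp
  have key : m ∈ stdRep π lt (elems π H) {q | q = p ∨ lt q p} := by
    refine h.buchberger ?_ ?_ (hle hm) hmp
    · rintro _ ⟨ρ, hρ, rfl⟩ _ ⟨ρ', hρ', rfl⟩ α β e hα hβ hne -
      rw [hlec ρ hρ, Option.some_inj] at hα
      rw [hlec ρ' hρ', Option.some_inj] at hβ
      have hρe : ρ.1.2 = e := congrArg Prod.snd hα
      have hρe' : ρ'.1.2 = e := congrArg Prod.snd hβ
      have hρα : listExpo ρ.1.1 = α := congrArg Prod.fst hα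
      have hρβ : listExpo ρ'.1.1 = β := congrArg Prod.fst hβ
      have hl : ρ.lcm ρ' = (α ⊔ β, e) := by rw [Rule.lcm, hρe, hρα, hρβ]
      have hl' : ρ'.lcm ρ = (α ⊔ β, e) := by rw [Rule.lcm, hρe', hρα, hρβ, sup_comm]
      have hd : PairDone π lt S H ρ ρ' ∨ PairDone π lt S H ρ' ρ := by
        have hsym : Std.Symm (fun ρ ρ' : Rule K (Fin n) E => ρ.1.2 = ρ'.1.2 →
          (PairDone π lt S H ρ ρ' ∨ PairDone π lt S H ρ' ρ)) :=
            ⟨fun a b hab he => (hab he.symm).symm⟩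
        have h1 := List.Pairwise.forall (R := fun ρ ρ' : Rule K (Fin n) E => ρ.1.2 = ρ'.1.2 →
          (PairDone π lt S H ρ ρ' ∨ PairDone π lt S H ρ' ρ))
          (hs.pair.imp fun {a b} hab he => Or.inl ((hab he).resolve_left (by simp)))
        exact h1 hρ hρ' (fun hh => hne (by rw [hh])) (hρe.trans hρe'.symm)
      have hcomm : ∃ (c c' : K) (w w' : List (Fin n)), c ≠ 0 ∧ c' ≠ 0 ∧
          shift (listExpo w) (ex ρ.1) = (α ⊔ β, e) ∧ shift (listExpo w') (ex ρ'.1) = (α ⊔ β, e) ∧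
          c • wv π w • ρ.elem π - c' • wv π w' • ρ'.elem π ∈
            stdRep π lt (elems π H) {r | lt r (α ⊔ β, e)} := by
        rcases hd with hd | hd
        · obtain ⟨⟨c, c', w, w', hc, hc', h1, h2, h3⟩, -⟩ :=
            hS.spair_spec (hs.ok ρ hρ).1 (hs.ok ρ' hρ').1 (hρe.trans hρe'.symm)
          rw [hl] at h1 h2
          rw [PairDone, h3, hl] at hd
          refine ⟨c, c', w, w', hc, hc', h1, h2, ?_⟩
          rw [← neg_sub]; exact neg_mem hd
        · obtain ⟨⟨c, c', w, w', hc, hc', h1, h2, h3⟩, -⟩ :=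
            hS.spair_spec (hs.ok ρ' hρ').1 (hs.ok ρ hρ).1 (hρe'.trans hρe.symm)
          rw [hl'] at h1 h2
          rw [PairDone, h3, hl'] at hd
          exact ⟨c', c, w', w, hc', hc, h2, h1, hd⟩
      obtain ⟨c, c', w, w', hc, hc', h1, h2, h3⟩ := hcomm
      have hw : listExpo w = α ⊔ β - α := by
        have := congrArg Prod.fst h1
        rw [shift, ex, hρα] at this
        exact eq_tsub_of_add_eq this
      have hw' : listExpo w' = α ⊔ β - β := by
        have := congrArg Prod.fst h2
        rw [shift, ex, hρβ] at this
        exact eq_tsub_of_add_eq this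
      obtain ⟨d, hd0, h4⟩ := hmul ρ hρ w _ (α ⊔ β, e) hw (by rw [← hw]; exact h1)
      obtain ⟨d', hd0', h5⟩ := hmul ρ' hρ' w' _ (α ⊔ β, e) hw' (by rw [← hw']; exact h2)
      refine ⟨c * d, c' * d', mul_ne_zero hc hd0, mul_ne_zero hc' hd0', ?_⟩
      have := add_mem (sub_mem h3 (Submodule.smul_mem _ c h4)) (Submodule.smul_mem _ c' h5)
      convert this using 1
      simp only [smul_sub, mul_smul]
      abel
    · rintro _ ⟨ρ, hρ, rfl⟩ α e hα β hβ
      rw [hlec ρ hρ, Option.some_inj] at hα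
      obtain ⟨ρ', hρ', hβ'⟩ := hRI.complete e β hβ
      have hρe : ρ.1.2 = e := congrArg Prod.snd hα
      have hρe' : ρ'.1.2 = e := congrArg Prod.snd hβ'
      have hρα : listExpo ρ.1.1 = α := congrArg Prod.fst hα
      have hρβ : listExpo ρ'.1.1 = β := congrArg Prod.fst hβ'
      have hl : ρ.lcm ρ' = (α ⊔ β, e) := by rw [Rule.lcm, hρe, hρα, hρβ]
      have hd := (hs.rel ρ hρ ρ' hρ' (hρe.trans hρe'.symm)).resolve_left (by simp)
      obtain ⟨⟨c, c', w, w', hc, -, h1, -, h3⟩, -⟩ :=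
        hS.spair_spec (hs.ok ρ hρ).1 (hRI.ok ρ' hρ') (hρe.trans hρe'.symm)
      rw [hl] at h1
      -- The element of the relation rule is zero, so the pair reduces to a monomial multiple of the
      -- element of `ρ` alone.
      rw [PairDone, h3, hl, hRI.zero ρ' hρ', smul_zero, smul_zero, zero_sub, neg_mem_iff] at hd
      have hw : listExpo w = α ⊔ β - α := by
        have := congrArg Prod.fst h1
        rw [shift, ex, hρα] at this
        exact eq_tsub_of_add_eq this
      obtain ⟨d, hd0, h4⟩ := hmul ρ hρ w _ (α ⊔ β, e) hw (by rw [← hw]; exact h1)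
      have h5 : (c * d) • xm π (α ⊔ β - α) • ρ.elem π ∈
          stdRep π lt (elems π H) {r | lt r (α ⊔ β, e)} := by
        have := sub_mem hd (Submodule.smul_mem _ c h4)
        convert this using 1
        simp only [smul_sub, mul_smul]
        abel
      have := Submodule.smul_mem _ (c * d)⁻¹ h5
      rwa [smul_smul, inv_mul_cancel₀ (mul_ne_zero hc hd0), one_smul] at this
  obtain ⟨_, ⟨ρ, hρ, rfl⟩, q, hq, hd⟩ := h.exists_of_mem_stdRep hmp key
  rw [hlec ρ hρ, Option.some_inj] at hq
  exact ⟨ρ, hρ, by rw [hq]; exact hd⟩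

/-- The element of the reduced Gröbner basis obtained from a rule with the reduced tail `r`. -/
theorem ComplInv.reduced (h : IsModuleDatum π lt D)
    {RI : List (Rule K (Fin n) E)}
    (hRI : RelRules π lt D RI) {vars : List (Fin n)} {M : Submodule A (E → A)} {G : Set (E → A)}
    {H : List (Rule K (Fin n) E)}
    (hs : ComplInv π lt D S RI vars M G (H, []))
    (hL : ∀ p ∈ lecSet π lt M, ∃ ρ ∈ H, Dvd' (ex ρ.1) p)
    {ρ : Rule K (Fin n) E} (hρ : ρ ∈ H) {r : List (WTerm K (Fin n) E)}
    (hr : IsNF π lt (elems π H) (RI ++ H) ρ.2 r) :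
    tv π ρ.1 - mv π r ∈ M ∧ lec π lt (tv π ρ.1 - mv π r) = some (ex ρ.1) ∧
      coef π lt (tv π ρ.1 - mv π r) (ex ρ.1) = 1 ∧
      ∀ q, q ≠ ex ρ.1 → coef π lt (tv π ρ.1 - mv π r) q ≠ 0 → q ∉ lecSet π lt M := by
  obtain ⟨hok, hn, hm⟩ := hs.ok ρ hρ
  have hHM : Submodule.span A (elems π H) ≤ M := by
    refine Submodule.span_le.2 ?_
    rintro _ ⟨ρ, hρ, rfl⟩
    exact (hs.ok ρ hρ).2.2
  obtain ⟨h1, h2⟩ := hr.bound {q | lt q (ex ρ.1)} (isLower_lt h _) hok.low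
  have h3 := h.mv_mem_fil (isLower_lt h _) h1
  have h4 : tv π ρ.1 - mv π r - (1 : K) • mon π (ex ρ.1) ∈ fil π {q | lt q (ex ρ.1)} := by
    rw [tv_of_pairwise hok.sorted, one_smul, sub_sub_cancel_left]
    exact neg_mem h3
  refine ⟨?_, h.lec_eq_of_sub_mem one_ne_zero hn h4, h.coef_eq_of_sub_mem hn h4, ?_⟩
  · have : tv π ρ.1 - mv π r = ρ.elem π + (mv π ρ.2 - mv π r) := by
      rw [Rule.elem]; abel
    rw [this]
    exact M.add_mem hm (hHM (stdRep_le_span (lt := lt) (elems π H) _ h2))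
  -- Away from the leading monomial only the monomials of `r` occur. No rule divides them, whereas
  -- every leading exponent of `M` is divisible by one.
  · intro q hq hc hqL
    rw [h.coef_sub, tv_of_pairwise hok.sorted, h.coef_mon_of_ne hn hq, zero_sub, neg_ne_zero] at hc
    have : ∃ t ∈ r, ex t.2 = q := by
      clear h1 h2 h3 h4
      have hir := hr.irred
      clear hr
      induction r with
      | nil => rw [mv_nil, h.coef_zero] at hc; exact absurd rfl hc
      | cons t l ih =>
        by_cases htq : ex t.2 = q
        · exact ⟨t, List.mem_cons_self, htq⟩
        · obtain ⟨ht1, ht2⟩ := hir t List.mem_cons_self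
          rw [mv_cons, h.coef_add, h.coef_smul, tv_of_pairwise ht1,
            h.coef_mon_of_ne (hRI.mem_normalSet fun ρ hρ => ht2 ρ (List.mem_append_left _ hρ))
              (Ne.symm htq), mul_zero, zero_add] at hc
          obtain ⟨t', ht', hq'⟩ := ih hc fun t ht => hir t (List.mem_cons_of_mem _ ht)
          exact ⟨t', List.mem_cons_of_mem _ ht', hq'⟩
    obtain ⟨t, ht, rfl⟩ := this
    obtain ⟨ρ', hρ', hd⟩ := hL _ hqL
    exact (hr.irred t ht).2 ρ' (List.mem_append_right _ hρ') (divides_iff.2 hd)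

theorem ComplInv.isReducedGroebnerBasis (h : IsModuleDatum π lt D) (hS : S.Compatible π lt)
    {RI : List (Rule K (Fin n) E)}
    (hRI : RelRules π lt D RI) {vars : List (Fin n)} {M : Submodule A (E → A)} {G : Set (E → A)}
    (hM : ∀ N : Submodule A (E → A), G ⊆ N → (∀ m ∈ N, ∀ i ∈ vars, rmulVar π i m ∈ N) → M ≤ N)
    {H : List (Rule K (Fin n) E)}
    (hs : ComplInv π lt D S RI vars M G (H, [])) {B : Finset (E → A)}
    (hB : ∀ g ∈ B, ∃ ρ ∈ minimize H, ∃ r, IsNF π lt (elems π H) (RI ++ H) ρ.2 r ∧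
      g = tv π ρ.1 - mv π r)
    (hB' : ∀ ρ ∈ minimize H, ∃ r, IsNF π lt (elems π H) (RI ++ H) ρ.2 r ∧
      tv π ρ.1 - mv π r ∈ B) : IsReducedGroebnerBasis π lt M B := by
  have hL := fun p (hp : p ∈ lecSet π lt M) => hs.exists_dvd h hS hRI hM hp
  refine h.isReducedGroebnerBasis ?_ ?_ ?_
  · intro g hg
    obtain ⟨ρ, hρ, r, hr, rfl⟩ := hB g hg
    obtain ⟨h1, h2, h3, h4⟩ := hs.reduced h hRI hL (minimize_subset H ρ hρ) hr
    exact ⟨h1, _, h2, h3, h4⟩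
  · intro p hp
    obtain ⟨ρ, hρ, hd⟩ := hL p hp
    obtain ⟨ρ', hρ', hd'⟩ := minimize_covers H ρ hρ
    obtain ⟨r, hr, hm⟩ := hB' ρ' hρ'
    obtain ⟨γ, hγ⟩ := dvd'_iff.1 (hd'.trans hd)
    exact ⟨_, hm, γ, _, (hs.reduced h hRI hL (minimize_subset H ρ' hρ') hr).2.1, hγ⟩
  · intro g hg g' hg' q γ hq hq'
    obtain ⟨ρ, hρ, r, hr, rfl⟩ := hB g hg
    obtain ⟨ρ', hρ', r', hr', rfl⟩ := hB g' hg'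
    obtain ⟨h1, h2, h3, h4⟩ := hs.reduced h hRI hL (minimize_subset H ρ hρ) hr
    obtain ⟨h1', h2', h3', h4'⟩ := hs.reduced h hRI hL (minimize_subset H ρ' hρ') hr'
    rw [h2, Option.some_inj] at hq
    rw [h2', Option.some_inj] at hq'
    have hd : Dvd' (ex ρ.1) (ex ρ'.1) := dvd'_iff.2 ⟨γ, by rw [hq, hq']⟩
    by_cases hρρ : ρ = ρ'
    -- The hypotheses allow two normal forms of the same tail. Their difference gives an element of
    -- `M` without any monomial in `lecSet`, hence zero.
    · subst hρρ
      by_contra hne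
      obtain ⟨p, hp⟩ := h.exists_lec (sub_ne_zero.2 hne)
      have hpL : p ∈ lecSet π lt M := ⟨_, M.sub_mem h1' h1, hp⟩
      have hc := (h.lec_eq_some_iff.1 hp).1
      rw [h.coef_sub] at hc
      by_cases hpρ : p = ex ρ.1
      · subst hpρ
        rw [h3, h3', sub_self] at hc
        exact hc rfl
      · by_cases h0 : coef π lt (tv π ρ.1 - mv π r) p = 0
        · rw [h0, sub_zero] at hc
          exact h4' p hpρ hc hpL
        · exact h4 p hpρ h0 hpL
    · exfalso
      have hsym : Std.Symm (fun ρ ρ' : Rule K (Fin n) E =>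
        ¬ ρ'.Divides ρ.1 ∧ ¬ ρ.Divides ρ'.1) := ⟨fun a b hab => ⟨hab.2, hab.1⟩⟩
      have h5 := List.Pairwise.forall (R := fun ρ ρ' : Rule K (Fin n) E =>
        ¬ ρ'.Divides ρ.1 ∧ ¬ ρ.Divides ρ'.1) (minimize_pairwise hs.anti)
      exact (h5 hρ hρ' hρρ).2 (divides_iff.2 hd)

end Completion

end PBWRed

namespace PBWRed

/-! ### Functions computed by programs -/

/-- A field together with answers to the comparisons of monomials. -/
structure Env where
  K : Type u
  fld : Field K
  ord : Ty.mon.Val K → Ty.mon.Val K → Prop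

attribute [instance] Env.fld

/-- The functions `F` are computed by one program. -/
def Cp {a b : Ty} (F : ∀ e : Env.{u}, a.Val e.K → b.Val e.K) : Prop :=
  ∃ P : Prog a b, ∀ (e : Env.{u}) (x : a.Val e.K), P.eval e.ord x = Part.some (F e x)

/-- The truth values of `p` are computed by one program. -/
def CpB {a : Ty} (p : ∀ e : Env.{u}, a.Val e.K → Prop) : Prop :=
  Cp (b := Ty.bool) fun e x => truth e.K (p e x)

section Basic

variable {a b c d s t : Ty}

theorem Cp.of_eq {F G : ∀ e : Env.{u}, a.Val e.K → b.Val e.K} (hF : Cp F)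
    (h : ∀ e x, F e x = G e x) : Cp G := by
  obtain rfl : F = G := funext fun e => funext fun x => h e x
  exact hF

theorem CpB.of_iff {p q : ∀ e : Env.{u}, a.Val e.K → Prop} (hp : CpB p)
    (h : ∀ e x, p e x ↔ q e x) : CpB q := by
  obtain rfl : p = q := funext fun e => funext fun x => propext (h e x)
  exact hp

theorem Cp.id (a : Ty) : Cp (a := a) (b := a) fun (_ : Env.{u}) x => x := ⟨.id a, fun _ _ => rfl⟩

theorem Cp.comp {G : ∀ e : Env.{u}, b.Val e.K → c.Val e.K}
    {F : ∀ e : Env.{u}, a.Val e.K → b.Val e.K} (hG : Cp G) (hF : Cp F) :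
    Cp fun e x => G e (F e x) := by
  obtain ⟨P, hP⟩ := hF
  obtain ⟨P', hP'⟩ := hG
  exact ⟨.comp P' P, fun e x => by simp only [Prog.eval, hP, Part.bind_some, hP']⟩

theorem CpB.comp {G : ∀ e : Env.{u}, b.Val e.K → Prop}
    {F : ∀ e : Env.{u}, a.Val e.K → b.Val e.K} (hG : CpB G) (hF : Cp F) :
    CpB fun e x => G e (F e x) :=
  Cp.comp hG hF

theorem Cp.unit (a : Ty) : Cp (a := a) (b := .one) fun (_ : Env.{u}) _ => PUnit.unit :=
  ⟨.unit a, fun _ _ => rfl⟩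

theorem Cp.pair {F : ∀ e : Env.{u}, a.Val e.K → b.Val e.K}
    {G : ∀ e : Env.{u}, a.Val e.K → c.Val e.K} (hF : Cp F) (hG : Cp G) :
    Cp (b := .prod b c) fun e x => (F e x, G e x) := by
  obtain ⟨P, hP⟩ := hF
  obtain ⟨P', hP'⟩ := hG
  exact ⟨.pair P P', fun e x => by simp only [Prog.eval, hP, Part.bind_some, hP', Part.map_some]⟩

theorem Cp.fst {F : ∀ e : Env.{u}, a.Val e.K → (Ty.prod b c).Val e.K} (hF : Cp F) :
    Cp fun e x => (F e x).1 :=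
  Cp.comp (G := fun e (x : (Ty.prod b c).Val e.K) => x.1) ⟨.fst b c, fun _ _ => rfl⟩ hF

theorem Cp.snd {F : ∀ e : Env.{u}, a.Val e.K → (Ty.prod b c).Val e.K} (hF : Cp F) :
    Cp fun e x => (F e x).2 :=
  Cp.comp (G := fun e (x : (Ty.prod b c).Val e.K) => x.2) ⟨.snd b c, fun _ _ => rfl⟩ hF

theorem Cp.inl {F : ∀ e : Env.{u}, a.Val e.K → b.Val e.K} (hF : Cp F) (c : Ty) :
    Cp (b := .sum b c) fun e x => Sum.inl (F e x) :=
  Cp.comp (c := .sum b c) (G := fun _ x => Sum.inl x) ⟨.inl b c, fun _ _ => rfl⟩ hF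

theorem Cp.inr {F : ∀ e : Env.{u}, a.Val e.K → c.Val e.K} (hF : Cp F) (b : Ty) :
    Cp (b := .sum b c) fun e x => Sum.inr (F e x) :=
  Cp.comp (c := .sum b c) (G := fun _ x => Sum.inr x) ⟨.inr b c, fun _ _ => rfl⟩ hF

theorem Cp.nil (a b : Ty) : Cp (a := a) (b := .list b) fun (_ : Env.{u}) _ => [] :=
  Cp.comp (G := fun _ _ => []) ⟨.nil b, fun _ _ => rfl⟩ (Cp.unit a)

theorem Cp.cons {F : ∀ e : Env.{u}, a.Val e.K → b.Val e.K}
    {G : ∀ e : Env.{u}, a.Val e.K → (Ty.list b).Val e.K} (hF : Cp F) (hG : Cp G) :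
    Cp (b := .list b) fun e x => F e x :: G e x :=
  Cp.comp (G := fun e (x : (Ty.prod b (.list b)).Val e.K) => (x.1 :: x.2 : List (b.Val e.K)))
    ⟨.cons b, fun _ _ => rfl⟩ (hF.pair hG)

theorem Cp.zero (a : Ty) : Cp (a := a) (b := .fld) fun (e : Env.{u}) _ => (0 : e.K) :=
  Cp.comp (G := fun e _ => (0 : e.K)) ⟨.zero, fun _ _ => rfl⟩ (Cp.unit a)

theorem Cp.one (a : Ty) : Cp (a := a) (b := .fld) fun (e : Env.{u}) _ => (1 : e.K) :=
  Cp.comp (G := fun e _ => (1 : e.K)) ⟨.one, fun _ _ => rfl⟩ (Cp.unit a)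

theorem Cp.add {F G : ∀ e : Env.{u}, a.Val e.K → Ty.fld.Val e.K} (hF : Cp F) (hG : Cp G) :
    Cp (b := .fld) fun e x => (F e x + G e x : e.K) :=
  Cp.comp (G := fun e (x : (Ty.prod .fld .fld).Val e.K) => (x.1 + x.2 : e.K))
    ⟨.add, fun _ _ => rfl⟩ (hF.pair hG)

theorem Cp.mul {F G : ∀ e : Env.{u}, a.Val e.K → Ty.fld.Val e.K} (hF : Cp F) (hG : Cp G) :
    Cp (b := .fld) fun e x => (F e x * G e x : e.K) :=
  Cp.comp (G := fun e (x : (Ty.prod .fld .fld).Val e.K) => (x.1 * x.2 : e.K))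
    ⟨.mul, fun _ _ => rfl⟩ (hF.pair hG)

theorem Cp.neg {F : ∀ e : Env.{u}, a.Val e.K → Ty.fld.Val e.K} (hF : Cp F) :
    Cp (b := .fld) fun e x => (-(F e x) : e.K) :=
  Cp.comp (G := fun e (x : Ty.fld.Val e.K) => (-x : e.K)) ⟨.neg, fun _ _ => rfl⟩ hF

theorem Cp.inv {F : ∀ e : Env.{u}, a.Val e.K → Ty.fld.Val e.K} (hF : Cp F) :
    Cp (b := .fld) fun e x => ((F e x)⁻¹ : e.K) :=
  Cp.comp (G := fun e (x : Ty.fld.Val e.K) => (x⁻¹ : e.K)) ⟨.inv, fun _ _ => rfl⟩ hF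

theorem CpB.isZero {F : ∀ e : Env.{u}, a.Val e.K → Ty.fld.Val e.K} (hF : Cp F) :
    CpB fun e x => F e x = (0 : e.K) :=
  CpB.comp (G := fun e (x : Ty.fld.Val e.K) => x = (0 : e.K)) ⟨.isZero, fun _ _ => rfl⟩ hF

theorem CpB.less {F G : ∀ e : Env.{u}, a.Val e.K → Ty.mon.Val e.K} (hF : Cp F) (hG : Cp G) :
    CpB fun e x => e.ord (F e x) (G e x) :=
  CpB.comp (G := fun e (x : (Ty.prod .mon .mon).Val e.K) => e.ord x.1 x.2)
    ⟨.less, fun _ _ => rfl⟩ (hF.pair hG)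

theorem Cp.cases {r : ∀ e : Env.{u}, c.Val e.K → (Ty.sum a b).Val e.K} (hr : Cp r)
    {F : ∀ e : Env.{u}, (Ty.prod a c).Val e.K → d.Val e.K} (hF : Cp F)
    {G : ∀ e : Env.{u}, (Ty.prod b c).Val e.K → d.Val e.K} (hG : Cp G) :
    Cp fun e x => Sum.elim (fun y => F e (y, x)) (fun y => G e (y, x)) (r e x) := by
  obtain ⟨P, hP⟩ := hF
  obtain ⟨P', hP'⟩ := hG
  have h : Cp (a := .prod (.sum a b) c) (b := d) fun (e : Env.{u}) x =>
      Sum.elim (fun y => F e (y, x.2)) (fun y => G e (y, x.2)) x.1 := by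
    refine ⟨.cases P P', fun e x => ?_⟩
    rw [Prog.eval]
    obtain ⟨y | y, z⟩ := x
    · exact hP e (y, z)
    · exact hP' e (y, z)
  exact h.comp (hr.pair (Cp.id c))

/-- Elimination for lists. -/
def listElim {α : Type*} {β : Type*} (f : β) (g : α → List α → β) : List α → β
  | [] => f
  | y :: l => g y l

theorem Cp.listElim {l : ∀ e : Env.{u}, c.Val e.K → (Ty.list a).Val e.K} (hl : Cp l)
    {f : ∀ e : Env.{u}, c.Val e.K → d.Val e.K} (hf : Cp f)
    {G : ∀ e : Env.{u}, (Ty.prod (.prod a (.list a)) c).Val e.K → d.Val e.K} (hG : Cp G) :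
    Cp fun e x => PBWRed.listElim (f e x) (fun y ys => G e ((y, ys), x)) (l e x) := by
  have h : Cp (a := .list a) (b := .sum .one (.prod a (.list a))) fun (e : Env.{u}) x =>
      PBWRed.listElim (Sum.inl PUnit.unit) (fun y ys => Sum.inr (y, ys)) x := by
    refine ⟨.uncons a, fun e x => ?_⟩
    cases x <;> rfl
  have h' := Cp.cases (h.comp hl) (F := fun e x => f e x.2) (hf.comp (Cp.id (.prod .one c)).snd) hG
  refine h'.of_eq fun e x => ?_
  cases l e x <;> rfl

theorem foldlM_eq_some {σ α : Type*} {f : σ → α → Part σ} {g : σ → α → σ}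
    (h : ∀ s y, f s y = Part.some (g s y)) (l : List α) (s : σ) :
    l.foldlM (m := Part) f s = Part.some (l.foldl g s) := by
  induction l generalizing s with
  | nil => rfl
  | cons y l ih =>
    rw [List.foldlM_cons, h, Part.bind_eq_bind, Part.bind_some, ih, List.foldl_cons]

/-- The body of `forEach` sees only the state and the current entry, so the context is carried along
in the state. -/
theorem Cp.foldl {l : ∀ e : Env.{u}, c.Val e.K → (Ty.list t).Val e.K} (hl : Cp l)
    {i : ∀ e : Env.{u}, c.Val e.K → s.Val e.K} (hi : Cp i)
    {F : ∀ e : Env.{u}, (Ty.prod c (.prod s t)).Val e.K → s.Val e.K} (hF : Cp F) :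
    Cp fun e x => (l e x).foldl (fun st y => F e (x, (st, y))) (i e x) := by
  have x := Cp.id.{u} (.prod (.prod c s) t)
  obtain ⟨P, hP⟩ := x.fst.fst.pair (hF.comp (x.fst.fst.pair (x.fst.snd.pair x.snd)))
  have h : Cp (a := .prod (.prod c s) (.list t)) (b := .prod c s) fun (e : Env.{u}) x =>
      x.2.foldl (fun st y => (st.1, F e (st.1, (st.2, y)))) x.1 := by
    refine ⟨.forEach P, fun e x => ?_⟩
    rw [Prog.eval]
    exact foldlM_eq_some (fun st y => hP e (st, y)) _ _
  refine (h.comp (((Cp.id c).pair hi).pair hl)).snd.of_eq fun e x => ?_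
  generalize i e x = z
  generalize l e x = l
  simp only
  induction l generalizing z with
  | nil => rfl
  | cons y l ih => exact ih _

theorem Cp.reverse {l : ∀ e : Env.{u}, c.Val e.K → (Ty.list t).Val e.K} (hl : Cp l) :
    Cp (b := .list t) fun e x => (l e x).reverse := by
  have x := Cp.id.{u} (.prod c (.prod (.list t) t))
  refine (Cp.foldl hl (Cp.nil c t) (x.snd.snd.cons x.snd.fst)).of_eq fun e x => ?_
  rw [List.foldl_flip_cons_eq_append' , List.append_nil]

theorem Cp.foldr {l : ∀ e : Env.{u}, c.Val e.K → (Ty.list t).Val e.K} (hl : Cp l)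
    {i : ∀ e : Env.{u}, c.Val e.K → s.Val e.K} (hi : Cp i)
    {F : ∀ e : Env.{u}, (Ty.prod c (.prod t s)).Val e.K → s.Val e.K} (hF : Cp F) :
    Cp fun e x => (l e x).foldr (fun y st => F e (x, (y, st))) (i e x) := by
  have x := Cp.id.{u} (.prod c (.prod s t))
  refine (Cp.foldl hl.reverse hi (hF.comp (x.fst.pair (x.snd.snd.pair x.snd.fst)))).of_eq
    fun e x => ?_
  rw [List.foldl_reverse]

/-- Recursion on lists. -/
theorem Cp.listRec {f : ∀ e : Env.{u}, c.Val e.K → List (t.Val e.K) → s.Val e.K}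
    {i : ∀ e : Env.{u}, c.Val e.K → s.Val e.K} (hi : Cp i)
    {G : ∀ e : Env.{u}, (Ty.prod c (.prod t (.prod (.list t) s))).Val e.K → s.Val e.K} (hG : Cp G)
    (f_nil : ∀ e x, f e x [] = i e x)
    (f_cons : ∀ e x y l, f e x (y :: l) = G e (x, (y, (l, f e x l))))
    {l : ∀ e : Env.{u}, c.Val e.K → (Ty.list t).Val e.K} (hl : Cp l) :
    Cp fun e x => f e x (l e x) := by
  have x := Cp.id.{u} (.prod c (.prod t (.prod (.list t) s)))
  -- The fold rebuilds the list next to the value, so that the body also has access to the tail.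
  have h := (Cp.foldr hl ((Cp.nil c t).pair hi) ((x.snd.fst.cons x.snd.snd.fst).pair hG)).snd
  refine h.of_eq fun e x => ?_
  have : ∀ l : List (t.Val e.K), l.foldr (fun y st => (y :: st.1, G e (x, (y, st)))) ([], i e x) =
      (l, f e x l) := by
    intro l
    induction l with
    | nil => rw [f_nil]; rfl
    | cons y l ih => rw [List.foldr_cons, ih, f_cons]
  exact congrArg Prod.snd (this (l e x))

theorem Cp.map {l : ∀ e : Env.{u}, c.Val e.K → (Ty.list t).Val e.K} (hl : Cp l)
    {F : ∀ e : Env.{u}, (Ty.prod c t).Val e.K → s.Val e.K} (hF : Cp F) :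
    Cp (b := .list s) fun e x => (l e x).map fun y => F e (x, y) := by
  have x := Cp.id.{u} (.prod c (.prod t (.list s)))
  refine (Cp.foldr hl (Cp.nil c s) ((hF.comp (x.fst.pair x.snd.fst)).cons x.snd.snd)).of_eq
    fun e x => ?_
  generalize l e x = l
  induction l with
  | nil => rfl
  | cons y l ih => rw [List.foldr_cons, ih, List.map_cons]

theorem Cp.append {l l' : ∀ e : Env.{u}, c.Val e.K → (Ty.list t).Val e.K} (hl : Cp l)
    (hl' : Cp l') : Cp (b := .list t) fun e x => l e x ++ l' e x := by
  have x := Cp.id.{u} (.prod c (.prod t (.list t)))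
  refine (Cp.foldr hl hl' (x.snd.fst.cons x.snd.snd)).of_eq fun e x => ?_
  generalize l e x = l
  induction l with
  | nil => rfl
  | cons y l ih => rw [List.foldr_cons, ih, List.cons_append]

theorem Cp.flatMap {l : ∀ e : Env.{u}, c.Val e.K → (Ty.list t).Val e.K} (hl : Cp l)
    {F : ∀ e : Env.{u}, (Ty.prod c t).Val e.K → (Ty.list s).Val e.K} (hF : Cp F) :
    Cp (b := .list s) fun e x => (l e x).flatMap fun y => F e (x, y) := by
  have x := Cp.id.{u} (.prod c (.prod t (.list s)))
  refine (Cp.foldr hl (Cp.nil c s) ((hF.comp (x.fst.pair x.snd.fst)).append x.snd.snd)).of_eq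
    fun e x => ?_
  generalize l e x = l
  induction l with
  | nil => rfl
  | cons y l ih => rw [List.foldr_cons, ih, List.flatMap_cons]

theorem CpB.ite {p : ∀ e : Env.{u}, a.Val e.K → Prop} (hp : CpB p)
    {F G : ∀ e : Env.{u}, a.Val e.K → b.Val e.K} (hF : Cp F) (hG : Cp G)
    [∀ e x, Decidable (p e x)] : Cp fun e x => if p e x then F e x else G e x := by
  refine (Cp.cases hp (hF.comp (Cp.id (.prod .one a)).snd)
    (hG.comp (Cp.id (.prod .one a)).snd)).of_eq fun e x => ?_
  rw [truth]
  split_ifs <;> rfl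

theorem CpB.true (a : Ty) : CpB (a := a) fun (_ : Env.{u}) _ => True :=
  Cp.of_eq ((Cp.unit a).inl .one) fun e x => by rw [truth, if_pos trivial]

theorem CpB.false (a : Ty) : CpB (a := a) fun (_ : Env.{u}) _ => False :=
  Cp.of_eq ((Cp.unit a).inr .one) fun e x => by rw [truth, if_neg id]

theorem CpB.not {p : ∀ e : Env.{u}, a.Val e.K → Prop} (hp : CpB p) : CpB fun e x => ¬ p e x := by
  classical
  refine Cp.of_eq (CpB.ite hp (CpB.false a) (CpB.true a)) fun e x => ?_
  by_cases h : p e x <;> simp [h]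

theorem CpB.and {p q : ∀ e : Env.{u}, a.Val e.K → Prop} (hp : CpB p) (hq : CpB q) :
    CpB fun e x => p e x ∧ q e x := by
  classical
  refine Cp.of_eq (CpB.ite hp hq (CpB.false a)) fun e x => ?_
  by_cases h : p e x <;> simp [h]

theorem Cp.filter {l : ∀ e : Env.{u}, c.Val e.K → (Ty.list t).Val e.K} (hl : Cp l)
    {p : ∀ e : Env.{u}, (Ty.prod c t).Val e.K → Prop} (hp : CpB p) [∀ e x, Decidable (p e x)] :
    Cp (b := .list t) fun e x => (l e x).filter fun y => p e (x, y) := by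
  have x := Cp.id.{u} (.prod c (.prod t (.list t)))
  refine (Cp.foldr hl (Cp.nil c t) (CpB.ite (hp.comp (x.fst.pair x.snd.fst))
    (x.snd.fst.cons x.snd.snd) x.snd.snd)).of_eq fun e x => ?_
  generalize l e x = l
  induction l with
  | nil => rfl
  | cons y l ih =>
    rw [List.foldr_cons, ih, List.filter_cons]
    simp

theorem CpB.eq_nil {l : ∀ e : Env.{u}, c.Val e.K → (Ty.list t).Val e.K} (hl : Cp l) :
    CpB fun e x => l e x = [] := by
  refine Cp.of_eq (Cp.listElim hl (CpB.true c) (CpB.false (.prod (.prod t (.list t)) c)))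
    fun e x => ?_
  beta_reduce
  rcases l e x with _ | ⟨y, l⟩ <;> simp [PBWRed.listElim]

/-- Equality of data of type `t` is decided by a program. -/
def EqCp (t : Ty) : Prop := CpB.{u} (a := .prod t t) fun _ x => x.1 = x.2

theorem EqCp.comp (ht : EqCp.{u} t) {F G : ∀ e : Env.{u}, a.Val e.K → t.Val e.K} (hF : Cp F)
    (hG : Cp G) : CpB fun e x => F e x = G e x :=
  CpB.comp ht (hF.pair hG)

theorem EqCp.one : EqCp.{u} .one := (CpB.true (.prod .one .one)).of_iff fun _ _ => by simp

theorem EqCp.prod (hs : EqCp.{u} s) (ht : EqCp.{u} t) : EqCp.{u} (.prod s t) := by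
  have x := Cp.id.{u} (.prod (.prod s t) (.prod s t))
  exact ((hs.comp x.fst.fst x.snd.fst).and (ht.comp x.fst.snd x.snd.snd)).of_iff
    fun _ _ => Prod.ext_iff.symm

/-- One pass through the first list; the state is the unread part of the second list (`inr`) or a
recorded mismatch (`inl`). The lists agree if nothing is left unread at the end. -/
theorem EqCp.list (ht : EqCp.{u} t) : EqCp.{u} (.list t) := by
  classical
  have x := Cp.id.{u} (.prod (.list t) (.list t))
  have y := Cp.id.{u} (.prod (.prod (.list t) (.list t)) (.prod (.sum .one (.list t)) t))
  have z := Cp.id.{u} (.prod (.list t) (.prod (.prod (.list t) (.list t))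
    (.prod (.sum .one (.list t)) t)))
  have w := Cp.id.{u} (.prod (.prod t (.list t)) (.prod (.list t) (.prod (.prod (.list t) (.list t))
    (.prod (.sum .one (.list t)) t))))
  have hstep := Cp.cases y.snd.fst
    (((Cp.unit.{u} _).inl (.list t)).comp
      (Cp.id (.prod .one (.prod (.prod (.list t) (.list t)) (.prod (.sum .one (.list t)) t)))))
    (Cp.listElim z.fst ((Cp.unit _).inl (.list t))
      (CpB.ite (ht.comp w.fst.fst w.snd.snd.snd.snd) (w.fst.snd.inr .one)
        ((Cp.unit _).inl (.list t))))
  have h := Cp.foldl x.fst (x.snd.inr .one) hstep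
  have h' := Cp.cases h (CpB.false _) (CpB.eq_nil (Cp.id.{u} (.prod (.list t)
    (.prod (.list t) (.list t)))).fst)
  refine Cp.of_eq h' fun e x => ?_
  obtain ⟨l, l'⟩ := x
  simp only
  suffices H : ∀ (l : List (t.Val e.K)) (r : PUnit.{u + 1} ⊕ List (t.Val e.K)),
      Sum.elim (fun _ => truth e.K False) (fun y => truth e.K (y = []))
        (l.foldl (fun st y => Sum.elim (fun _ => Sum.inl PUnit.unit)
          (fun r => PBWRed.listElim (Sum.inl PUnit.unit)
            (fun z zs => if z = y then Sum.inr zs else Sum.inl PUnit.unit) r) st) r) =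
      Sum.elim (fun _ => truth e.K False) (fun l' => truth e.K (l = l')) r from
    H l (Sum.inr l')
  intro l
  induction l with
  | nil => rintro (r | r) <;> simp [eq_comm]
  | cons y l ih =>
    rintro (r | r)
    · rw [List.foldl_cons, ih]; rfl
    · rw [List.foldl_cons, ih]
      cases r with
      | nil => simp [PBWRed.listElim]
      | cons z zs =>
        by_cases hz : z = y
        · simp [PBWRed.listElim, hz]
        · simp [PBWRed.listElim, hz, Ne.symm hz]

theorem Cp.erase (ht : EqCp.{u} t) [∀ e : Env.{u}, DecidableEq (t.Val e.K)]
    {l : ∀ e : Env.{u}, c.Val e.K → (Ty.list t).Val e.K} (hl : Cp l)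
    {F : ∀ e : Env.{u}, c.Val e.K → t.Val e.K} (hF : Cp F) :
    Cp (b := .list t) fun e x => (l e x).erase (F e x) := by
  have x := Cp.id.{u} (.prod c (.prod t (.prod (.list t) (.list t))))
  refine Cp.listRec (Cp.nil c t) (CpB.ite (ht.comp x.snd.fst (hF.comp x.fst)) x.snd.snd.fst
    (x.snd.fst.cons x.snd.snd.snd)) (f := fun e x l => l.erase (F e x)) (fun e x => rfl)
    (fun e x y l => ?_) hl
  rw [List.erase_cons]
  simp

theorem Cp.diff (ht : EqCp.{u} t) [∀ e : Env.{u}, DecidableEq (t.Val e.K)]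
    {l l' : ∀ e : Env.{u}, c.Val e.K → (Ty.list t).Val e.K} (hl : Cp l) (hl' : Cp l') :
    Cp (b := .list t) fun e x => (l e x).diff (l' e x) := by
  have x := Cp.id.{u} (.prod c (.prod (.list t) t))
  refine (Cp.foldl hl' hl (Cp.erase ht x.snd.fst x.snd.snd)).of_eq fun e x => ?_
  rw [List.diff_eq_foldl]

/-- The entry of a list with an index in unary notation. -/
theorem Cp.getD {l : ∀ e : Env.{u}, c.Val e.K → (Ty.list t).Val e.K} (hl : Cp l)
    {i : ∀ e : Env.{u}, c.Val e.K → Ty.nat.Val e.K} (hi : Cp i)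
    {F : ∀ e : Env.{u}, c.Val e.K → t.Val e.K} (hF : Cp F) :
    Cp fun e x => (l e x).getD (i e x).length (F e x) := by
  have x := Cp.id.{u} (.prod c (.prod (.list t) .one))
  -- Each unit of the index removes one entry; the empty list stays empty, and then the default
  -- value is returned.
  have h := Cp.foldl hi hl (Cp.listElim x.snd.fst (Cp.nil _ t) (Cp.id (.prod (.prod t (.list t))
    (.prod c (.prod (.list t) .one)))).fst.snd)
  refine (Cp.listElim h hF (Cp.id (.prod (.prod t (.list t)) c)).fst.fst).of_eq fun e x => ?_
  simp only
  generalize i e x = i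
  generalize l e x = l
  induction i generalizing l with
  | nil => cases l <;> rfl
  | cons _ i ih =>
    rw [List.foldl_cons, ih]
    cases l <;> simp [PBWRed.listElim]

end Basic

end PBWRed

namespace PBWRed

/-! ### The algorithm on encoded data -/

/-- Words, with variables given by their index. -/
abbrev Ty.word : Ty := .list .nat

/-- Words in components. -/
abbrev Ty.wmon : Ty := .prod .word .nat

abbrev Ty.wterm : Ty := .prod .fld .wmon

abbrev Ty.wpoly : Ty := .list .wterm

abbrev Ty.rule : Ty := .prod .wmon .wpoly

abbrev Ty.terms : Ty := .list (.prod .fld .word)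

/-- Tables of commutation relations for each component. -/
abbrev Ty.sys : Ty := .list (.list (.list (.prod .fld .terms)))

/-- The commutation relations given by a table. -/
def rawSys {K : Type u} [Field K] (T : Ty.sys.Val K) : Sys K (Ty.nat.Val K) (Ty.nat.Val K) where
  -- For unary numbers the list difference is truncated subtraction, which vanishes exactly if `i ≤
  -- j`.
  le i j := decide (i.diff j = [])
  cf e i j := (((T.getD e.length []).getD i.length []).getD j.length (0, [])).1
  dw e i j := (((T.getD e.length []).getD i.length []).getD j.length (0, [])).2

section Raw

variable {a b c : Ty}

theorem eqCp_nat : EqCp.{u} .nat := EqCp.one.list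

theorem eqCp_word : EqCp.{u} .word := eqCp_nat.list

theorem eqCp_wmon : EqCp.{u} .wmon := eqCp_word.prod eqCp_nat

variable {T : ∀ e : Env.{u}, c.Val e.K → Ty.sys.Val e.K}
  {k i j : ∀ e : Env.{u}, c.Val e.K → Ty.nat.Val e.K}

theorem CpB.le (hi : Cp i) (hj : Cp j) : CpB fun e x => (rawSys (T e x)).le (i e x) (j e x) = Bool.true := by
  have h : CpB fun e x => (i e x).diff (j e x) = [] := CpB.eq_nil (Cp.diff EqCp.one hi hj)
  exact h.of_iff fun e x => by simp [rawSys]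

theorem Cp.entry (hT : Cp T) (hk : Cp k) (hi : Cp i) (hj : Cp j) :
    Cp (b := .prod .fld .terms) fun e x => (((T e x).getD (k e x).length []).getD
      (i e x).length []).getD (j e x).length (0, []) :=
  Cp.getD (Cp.getD (Cp.getD hT hk (Cp.nil c _)) hi (Cp.nil c _)) hj
    ((Cp.zero c).pair (Cp.nil c (.prod .fld .word)))

theorem Cp.cf (hT : Cp T) (hk : Cp k) (hi : Cp i) (hj : Cp j) :
    Cp (b := .fld) fun e x => (rawSys (T e x)).cf (k e x) (i e x) (j e x) :=
  (Cp.entry hT hk hi hj).fst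

theorem Cp.dw (hT : Cp T) (hk : Cp k) (hi : Cp i) (hj : Cp j) :
    Cp (b := .terms) fun e x => (rawSys (T e x)).dw (k e x) (i e x) (j e x) :=
  (Cp.entry hT hk hi hj).snd

theorem Cp.scale {f : ∀ e : Env.{u}, c.Val e.K → Ty.fld.Val e.K} (hf : Cp f)
    {l : ∀ e : Env.{u}, c.Val e.K → (Ty.list (.prod .fld b)).Val e.K} (hl : Cp l) :
    Cp (b := .list (.prod .fld b)) fun e x =>
      PBWRed.scale (K := e.K) (β := b.Val e.K) (f e x) (l e x) := by
  have x := Cp.id.{u} (.prod c (.prod .fld b))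
  exact Cp.map hl (((hf.comp x.fst).mul x.snd.fst).pair x.snd.snd)

theorem Cp.lmulTerms {w : ∀ e : Env.{u}, c.Val e.K → Ty.word.Val e.K} (hw : Cp w)
    {l : ∀ e : Env.{u}, c.Val e.K → Ty.terms.Val e.K} (hl : Cp l) :
    Cp (b := .terms) fun e x =>
      PBWRed.lmulTerms (K := e.K) (ι := Ty.nat.Val e.K) (w e x) (l e x) := by
  have x := Cp.id.{u} (.prod c (.prod .fld .word))
  exact Cp.map hl (x.snd.fst.pair ((hw.comp x.fst).append x.snd.snd))

theorem Cp.rmulTerms {w : ∀ e : Env.{u}, c.Val e.K → Ty.word.Val e.K} (hw : Cp w)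
    {l : ∀ e : Env.{u}, c.Val e.K → Ty.terms.Val e.K} (hl : Cp l) :
    Cp (b := .terms) fun e x => (l e x).map fun t => (t.1, t.2 ++ w e x) := by
  have x := Cp.id.{u} (.prod c (.prod .fld .word))
  exact Cp.map hl (x.snd.fst.pair (x.snd.snd.append (hw.comp x.fst)))

/-- The type of the result of sorting. -/
abbrev Ty.sorted : Ty := .prod .fld (.prod .word .terms)

theorem Cp.ins (hT : Cp T) (hk : Cp k) (hi : Cp i)
    {w : ∀ e : Env.{u}, c.Val e.K → Ty.word.Val e.K} (hw : Cp w) :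
    Cp (b := .sorted) fun e x => (rawSys (T e x)).ins (k e x) (i e x) (w e x) := by
  have x := Cp.id.{u} (.prod c (.prod .nat (.prod .word .sorted)))
  have hi' := hi.comp x.fst
  have hcf := Cp.cf (hT.comp x.fst) (hk.comp x.fst) x.snd.fst hi'
  have hdw := Cp.dw (hT.comp x.fst) (hk.comp x.fst) x.snd.fst hi'
  have hr := x.snd.snd.snd
  have hu := x.snd.snd.fst
  have hj := x.snd.fst
  refine Cp.listRec (s := .sorted) (f := fun e x w => (rawSys (T e x)).ins (k e x) (i e x) w)
    ((Cp.one c).pair ((hi.cons (Cp.nil c .nat)).pair (Cp.nil c (.prod .fld .word))))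
    (CpB.ite (CpB.le (T := fun e (x : (Ty.prod c (.prod .nat (.prod .word .sorted))).Val e.K) => T e x.1) hi' hj)
      ((Cp.one _).pair ((hi'.cons (hj.cons hu)).pair (Cp.nil _ (.prod .fld .word))))
      ((hcf.mul hr.fst).pair ((hj.cons hr.snd.fst).pair
        ((Cp.scale hcf (Cp.lmulTerms (hj.cons (Cp.nil _ .nat)) hr.snd.snd)).append
          (Cp.rmulTerms hu hdw)))))
    (fun e x => rfl) (fun e x y l => ?_) hw
  rw [Sys.ins, Bool.cond_eq_ite]

theorem Cp.sort (hT : Cp T) (hk : Cp k)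
    {w : ∀ e : Env.{u}, c.Val e.K → Ty.word.Val e.K} (hw : Cp w) :
    Cp (b := .sorted) fun e x => (rawSys (T e x)).sort (k e x) (w e x) := by
  have x := Cp.id.{u} (.prod c (.prod .nat (.prod .word .sorted)))
  have hr := x.snd.snd.snd
  have hi := x.snd.fst
  have hins := Cp.ins (hT.comp x.fst) (hk.comp x.fst) hi hr.snd.fst
  exact Cp.listRec (s := .sorted) (f := fun e x w => (rawSys (T e x)).sort (k e x) w)
    ((Cp.one c).pair ((Cp.nil c .nat).pair (Cp.nil c (.prod .fld .word))))
    ((hr.fst.mul hins.fst).pair (hins.snd.fst.pair ((Cp.scale hr.fst hins.snd.snd).append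
      (Cp.lmulTerms (hi.cons (Cp.nil _ .nat)) hr.snd.snd))))
    (fun e x => rfl) (fun e x y l => rfl) hw

variable {l : ∀ e : Env.{u}, c.Val e.K → Ty.wpoly.Val e.K}
  {t : ∀ e : Env.{u}, c.Val e.K → Ty.wmon.Val e.K}
  {ρ ρ' : ∀ e : Env.{u}, c.Val e.K → Ty.rule.Val e.K}

theorem Cp.lmulWTerms {w : ∀ e : Env.{u}, c.Val e.K → Ty.word.Val e.K} (hw : Cp w)
    (hl : Cp l) : Cp (b := .wpoly) fun e x =>
      PBWRed.lmulWTerms (K := e.K) (ι := Ty.nat.Val e.K) (κ := Ty.nat.Val e.K) (w e x) (l e x) := by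
  have x := Cp.id.{u} (.prod c .wterm)
  exact Cp.map hl (x.snd.fst.pair (((hw.comp x.fst).append x.snd.snd.fst).pair x.snd.snd.snd))

theorem Cp.rmulWTerms (hi : Cp i) (hl : Cp l) : Cp (b := .wpoly) fun e x =>
      PBWRed.rmulWTerms (K := e.K) (ι := Ty.nat.Val e.K) (κ := Ty.nat.Val e.K) (i e x) (l e x) := by
  have x := Cp.id.{u} (.prod c .wterm)
  exact Cp.map hl (x.snd.fst.pair
    ((x.snd.snd.fst.append ((hi.comp x.fst).cons (Cp.nil _ .nat))).pair x.snd.snd.snd))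

theorem Cp.atComp (hk : Cp k) {l : ∀ e : Env.{u}, c.Val e.K → Ty.terms.Val e.K} (hl : Cp l) :
    Cp (b := .wpoly) fun e x =>
      PBWRed.atComp (K := e.K) (ι := Ty.nat.Val e.K) (κ := Ty.nat.Val e.K) (k e x) (l e x) := by
  have x := Cp.id.{u} (.prod c (.prod .fld .word))
  exact Cp.map hl (x.snd.fst.pair (x.snd.snd.pair (hk.comp x.fst)))

theorem Cp.redBy (hT : Cp T) (hρ : Cp ρ) {w : ∀ e : Env.{u}, c.Val e.K → Ty.word.Val e.K}
    (hw : Cp w) : Cp (b := .wpoly) fun e x => (rawSys (T e x)).redBy (ρ e x) (w e x) := by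
  have hd := Cp.diff eqCp_nat hw hρ.fst.fst
  have hp := Cp.sort hT hρ.fst.snd (hd.append hρ.fst.fst)
  exact (Cp.scale hp.fst.inv (Cp.lmulWTerms hd hρ.snd)).append
    (Cp.scale hp.fst.inv.neg (Cp.atComp hρ.fst.snd hp.snd.snd))

theorem CpB.divides (hρ : Cp ρ) (ht : Cp t) : CpB fun e x => Rule.Divides (K := e.K) (ρ e x) (t e x) :=
  (eqCp_nat.comp hρ.fst.snd ht.snd).and (CpB.eq_nil (Cp.diff eqCp_nat hρ.fst.fst ht.fst))

theorem Cp.nfStep (hT : Cp T) {R : ∀ e : Env.{u}, c.Val e.K → (Ty.list .rule).Val e.K}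
    (hR : Cp R) {s : ∀ e : Env.{u}, c.Val e.K → (Ty.prod .wpoly .wpoly).Val e.K} (hs : Cp s) :
    Cp (b := .sum .wpoly (.prod .wpoly .wpoly)) fun e x => (rawSys (T e x)).nfStep (R e x) (s e x) := by
  let c' : Ty := .prod (.prod .wterm .wpoly) c
  have x := Cp.id.{u} c'
  have ht := x.fst.fst
  have hl := x.fst.snd
  have hdn := (hs.comp x.snd).snd
  have hp := Cp.sort (hT.comp x.snd) ht.snd.snd ht.snd.fst
  have hm : Cp (a := c') (b := .wmon) _ := hp.snd.fst.pair ht.snd.snd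
  have hlow := (Cp.scale ht.fst (Cp.atComp ht.snd.snd hp.snd.snd)).append hl
  have y := Cp.id.{u} (.prod c' .rule)
  have hf := Cp.filter (hR.comp x.snd) (CpB.divides y.snd (hm.comp y.fst))
  have z := Cp.id.{u} (.prod (.prod .rule (.list .rule)) c')
  have hred := Cp.redBy ((hT.comp x.snd).comp z.snd) z.fst.fst (hp.snd.fst.comp z.snd)
  have h := Cp.listElim hs.fst (hs.snd.inl (.prod .wpoly .wpoly))
    (Cp.listElim hf ((hlow.pair (((ht.fst.mul hp.fst).pair hm).cons hdn)).inr .wpoly)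
      ((((Cp.scale ((ht.fst.mul hp.fst).comp z.snd) hred).append
        (hlow.comp z.snd)).pair (hdn.comp z.snd)).inr .wpoly))
  refine h.of_eq fun e x => ?_
  rcases hse : s e x with ⟨_ | ⟨t, l⟩, dn⟩
  · rfl
  · obtain rfl : (s e x).2 = dn := by rw [hse]
    simp only [PBWRed.listElim]
    rw [Sys.nfStep]
    rcases ((R e x).filter fun ρ => Rule.Divides (K := e.K) ρ (((rawSys (T e x)).sort t.2.2 t.2.1).2.1, t.2.2))
      with _ | ⟨ρ, R'⟩ <;> rfl

theorem Cp.addTerm {s : ∀ e : Env.{u}, c.Val e.K → Ty.wterm.Val e.K} (hs : Cp s) (hl : Cp l) :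
    Cp (b := .wpoly) fun e x =>
      PBWRed.addTerm (K := e.K) (ι := Ty.nat.Val e.K) (κ := Ty.nat.Val e.K) (s e x) (l e x) := by
  have x := Cp.id.{u} (.prod c (.prod .wterm (.prod .wpoly .wpoly)))
  have ht := hs.comp x.fst
  exact Cp.listRec (s := .wpoly) (f := fun e x l =>
    PBWRed.addTerm (K := e.K) (ι := Ty.nat.Val e.K) (κ := Ty.nat.Val e.K) (s e x) l)
    (hs.cons (Cp.nil c .wterm))
    (CpB.ite (eqCp_wmon.comp x.snd.fst.snd ht.snd)
      (((x.snd.fst.fst.add ht.fst).pair x.snd.fst.snd).cons x.snd.snd.fst)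
      (x.snd.fst.cons x.snd.snd.snd))
    (fun e x => rfl) (fun e x y l => rfl) hl

theorem Cp.collect (hl : Cp l) : Cp (b := .wpoly) fun e x =>
    PBWRed.collect (K := e.K) (ι := Ty.nat.Val e.K) (κ := Ty.nat.Val e.K) (l e x) := by
  classical
  have x := Cp.id.{u} (.prod c (.prod .wterm .wpoly))
  have y := Cp.id.{u} (.prod c .wterm)
  refine (Cp.filter (Cp.foldr hl (Cp.nil c .wterm) (Cp.addTerm x.snd.fst x.snd.snd))
    (CpB.isZero y.snd.fst).not).of_eq fun e x => ?_
  rw [PBWRed.collect]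

/-- The range `0, …, n - 1` in unary notation. -/
def rawRange {α : Type*} : List α → List (List α)
  | [] => []
  -- If the argument is `n` in unary notation, `l` is `n - 1`, the last entry of the range.
  | _ :: l => rawRange l ++ [l]

theorem Cp.rawRange (hi : Cp i) : Cp (b := .word) fun e x => PBWRed.rawRange (i e x) := by
  have x := Cp.id.{u} (.prod c (.prod .one (.prod .nat .word)))
  exact Cp.listRec (s := .word) (f := fun e x l => PBWRed.rawRange l) (Cp.nil c .nat)
    (x.snd.snd.snd.append (x.snd.snd.fst.cons (Cp.nil _ .nat))) (fun e x => rfl)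
    (fun e x y l => rfl) hi

/-- The exponent of a word. -/
def rawExpo {K : Type u} (n : Ty.nat.Val K) (w : Ty.word.Val K) : Ty.expo.Val K :=
  (rawRange n).map fun i => (w.filter fun j => i = j).map fun _ => PUnit.unit

theorem Cp.rawExpo (hi : Cp i) {w : ∀ e : Env.{u}, c.Val e.K → Ty.word.Val e.K} (hw : Cp w) :
    Cp (b := .expo) fun e x => PBWRed.rawExpo (i e x) (w e x) := by
  have x := Cp.id.{u} (.prod c .nat)
  have y := Cp.id.{u} (.prod (.prod c .nat) .nat)
  exact Cp.map (Cp.rawRange hi) (Cp.map (Cp.filter (hw.comp x.fst) (eqCp_nat.comp y.fst.snd y.snd))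
    (Cp.unit (.prod (.prod c .nat) .nat)))

/-- The comparison of words in components by their exponents. -/
def rawLt (e : Env.{u}) (n : Ty.nat.Val e.K) (t t' : Ty.wmon.Val e.K) : Prop :=
  e.ord (rawExpo n t.1, t.2) (rawExpo n t'.1, t'.2)

theorem CpB.rawLt (hi : Cp i) (ht : Cp t) {t' : ∀ e : Env.{u}, c.Val e.K → Ty.wmon.Val e.K}
    (ht' : Cp t') : CpB fun e x => PBWRed.rawLt e (i e x) (t e x) (t' e x) :=
  CpB.less ((Cp.rawExpo hi ht.fst).pair ht.snd) ((Cp.rawExpo hi ht'.fst).pair ht'.snd)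

theorem Cp.front (hi : Cp i) (hl : Cp l) : Cp (b := .wpoly) fun e x =>
    PBWRed.front (K := e.K) (ι := Ty.nat.Val e.K) (κ := Ty.nat.Val e.K)
      (PBWRed.rawLt e (i e x)) (l e x) := by
  classical
  let c' : Ty := .prod c (.prod .wterm (.prod .wpoly .wpoly))
  have x := Cp.id.{u} c'
  have y := Cp.id.{u} (.prod (.prod .wterm .wpoly) c')
  refine Cp.listRec (s := .wpoly) (f := fun e x l =>
    PBWRed.front (K := e.K) (ι := Ty.nat.Val e.K) (κ := Ty.nat.Val e.K)
      (PBWRed.rawLt e (i e x)) l) (Cp.nil c .wterm)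
    (Cp.listElim x.snd.snd.snd (x.snd.fst.cons (Cp.nil _ .wterm))
      (CpB.ite (CpB.rawLt (hi.comp y.snd.fst) y.fst.fst.snd y.snd.snd.fst.snd)
        (y.snd.snd.fst.cons (y.fst.fst.cons y.fst.snd))
        (y.fst.fst.cons (y.snd.snd.fst.cons y.fst.snd))))
    (fun e x => rfl) (fun e x y l => ?_) hl
  rw [PBWRed.front]
  rcases PBWRed.front (K := e.K) (PBWRed.rawLt e (i e x)) l with _ | ⟨s, l'⟩
  · rfl
  · simp only [PBWRed.listElim]

theorem Cp.mkRules (hl : Cp l) : Cp (b := .list .rule) fun e x =>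
    PBWRed.mkRules (K := e.K) (ι := Ty.nat.Val e.K) (κ := Ty.nat.Val e.K) (l e x) := by
  have x := Cp.id.{u} (.prod (.prod .wterm .wpoly) c)
  have hr : Cp (a := .prod (.prod .wterm .wpoly) c) (b := .rule) _ :=
    x.fst.fst.snd.pair (Cp.scale x.fst.fst.fst.inv.neg x.fst.snd)
  refine (Cp.listElim hl (Cp.nil c .rule) (hr.cons (Cp.nil _ .rule))).of_eq fun e x => ?_
  generalize l e x = l
  cases l <;> rfl

theorem Cp.spair (hT : Cp T) (hρ : Cp ρ) (hρ' : Cp ρ') :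
    Cp (b := .wpoly) fun e x => (rawSys (T e x)).spair (ρ e x) (ρ' e x) := by
  have hb := (Cp.diff eqCp_nat hρ.fst.fst hρ'.fst.fst).append hρ'.fst.fst
  exact CpB.ite (eqCp_nat.comp hρ.fst.snd hρ'.fst.snd)
    ((Cp.redBy hT hρ hb).append (Cp.scale (Cp.one c).neg (Cp.redBy hT hρ' hb))) (Cp.nil c .wterm)

theorem Cp.ruleTerms (hρ : Cp ρ) : Cp (b := .wpoly) fun e x =>
    Rule.terms (K := e.K) (ι := Ty.nat.Val e.K) (κ := Ty.nat.Val e.K) (ρ e x) :=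
  ((Cp.one c).pair hρ.fst).cons (Cp.scale (Cp.one c).neg hρ.snd)

theorem Cp.newPairs (hT : Cp T) {vars : ∀ e : Env.{u}, c.Val e.K → Ty.word.Val e.K}
    (hv : Cp vars) {R : ∀ e : Env.{u}, c.Val e.K → (Ty.list .rule).Val e.K} (hR : Cp R)
    (hρ : Cp ρ) : Cp (b := .list .wpoly) fun e x =>
      (rawSys (T e x)).newPairs (vars e x) (R e x) (ρ e x) := by
  have x := Cp.id.{u} (.prod c .rule)
  have y := Cp.id.{u} (.prod c .nat)
  exact (Cp.map hR (Cp.spair (hT.comp x.fst) (hρ.comp x.fst) x.snd)).append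
    (Cp.map hv (Cp.rmulWTerms y.snd (Cp.ruleTerms (hρ.comp y.fst))))

theorem Cp.minimize {R : ∀ e : Env.{u}, c.Val e.K → (Ty.list .rule).Val e.K} (hR : Cp R) :
    Cp (b := .list .rule) fun e x =>
      PBWRed.minimize (K := e.K) (ι := Ty.nat.Val e.K) (κ := Ty.nat.Val e.K) (R e x) := by
  have x := Cp.id.{u} (.prod c (.prod .rule (.prod (.list .rule) (.list .rule))))
  have y := Cp.id.{u} (.prod (.prod c (.prod .rule (.prod (.list .rule) (.list .rule)))) .rule)
  refine Cp.listRec (s := .list .rule) (f := fun e x l =>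
    PBWRed.minimize (K := e.K) (ι := Ty.nat.Val e.K) (κ := Ty.nat.Val e.K) l) (Cp.nil c .rule)
    (x.snd.fst.cons (Cp.filter x.snd.snd.snd (CpB.divides y.fst.snd.fst y.snd.fst).not))
    (fun e x => rfl) (fun e x y l => ?_) hR
  rw [PBWRed.minimize]

theorem Cp.complStep (hT : Cp T) (hi : Cp i) {vars : ∀ e : Env.{u}, c.Val e.K → Ty.word.Val e.K}
    (hv : Cp vars) {R H : ∀ e : Env.{u}, c.Val e.K → (Ty.list .rule).Val e.K} (hR : Cp R)
    (hH : Cp H) {Q : ∀ e : Env.{u}, c.Val e.K → (Ty.list .wpoly).Val e.K} (hQ : Cp Q) (hl : Cp l) :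
    Cp (b := .prod (.list .rule) (.list .wpoly)) fun e x =>
      (rawSys (T e x)).complStep (vars e x) (PBWRed.rawLt e (i e x)) (R e x) (H e x) (Q e x)
        (l e x) := by
  have hm := Cp.mkRules (Cp.front hi (Cp.collect hl))
  have x := Cp.id.{u} (.prod c .rule)
  exact (hm.append hH).pair ((Cp.flatMap hm (Cp.newPairs (hT.comp x.fst) (hv.comp x.fst)
    ((hR.comp x.fst).append (hH.comp x.fst)) x.snd)).append hQ)

end Raw

end PBWRed

namespace PBWRed

/-! ### Compatibility of the algorithm with encodings -/

section Naturality

variable {K ι κ ι' κ' : Type*} [Field K] [DecidableEq ι] [DecidableEq κ] [DecidableEq ι']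
  [DecidableEq κ'] {φ : ι → ι'} {ψ : κ → κ'}

def mapPTerm (φ : ι → ι') (t : K × List ι) : K × List ι' := (t.1, t.2.map φ)

def mapWMon (φ : ι → ι') (ψ : κ → κ') (t : List ι × κ) : List ι' × κ' := (t.1.map φ, ψ t.2)

def mapWTerm (φ : ι → ι') (ψ : κ → κ') (t : WTerm K ι κ) : WTerm K ι' κ' :=
  (t.1, mapWMon φ ψ t.2)

def mapRule (φ : ι → ι') (ψ : κ → κ') (ρ : Rule K ι κ) : Rule K ι' κ' :=
  (mapWMon φ ψ ρ.1, ρ.2.map (mapWTerm φ ψ))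

/-- `S'` describes the same commutation relations as `S`, for renamed variables and components. -/
structure SysRel (φ : ι → ι') (ψ : κ → κ') (S : Sys K ι κ) (S' : Sys K ι' κ') : Prop where
  le : ∀ i j, S'.le (φ i) (φ j) = S.le i j
  cf : ∀ e i j, S'.cf (ψ e) (φ i) (φ j) = S.cf e i j
  dw : ∀ e i j, S'.dw (ψ e) (φ i) (φ j) = (S.dw e i j).map (mapPTerm φ)

theorem scale_mapPTerm (c : K) (l : List (K × List ι)) :
    scale c (l.map (mapPTerm φ)) = (scale c l).map (mapPTerm φ) := by
  simp [scale, mapPTerm]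

theorem scale_mapWTerm (c : K) (l : List (WTerm K ι κ)) :
    scale c (l.map (mapWTerm φ ψ)) = (scale c l).map (mapWTerm φ ψ) := by
  simp [scale, mapWTerm]

theorem lmulTerms_map (w : List ι) (l : List (K × List ι)) :
    lmulTerms (w.map φ) (l.map (mapPTerm φ)) = (lmulTerms w l).map (mapPTerm φ) := by
  simp [lmulTerms, mapPTerm]

theorem lmulWTerms_map (w : List ι) (l : List (WTerm K ι κ)) :
    lmulWTerms (w.map φ) (l.map (mapWTerm φ ψ)) = (lmulWTerms w l).map (mapWTerm φ ψ) := by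
  simp [lmulWTerms, mapWTerm, mapWMon]

theorem rmulWTerms_map (i : ι) (l : List (WTerm K ι κ)) :
    rmulWTerms (φ i) (l.map (mapWTerm φ ψ)) = (rmulWTerms i l).map (mapWTerm φ ψ) := by
  simp [rmulWTerms, mapWTerm, mapWMon]

theorem atComp_map (e : κ) (l : List (K × List ι)) :
    atComp (ψ e) (l.map (mapPTerm φ)) = (atComp e l).map (mapWTerm φ ψ) := by
  simp [atComp, mapWTerm, mapWMon, mapPTerm]

/-- Renaming of the variables in the result of sorting. -/
def mapSorted (φ : ι → ι') (r : K × (List ι × List (K × List ι))) :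
    K × (List ι' × List (K × List ι')) :=
  (r.1, (r.2.1.map φ, r.2.2.map (mapPTerm φ)))

variable {S : Sys K ι κ} {S' : Sys K ι' κ'}

theorem SysRel.ins_map (h : SysRel φ ψ S S') (e : κ) (i : ι) (w : List ι) :
    S'.ins (ψ e) (φ i) (w.map φ) = mapSorted φ (S.ins e i w) := by
  induction w with
  | nil => simp [Sys.ins, mapSorted]
  | cons j u ih =>
    rw [List.map_cons, Sys.ins, Sys.ins, h.le, h.cf, h.dw, ih]
    cases S.le i j
    · have h2 := lmulTerms_map (φ := φ) [j] (S.ins e i u).2.2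
      rw [List.map_singleton] at h2
      simp only [cond_false, mapSorted, List.map_cons, List.map_append, h2, scale_mapPTerm,
        List.map_map]
      congr 4
      funext t
      simp [mapPTerm]
    · simp [mapSorted]

theorem SysRel.sort_map (h : SysRel φ ψ S S') (e : κ) (w : List ι) :
    S'.sort (ψ e) (w.map φ) = mapSorted φ (S.sort e w) := by
  induction w with
  | nil => simp [Sys.sort, mapSorted]
  | cons i w ih =>
    have h1 := h.ins_map e i (S.sort e w).2.1
    have h2 := lmulTerms_map (φ := φ) [i] (S.sort e w).2.2
    rw [List.map_singleton] at h2
    simp only [List.map_cons, Sys.sort, ih]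
    simp only [mapSorted] at h1 ⊢
    simp only [h1, h2, scale_mapPTerm, List.map_append]

/-- Sorting commutes with any renaming related by `SysRel`, but list difference compares letters for
equality, whence the injectivity of `φ`. -/
theorem SysRel.redBy_map (h : SysRel φ ψ S S') (hφ : Function.Injective φ) (ρ : Rule K ι κ)
    (b : List ι) : S'.redBy (mapRule φ ψ ρ) (b.map φ) = (S.redBy ρ b).map (mapWTerm φ ψ) := by
  have hp : S'.prodSort (mapRule φ ψ ρ) (b.map φ) = mapSorted φ (S.prodSort ρ b) := by
    rw [Sys.prodSort, Sys.prodSort, ← h.sort_map, List.map_append, List.map_diff hφ]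
    rfl
  have hd : (b.map φ).diff (mapRule φ ψ ρ).1.1 = (b.diff ρ.1.1).map φ := (List.map_diff hφ).symm
  rw [Sys.redBy, Sys.redBy, hp, hd]
  simp only [mapSorted, mapRule]
  rw [lmulWTerms_map, scale_mapWTerm, List.map_append]
  simp only [mapWMon]
  rw [atComp_map, scale_mapWTerm]

theorem divides_map (hφ : Function.Injective φ) (hψ : Function.Injective ψ) (ρ : Rule K ι κ)
    (t : List ι × κ) : (mapRule φ ψ ρ).Divides (mapWMon φ ψ t) ↔ ρ.Divides t := by
  simp only [Rule.Divides, mapRule, mapWMon]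
  rw [hψ.eq_iff, ← List.map_diff hφ, List.map_eq_nil_iff]

theorem filter_map_of_iff {α β : Type*} {f : α → β} {p : α → Prop} {q : β → Prop} [DecidablePred p]
    [DecidablePred q] (h : ∀ a, q (f a) ↔ p a) (l : List α) :
    (l.map f).filter (fun b => q b) = (l.filter fun a => p a).map f := by
  induction l with
  | nil => rfl
  | cons a l ih =>
    by_cases ha : p a
    · rw [List.map_cons, List.filter_cons_of_pos (by simpa using (h a).2 ha),
        List.filter_cons_of_pos (by simpa using ha), ih, List.map_cons]
    · rw [List.map_cons, List.filter_cons_of_neg (by simpa [h] using ha),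
        List.filter_cons_of_neg (by simpa using ha), ih]

def mapNFState (φ : ι → ι') (ψ : κ → κ') (s : List (WTerm K ι κ) × List (WTerm K ι κ)) :
    List (WTerm K ι' κ') × List (WTerm K ι' κ') :=
  (s.1.map (mapWTerm φ ψ), s.2.map (mapWTerm φ ψ))

/-- Variables and components are inspected only through `le`, the tables and equality tests, all
preserved by injective renaming. In particular the same first applicable rule is selected on both
sides. -/
theorem SysRel.nfStep_map (h : SysRel φ ψ S S') (hφ : Function.Injective φ)
    (hψ : Function.Injective ψ) (R : List (Rule K ι κ))
    (s : List (WTerm K ι κ) × List (WTerm K ι κ)) :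
    S'.nfStep (R.map (mapRule φ ψ)) (mapNFState φ ψ s) =
      Sum.map (List.map (mapWTerm φ ψ)) (mapNFState φ ψ) (S.nfStep R s) := by
  obtain ⟨l, dn⟩ := s
  cases l with
  | nil => rfl
  | cons t l =>
    have h1 : S'.sort (mapWTerm φ ψ t).2.2 (mapWTerm φ ψ t).2.1 =
        mapSorted φ (S.sort t.2.2 t.2.1) := h.sort_map _ _
    have h2 := filter_map_of_iff (f := mapRule (K := K) φ ψ)
      (p := fun ρ => ρ.Divides ((S.sort t.2.2 t.2.1).2.1, t.2.2))
      (q := fun ρ => ρ.Divides (mapWMon φ ψ ((S.sort t.2.2 t.2.1).2.1, t.2.2)))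
      (fun ρ => divides_map (K := K) hφ hψ ρ _) R
    have h3 := fun ρ => h.redBy_map hφ ρ (S.sort t.2.2 t.2.1).2.1
    have h4 := atComp_map (K := K) (φ := φ) (ψ := ψ) t.2.2 (S.sort t.2.2 t.2.1).2.2
    have h5 : (R.map (mapRule φ ψ)).filter (fun ρ => ρ.Divides
        ((S'.sort (mapWTerm φ ψ t).2.2 (mapWTerm φ ψ t).2.1).2.1, (mapWTerm φ ψ t).2.2)) =
        (R.filter fun ρ => ρ.Divides ((S.sort t.2.2 t.2.1).2.1, t.2.2)).map (mapRule φ ψ) := by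
      rw [h1]; exact h2
    simp only [mapNFState, List.map_cons]
    rw [Sys.nfStep, Sys.nfStep, h5, h1]
    simp only [mapSorted]
    simp only [mapWTerm, mapWMon] at h4 ⊢
    rcases hF : R.filter (fun ρ => ρ.Divides ((S.sort t.2.2 t.2.1).2.1, t.2.2)) with _ | ⟨ρ, R'⟩
    · simp only [hF, List.map_nil, Sum.map_inr, mapNFState, List.map_append, List.map_cons]
      rw [h4]
      erw [scale_mapWTerm]
      rfl
    · simp only [hF, List.map_cons, Sum.map_inr, mapNFState, List.map_append]
      rw [h4, h3]
      erw [scale_mapWTerm, scale_mapWTerm]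

theorem mapWMon_injective (hφ : Function.Injective φ) (hψ : Function.Injective ψ) :
    Function.Injective (mapWMon φ ψ) := by
  rintro ⟨w, e⟩ ⟨w', e'⟩ h
  rw [mapWMon, mapWMon, Prod.mk.injEq] at h
  exact Prod.ext (List.map_injective_iff.2 hφ h.1) (hψ h.2)

theorem addTerm_map (hφ : Function.Injective φ) (hψ : Function.Injective ψ) (t : WTerm K ι κ)
    (l : List (WTerm K ι κ)) : addTerm (mapWTerm φ ψ t) (l.map (mapWTerm φ ψ)) =
      (addTerm t l).map (mapWTerm φ ψ) := by
  induction l with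
  | nil => rfl
  | cons s l ih =>
    rw [List.map_cons, addTerm, addTerm, ih]
    have : (mapWTerm φ ψ s).2 = (mapWTerm φ ψ t).2 ↔ s.2 = t.2 :=
      (mapWMon_injective hφ hψ).eq_iff
    by_cases hst : s.2 = t.2
    · rw [if_pos hst, if_pos (this.2 hst)]; rfl
    · rw [if_neg hst, if_neg (mt this.1 hst)]; rfl

theorem collect_map (hφ : Function.Injective φ) (hψ : Function.Injective ψ)
    (l : List (WTerm K ι κ)) : collect (l.map (mapWTerm φ ψ)) =
      (collect l).map (mapWTerm φ ψ) := by
  classical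
  have h1 : (l.map (mapWTerm φ ψ)).foldr addTerm [] =
      (l.foldr addTerm []).map (mapWTerm φ ψ) := by
    induction l with
    | nil => rfl
    | cons t l ih => rw [List.map_cons, List.foldr_cons, ih, addTerm_map hφ hψ, List.foldr_cons]
  rw [collect, collect, h1]
  exact filter_map_of_iff (p := fun t : WTerm K ι κ => t.1 ≠ 0)
    (q := fun t : WTerm K ι' κ' => t.1 ≠ 0) (fun t => Iff.rfl) _

theorem front_map {lt : List ι × κ → List ι × κ → Prop} {lt' : List ι' × κ' → List ι' × κ' → Prop}
    (h : ∀ a b, lt' (mapWMon φ ψ a) (mapWMon φ ψ b) ↔ lt a b) (l : List (WTerm K ι κ)) :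
    front lt' (l.map (mapWTerm φ ψ)) = (front lt l).map (mapWTerm φ ψ) := by
  induction l with
  | nil => rfl
  | cons t l ih =>
    rw [List.map_cons, front, front, ih]
    rcases front lt l with _ | ⟨s, l'⟩
    · rfl
    · simp only [List.map_cons]
      have h' : lt' (mapWTerm φ ψ s).2 (mapWTerm φ ψ t).2 ↔ lt s.2 t.2 := h _ _
      by_cases hst : lt s.2 t.2
      · rw [if_pos hst, if_pos (h'.2 hst)]; rfl
      · rw [if_neg hst, if_neg (mt h'.1 hst)]; rfl

theorem mkRules_map (l : List (WTerm K ι κ)) :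
    mkRules (l.map (mapWTerm φ ψ)) = (mkRules l).map (mapRule φ ψ) := by
  cases l with
  | nil => rfl
  | cons s l =>
    rw [List.map_cons, mkRules, mkRules, List.map_singleton, scale_mapWTerm]
    rfl

theorem SysRel.spair_map (h : SysRel φ ψ S S') (hφ : Function.Injective φ)
    (hψ : Function.Injective ψ) (ρ ρ' : Rule K ι κ) :
    S'.spair (mapRule φ ψ ρ) (mapRule φ ψ ρ') = (S.spair ρ ρ').map (mapWTerm φ ψ) := by
  rw [Sys.spair, Sys.spair]
  have hb : (mapRule φ ψ ρ).1.1.diff (mapRule φ ψ ρ').1.1 ++ (mapRule φ ψ ρ').1.1 =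
      (ρ.1.1.diff ρ'.1.1 ++ ρ'.1.1).map φ := by
    rw [List.map_append, List.map_diff hφ]; rfl
  have he : (mapRule φ ψ ρ).1.2 = (mapRule φ ψ ρ').1.2 ↔ ρ.1.2 = ρ'.1.2 := hψ.eq_iff
  by_cases hc : ρ.1.2 = ρ'.1.2
  · rw [if_pos hc, if_pos (he.2 hc), hb, h.redBy_map hφ, h.redBy_map hφ, scale_mapWTerm,
      List.map_append]
  · rw [if_neg hc, if_neg (mt he.1 hc)]; rfl

theorem terms_map (ρ : Rule K ι κ) :
    (mapRule φ ψ ρ).terms = ρ.terms.map (mapWTerm φ ψ) := by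
  rw [Rule.terms, Rule.terms, List.map_cons, ← scale_mapWTerm]
  rfl

theorem SysRel.newPairs_map (h : SysRel φ ψ S S') (hφ : Function.Injective φ)
    (hψ : Function.Injective ψ) (vars : List ι) (R : List (Rule K ι κ)) (ρ : Rule K ι κ) :
    S'.newPairs (vars.map φ) (R.map (mapRule φ ψ)) (mapRule φ ψ ρ) =
      (S.newPairs vars R ρ).map (List.map (mapWTerm φ ψ)) := by
  rw [Sys.newPairs, Sys.newPairs, List.map_append, List.map_map, List.map_map, List.map_map,
    List.map_map]
  congr 1
  · exact List.map_congr_left fun ρ' _ => h.spair_map hφ hψ ρ ρ'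
  · refine List.map_congr_left fun i _ => ?_
    simp only [Function.comp, terms_map, rmulWTerms_map]

theorem minimize_map (hφ : Function.Injective φ) (hψ : Function.Injective ψ)
    (H : List (Rule K ι κ)) :
    minimize (H.map (mapRule φ ψ)) = (minimize H).map (mapRule φ ψ) := by
  induction H with
  | nil => rfl
  | cons ρ H ih =>
    rw [List.map_cons, minimize, minimize, ih, List.map_cons]
    congr 1
    exact filter_map_of_iff (p := fun ρ' : Rule K ι κ => ¬ ρ.Divides ρ'.1)
      (q := fun ρ' : Rule K ι' κ' => ¬ (mapRule φ ψ ρ).Divides ρ'.1)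
      (fun ρ' : Rule K ι κ => not_congr (divides_map hφ hψ ρ ρ'.1)) _

def mapComplState (φ : ι → ι') (ψ : κ → κ') (s : List (Rule K ι κ) × List (List (WTerm K ι κ))) :
    List (Rule K ι' κ') × List (List (WTerm K ι' κ')) :=
  (s.1.map (mapRule φ ψ), s.2.map (List.map (mapWTerm φ ψ)))

theorem SysRel.complStep_map (h : SysRel φ ψ S S') (hφ : Function.Injective φ)
    (hψ : Function.Injective ψ) {lt : List ι × κ → List ι × κ → Prop}
    {lt' : List ι' × κ' → List ι' × κ' → Prop}
    (hlt : ∀ a b, lt' (mapWMon φ ψ a) (mapWMon φ ψ b) ↔ lt a b) (vars : List ι)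
    (R H : List (Rule K ι κ)) (Q : List (List (WTerm K ι κ))) (r : List (WTerm K ι κ)) :
    S'.complStep (vars.map φ) lt' (R.map (mapRule φ ψ)) (H.map (mapRule φ ψ))
        (Q.map (List.map (mapWTerm φ ψ))) (r.map (mapWTerm φ ψ)) =
      mapComplState φ ψ (S.complStep vars lt R H Q r) := by
  simp only [Sys.complStep, mapComplState]
  rw [collect_map hφ hψ, front_map hlt, mkRules_map, List.map_append, List.map_append,
    List.flatMap_map, List.map_flatMap]
  congr 3
  funext ρ
  rw [← List.map_append]
  exact h.newPairs_map hφ hψ vars (R ++ H) ρ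

end Naturality

end PBWRed

namespace PBWRed

/-! ### The input of the algorithm -/

section Input

variable {K : Type*} [Field K] {n : ℕ}

/-- The terms of a polynomial, with words instead of exponents. -/
def termsOf (f : PolyTerms K n) : List (K × List (Fin n)) := f.map fun t => (t.1, stdList t.2)

theorem pv_termsOf {A : Type*} [Ring A] [Algebra K A] (π : Free K n →ₐ[K] A)
    (f : PolyTerms K n) : pv π (termsOf f) = π (polyOf f) := by
  rw [pv, termsOf, polyOf, List.map_map, map_list_sum, List.map_map]
  congr 1
  refine List.map_congr_left fun t _ => ?_
  simp only [Function.comp, wv_stdList, map_smul]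
  rfl

/-- The terms of a polynomial after collecting the terms with the same monomial. -/
noncomputable def normTerms {ι κ : Type*} [DecidableEq ι] [DecidableEq κ] (e : κ)
    (l : List (K × List ι)) : List (K × List ι) :=
  (collect (atComp e l)).map fun t => (t.1, t.2.1)

theorem mem_atComp {ι κ : Type*} {e : κ} {l : List (K × List ι)} {s : WTerm K ι κ}
    (hs : s ∈ atComp e l) : s.2.2 = e ∧ ∃ t ∈ l, s.2.1 = t.2 := by
  obtain ⟨t, ht, rfl⟩ := List.mem_map.1 hs
  exact ⟨rfl, t, ht, rfl⟩

theorem collect_atComp_comp {ι κ : Type*} [DecidableEq ι] [DecidableEq κ] {e : κ}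
    {l : List (K × List ι)} {s : WTerm K ι κ} (hs : s ∈ collect (atComp e l)) :
    s.2.2 = e ∧ ∃ t ∈ l, s.2.1 = t.2 := by
  obtain ⟨r, hr, hk⟩ := collect_keys s hs
  rw [hk]
  exact mem_atComp hr

theorem atComp_normTerms {ι κ : Type*} [DecidableEq ι] [DecidableEq κ] (e : κ)
    (l : List (K × List ι)) : atComp e (normTerms e l) = collect (atComp e l) := by
  rw [atComp, normTerms, List.map_map]
  conv_rhs => rw [← List.map_id (collect (atComp e l))]
  refine List.map_congr_left fun t ht => ?_
  simp only [Function.comp, id]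
  rw [← (collect_atComp_comp ht).1]

theorem normTerms_pairwise {ι κ : Type*} [DecidableEq ι] [DecidableEq κ] (e : κ)
    (l : List (K × List ι)) : (normTerms e l).Pairwise fun a b => a.2 ≠ b.2 := by
  rw [normTerms, List.pairwise_map]
  refine (collect_pairwise (atComp e l)).imp_of_mem fun {a b} ha hb hab h => hab ?_
  exact Prod.ext h ((collect_atComp_comp ha).1.trans (collect_atComp_comp hb).1.symm)

theorem normTerms_ne_zero {ι κ : Type*} [DecidableEq ι] [DecidableEq κ] {e : κ}
    {l : List (K × List ι)} {t : K × List ι} (ht : t ∈ normTerms e l) : t.1 ≠ 0 := by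
  obtain ⟨s, hs, rfl⟩ := List.mem_map.1 ht
  exact collect_ne_zero hs

theorem pv_normTerms {κ : Type*} [Finite κ] [DecidableEq κ] {A : Type*} [Ring A] [Algebra K A]
    (π : Free K n →ₐ[K] A) (e : κ) (l : List (K × List (Fin n))) :
    pv π (normTerms e l) = pv π l := by
  have h := mv_collect (π := π) (atComp e l)
  rw [← atComp_normTerms, mv_atComp, mv_atComp] at h
  have h' := congrFun h e
  simpa only [Pi.smul_apply, mon_apply_self, xm_zero, smul_eq_mul, mul_one] using h'

open Classical in
theorem coeff_pv (l : List (K × List (Fin n))) (w : Word n) :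
    (pv (AlgHom.id K (Free K n)) l).coeff w =
      (l.map fun t => if FreeMonoid.ofList t.2 = w then t.1 else 0).sum := by
  induction l with
  | nil => rfl
  | cons t l ih =>
    rw [pv_cons, MonoidAlgebra.coeff_add, Finsupp.add_apply, ih, List.map_cons, List.sum_cons,
      MonoidAlgebra.coeff_smul, Finsupp.smul_apply, wv, AlgHom.id_apply, MonoidAlgebra.coeff_single,
      Finsupp.single_apply, smul_eq_mul, mul_ite, mul_one, mul_zero]

theorem coeff_pv_of_mem {l : List (K × List (Fin n))} (hl : l.Pairwise fun a b => a.2 ≠ b.2)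
    {t : K × List (Fin n)} (ht : t ∈ l) :
    (pv (AlgHom.id K (Free K n)) l).coeff (FreeMonoid.ofList t.2) = t.1 := by
  rw [coeff_pv]
  induction l with
  | nil => cases ht
  | cons s l ih =>
    rw [List.pairwise_cons] at hl
    rw [List.map_cons, List.sum_cons]
    rcases List.mem_cons.1 ht with rfl | ht
    · rw [if_pos rfl, List.sum_eq_zero, add_zero]
      intro x hx
      obtain ⟨r, hr, rfl⟩ := List.mem_map.1 hx
      exact if_neg fun h => hl.1 r hr (FreeMonoid.ofList.injective h).symm
    · rw [if_neg fun h => hl.1 t ht (FreeMonoid.ofList.injective h), zero_add, ih hl.2 ht]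

theorem exists_of_coeff_pv_ne {l : List (K × List (Fin n))} {w : Word n}
    (h : (pv (AlgHom.id K (Free K n)) l).coeff w ≠ 0) : ∃ t ∈ l, FreeMonoid.ofList t.2 = w := by
  by_contra hne
  refine h ?_
  rw [coeff_pv, List.sum_eq_zero]
  intro x hx
  obtain ⟨r, hr, rfl⟩ := List.mem_map.1 hx
  exact if_neg fun h => hne ⟨r, hr, h⟩

/-- A list of terms may contain zero or cancelling terms. After collection each listed coefficient
is a true coefficient of the polynomial, so that the bounds in the datum apply to the list. -/
theorem coeff_polyOf_of_mem {κ : Type*} [Finite κ] [DecidableEq κ] {e : κ} {f : PolyTerms K n}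
    {t : K × List (Fin n)} (ht : t ∈ normTerms e (termsOf f)) :
    (polyOf f).coeff (FreeMonoid.ofList t.2) = t.1 := by
  have h := coeff_pv_of_mem (normTerms_pairwise e (termsOf f)) ht
  rwa [pv_normTerms, pv_termsOf] at h

theorem exists_of_coeff_polyOf_ne {κ : Type*} [Finite κ] [DecidableEq κ] (e : κ)
    {f : PolyTerms K n} {w : Word n}
    (h : (polyOf f).coeff w ≠ 0) : ∃ t ∈ normTerms e (termsOf f), FreeMonoid.ofList t.2 = w := by
  refine exists_of_coeff_pv_ne ?_
  rw [pv_normTerms, pv_termsOf]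
  exact h

variable {k : ℕ} {A : Type*} [Ring A] [Algebra K A] {π : Free K n →ₐ[K] A}
  {lt : Expo n × Fin k → Expo n × Fin k → Prop} {R : Fin k → RawDatum K n}

/-- The commutation relations of the data. -/
noncomputable def inputSys (R : Fin k → RawDatum K n) : Sys K (Fin n) (Fin k) where
  le i j := decide (i ≤ j)
  cf e i j := (R e).c i j
  -- Cancelling terms above `x_i x_j` would destroy the bound on exponents, so the terms are
  -- collected first; `()` is a dummy component.
  dw e i j := normTerms () (termsOf ((R e).d i j))

theorem compatible_inputSys (h : IsModuleDatum π lt fun e => (R e).toDatum) :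
    (inputSys R).Compatible π lt where
  ordering := h.ordering
  le_iff i j := by simp [inputSys]
  cf_ne e i j hij := (h.datum e).comm.c_ne_zero i j hij
  rel e i j hij := by
    rw [h.wv_rel e hij]
    congr 1
    exact ((pv_normTerms π () _).trans (pv_termsOf π _)).symm
  dw_lt e i j hij t ht := by
    refine h.d_lt e hij (w := FreeMonoid.ofList t.2) ?_
    have := coeff_polyOf_of_mem ht
    change (polyOf ((R e).d i j)).coeff _ ≠ 0
    rw [this]
    exact normTerms_ne_zero ht

/-- The rules given by the relations in the data. -/
noncomputable def inputRules (lt : Expo n × Fin k → Expo n × Fin k → Prop)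
    (R : Fin k → RawDatum K n) : List (Rule K (Fin n) (Fin k)) :=
  (List.finRange k).flatMap fun e => (R e).I.flatMap fun f =>
    mkRules (front (exLt lt) (collect (atComp e (termsOf f))))

theorem termsOf_sorted (e : Fin k) (f : PolyTerms K n) :
    ∀ t ∈ atComp e (termsOf f), t.2.1.Pairwise (· ≤ ·) := by
  intro t ht
  obtain ⟨-, s, hs, hts⟩ := mem_atComp ht
  obtain ⟨r, -, rfl⟩ := List.mem_map.1 hs
  rw [hts]
  exact stdList_pairwise _

theorem mem_toDatum_I {e : Fin k} {f : PolyTerms K n} (hf : f ∈ (R e).I) :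
    polyOf f ∈ ((R e).toDatum).I := by
  simp only [RawDatum.toDatum, List.mem_toFinset]
  exact List.mem_map_of_mem hf

/-- Each relation vanishes in `A`, so its rule has element zero. The leading term found on the
collected list agrees with the leading exponent of the polynomial, because each is maximal among the
nonzero terms; zero polynomials give no rule. -/
theorem relRules_inputRules (h : IsModuleDatum π lt fun e => (R e).toDatum) :
    RelRules π lt (fun e => (R e).toDatum) (inputRules lt R) := by
  have key : ∀ ρ ∈ inputRules lt R, ρ.IsOk lt ∧ ρ.elem π = 0 := by
    intro ρ hρ
    simp only [inputRules, List.mem_flatMap] at hρ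
    obtain ⟨e, -, f, hf, hρ⟩ := hρ
    rcases hfr : front (exLt lt) (collect (atComp e (termsOf f))) with _ | ⟨s, l⟩
    · rw [hfr] at hρ; cases hρ
    · rw [hfr, mkRules, List.mem_singleton] at hρ
      subst hρ
      obtain ⟨h0, ⟨t, ht, hst⟩, hlow, hmv⟩ := h.front_collect (π := π) (termsOf_sorted e f) hfr
      refine ⟨⟨?_, ?_⟩, ?_⟩
      · rw [hst]; exact termsOf_sorted e f t ht
      · intro t' ht'
        obtain ⟨t'', ht'', hk⟩ := mem_scale ht'
        rw [hk]; exact hlow t'' ht''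
      · rw [mv_atComp, pv_termsOf, h.map_I e (mem_toDatum_I hf), zero_smul] at hmv
        have h1 : s.1⁻¹ • (s.1 • tv π s.2 + mv π l) = 0 := by rw [← hmv, smul_zero]
        rw [smul_add, smul_smul, inv_mul_cancel₀ h0, one_smul] at h1
        rw [Rule.elem, mv_scale, neg_smul, sub_neg_eq_add, h1]
  refine ⟨fun ρ hρ => (key ρ hρ).1, fun ρ hρ => (key ρ hρ).2, ?_⟩
  rintro e β ⟨g, hg, -, hl⟩
  obtain ⟨f, hf, rfl⟩ : ∃ f ∈ (R e).I, polyOf f = g := by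
    simpa only [RawDatum.toDatum, Finset.mem_coe, List.mem_toFinset, List.mem_map] using hg
  have hw := (h.datum e).well
  have hlm := (lexp_eq_some_of_isPoly hw ((h.datum e).I_poly _ (mem_toDatum_I hf))).1 hl
  rw [lm_eq_some_iff hw] at hlm
  obtain ⟨t, ht, htw⟩ := exists_of_coeff_polyOf_ne e hlm.1
  have hperm := front_perm (exLt lt) (collect (atComp e (termsOf f)))
  have ht' : (t.1, (t.2, e)) ∈ collect (atComp e (termsOf f)) := by
    rw [← atComp_normTerms]
    exact List.mem_map_of_mem ht
  rcases hfr : front (exLt lt) (collect (atComp e (termsOf f))) with _ | ⟨s, l⟩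
  · rw [hfr] at hperm
    rw [← hperm.nil_eq] at ht'
    cases ht'
  · rw [hfr] at hperm
    obtain ⟨h0, -, hlow, -⟩ := h.front_collect (π := π) (termsOf_sorted e f) hfr
    refine ⟨(s.2, scale (-s.1⁻¹) l), ?_, ?_⟩
    · simp only [inputRules, List.mem_flatMap]
      exact ⟨e, List.mem_finRange e, f, hf, by rw [hfr, mkRules]; exact List.mem_cons_self⟩
    · have hse := (collect_atComp_comp (hperm.subset List.mem_cons_self)).1
      have hcs : (s.1, s.2.1) ∈ normTerms e (termsOf f) :=
        List.mem_map_of_mem (hperm.subset List.mem_cons_self)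
      have hc := coeff_polyOf_of_mem hcs
      have hext : ex (t.2, e) = (β, e) := by
        rw [ex, ← wordExpo_ofList, htw, wordExpo_stdWord]
      have hs1 : ex s.2 = (listExpo s.2.1, e) := by rw [ex, hse]
      rcases List.mem_cons.1 (hperm.symm.subset ht') with hts | hts
      · rw [← hext, ← hts]
      · exfalso
        have h1 : lt (β, e) (ex s.2) := by
          have := hlow _ hts
          rwa [hext] at this
        have := h.ordering.total
        rcases hlm.2 (FreeMonoid.ofList s.2.1) (by rw [hc]; exact h0) with h2 | h2
        · have h3 : listExpo s.2.1 = β := by rw [← wordExpo_ofList, h2, wordExpo_stdWord]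
          rw [hs1, h3] at h1
          exact irrefl_of lt _ h1
        · have h3 := wordExpo_le_of_wordLt h2
          rw [wordExpo_ofList] at h3
          rw [hs1] at h1
          exact irrefl_of lt _ (trans_of lt h1 h3)

/-- The terms of an element of a free module, with words instead of exponents. -/
def wtermsOf (f : ModTerms K n k) : List (WTerm K (Fin n) (Fin k)) :=
  f.map fun t => (t.1, (stdList t.2.1, t.2.2))

/-- Only the exponents of the words are compared with `f`, so the lemma serves both for reading the
input and for writing the output. -/
theorem classOf_eq_mv (f : ModTerms K n k) (l : List (WTerm K (Fin n) (Fin k)))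
    (hl : f.map (fun t => (t.1, t.2)) = l.map fun t => (t.1, ex t.2))
    (hs : ∀ t ∈ l, t.2.1.Pairwise (· ≤ ·)) : classOf π f = mv π l := by
  have h1 : classOf π f = ((f.map fun t => (t.1, t.2)).map fun t => t.1 • mon π t.2).sum := by
    rw [classOf, List.map_map]
    congr 1
    refine List.map_congr_left fun t _ => ?_
    simp only [Function.comp, map_smul]
    funext e
    by_cases he : e = t.2.2
    · subst he
      rw [Pi.single_eq_same, Pi.smul_apply, mon_apply_self]
      rfl
    · rw [Pi.single_eq_of_ne he, Pi.smul_apply, mon_apply_of_ne _ he, smul_zero]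
  rw [h1, hl, mv, List.map_map]
  congr 1
  refine List.map_congr_left fun t ht => ?_
  simp only [Function.comp, tv_of_pairwise (hs t ht)]

theorem mv_wtermsOf (f : ModTerms K n k) : mv π (wtermsOf f) = classOf π f := by
  refine (classOf_eq_mv f _ ?_ ?_).symm
  · rw [wtermsOf, List.map_map]
    refine List.map_congr_left fun t _ => ?_
    simp [Function.comp, ex, listExpo_stdList]
  · intro t ht
    obtain ⟨s, -, rfl⟩ := List.mem_map.1 ht
    exact stdList_pairwise _

theorem mv_image_wtermsOf (G : List (ModTerms K n k)) :
    {x | ∃ q ∈ G.map wtermsOf, mv π q = x} = (classesOf π G : Set (Fin k → A)) := by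
  ext x
  simp only [classesOf, Set.mem_ofPred_eq, List.mem_map, Finset.mem_coe, List.mem_toFinset,
    exists_exists_and_eq_and, mv_wtermsOf]

/-- The left module is the case without variables, where stability under right multiplication is an
empty condition. -/
theorem leftSpan_isLeast (G : Set (Fin k → A)) :
    G ⊆ leftSpan A G ∧
    (∀ m ∈ leftSpan A G, ∀ i ∈ ([] : List (Fin n)), rmulVar π i m ∈ leftSpan A G) ∧
    ∀ N : Submodule A (Fin k → A), G ⊆ N →
      (∀ m ∈ N, ∀ i ∈ ([] : List (Fin n)), rmulVar π i m ∈ N) → leftSpan A G ≤ N :=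
  ⟨Submodule.subset_span, by simp, fun _ hN _ => Submodule.span_le.2 hN⟩

/-- Stability under right multiplication by the variables extends to words by induction on the word,
and to all of `A` because the words span `A` over K. -/
theorem twoSidedSpan_isLeast (hπ : Function.Surjective π) (G : Set (Fin k → A)) :
    G ⊆ twoSidedSpan A G ∧
    (∀ m ∈ twoSidedSpan A G, ∀ i ∈ List.finRange n, rmulVar π i m ∈ twoSidedSpan A G) ∧
    ∀ N : Submodule A (Fin k → A), G ⊆ N →
      (∀ m ∈ N, ∀ i ∈ List.finRange n, rmulVar π i m ∈ N) → twoSidedSpan A G ≤ N := by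
  refine ⟨fun g hg => ?_, fun m hm i _ => ?_, fun N hG hN => ?_⟩
  · rw [SetLike.mem_coe, twoSidedSpan, Submodule.mem_sInf]
    exact fun N hN => hN.1 hg
  · rw [twoSidedSpan, Submodule.mem_sInf] at hm ⊢
    exact fun N hN => hN.2 m (hm N hN) _
  · refine sInf_le ⟨hG, fun m hm b => ?_⟩
    obtain ⟨t, rfl⟩ := hπ b
    have hw : ∀ (w : List (Fin n)) (m : Fin k → A), m ∈ N → (fun e => m e * wv π w) ∈ N := by
      intro w
      induction w with
      | nil => intro m hm; simpa only [wv_nil, mul_one] using hm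
      | cons i w ih =>
        intro m hm
        have := ih _ (hN m hm i (List.mem_finRange i))
        simp only [rmulVar, mul_assoc] at this
        simpa only [wv_cons π i w] using this
    rw [eq_sum_single t, map_sum]
    have : (fun e => m e * ∑ w ∈ t.coeff.support, π (t.coeff w • MonoidAlgebra.single w 1)) =
        ∑ w ∈ t.coeff.support, t.coeff w • fun e => m e * wv π (FreeMonoid.toList w) := by
      funext e
      rw [Finset.mul_sum, Finset.sum_apply]
      refine Finset.sum_congr rfl fun w _ => ?_
      rw [Pi.smul_apply, map_smul, mul_smul_comm]
      rfl
    rw [this]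
    exact N.sum_mem fun w _ => smul_mem_of_mem _ (hw _ m hm)

end Input

end PBWRed

namespace PBWRed

/-! ### Encodings -/

section Encoding

/-- The index of a variable or component in unary notation. -/
def encVar (K : Type u) {n : ℕ} (i : Fin n) : Ty.nat.Val K := encNat K i

theorem encNat_injective (K : Type u) : Function.Injective (encNat K) := fun a b h => by
  simpa [encNat] using congrArg List.length h

theorem length_encNat (K : Type u) (m : ℕ) : (encNat K m).length = m := List.length_replicate

theorem length_encVar (K : Type u) {n : ℕ} (i : Fin n) : (encVar K i).length = i :=
  List.length_replicate

theorem getD_ofFn_encVar {K : Type u} {n : ℕ} {α : Type*} (f : Fin n → α) (i : Fin n) (d : α) :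
    (List.ofFn f).getD (encVar K i).length d = f i := by
  have h : (encVar K i).length < (List.ofFn f).length := by
    rw [length_encVar, List.length_ofFn]
    exact i.2
  rw [List.getD_eq_getElem _ _ h, List.getElem_ofFn]
  exact congrArg f (Fin.ext (length_encVar K i))

theorem encVar_injective (K : Type u) {n : ℕ} :
    Function.Injective (encVar K : Fin n → Ty.nat.Val K) :=
  fun _ _ h => Fin.ext (encNat_injective K h)

theorem rawRange_encNat (K : Type u) (n : ℕ) :
    rawRange (encNat K n) = (List.finRange n).map (encVar K) := by
  have h1 : rawRange (encNat K n) = (List.range n).map (encNat K) := by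
    induction n with
    | zero => rfl
    | succ n ih =>
      rw [encNat, List.replicate_succ, rawRange, ← encNat, ih, List.range_succ, List.map_append]
      rfl
  rw [h1, ← List.map_coe_finRange_eq_range, List.map_map]
  rfl

variable {K : Type u} {n k : ℕ}

theorem rawExpo_map (w : List (Fin n)) :
    rawExpo (K := K) (encNat K n) (w.map (encVar K)) = encExpo K (listExpo w) := by
  rw [rawExpo, rawRange_encNat, encExpo, List.ofFn_eq_map, List.map_map]
  refine List.map_congr_left fun i _ => ?_
  simp only [Function.comp]
  rw [List.map_const', encNat]
  congr 1
  rw [listExpo, List.filter_map, List.length_map, List.count_eq_length_filter]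
  congr 2
  funext j
  simp only [Function.comp, (encVar_injective K).eq_iff]
  exact decide_eq_decide.2 eq_comm

theorem encExpo_injective : Function.Injective (encExpo K : Expo n → Ty.expo.Val K) := by
  intro α β h
  have := List.ofFn_injective h
  funext i
  exact encNat_injective K (congrFun this i)

theorem encMon_injective : Function.Injective (encMon K : Expo n × Fin k → Ty.mon.Val K) := by
  rintro ⟨α, e⟩ ⟨β, e'⟩ h
  exact Prod.ext (encExpo_injective (congrArg Prod.fst h))
    (encVar_injective K (congrArg Prod.snd h))

theorem ordOf_encMon {lt : Expo n × Fin k → Expo n × Fin k → Prop} (p q : Expo n × Fin k) :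
    ordOf K lt (encMon K p) (encMon K q) ↔ lt p q := by
  constructor
  · rintro ⟨p', q', hp, hq, h⟩
    rwa [encMon_injective hp, encMon_injective hq]
  · exact fun h => ⟨p, q, rfl, rfl, h⟩

/-- The word with a given exponent. -/
def rawWord (n : Ty.nat.Val K) (α : Ty.expo.Val K) : Ty.word.Val K :=
  (rawRange n).flatMap fun i => (α.getD i.length []).map fun _ => i

theorem rawWord_encExpo (α : Expo n) :
    rawWord (K := K) (encNat K n) (encExpo K α) = (stdList α).map (encVar K) := by
  rw [rawWord, rawRange_encNat, List.flatMap_map, stdList, List.ofFn_eq_map, ← List.flatMap_def,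
    List.map_flatMap]
  congr 1
  funext i
  rw [length_encVar, List.map_replicate, List.map_const', encExpo, List.getD_eq_getElem _ _ (by simp),
    List.getElem_ofFn, length_encNat]

variable [Field K]

def rawTerms (n : Ty.nat.Val K) (f : Ty.poly.Val K) : Ty.terms.Val K :=
  f.map fun t => (t.1, rawWord n t.2)

theorem rawTerms_encPoly (f : PolyTerms K n) :
    rawTerms (encNat K n) (encPoly f) = (termsOf f).map (mapPTerm (encVar K)) := by
  rw [rawTerms, encPoly, termsOf, List.map_map, List.map_map]
  refine List.map_congr_left fun t _ => ?_
  simp only [Function.comp, mapPTerm, rawWord_encExpo]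

/-- The tables of the commutation relations. -/
noncomputable def rawTable (n : Ty.nat.Val K) (d : List (Ty.datum.Val K)) : Ty.sys.Val K :=
  d.map fun d => d.1.map fun r => r.map fun p =>
    (p.1, normTerms ([] : Ty.nat.Val K) (rawTerms n p.2))

theorem normTerms_map {ι ι' κ κ' : Type*} [DecidableEq ι] [DecidableEq κ] [DecidableEq ι']
    [DecidableEq κ'] {φ : ι → ι'} {ψ : κ → κ'} (hφ : Function.Injective φ)
    (hψ : Function.Injective ψ) (e : κ) (l : List (K × List ι)) :
    normTerms (ψ e) (l.map (mapPTerm φ)) = (normTerms e l).map (mapPTerm φ) := by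
  rw [normTerms, normTerms, atComp_map, collect_map hφ hψ, List.map_map, List.map_map]
  rfl

theorem diff_encNat (a b : ℕ) : (encNat K a).diff (encNat K b) = encNat K (a - b) := by
  induction b generalizing a with
  | zero => rfl
  | succ b ih =>
    rw [encNat, encNat, List.replicate_succ, List.diff_cons, ← encNat, ← encNat]
    cases a with
    | zero =>
      rw [Nat.zero_sub]
      exact (ih 0).trans (by rw [Nat.zero_sub])
    | succ a =>
      rw [Nat.succ_sub_succ, ← ih, encNat, List.replicate_succ, List.erase_cons_head]
      rfl

theorem sysRel_rawTable (R : Fin k → RawDatum K n) :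
    SysRel (encVar K) (encVar K) (inputSys R)
      (rawSys (rawTable (encNat K n) (List.ofFn fun e => encDatum (R e)))) := by
  have hT : ∀ (e : Fin k) (i j : Fin n),
      (((rawTable (encNat K n) (List.ofFn fun e => encDatum (R e))).getD
        (encVar K e).length []).getD (encVar K i).length []).getD (encVar K j).length (0, []) =
      ((R e).c i j, (normTerms () (termsOf ((R e).d i j))).map (mapPTerm (encVar K))) := by
    intro e i j
    rw [rawTable, List.map_ofFn, getD_ofFn_encVar]
    simp only [Function.comp, encDatum, List.map_ofFn]
    rw [getD_ofFn_encVar]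
    simp only [Function.comp, List.map_ofFn]
    rw [getD_ofFn_encVar]
    simp only [Function.comp, rawTerms_encPoly]
    -- The two tables use different dummy components, `()` and the empty list; the map between them
    -- is injective since its domain is a point.
    rw [← normTerms_map (ψ := fun _ : Unit => ([] : Ty.nat.Val K)) (encVar_injective K)
      (fun _ _ _ => rfl)]
  refine ⟨fun i j => ?_, fun e i j => ?_, fun e i j => ?_⟩
  · simp only [rawSys, inputSys]
    refine decide_eq_decide.2 ?_
    rw [encVar, encVar, diff_encNat, Fin.le_iff_val_le_val, ← Nat.sub_eq_zero_iff_le]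
    exact ⟨fun h => by have := congrArg List.length h; rwa [length_encNat] at this, fun h => by rw [h]; rfl⟩
  · exact congrArg Prod.fst (hT e i j)
  · exact congrArg Prod.snd (hT e i j)

/-- The rules given by the relations in the input. -/
noncomputable def rawInputRules (e : Env.{u}) (n k : Ty.nat.Val e.K) (d : List (Ty.datum.Val e.K)) :
    List (Ty.rule.Val e.K) :=
  (rawRange k).flatMap fun i => (d.getD i.length ([], [])).2.flatMap fun f =>
    mkRules (K := e.K) (ι := Ty.nat.Val e.K) (κ := Ty.nat.Val e.K) (front (rawLt e n)
      (collect (atComp i (rawTerms n f))))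

/-- The generators in the input. -/
def rawGens (n : Ty.nat.Val K) (G : List (Ty.modElt.Val K)) : List (Ty.wpoly.Val K) :=
  G.map fun g => g.map fun t => (t.1, (rawWord n t.2.1, t.2.2))

/-- The environment for an ordering. -/
@[reducible] def envOf (K : Type u) [Field K] (lt : Expo n × Fin k → Expo n × Fin k → Prop) : Env :=
  ⟨K, inferInstance, ordOf K lt⟩

variable {lt : Expo n × Fin k → Expo n × Fin k → Prop}

theorem rawLt_map (a b : List (Fin n) × Fin k) :
    rawLt (envOf K lt) (encNat K n) (mapWMon (encVar K) (encVar K) a)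
      (mapWMon (encVar K) (encVar K) b) ↔ exLt lt a b := by
  rw [rawLt, exLt, ← ordOf_encMon (K := K) (lt := lt)]
  simp only [mapWMon]
  erw [rawExpo_map, rawExpo_map]
  exact Iff.rfl

theorem rawInputRules_eq (R : Fin k → RawDatum K n) :
    rawInputRules (envOf K lt) (encNat K n) (encNat K k) (List.ofFn fun e => encDatum (R e)) =
      (inputRules lt R).map (mapRule (encVar K) (encVar K)) := by
  rw [rawInputRules, rawRange_encNat, inputRules, List.flatMap_map, List.map_flatMap]
  congr 1
  funext e
  rw [length_encVar, List.getD_eq_getElem _ _ (by simp), List.getElem_ofFn, encDatum,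
    List.map_flatMap]
  simp only
  rw [List.flatMap_map]
  congr 1
  funext f
  rw [← mkRules_map, ← front_map (rawLt_map (K := K)), ← collect_map (encVar_injective K)
    (encVar_injective K), ← atComp_map, ← rawTerms_encPoly]

theorem rawGens_eq (G : List (ModTerms K n k)) :
    rawGens (encNat K n) (G.map encModElt) =
      (G.map wtermsOf).map (List.map (mapWTerm (encVar K) (encVar K))) := by
  rw [rawGens, List.map_map, List.map_map]
  refine List.map_congr_left fun g _ => ?_
  simp only [Function.comp, encModElt, wtermsOf, List.map_map]
  refine List.map_congr_left fun t _ => ?_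
  simp only [Function.comp, mapWTerm, mapWMon, encMon, rawWord_encExpo]
  rfl

end Encoding

/-! ### Programs that read the input and write the output -/

section Raw

variable {c : Ty} {i j : ∀ e : Env.{u}, c.Val e.K → Ty.nat.Val e.K}

theorem Cp.rawWord (hi : Cp i) {α : ∀ e : Env.{u}, c.Val e.K → Ty.expo.Val e.K} (hα : Cp α) :
    Cp (b := .word) fun e x => PBWRed.rawWord (K := e.K) (i e x) (α e x) := by
  have x := Cp.id.{u} (.prod c .nat)
  exact Cp.flatMap (Cp.rawRange hi) (Cp.map (Cp.getD (hα.comp x.fst) x.snd (Cp.nil _ .one))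
    (Cp.id (.prod (.prod c .nat) .one)).fst.snd)

theorem Cp.rawTerms (hi : Cp i) {f : ∀ e : Env.{u}, c.Val e.K → Ty.poly.Val e.K} (hf : Cp f) :
    Cp (b := .terms) fun e x => PBWRed.rawTerms (K := e.K) (i e x) (f e x) := by
  have x := Cp.id.{u} (.prod c (.prod .fld .expo))
  exact Cp.map hf (x.snd.fst.pair (Cp.rawWord (hi.comp x.fst) x.snd.snd))

theorem Cp.normTerms (hi : Cp i) {f : ∀ e : Env.{u}, c.Val e.K → Ty.terms.Val e.K} (hf : Cp f) :
    Cp (b := .terms) fun e x =>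
      PBWRed.normTerms (K := e.K) (ι := Ty.nat.Val e.K) (κ := Ty.nat.Val e.K) (i e x) (f e x) := by
  have x := Cp.id.{u} (.prod c .wterm)
  exact Cp.map (Cp.collect (Cp.atComp hi hf)) (x.snd.fst.pair x.snd.snd.fst)

theorem Cp.rawTable (hi : Cp i) {d : ∀ e : Env.{u}, c.Val e.K → (Ty.list .datum).Val e.K}
    (hd : Cp d) : Cp (b := .sys) fun e x => PBWRed.rawTable (K := e.K) (i e x) (d e x) := by
  have x := Cp.id.{u} (.prod c .datum)
  have y := Cp.id.{u} (.prod (.prod c .datum) (.list (.prod .fld .poly)))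
  have z := Cp.id.{u} (.prod (.prod (.prod c .datum) (.list (.prod .fld .poly))) (.prod .fld .poly))
  exact Cp.map hd (Cp.map x.snd.fst (Cp.map y.snd (z.snd.fst.pair
    (Cp.normTerms (Cp.nil _ .one) (Cp.rawTerms (hi.comp z.fst.fst.fst) z.snd.snd)))))

theorem Cp.rawInputRules (hi : Cp i) (hj : Cp j)
    {d : ∀ e : Env.{u}, c.Val e.K → (Ty.list .datum).Val e.K} (hd : Cp d) :
    Cp (b := .list .rule) fun e x => PBWRed.rawInputRules e (i e x) (j e x) (d e x) := by
  have x := Cp.id.{u} (.prod c .nat)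
  have y := Cp.id.{u} (.prod (.prod c .nat) .poly)
  exact Cp.flatMap (Cp.rawRange hj) (Cp.flatMap (Cp.getD (hd.comp x.fst) x.snd
    ((Cp.nil _ _).pair (Cp.nil _ _))).snd (Cp.mkRules (Cp.front (hi.comp y.fst.fst)
      (Cp.collect (Cp.atComp y.fst.snd (Cp.rawTerms (hi.comp y.fst.fst) y.snd))))))

theorem Cp.rawGens (hi : Cp i) {G : ∀ e : Env.{u}, c.Val e.K → (Ty.list .modElt).Val e.K}
    (hG : Cp G) : Cp (b := .list .wpoly) fun e x => PBWRed.rawGens (K := e.K) (i e x) (G e x) := by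
  have x := Cp.id.{u} (.prod c .modElt)
  have y := Cp.id.{u} (.prod (.prod c .modElt) (.prod .fld .mon))
  exact Cp.map hG (Cp.map x.snd (y.snd.fst.pair
    ((Cp.rawWord (hi.comp y.fst.fst) y.snd.snd.fst).pair y.snd.snd.snd)))

/-- The terms of an element of the output. -/
def rawOut {K : Type u} (n : Ty.nat.Val K) (l : Ty.wpoly.Val K) : Ty.modElt.Val K :=
  l.map fun t => (t.1, (rawExpo n t.2.1, t.2.2))

theorem Cp.rawOut (hi : Cp i) {l : ∀ e : Env.{u}, c.Val e.K → Ty.wpoly.Val e.K} (hl : Cp l) :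
    Cp (b := .modElt) fun e x => PBWRed.rawOut (i e x) (l e x) := by
  have x := Cp.id.{u} (.prod c .wterm)
  exact Cp.map hl (x.snd.fst.pair ((Cp.rawExpo (hi.comp x.fst) x.snd.snd.fst).pair x.snd.snd.snd))

end Raw

end PBWRed

namespace PBWRed

/-! ### Relations computed by programs -/

/-- One program halts on `x` with the output `y` whenever `F e x y`. -/
def CpR {a b : Ty} (F : ∀ e : Env.{u}, a.Val e.K → b.Val e.K → Prop) : Prop :=
  ∃ P : Prog a b, ∀ (e : Env.{u}) (x : a.Val e.K) (y : b.Val e.K), F e x y → y ∈ P.eval e.ord x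

section Rel

variable {a b c d s t : Ty}

theorem Cp.toRel {F : ∀ e : Env.{u}, a.Val e.K → b.Val e.K} (hF : Cp F) :
    CpR fun e x y => y = F e x := by
  obtain ⟨P, hP⟩ := hF
  refine ⟨P, fun e x y h => ?_⟩
  rw [hP, h]
  exact Part.mem_some _

theorem CpR.bind {F : ∀ e : Env.{u}, a.Val e.K → b.Val e.K → Prop} (hF : CpR F)
    {G : ∀ e : Env.{u}, (Ty.prod a b).Val e.K → d.Val e.K → Prop} (hG : CpR G) :
    CpR fun e x z => ∃ y, F e x y ∧ G e (x, y) z := by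
  obtain ⟨P, hP⟩ := hF
  obtain ⟨P', hP'⟩ := hG
  refine ⟨.comp P' (.pair (.id a) P), ?_⟩
  rintro e x z ⟨y, hy, hz⟩
  simp only [Prog.eval, Part.bind_some]
  exact Part.mem_bind (Part.mem_map _ (hP e x y hy)) (hP' e (x, y) z hz)

theorem CpR.comp {G : ∀ e : Env.{u}, b.Val e.K → d.Val e.K → Prop} (hG : CpR G)
    {F : ∀ e : Env.{u}, a.Val e.K → b.Val e.K} (hF : Cp F) : CpR fun e x z => G e (F e x) z := by
  obtain ⟨P, hP⟩ := hF
  obtain ⟨P', hP'⟩ := hG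
  refine ⟨.comp P' P, fun e x z hz => ?_⟩
  simp only [Prog.eval, hP, Part.bind_some]
  exact hP' e _ z hz

theorem CpR.listElim {l : ∀ e : Env.{u}, c.Val e.K → (Ty.list b).Val e.K} (hl : Cp l)
    {F : ∀ e : Env.{u}, c.Val e.K → d.Val e.K → Prop} (hF : CpR F)
    {G : ∀ e : Env.{u}, (Ty.prod (.prod b (.list b)) c).Val e.K → d.Val e.K → Prop} (hG : CpR G) :
    CpR fun e x z => PBWRed.listElim (F e x z) (fun y l => G e ((y, l), x) z) (l e x) := by
  obtain ⟨Pl, hl⟩ := hl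
  obtain ⟨P, hP⟩ := hF
  obtain ⟨P', hP'⟩ := hG
  refine ⟨.comp (.cases (.comp P (.snd .one c)) P') (.pair (.comp (.uncons b) Pl) (.id c)),
    fun e x z hz => ?_⟩
  simp only [Prog.eval, hl, Part.bind_some, Part.map_some]
  beta_reduce at hz
  generalize l e x = l at hz ⊢
  cases l with
  | nil => simpa only [Part.bind_some] using hP e x z hz
  | cons y l => simpa only [Part.bind_some] using hP' e ((y, l), x) z hz

theorem mem_fix_of_reflTransGen {α β : Type*} {f : α →. β ⊕ α} {s s' : α} {b : β}
    (h : Relation.ReflTransGen (fun s s' => Sum.inr s' ∈ f s) s s') (hb : Sum.inl b ∈ f s') :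
    b ∈ f.fix s := by
  induction h using Relation.ReflTransGen.head_induction_on with
  | refl => exact PFun.fix_stop hb
  | head h _ ih => exact PFun.mem_fix_iff.2 (Or.inr ⟨_, h, ih⟩)

/-- As for `forEach`, the context has to travel in the state: the loop runs on pairs, and the
context is removed when the loop is left. -/
theorem CpR.loop {i : ∀ e : Env.{u}, c.Val e.K → s.Val e.K} (hi : Cp i)
    {F : ∀ e : Env.{u}, (Ty.prod c s).Val e.K → (Ty.sum b s).Val e.K → Prop} (hF : CpR F) :
    CpR fun e x y => ∃ z, Relation.ReflTransGen (fun s s' => F e (x, s) (Sum.inr s')) (i e x) z ∧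
      F e (x, z) (Sum.inl y) := by
  have u := Cp.id.{u} (.prod (.prod c s) (.sum b s))
  have w := Cp.id.{u} (.prod s (.prod (.prod c s) (.sum b s)))
  obtain ⟨P, hP⟩ := hF.bind (Cp.cases u.snd
    ((Cp.id.{u} (.prod b (.prod (.prod c s) (.sum b s)))).fst.inl (.prod c s))
    ((w.snd.fst.fst.pair w.fst).inr b)).toRel
  obtain ⟨P', hP'⟩ := (Cp.id c).pair hi
  refine ⟨.comp (.loop P) P', ?_⟩
  rintro e x y ⟨z, hz, hy⟩
  refine Part.mem_bind (a := (x, i e x)) (by rw [hP']; exact Part.mem_some _) ?_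
  refine mem_fix_of_reflTransGen (s' := (x, z)) ?_ (hP e _ _ ⟨_, hy, rfl⟩)
  exact hz.lift (fun s => (x, s)) fun s s' h => hP e _ _ ⟨_, h, rfl⟩

theorem mem_foldlM_of_forall₂ {σ α β : Type*} {f : σ × List β → α → Part (σ × List β)} {x : σ}
    {R : α → β → Prop} (h : ∀ acc y z, R y z → (x, z :: acc) ∈ f (x, acc) y) {l : List α}
    {L : List β} (hl : List.Forall₂ R l L) (acc : List β) :
    (x, L.reverse ++ acc) ∈ l.foldlM (m := Part) f (x, acc) := by
  induction hl generalizing acc with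
  | nil => exact Part.mem_some _
  | cons hyz _ ih =>
    rw [List.foldlM_cons, List.reverse_cons, List.append_assoc]
    exact Part.mem_bind (h acc _ _ hyz) (ih _)

theorem CpR.map {l : ∀ e : Env.{u}, c.Val e.K → (Ty.list t).Val e.K} (hl : Cp l)
    {F : ∀ e : Env.{u}, (Ty.prod c t).Val e.K → s.Val e.K → Prop} (hF : CpR F) :
    CpR (b := .list s) fun e x L => List.Forall₂ (fun y z => F e (x, y) z) (l e x) L := by
  have u := Cp.id.{u} (.prod (.prod c (.list s)) t)
  have w := Cp.id.{u} (.prod (.prod (.prod c (.list s)) t) s)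
  obtain ⟨P, hP⟩ := (hF.comp (u.fst.fst.pair u.snd)).bind
    (w.fst.fst.fst.pair (w.snd.cons w.fst.fst.snd)).toRel
  -- Results are accumulated at the front, so the list is reversed beforehand.
  obtain ⟨P', hP'⟩ := ((Cp.id c).pair (Cp.nil c s)).pair (Cp.reverse hl)
  refine ⟨.comp (.snd c (.list s)) (.comp (.forEach P) P'), fun e x L hL => ?_⟩
  simp only [Prog.eval, hP', Part.bind_some]
  have h := mem_foldlM_of_forall₂ (f := fun s y => P.eval e.ord (s, y)) (x := x)
    (fun acc y z hyz => hP e _ _ ⟨_, hyz, rfl⟩) (List.forall₂_reverse_iff.2 hL) []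
  rw [List.reverse_reverse, List.append_nil] at h
  exact Part.mem_bind h (Part.mem_some _)

end Rel

/-! ### Runs of the algorithm -/

section Runs

variable {K ι κ : Type*} [Field K] [DecidableEq ι] [DecidableEq κ]

/-- The normal form computation that starts with the state `s` returns `r`. -/
def Sys.NFRuns (S : Sys K ι κ) (R : List (Rule K ι κ))
    (s : List (WTerm K ι κ) × List (WTerm K ι κ)) (r : List (WTerm K ι κ)) : Prop :=
  ∃ s', Relation.ReflTransGen (fun a b => Sum.inr b = S.nfStep R a) s s' ∧
    Sum.inl r = S.nfStep R s'

/-- One pass of the completion, with the result `o`. -/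
def Sys.ComplRel (S : Sys K ι κ) (vars : List ι) (ltw : List ι × κ → List ι × κ → Prop)
    (RI : List (Rule K ι κ)) (s : List (Rule K ι κ) × List (List (WTerm K ι κ)))
    (o : List (Rule K ι κ) ⊕ (List (Rule K ι κ) × List (List (WTerm K ι κ)))) : Prop :=
  listElim (o = Sum.inl s.1) (fun q Q => ∃ r, S.NFRuns (RI ++ s.1) (q, []) r ∧
    o = Sum.inr (S.complStep vars ltw RI s.1 Q r)) s.2

/-- The completion that starts with the state `s` returns `H`. -/
def Sys.ComplRuns (S : Sys K ι κ) (vars : List ι) (ltw : List ι × κ → List ι × κ → Prop)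
    (RI : List (Rule K ι κ)) (s : List (Rule K ι κ) × List (List (WTerm K ι κ)))
    (H : List (Rule K ι κ)) : Prop :=
  ∃ s', Relation.ReflTransGen (fun a b => S.ComplRel vars ltw RI a (Sum.inr b)) s s' ∧
    S.ComplRel vars ltw RI s' (Sum.inl H)

variable {ι' κ' : Type*} [DecidableEq ι'] [DecidableEq κ'] {φ : ι → ι'} {ψ : κ → κ'}
  {S : Sys K ι κ} {S' : Sys K ι' κ'}

theorem SysRel.nfRuns_map (h : SysRel φ ψ S S') (hφ : Function.Injective φ)
    (hψ : Function.Injective ψ) {R : List (Rule K ι κ)}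
    {s : List (WTerm K ι κ) × List (WTerm K ι κ)} {r : List (WTerm K ι κ)} (hr : S.NFRuns R s r) :
    S'.NFRuns (R.map (mapRule φ ψ)) (mapNFState φ ψ s) (r.map (mapWTerm φ ψ)) := by
  obtain ⟨s', hs, hr⟩ := hr
  refine ⟨mapNFState φ ψ s', hs.lift _ fun a b hab => ?_, ?_⟩
  · rw [Function.onFun, h.nfStep_map hφ hψ, ← hab]; rfl
  · rw [h.nfStep_map hφ hψ, ← hr]; rfl

theorem SysRel.complRel_map (h : SysRel φ ψ S S') (hφ : Function.Injective φ)
    (hψ : Function.Injective ψ) {lt : List ι × κ → List ι × κ → Prop}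
    {lt' : List ι' × κ' → List ι' × κ' → Prop}
    (hlt : ∀ a b, lt' (mapWMon φ ψ a) (mapWMon φ ψ b) ↔ lt a b) {vars : List ι}
    {RI : List (Rule K ι κ)} {s : List (Rule K ι κ) × List (List (WTerm K ι κ))}
    {o : List (Rule K ι κ) ⊕ (List (Rule K ι κ) × List (List (WTerm K ι κ)))}
    (ho : S.ComplRel vars lt RI s o) :
    S'.ComplRel (vars.map φ) lt' (RI.map (mapRule φ ψ)) (mapComplState φ ψ s)
      (Sum.map (List.map (mapRule φ ψ)) (mapComplState φ ψ) o) := by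
  obtain ⟨H, Q⟩ := s
  cases Q with
  | nil => exact congrArg _ ho
  | cons q Q =>
    obtain ⟨r, hr, rfl⟩ := ho
    refine ⟨r.map (mapWTerm φ ψ), ?_, ?_⟩
    · have := h.nfRuns_map hφ hψ hr
      rwa [List.map_append] at this
    · exact congrArg Sum.inr (h.complStep_map hφ hψ hlt vars RI H Q r).symm

theorem SysRel.complRuns_map (h : SysRel φ ψ S S') (hφ : Function.Injective φ)
    (hψ : Function.Injective ψ) {lt : List ι × κ → List ι × κ → Prop}
    {lt' : List ι' × κ' → List ι' × κ' → Prop}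
    (hlt : ∀ a b, lt' (mapWMon φ ψ a) (mapWMon φ ψ b) ↔ lt a b) {vars : List ι}
    {RI H : List (Rule K ι κ)} {s : List (Rule K ι κ) × List (List (WTerm K ι κ))}
    (hs : S.ComplRuns vars lt RI s H) :
    S'.ComplRuns (vars.map φ) lt' (RI.map (mapRule φ ψ)) (mapComplState φ ψ s)
      (H.map (mapRule φ ψ)) := by
  obtain ⟨s', hs, hH⟩ := hs
  exact ⟨mapComplState φ ψ s', hs.lift _ fun a b hab => h.complRel_map hφ hψ hlt hab,
    h.complRel_map hφ hψ hlt hH⟩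

end Runs

/-! ### Existence of terminating runs -/

section Termination

variable {K : Type*} [Field K] {n : ℕ} {E : Type*} [Finite E] [DecidableEq E] {A : Type*} [Ring A]
  [Algebra K A] {π : Free K n →ₐ[K] A} {lt : Expo n × E → Expo n × E → Prop} {D : E → Datum K n}
  {S : Sys K (Fin n) E}

theorem IsModuleDatum.exists_nfRuns (h : IsModuleDatum π lt D) (hS : S.Compatible π lt)
    {H : Set (E → A)} {R : List (Rule K (Fin n) E)} (hR : GoodRules π lt H R)
    (q : List (WTerm K (Fin n) E)) : ∃ r, S.NFRuns R (q, []) r ∧ IsNF π lt H R q r := by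
  suffices key : ∀ s, NFInv π lt H R q s → ∃ r, S.NFRuns R s r ∧ IsNF π lt H R q r from
    key _ (NFInv.init H R q)
  intro s
  induction s using h.wellFounded_nfLt.induction with
  | _ s ih =>
    intro hs
    rcases hst : S.nfStep R s with r | s'
    · exact ⟨r, ⟨s, .refl, hst.symm⟩, hs.isNF hst⟩
    · obtain ⟨hs', hlt⟩ := NFInv.step h hS hR hs hst
      obtain ⟨r, ⟨z, hz, hr⟩, hr'⟩ := ih s' hlt hs'
      exact ⟨r, ⟨z, .head hst.symm hz, hr⟩, hr'⟩

/-- Each pass first needs a terminating normal form computation, for which the invariant supplies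
admissible rules; the pass then lowers the state for `complLt` and preserves the invariant. -/
theorem ComplInv.exists_complRuns (h : IsModuleDatum π lt D) (hS : S.Compatible π lt)
    {RI : List (Rule K (Fin n) E)} (hRI : RelRules π lt D RI) {vars : List (Fin n)}
    {M : Submodule A (E → A)} {G : Set (E → A)} (hM : ∀ m ∈ M, ∀ i ∈ vars, rmulVar π i m ∈ M)
    {s : List (Rule K (Fin n) E) × List (List (WTerm K (Fin n) E))}
    (hs : ComplInv π lt D S RI vars M G s) :
    ∃ H, S.ComplRuns vars (exLt lt) RI s H ∧ ComplInv π lt D S RI vars M G (H, []) := by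
  induction s using (wellFounded_complLt (K := K) (n := n) (E := E)).induction with
  | _ s ih =>
    obtain ⟨H, _ | ⟨q, Q⟩⟩ := s
    · exact ⟨H, ⟨_, .refl, rfl⟩, hs⟩
    · obtain ⟨r, hr, hr'⟩ := h.exists_nfRuns hS (hs.goodRules h hRI) q
      obtain ⟨hs', hlt⟩ := ComplInv.step h hS hRI hM hs hr'
      obtain ⟨H', ⟨z, hz, hH⟩, hH'⟩ := ih _ hlt hs'
      exact ⟨H', ⟨z, .head ⟨r, hr, rfl⟩ hz, hH⟩, hH'⟩

end Termination

/-! ### Programs for the algorithm -/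

section Programs

variable {c : Ty} {T : ∀ e : Env.{u}, c.Val e.K → Ty.sys.Val e.K}

theorem CpR.nfRuns (hT : Cp T) {R : ∀ e : Env.{u}, c.Val e.K → (Ty.list .rule).Val e.K}
    (hR : Cp R) {q : ∀ e : Env.{u}, c.Val e.K → Ty.wpoly.Val e.K} (hq : Cp q) :
    CpR (b := .wpoly) fun e x r => (rawSys (T e x)).NFRuns (R e x) (q e x, []) r := by
  have x := Cp.id.{u} (.prod c (.prod .wpoly .wpoly))
  exact CpR.loop (b := .wpoly) (hq.pair (Cp.nil c .wterm))
    (Cp.nfStep (hT.comp x.fst) (hR.comp x.fst) x.snd).toRel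

theorem CpR.complRuns (hT : Cp T) {i : ∀ e : Env.{u}, c.Val e.K → Ty.nat.Val e.K} (hi : Cp i)
    {vars : ∀ e : Env.{u}, c.Val e.K → Ty.word.Val e.K} (hv : Cp vars)
    {R : ∀ e : Env.{u}, c.Val e.K → (Ty.list .rule).Val e.K} (hR : Cp R)
    {Q : ∀ e : Env.{u}, c.Val e.K → (Ty.list .wpoly).Val e.K} (hQ : Cp Q) :
    CpR (b := .list .rule) fun e x H => (rawSys (T e x)).ComplRuns (vars e x)
      (rawLt e (i e x)) (R e x) ([], Q e x) H := by
  have x := Cp.id.{u} (.prod c (.prod (.list .rule) (.list .wpoly)))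
  let c' : Ty := .prod (.prod .wpoly (.list .wpoly)) (.prod c (.prod (.list .rule) (.list .wpoly)))
  have y := Cp.id.{u} c'
  have z := Cp.id.{u} (.prod c' .wpoly)
  have hc := y.snd.fst
  have hH := y.snd.snd.fst
  have h1 := CpR.nfRuns (hT.comp hc) ((hR.comp hc).append hH) y.fst.fst
  have hd := hc.comp z.fst
  have h2 := (Cp.complStep (hT.comp hd) (hi.comp hd) (hv.comp hd) (hR.comp hd) (hH.comp z.fst)
    (y.fst.snd.comp z.fst) z.snd).inr (.list .rule)
  exact CpR.loop (b := .list .rule) ((Cp.nil c .rule).pair hQ)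
    (CpR.listElim x.snd.snd (x.snd.fst.inl _).toRel (h1.bind h2.toRel))

theorem CpR.outputs (hT : Cp T) {i : ∀ e : Env.{u}, c.Val e.K → Ty.nat.Val e.K} (hi : Cp i)
    {R H : ∀ e : Env.{u}, c.Val e.K → (Ty.list .rule).Val e.K} (hR : Cp R) (hH : Cp H) :
    CpR (b := .list .modElt) fun e x L => List.Forall₂ (fun (ρ : Ty.rule.Val e.K) o =>
      ∃ r : Ty.wpoly.Val e.K, (rawSys (T e x)).NFRuns (R e x ++ H e x) (ρ.2, []) r ∧
        o = rawOut (i e x) (Rule.terms (K := e.K) (ι := Ty.nat.Val e.K) (κ := Ty.nat.Val e.K)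
          (ρ.1, r))) (minimize (K := e.K) (ι := Ty.nat.Val e.K) (κ := Ty.nat.Val e.K) (H e x)) L := by
  have x := Cp.id.{u} (.prod c .rule)
  have y := Cp.id.{u} (.prod (.prod c .rule) .wpoly)
  have h1 := CpR.nfRuns (hT.comp x.fst) ((hR.comp x.fst).append (hH.comp x.fst)) x.snd.snd
  have h2 := Cp.rawOut (hi.comp y.fst.fst) (Cp.ruleTerms (y.fst.snd.fst.pair y.snd))
  exact CpR.map (Cp.minimize hH) (h1.bind h2.toRel)

end Programs

end PBWRed

namespace PBWRed

/-! ### Computability of reduced Gröbner bases -/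

section Main

variable {K : Type u} [Field K] {n k : ℕ} {A : Type v} [Ring A] [Algebra K A]
  {π : Free K n →ₐ[K] A} {lt : Expo n × Fin k → Expo n × Fin k → Prop}

/-- The terms of a linear combination of words, with exponents instead of words. -/
def modTermsOf (l : List (WTerm K (Fin n) (Fin k))) : ModTerms K n k := l.map fun t => (t.1, ex t.2)

theorem classOf_modTermsOf {l : List (WTerm K (Fin n) (Fin k))}
    (hl : ∀ t ∈ l, t.2.1.Pairwise (· ≤ ·)) : classOf π (modTermsOf l) = mv π l :=
  classOf_eq_mv _ l (by simp [modTermsOf]) hl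

theorem encModElt_modTermsOf (l : List (WTerm K (Fin n) (Fin k))) :
    encModElt (modTermsOf l) = rawOut (encNat K n) (l.map (mapWTerm (encVar K) (encVar K))) := by
  rw [encModElt, modTermsOf, rawOut, List.map_map, List.map_map]
  refine List.map_congr_left fun t _ => ?_
  simp only [Function.comp, mapWTerm, mapWMon, encMon, ex]
  erw [rawExpo_map]
  rfl

/-- Reduced Gröbner bases of the submodules generated by `G` under left multiplication and right
multiplication with the variables in `vars` are computed by one program. -/
theorem exists_prog_reducedGroebnerBasis {vars : ∀ e : Env.{u}, Ty.input.Val e.K → Ty.word.Val e.K}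
    (hv : Cp vars) : ∃ P : Prog Ty.input (.list Ty.modElt),
      ∀ (K : Type u) [Field K] (n k : ℕ) (A : Type v) [Ring A] [Algebra K A]
        (π : Free K n →ₐ[K] A) (lt : Expo n × Fin k → Expo n × Fin k → Prop)
        (R : Fin k → RawDatum K n), IsModuleDatum π lt (fun e => (R e).toDatum) →
        ∀ (G : List (ModTerms K n k)) (M : Submodule A (Fin k → A)) (vs : List (Fin n)),
          vars (envOf K lt) (encInput R G) = vs.map (encVar K) →
          ((classesOf π G : Set (Fin k → A)) ⊆ M ∧ (∀ m ∈ M, ∀ i ∈ vs, rmulVar π i m ∈ M) ∧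
            ∀ N : Submodule A (Fin k → A), (classesOf π G : Set (Fin k → A)) ⊆ N →
              (∀ m ∈ N, ∀ i ∈ vs, rmulVar π i m ∈ N) → M ≤ N) →
          ∃ H : List (ModTerms K n k),
            H.map encModElt ∈ P.eval (ordOf K lt) (encInput R G) ∧
            IsReducedGroebnerBasis π lt M (classesOf π H) := by
  have x := Cp.id.{u} Ty.input
  have y := Cp.id.{u} (.prod Ty.input (.list .rule))
  have hT := Cp.rawTable x.fst.fst x.snd.fst
  have hRI := Cp.rawInputRules x.fst.fst x.fst.snd x.snd.fst
  obtain ⟨P, hP⟩ := (CpR.complRuns hT x.fst.fst hv hRI (Cp.rawGens x.fst.fst x.snd.snd)).bind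
    (CpR.outputs (hT.comp y.fst) (x.fst.fst.comp y.fst) (hRI.comp y.fst) y.snd)
  refine ⟨P, fun K _ n k A _ _ π lt R h G M vs hvs hM => ?_⟩
  have hφ := encVar_injective K (n := n)
  have hψ := encVar_injective K (n := k)
  have hS := compatible_inputSys h
  have hR := relRules_inputRules h
  have hrel := sysRel_rawTable R
  rw [← mv_image_wtermsOf] at hM
  obtain ⟨H, hH, hs⟩ := ComplInv.exists_complRuns h hS hR hM.2.1
    (ComplInv.init (inputRules lt R) vs hM.1)
  have hgood := hs.goodRules h hR
  -- One normal form for each list of terms: applied to the tails, `f` gives both the output of the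
  -- run and the tails of the reduced basis.
  choose f hf hf' using fun q => h.exists_nfRuns hS hgood q
  have hsort : ∀ ρ ∈ minimize H, ∀ t ∈ Rule.terms (ρ.1, f ρ.2), t.2.1.Pairwise (· ≤ ·) := by
    intro ρ hρ t ht
    rcases List.mem_cons.1 ht with rfl | ht
    · exact (hs.ok ρ (minimize_subset H ρ hρ)).1.sorted
    · obtain ⟨s, hs, rfl⟩ := List.mem_map.1 ht
      exact ((hf' ρ.2).irred s hs).1
  have hcl : ∀ ρ ∈ minimize H, classOf π (modTermsOf (Rule.terms (ρ.1, f ρ.2))) =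
      tv π ρ.1 - mv π (f ρ.2) := fun ρ hρ => by
    rw [classOf_modTermsOf (hsort ρ hρ), Rule.mv_terms, Rule.elem]
  refine ⟨(minimize H).map fun ρ => modTermsOf (Rule.terms (ρ.1, f ρ.2)), ?_, ?_⟩
  · refine hP (envOf K lt) (encInput R G) _ ⟨H.map (mapRule (encVar K) (encVar K)), ?_, ?_⟩
    -- The run over `Fin n` and `Fin k` is transported along the unary encodings to a run on the
    -- actual input.
    · have := hrel.complRuns_map hφ hψ (rawLt_map (K := K) (lt := lt)) hH
      rw [← hvs, ← rawInputRules_eq, mapComplState, ← rawGens_eq] at this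
      exact this
    · have hmin : minimize (H.map (mapRule (encVar K) (encVar K))) =
        (minimize H).map (mapRule (encVar K) (encVar K)) := minimize_map hφ hψ H
      have key : List.Forall₂ (fun (ρ : Ty.rule.Val K) o => ∃ r : Ty.wpoly.Val K,
          (rawSys (rawTable (encNat K n) (List.ofFn fun e => encDatum (R e)))).NFRuns
            (rawInputRules (envOf K lt) (encNat K n) (encNat K k)
              (List.ofFn fun e => encDatum (R e)) ++ H.map (mapRule (encVar K) (encVar K)))
            (ρ.2, []) r ∧ o = rawOut (encNat K n) (Rule.terms (K := K) (ρ.1, r)))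
          ((minimize H).map (mapRule (encVar K) (encVar K)))
          (((minimize H).map fun ρ => modTermsOf (Rule.terms (ρ.1, f ρ.2))).map encModElt) := by
        rw [List.map_map, List.forall₂_map_left_iff, List.forall₂_map_right_iff,
          List.forall₂_same]
        intro ρ _
        refine ⟨(f ρ.2).map (mapWTerm (encVar K) (encVar K)), ?_, ?_⟩
        · have := hrel.nfRuns_map hφ hψ (hf ρ.2)
          rw [List.map_append, ← rawInputRules_eq] at this
          exact this
        · simp only [Function.comp]
          rw [encModElt_modTermsOf, ← terms_map]
          rfl
      rw [← hmin] at key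
      exact key
  · refine hs.isReducedGroebnerBasis h hS hR hM.2.2 (fun g hg => ?_) fun ρ hρ => ?_
    · simp only [classesOf, List.mem_toFinset, List.mem_map, exists_exists_and_eq_and] at hg
      obtain ⟨ρ, hρ, rfl⟩ := hg
      exact ⟨ρ, hρ, f ρ.2, hf' ρ.2, hcl ρ hρ⟩
    · refine ⟨f ρ.2, hf' ρ.2, ?_⟩
      simp only [classesOf, List.mem_toFinset, List.mem_map, exists_exists_and_eq_and]
      exact ⟨ρ, hρ, hcl ρ hρ⟩

end Main

end PBWRed

theorem mainTheorem2 :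
    -- the completion algorithm is correct and terminates, and reduced Groebner bases exist
    (∀ (K : Type u) [Field K] (n : ℕ) (E : Type w) [Finite E] (A : Type v) [Ring A] [Algebra K A]
        (π : PBWRed.Free K n →ₐ[K] A)
        (lt : PBWRed.Expo n × E → PBWRed.Expo n × E → Prop)
        (D : E → PBWRed.Datum K n), PBWRed.IsModuleDatum π lt D →
        ∀ G : Finset (E → A),
          PBWRed.CompletionCorrectAndTerminates π lt D G ∧
          (∃ H, PBWRed.IsReducedGroebnerBasis π lt
            (PBWRed.leftSpan A (G : Set (E → A))) H) ∧
          (∃ H, PBWRed.IsReducedGroebnerBasis π lt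
            (PBWRed.twoSidedSpan A (G : Set (E → A))) H)) ∧
    -- reduced Groebner bases of left submodules are computable
    (∃ P : PBWRed.Prog PBWRed.Ty.input (.list PBWRed.Ty.modElt),
      ∀ (K : Type u) [Field K] (n k : ℕ) (A : Type v) [Ring A] [Algebra K A]
        (π : PBWRed.Free K n →ₐ[K] A)
        (lt : PBWRed.Expo n × Fin k → PBWRed.Expo n × Fin k → Prop)
        (R : Fin k → PBWRed.RawDatum K n),
        PBWRed.IsModuleDatum π lt (fun e => (R e).toDatum) →
        ∀ G : List (PBWRed.ModTerms K n k), ∃ H : List (PBWRed.ModTerms K n k),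
          H.map PBWRed.encModElt ∈ P.eval (PBWRed.ordOf K lt) (PBWRed.encInput R G) ∧
          PBWRed.IsReducedGroebnerBasis π lt
            (PBWRed.leftSpan A (PBWRed.classesOf π G : Set (Fin k → A)))
            (PBWRed.classesOf π H)) ∧
    -- reduced Groebner bases of two-sided submodules are computable
    (∃ P : PBWRed.Prog PBWRed.Ty.input (.list PBWRed.Ty.modElt),
      ∀ (K : Type u) [Field K] (n k : ℕ) (A : Type v) [Ring A] [Algebra K A]
        (π : PBWRed.Free K n →ₐ[K] A)
        (lt : PBWRed.Expo n × Fin k → PBWRed.Expo n × Fin k → Prop)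
        (R : Fin k → PBWRed.RawDatum K n),
        PBWRed.IsModuleDatum π lt (fun e => (R e).toDatum) →
        ∀ G : List (PBWRed.ModTerms K n k), ∃ H : List (PBWRed.ModTerms K n k),
          H.map PBWRed.encModElt ∈ P.eval (PBWRed.ordOf K lt) (PBWRed.encInput R G) ∧
          PBWRed.IsReducedGroebnerBasis π lt
            (PBWRed.twoSidedSpan A (PBWRed.classesOf π G : Set (Fin k → A)))
            (PBWRed.classesOf π H)) := by
  refine ⟨fun K _ n E _ A _ _ π lt D h G => ⟨h.completionCorrectAndTerminates G,
    h.exists_isReducedGroebnerBasis _, h.exists_isReducedGroebnerBasis _⟩, ?_, ?_⟩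
  -- An empty list of variables: no products from the right are queued.
  · obtain ⟨P, hP⟩ := PBWRed.exists_prog_reducedGroebnerBasis.{u, v} (PBWRed.Cp.nil _ .nat)
    exact ⟨P, fun K _ n k A _ _ π lt R h G =>
      hP K n k A π lt R h G _ [] rfl (PBWRed.leftSpan_isLeast _)⟩
  -- The list of all variables is computed from the number `n` in the input.
  · obtain ⟨P, hP⟩ := PBWRed.exists_prog_reducedGroebnerBasis.{u, v}
      (PBWRed.Cp.rawRange (PBWRed.Cp.id.{u} PBWRed.Ty.input).fst.fst)
    exact ⟨P, fun K _ n k A _ _ π lt R h G =>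
      hP K n k A π lt R h G _ (List.finRange n) (PBWRed.rawRange_encNat K n)
        (PBWRed.twoSidedSpan_isLeast h.surjective _)⟩
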